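/- **Parallel primal/gradient maintenance.** Let $\Psi(z)=\sum_i\cosh(\lambda z_i)$ with a parameter $\lambda>0$. For $m,n\ge 1$, a constant $C>0$ and $\tau\in\mathbb{R}^m$ with non-negative entries let $\|v\|_{\tau+\infty}=\|v\|_\infty+C\log(4m/n)\left(\sum_i\tau_iv_i^2\right)^{1/2}$ and let $x^{\flat(\tau)}$ denote a maximizer of $\langle x,y\rangle$ over $\|y\|_{\tau+\infty}\le 1$. For vectors $u,v$, $u\approx_\epsilon v$ means $e^{-\epsilon}v_i\le u_i\le e^{\epsilon}v_i$ for all $i$; $\|\cdot\|_0$ and $\mathrm{nnz}$ count non-zero entries; and $a_i$ is the $i$-th row of $A$. The model is a (concurrent-read exclusive-write) work-depth PRAM with unit-cost exact real arithmetic ($+,-,\cdot,/,\sqrt{\ },\exp,\log$, comparisons; no rounding of reals to integers), with integers of $O(\log(m+n+1/\epsilon))$ bits, and with zero-initialized memory. Work is the number of operations, and depth the length of the longest chain of dependent operations. $\tilde O(f)$ means at most $c\,(2+\log m+1/\epsilon)^{k}\cdot f$ with universal constants $c,k$ (so that it hides polylogarithmic factors when $1/\epsilon$ is polylogarithmic).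 Matrices, $h$ and index sets are passed in sparse representation. There is a deterministic data structure (a finite collection of programs that do not depend on the input) which supports the following operations. * **Initialize**$(A\in\mathbb{R}^{m\times n},x^{\mathrm{init}},g,\tilde\tau,z\in\mathbb{R}^m,w\in[0,1]^m,\epsilon>0)$, given also $\lambda$ and $C$: assumes that $A$ has no zero row, $0.5\le z_i\le 2$ and $n/m\le\tilde\tau_i\le 2$ for all $i$. It takes $\tilde O(\mathrm{nnz}(A))$ work and $\tilde O(1)$ depth. Let $G=\mathrm{diag}(g)$ (for the current $g$). * **Update**$(I\subseteq[m],b,c,d\in\mathbb{R}^I)$: sets $g_i\leftarrow b_i$, $\tilde\tau_i\leftarrow c_i$, $z_i\leftarrow d_i$ for $i\in I$, assuming $n/m\le c_i\le 2$ and $0.5\le d_i\le 2$. It takes $\tilde O(1+\sum_{i\in I}\mathrm{nnz}(a_i))$ work and $\tilde O(1)$ depth. * **SetAccuracy**$(I\subseteq[m],\delta\in[0,1]^I)$: sets $w_i\leftarrow\delta_i$ for $i\in I$, in $\tilde O(1+|I|)$ work and $\tilde O(1)$ depth. * **QueryProduct**$()$: returns $\bar v=A^\top v$, where $v=G\,(\nabla\Psi(\bar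 z))^{\flat(\bar\tau)}$ for some $\bar\tau\approx_\epsilon\tilde\tau$ and some $\bar z$ with $\|\bar z-z\|_\infty\le\epsilon$. The next operation must be QuerySum, which may be called only then. Let $v^{(\ell)}$ be the vector $v$ of the $\ell$-th call; it is fixed by the operations up to that call. * **QuerySum**$(h\in\mathbb{R}^m)$: let $h^{(\ell)}$ be the argument of the $\ell$-th call and $x^{(t)}=x^{\mathrm{init}}+\sum_{\ell=1}^t(v^{(\ell)}+h^{(\ell)})$. The $t$-th call returns (a pointer to) $\bar x^{(t)}\in\mathbb{R}^m$ with $|\bar x^{(t)}_i-x^{(t)}_i|\le\epsilon w_i$ for all $i$ (that is, $\|w^{-1}(\bar x^{(t)}-x^{(t)})\|_\infty\le\epsilon$ if $w>0$), and the set $J=\{i:\bar x^{(t)}_i\ne\bar x^{(t-1)}_i\}$, where $\bar x^{(0)}=x^{\mathrm{init}}$. Let $w^{(\ell-1)}$ be the vector $w$ in force when the $\ell$-th call is made (after all preceding SetAccuracy operations). For every $T\ge 1$, the first $T$ calls of QueryProduct and of QuerySum together take total work $$\tilde O\Big(Tn+\sum_{\ell=1}^T\|h^{(\ell)}\|_0+T\sum_{\ell=1}^T\|v^{(\ell)}/w^{(\ell-1)}\|_2^2\Big)$$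 and total depth $\tilde O(T)$, where $a/0=\infty$ for $a\neq 0$ and $0/0=0$. * **ComputeExactSum**$()$: returns the exact $x^{(t)}$, where $t$ is the number of calls of QuerySum so far, in $\tilde O(m)$ work and $\tilde O(1)$ depth. * **Potential**$()$: returns $\Psi(z)$ in $\tilde O(1)$ work and depth. The guarantees hold for every finite sequence of operations that respects these assumptions. -/

import Mathlib

open scoped ENNReal

namespace PrimalGradient

/-! ## The parallel machine

A work-depth PRAM.  Programs are finite pieces of syntax in a structured language with a parallel
loop.  The shared memory consists of named arrays of words (natural numbers, subject to a word-size
bound) and named arrays of reals (exact real arithmetic); every processor has private registers.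
Each operation costs one unit of work.  Memory access is concurrent-read exclusive-write: a program
with a data race has no execution. -/

/-- The shared memory: `nat a i` and `real a i` are the cells `i` of the word array `a` and of
the real array `a`. -/
structure Mem where
  nat : ℕ → ℕ → ℕ
  real : ℕ → ℕ → ℝ

/-- Addresses of memory cells. -/
inductive Addr where
  | nat (a i : ℕ)
  | real (a i : ℕ)

/-- A processor's view: private word registers, private real registers, and the shared memory. -/
structure State where
  nreg : ℕ → ℕ
  rreg : ℕ → ℝ
  mem : Mem

/-- Word expressions; `sub` is truncated and `div` is rounded down. -/
inductive NExp where
  | const (k : ℕ)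
  | reg (x : ℕ)
  | load (a : ℕ) (i : NExp)
  | add (e f : NExp)
  | sub (e f : NExp)
  | mul (e f : NExp)
  | div (e f : NExp)

namespace NExp

def eval (σ : State) : NExp → ℕ
  | const k => k
  | reg x => σ.nreg x
  | load a i => σ.mem.nat a (i.eval σ)
  | add e f => e.eval σ + f.eval σ
  | sub e f => e.eval σ - f.eval σ
  | mul e f => e.eval σ * f.eval σ
  | div e f => e.eval σ / f.eval σ

/-- The number of operations in an expression. -/
def size : NExp → ℕ
  | const _ => 1
  | reg _ => 1
  | load _ i => i.size + 1
  | add e f => e.size + f.size + 1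
  | sub e f => e.size + f.size + 1
  | mul e f => e.size + f.size + 1
  | div e f => e.size + f.size + 1

/-- The memory cells that the evaluation of an expression reads. -/
def reads (σ : State) : NExp → Set Addr
  | const _ => ∅
  | reg _ => ∅
  | load a i => insert (Addr.nat a (i.eval σ)) (i.reads σ)
  | add e f => e.reads σ ∪ f.reads σ
  | sub e f => e.reads σ ∪ f.reads σ
  | mul e f => e.reads σ ∪ f.reads σ
  | div e f => e.reads σ ∪ f.reads σ

end NExp

/-- Real expressions.  There is no rounding of reals to words. -/
inductive RExp where
  | ofNat (e : NExp)
  | reg (x : ℕ)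
  | load (a : ℕ) (i : NExp)
  | add (e f : RExp)
  | sub (e f : RExp)
  | mul (e f : RExp)
  | div (e f : RExp)
  | sqrt (e : RExp)
  | exp (e : RExp)
  | log (e : RExp)

namespace RExp

noncomputable def eval (σ : State) : RExp → ℝ
  | ofNat e => (e.eval σ : ℝ)
  | reg x => σ.rreg x
  | load a i => σ.mem.real a (i.eval σ)
  | add e f => e.eval σ + f.eval σ
  | sub e f => e.eval σ - f.eval σ
  | mul e f => e.eval σ * f.eval σ
  | div e f => e.eval σ / f.eval σ
  | sqrt e => Real.sqrt (e.eval σ)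
  | exp e => Real.exp (e.eval σ)
  | log e => Real.log (e.eval σ)

def size : RExp → ℕ
  | ofNat e => e.size + 1
  | reg _ => 1
  | load _ i => i.size + 1
  | add e f => e.size + f.size + 1
  | sub e f => e.size + f.size + 1
  | mul e f => e.size + f.size + 1
  | div e f => e.size + f.size + 1
  | sqrt e => e.size + 1
  | exp e => e.size + 1
  | log e => e.size + 1

def reads (σ : State) : RExp → Set Addr
  | ofNat e => e.reads σ
  | reg _ => ∅
  | load a i => insert (Addr.real a (i.eval σ)) (i.reads σ)
  | add e f => e.reads σ ∪ f.reads σ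
  | sub e f => e.reads σ ∪ f.reads σ
  | mul e f => e.reads σ ∪ f.reads σ
  | div e f => e.reads σ ∪ f.reads σ
  | sqrt e => e.reads σ
  | exp e => e.reads σ
  | log e => e.reads σ

end RExp

/-- Tests. -/
inductive BExp where
  | natLT (e f : NExp)
  | natEq (e f : NExp)
  | realLT (e f : RExp)
  | realEq (e f : RExp)
  | not (b : BExp)
  | and (b d : BExp)

namespace BExp

def Holds (σ : State) : BExp → Prop
  | natLT e f => e.eval σ < f.eval σ
  | natEq e f => e.eval σ = f.eval σ
  | realLT e f => e.eval σ < f.eval σ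
  | realEq e f => e.eval σ = f.eval σ
  | not b => ¬ b.Holds σ
  | and b d => b.Holds σ ∧ d.Holds σ

def size : BExp → ℕ
  | natLT e f => e.size + f.size + 1
  | natEq e f => e.size + f.size + 1
  | realLT e f => e.size + f.size + 1
  | realEq e f => e.size + f.size + 1
  | not b => b.size + 1
  | and b d => b.size + d.size + 1

def reads (σ : State) : BExp → Set Addr
  | natLT e f => e.reads σ ∪ f.reads σ
  | natEq e f => e.reads σ ∪ f.reads σ
  | realLT e f => e.reads σ ∪ f.reads σ
  | realEq e f => e.reads σ ∪ f.reads σ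
  | not b => b.reads σ
  | and b d => b.reads σ ∪ d.reads σ

end BExp

/-- Programs.  `setN`, `setR` write registers, `storeN a i e`, `storeR a i e` write the memory
cell `i` of the array `a`, `loop b c` repeats `c` while `b` holds, and
`pfor x e c` runs `c` in parallel for all values `0, …, e - 1` of the register `x`. -/
inductive Cmd where
  | skip
  | setN (x : ℕ) (e : NExp)
  | setR (x : ℕ) (e : RExp)
  | storeN (a : ℕ) (i : NExp) (e : NExp)
  | storeR (a : ℕ) (i : NExp) (e : RExp)
  | seq (c d : Cmd)
  | ite (b : BExp) (c d : Cmd)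
  | loop (b : BExp) (c : Cmd)
  | pfor (x : ℕ) (e : NExp) (c : Cmd)

namespace Mem

def storeN (M : Mem) (a i v : ℕ) : Mem :=
  { M with nat := Function.update M.nat a (Function.update (M.nat a) i v) }

noncomputable def storeR (M : Mem) (a i : ℕ) (v : ℝ) : Mem :=
  { M with real := Function.update M.real a (Function.update (M.real a) i v) }

/-- Two memories have the same content in a given cell. -/
def SameAt (M M' : Mem) : Addr → Prop
  | Addr.nat a i => M.nat a i = M'.nat a i
  | Addr.real a i => M.real a i = M'.real a i

/-- Overwrite a whole word array by a list (followed by zeros). -/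
def putN (M : Mem) (a : ℕ) (l : List ℕ) : Mem :=
  { M with nat := Function.update M.nat a (fun i => l.getD i 0) }

/-- Overwrite a whole real array by a list (followed by zeros). -/
noncomputable def putR (M : Mem) (a : ℕ) (l : List ℝ) : Mem :=
  { M with real := Function.update M.real a (fun i => l.getD i 0) }

/-- The memory in which all cells are zero. -/
noncomputable def zero : Mem := ⟨fun _ _ => 0, fun _ _ => 0⟩

end Mem

namespace State

def setN (σ : State) (x v : ℕ) : State := { σ with nreg := Function.update σ.nreg x v }

noncomputable def setR (σ : State) (x : ℕ) (v : ℝ) : State :=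
  { σ with rreg := Function.update σ.rreg x v }

end State

/-- `Exec B c σ σ' W D R S`: with words bounded by `B`, the program `c` started in `σ` terminates
without a data race in `σ'`, using work `W` (the number of operations) and depth `D` (the length of
the longest chain of dependent operations), reading the cells in `R` and writing those in `S`.

In a parallel loop all iterations start from the current state, with a private copy of the
registers that is discarded at the end; no iteration may write a cell that another iteration
reads or writes, and the resulting memory collects the writes of all iterations. -/
inductive Exec (B : ℕ) :
    Cmd → State → State → ℕ → ℕ → Set Addr → Set Addr → Prop
  | skip (σ : State) : Exec B Cmd.skip σ σ 1 1 ∅ ∅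
  | setN (σ : State) (x : ℕ) (e : NExp) (hB : e.eval σ ≤ B) :
      Exec B (Cmd.setN x e) σ (σ.setN x (e.eval σ)) (e.size + 1) (e.size + 1) (e.reads σ) ∅
  | setR (σ : State) (x : ℕ) (e : RExp) :
      Exec B (Cmd.setR x e) σ (σ.setR x (e.eval σ)) (e.size + 1) (e.size + 1) (e.reads σ) ∅
  | storeN (σ : State) (a : ℕ) (i e : NExp) (hi : i.eval σ ≤ B) (hB : e.eval σ ≤ B) :
      Exec B (Cmd.storeN a i e) σ { σ with mem := σ.mem.storeN a (i.eval σ) (e.eval σ) }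
        (i.size + e.size + 1) (i.size + e.size + 1)
        (i.reads σ ∪ e.reads σ) {Addr.nat a (i.eval σ)}
  | storeR (σ : State) (a : ℕ) (i : NExp) (e : RExp) (hi : i.eval σ ≤ B) :
      Exec B (Cmd.storeR a i e) σ { σ with mem := σ.mem.storeR a (i.eval σ) (e.eval σ) }
        (i.size + e.size + 1) (i.size + e.size + 1)
        (i.reads σ ∪ e.reads σ) {Addr.real a (i.eval σ)}
  | seq {c d : Cmd} {σ σ₁ σ₂ : State} {W₁ W₂ D₁ D₂ : ℕ} {R₁ R₂ S₁ S₂ : Set Addr}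
      (h₁ : Exec B c σ σ₁ W₁ D₁ R₁ S₁) (h₂ : Exec B d σ₁ σ₂ W₂ D₂ R₂ S₂) :
      Exec B (Cmd.seq c d) σ σ₂ (W₁ + W₂) (D₁ + D₂) (R₁ ∪ R₂) (S₁ ∪ S₂)
  | iteTrue {b : BExp} {c d : Cmd} {σ σ₁ : State} {W D : ℕ} {R S : Set Addr}
      (hb : b.Holds σ) (h : Exec B c σ σ₁ W D R S) :
      Exec B (Cmd.ite b c d) σ σ₁ (b.size + W) (b.size + D) (b.reads σ ∪ R) S
  | iteFalse {b : BExp} {c d : Cmd} {σ σ₁ : State} {W D : ℕ} {R S : Set Addr}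
      (hb : ¬ b.Holds σ) (h : Exec B d σ σ₁ W D R S) :
      Exec B (Cmd.ite b c d) σ σ₁ (b.size + W) (b.size + D) (b.reads σ ∪ R) S
  | loopFalse {b : BExp} {c : Cmd} {σ : State} (hb : ¬ b.Holds σ) :
      Exec B (Cmd.loop b c) σ σ b.size b.size (b.reads σ) ∅
  | loopTrue {b : BExp} {c : Cmd} {σ σ₁ σ₂ : State} {W₁ W₂ D₁ D₂ : ℕ} {R₁ R₂ S₁ S₂ : Set Addr}
      (hb : b.Holds σ) (h₁ : Exec B c σ σ₁ W₁ D₁ R₁ S₁)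
      (h₂ : Exec B (Cmd.loop b c) σ₁ σ₂ W₂ D₂ R₂ S₂) :
      Exec B (Cmd.loop b c) σ σ₂ (b.size + W₁ + W₂) (b.size + D₁ + D₂)
        (b.reads σ ∪ R₁ ∪ R₂) (S₁ ∪ S₂)
  | pfor {x : ℕ} {e : NExp} {c : Cmd} {σ : State} {M : Mem}
      {τ : ℕ → State} {W D : ℕ → ℕ} {R S : ℕ → Set Addr}
      (hB : e.eval σ ≤ B)
      (hrun : ∀ i < e.eval σ, Exec B c (σ.setN x i) (τ i) (W i) (D i) (R i) (S i))
      (hrace : ∀ i < e.eval σ, ∀ j < e.eval σ, i ≠ j → Disjoint (S i) (R j ∪ S j))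
      (hwritten : ∀ i < e.eval σ, ∀ p ∈ S i, M.SameAt (τ i).mem p)
      (hkept : ∀ p, (∀ i < e.eval σ, p ∉ S i) → M.SameAt σ.mem p) :
      Exec B (Cmd.pfor x e c) σ { σ with mem := M }
        (e.size + 1 + ∑ i ∈ Finset.range (e.eval σ), (W i + 1))
        (e.size + 1 + (Finset.range (e.eval σ)).sup D)
        (e.reads σ ∪ ⋃ i ∈ Set.Iio (e.eval σ), R i) (⋃ i ∈ Set.Iio (e.eval σ), S i)

/-- A procedure call: started with all registers zero on the memory `M`, the program `c`
terminates with memory `M'`, work `W` and depth `D`. -/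
def Runs (B : ℕ) (c : Cmd) (M M' : Mem) (W D : ℕ) : Prop :=
  ∃ (σ' : State) (R S : Set Addr),
    Exec B c ⟨fun _ => 0, fun _ => 0, M⟩ σ' W D R S ∧ σ'.mem = M'

/-! ## The mathematical objects -/

section Math

variable {m n : ℕ}

/-- The potential `Ψ(z) = ∑ᵢ cosh (λ zᵢ)`. -/
noncomputable def Psi (lam : ℝ) (z : Fin m → ℝ) : ℝ := ∑ i, Real.cosh (lam * z i)

/-- The gradient of `Ψ`: the vector of its partial derivatives. -/
noncomputable def gradPsi (lam : ℝ) (z : Fin m → ℝ) : Fin m → ℝ :=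
  fun i => deriv (fun s => Psi lam (Function.update z i s)) (z i)

/-- The mixed norm `‖v‖_∞ + C log (4m/n) ‖v‖_τ` on `ℝ^m` (on `Fin m → ℝ` the norm of Mathlib is
the maximum norm). -/
noncomputable def mixedNorm (C : ℝ) (n : ℕ) (τ v : Fin m → ℝ) : ℝ :=
  ‖v‖ + C * Real.log (4 * (m : ℝ) / (n : ℝ)) * Real.sqrt (∑ i, τ i * v i ^ 2)

/-- `y` is the vector `x^{♭(τ)}`: a maximizer of `⟨x, ·⟩` over the unit ball of the mixed norm. -/
def IsFlat (C : ℝ) (n : ℕ) (τ x y : Fin m → ℝ) : Prop :=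
  mixedNorm C n τ y ≤ 1 ∧ ∀ u : Fin m → ℝ, mixedNorm C n τ u ≤ 1 → x ⬝ᵥ u ≤ x ⬝ᵥ y

/-- The number of non-zero entries of a vector. -/
noncomputable def nnz {d : ℕ} (x : Fin d → ℝ) : ℕ := {i | x i ≠ 0}.ncard

/-- The vector with given sparse representation. -/
noncomputable def ofEntries {d : ℕ} (l : List (Fin d × ℝ)) : Fin d → ℝ :=
  fun i => (l.lookup i).getD 0

/-- A list of index-value pairs is a sparse representation of a vector if it lists every
non-zero entry exactly once, in any order. -/
def IsSparse {d : ℕ} (l : List (Fin d × ℝ)) : Prop :=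
  (l.map Prod.fst).Nodup ∧ ∀ p ∈ l, p.2 ≠ 0

/-- The factor hidden by `Õ`. -/
noncomputable def polyFactor (c k m : ℕ) (ε : ℝ) : ℝ := c * (2 + Real.log m + 1 / ε) ^ k

/-- The word-size bound: words have `O(log (m + n + 1/ε))` bits. -/
noncomputable def wordBound (k m n : ℕ) (ε : ℝ) : ℕ := (m + n + ⌈1 / ε⌉₊ + 2) ^ k

end Math

/-! ## The interface of the data structure -/

/-- The arguments of `Initialize`, the matrix being given by the sparse representations of its
rows, together with the parameter `lam` of the potential `Ψ` and the constant `C` of the mixed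
norm. -/
structure Input (m n : ℕ) where
  rows : Fin m → List (Fin n × ℝ)
  x : Fin m → ℝ
  g : Fin m → ℝ
  τ : Fin m → ℝ
  z : Fin m → ℝ
  w : Fin m → ℝ
  ε : ℝ
  lam : ℝ
  C : ℝ

namespace Input

variable {m n : ℕ}

/-- The matrix `A`. -/
noncomputable def A (inp : Input m n) : Matrix (Fin m) (Fin n) ℝ :=
  Matrix.of fun i => ofEntries (inp.rows i)

/-- The number of non-zero entries of `A`. -/
noncomputable def nnzA (inp : Input m n) : ℕ := ∑ i, nnz (inp.A i)

/-- What the data structure assumes about the arguments of `Initialize`. -/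
structure Valid (inp : Input m n) : Prop where
  m_pos : 0 < m
  n_pos : 0 < n
  sparse : ∀ i, IsSparse (inp.rows i)
  row_ne_zero : ∀ i, inp.A i ≠ 0
  τ_mem : ∀ i, inp.τ i ∈ Set.Icc ((n : ℝ) / m) 2
  z_mem : ∀ i, inp.z i ∈ Set.Icc (0.5 : ℝ) 2
  w_mem : ∀ i, inp.w i ∈ Set.Icc (0 : ℝ) 1
  ε_pos : 0 < inp.ε
  lam_pos : 0 < inp.lam
  C_pos : 0 < inp.C

end Input

/-- The operations after `Initialize`, with their arguments.  An `update` carries a list of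
tuples `(i, bᵢ, cᵢ, dᵢ)`, a `setAccuracy` a list of pairs `(i, δᵢ)`, and a `querySum` the
sparse representation of `h`. -/
inductive Op (m : ℕ) where
  | update (u : List (Fin m × ℝ × ℝ × ℝ))
  | setAccuracy (u : List (Fin m × ℝ))
  | queryProduct
  | querySum (h : List (Fin m × ℝ))
  | computeExactSum
  | potential

/-- The sequence of operations performed since `Initialize`, the most recent one first. -/
abbrev History (m : ℕ) := List (Op m)

/-- The current values of the vectors that the user sets. -/
structure Params (m : ℕ) where
  g : Fin m → ℝ
  τ : Fin m → ℝ
  z : Fin m → ℝ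
  w : Fin m → ℝ

section Spec

variable {m n : ℕ}

/-- The values of `g`, `τ̃`, `z`, `w` after a history. -/
noncomputable def current (inp : Input m n) : History m → Params m
  | [] => ⟨inp.g, inp.τ, inp.z, inp.w⟩
  | Op.update u :: H =>
      { current inp H with
        g := fun i => ((u.lookup i).map fun p => p.1).getD ((current inp H).g i)
        τ := fun i => ((u.lookup i).map fun p => p.2.1).getD ((current inp H).τ i)
        z := fun i => ((u.lookup i).map fun p => p.2.2).getD ((current inp H).z i) }
  | Op.setAccuracy u :: H =>
      { current inp H with w := fun i => (u.lookup i).getD ((current inp H).w i) }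
  | _ :: H => current inp H

/-- The last operation was a `queryProduct` (so that a `querySum` has to follow). -/
def Pending : History m → Prop
  | Op.queryProduct :: _ => True
  | _ => False

/-- What the data structure assumes about the arguments of an operation. -/
def ValidArgs (n : ℕ) : Op m → Prop
  | Op.update u => (u.map Prod.fst).Nodup ∧
      ∀ p ∈ u, p.2.2.1 ∈ Set.Icc ((n : ℝ) / m) 2 ∧ p.2.2.2 ∈ Set.Icc (0.5 : ℝ) 2
  | Op.setAccuracy u => (u.map Prod.fst).Nodup ∧ ∀ p ∈ u, p.2 ∈ Set.Icc (0 : ℝ) 1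
  | Op.querySum h => IsSparse h
  | _ => True

/-- Histories that respect the assumptions: every call of `queryProduct` is followed by a call of
`querySum`, which is not called otherwise. -/
def ValidHistory (n : ℕ) : History m → Prop
  | [] => True
  | o :: H => ValidHistory n H ∧ ValidArgs n o ∧ (Pending H ↔ ∃ h, o = Op.querySum h)

/-- The exact sum `x^{(t)}`, where `t` is the number of calls of `querySum` so far, and where
`v H` for a history `H` that ends with the `ℓ`-th call of `queryProduct` is the vector `v^{(ℓ)}`. -/
noncomputable def exactSum (inp : Input m n) (v : History m → Fin m → ℝ) :
    History m → Fin m → ℝ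
  | [] => inp.x
  | Op.querySum h :: H => exactSum inp v H + (v H + ofEntries h)
  | _ :: H => exactSum inp v H

/-- The number `T` of calls of `querySum`. -/
def numQueries : History m → ℕ
  | [] => 0
  | Op.querySum _ :: H => numQueries H + 1
  | _ :: H => numQueries H

/-- `∑_ℓ ‖h^{(ℓ)}‖₀`. -/
noncomputable def sumSupport : History m → ℕ
  | [] => 0
  | Op.querySum h :: H => sumSupport H + nnz (ofEntries h)
  | _ :: H => sumSupport H

/-- `∑_ℓ ‖v^{(ℓ)} / w‖₂²`, where `w` is the accuracy vector in force when the `ℓ`-th call is made.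
Here `a / 0 = ∞` for `a > 0`, and `0 / 0 = 0`. -/
noncomputable def sumEnergy (inp : Input m n) (v : History m → Fin m → ℝ) : History m → ℝ≥0∞
  | [] => 0
  | Op.querySum _ :: H => sumEnergy inp v H +
      ∑ i, (ENNReal.ofReal |v H i| / ENNReal.ofReal ((current inp H).w i)) ^ 2
  | _ :: H => sumEnergy inp v H

/-- The total cost of all calls of `queryProduct` and `querySum`, where `cost H` is the cost of the
last operation of `H`. -/
def queryCost (cost : History m → ℕ) : History m → ℕ
  | [] => 0
  | Op.queryProduct :: H => queryCost cost H + cost (Op.queryProduct :: H)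
  | Op.querySum h :: H => queryCost cost H + cost (Op.querySum h :: H)
  | _ :: H => queryCost cost H

end Spec

/-! ### Calling convention

Before a call, the caller overwrites the argument arrays of that call; the rest of the memory is
left as the previous call left it. The data structure may use all arrays, in particular those not
named here. -/

section Convention

variable {m n : ℕ}

/-- Word arrays for arguments: the pair `m, n`; the row pointers, column indices of the matrix;
the index list of an operation and its length. -/
abbrev inDim : ℕ := 0
abbrev inPtr : ℕ := 1
abbrev inCol : ℕ := 2
abbrev inIdx : ℕ := 3
abbrev inLen : ℕ := 4

/-- Word arrays for results: the list `J` and its length. -/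
abbrev outJ : ℕ := 5
abbrev outLen : ℕ := 6

/-- Real arrays for arguments: the triple `ε, λ, C`; the non-zero entries of the matrix; the
vectors given to `Initialize`; the value lists of an operation. -/
abbrev inScal : ℕ := 0
abbrev inVal : ℕ := 1
abbrev inX : ℕ := 2
abbrev inG : ℕ := 3
abbrev inTau : ℕ := 4
abbrev inZ : ℕ := 5
abbrev inW : ℕ := 6
abbrev inArg1 : ℕ := 7
abbrev inArg2 : ℕ := 8
abbrev inArg3 : ℕ := 9

/-- Real arrays for results: `v̄`, `x̄`, the exact sum, the potential. -/
abbrev outV : ℕ := 10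
abbrev outXbar : ℕ := 11
abbrev outExact : ℕ := 12
abbrev outPot : ℕ := 13

/-- The memory on which `Initialize` is called: the arguments (the matrix in compressed row
format), and zeros elsewhere. -/
noncomputable def Input.load (inp : Input m n) : Mem :=
  (((((((((Mem.zero.putN inDim [m, n]).putN inPtr
    ((List.range (m + 1)).map fun i => (((List.ofFn inp.rows).take i).map List.length).sum)).putN
    inCol ((List.ofFn inp.rows).flatten.map fun p => (p.1 : ℕ))).putR
    inVal ((List.ofFn inp.rows).flatten.map Prod.snd)).putR
    inX (List.ofFn inp.x)).putR inG (List.ofFn inp.g)).putR inTau (List.ofFn inp.τ)).putR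
    inZ (List.ofFn inp.z)).putR inW (List.ofFn inp.w)).putR inScal [inp.ε, inp.lam, inp.C]

/-- Pass the arguments of an operation. -/
noncomputable def Op.load (M : Mem) : Op m → Mem
  | Op.update u => ((((M.putN inLen [u.length]).putN inIdx (u.map fun p => (p.1 : ℕ))).putR
      inArg1 (u.map fun p => p.2.1)).putR inArg2 (u.map fun p => p.2.2.1)).putR
      inArg3 (u.map fun p => p.2.2.2)
  | Op.setAccuracy u => ((M.putN inLen [u.length]).putN inIdx (u.map fun p => (p.1 : ℕ))).putR
      inArg1 (u.map Prod.snd)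
  | Op.querySum h => ((M.putN inLen [h.length]).putN inIdx (h.map fun p => (p.1 : ℕ))).putR
      inArg1 (h.map Prod.snd)
  | _ => M

/-- A data structure: one program for every operation.  The programs are fixed finite pieces of
syntax and do not depend on the dimensions or on any other part of the input. -/
structure DataStructure where
  init : Cmd
  update : Cmd
  setAccuracy : Cmd
  queryProduct : Cmd
  querySum : Cmd
  computeExactSum : Cmd
  potential : Cmd

def DataStructure.prog (ds : DataStructure) : Op m → Cmd
  | Op.update _ => ds.update
  | Op.setAccuracy _ => ds.setAccuracy
  | Op.queryProduct => ds.queryProduct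
  | Op.querySum _ => ds.querySum
  | Op.computeExactSum => ds.computeExactSum
  | Op.potential => ds.potential

/-- The first entries of a real array as a vector. -/
def Mem.vec (M : Mem) (a d : ℕ) : Fin d → ℝ := fun i => M.real a i

/-- The vector `x̄` returned by the last call of `querySum` (initially `x^{init}`), where
`mem H` is the memory after the history `H`. -/
noncomputable def lastXbar (inp : Input m n) (mem : History m → Mem) : History m → Fin m → ℝ
  | [] => inp.x
  | Op.querySum h :: H => (mem (Op.querySum h :: H)).vec outXbar m
  | _ :: H => lastXbar inp mem H

/-- The memory holds, as a list without repetitions, the set `J` of indices. -/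
def Mem.ListsJ (M : Mem) (J : Set (Fin m)) : Prop :=
  ∃ l : List (Fin m), l.Nodup ∧ (∀ i, i ∈ l ↔ i ∈ J) ∧ M.nat outLen 0 = l.length ∧
    ∀ p : Fin l.length, M.nat outJ p = (l.get p : ℕ)

/-- `v = G (∇Ψ(z̄))^{♭(τ̄)}` for some `τ̄ ≈_ε τ̃` and some `z̄` with `‖z̄ - z‖_∞ ≤ ε`. -/
def IsStep (inp : Input m n) (p : Params m) (v : Fin m → ℝ) : Prop :=
  ∃ τbar zbar y : Fin m → ℝ,
    (∀ i, Real.exp (-inp.ε) * p.τ i ≤ τbar i ∧ τbar i ≤ Real.exp inp.ε * p.τ i) ∧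
    ‖zbar - p.z‖ ≤ inp.ε ∧
    IsFlat inp.C n τbar (gradPsi inp.lam zbar) y ∧
    v = (Matrix.diagonal p.g).mulVec y

end Convention

end PrimalGradient

open PrimalGradient

namespace PrimalGradient

attribute [simp] NExp.eval RExp.eval BExp.Holds

/-! ## Program logic -/

/-- Names of arrays. -/
inductive Arr where
  | nat (a : ℕ)
  | real (a : ℕ)
  deriving DecidableEq

/-- The array of a cell. -/
def Addr.arr : Addr → Arr
  | Addr.nat a _ => Arr.nat a
  | Addr.real a _ => Arr.real a

/-- The expression does not read the array. -/
def NExp.avoids (A : Arr) : NExp → Bool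
  | const _ => true
  | reg _ => true
  | load a i => decide (A ≠ Arr.nat a) && i.avoids A
  | add e f => e.avoids A && f.avoids A
  | sub e f => e.avoids A && f.avoids A
  | mul e f => e.avoids A && f.avoids A
  | div e f => e.avoids A && f.avoids A

def RExp.avoids (A : Arr) : RExp → Bool
  | ofNat e => e.avoids A
  | reg _ => true
  | load a i => decide (A ≠ Arr.real a) && i.avoids A
  | add e f => e.avoids A && f.avoids A
  | sub e f => e.avoids A && f.avoids A
  | mul e f => e.avoids A && f.avoids A
  | div e f => e.avoids A && f.avoids A
  | sqrt e => e.avoids A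
  | exp e => e.avoids A
  | log e => e.avoids A

def BExp.avoids (A : Arr) : BExp → Bool
  | natLT e f => e.avoids A && f.avoids A
  | natEq e f => e.avoids A && f.avoids A
  | realLT e f => e.avoids A && f.avoids A
  | realEq e f => e.avoids A && f.avoids A
  | not b => b.avoids A
  | and b d => b.avoids A && d.avoids A

theorem NExp.arr_ne_of_avoids {A : Arr} {e : NExp} (h : e.avoids A = true) (σ : State) :
    ∀ p ∈ e.reads σ, p.arr ≠ A := by
  induction e with
  | const k => simp [NExp.reads]
  | reg x => simp [NExp.reads]
  | load a i ih =>
    simp only [NExp.avoids, Bool.and_eq_true, decide_eq_true_eq] at h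
    intro p hp
    rcases hp with rfl | hp
    · exact fun h' => h.1 h'.symm
    · exact ih h.2 p hp
  | add e f ihe ihf | sub e f ihe ihf | mul e f ihe ihf | div e f ihe ihf =>
    simp only [NExp.avoids, Bool.and_eq_true] at h
    rintro p (hp | hp)
    · exact ihe h.1 p hp
    · exact ihf h.2 p hp

theorem RExp.arr_ne_of_avoids {A : Arr} {e : RExp} (h : e.avoids A = true) (σ : State) :
    ∀ p ∈ e.reads σ, p.arr ≠ A := by
  induction e with
  | ofNat e => exact NExp.arr_ne_of_avoids h σ
  | reg x => simp [RExp.reads]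
  | load a i =>
    simp only [RExp.avoids, Bool.and_eq_true, decide_eq_true_eq] at h
    intro p hp
    rcases hp with rfl | hp
    · exact fun h' => h.1 h'.symm
    · exact NExp.arr_ne_of_avoids h.2 σ p hp
  | add e f ihe ihf | sub e f ihe ihf | mul e f ihe ihf | div e f ihe ihf =>
    simp only [RExp.avoids, Bool.and_eq_true] at h
    rintro p (hp | hp)
    · exact ihe h.1 p hp
    · exact ihf h.2 p hp
  | sqrt e ih | exp e ih | log e ih => exact ih h

theorem BExp.arr_ne_of_avoids {A : Arr} {b : BExp} (h : b.avoids A = true) (σ : State) :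
    ∀ p ∈ b.reads σ, p.arr ≠ A := by
  induction b with
  | natLT e f | natEq e f =>
    simp only [BExp.avoids, Bool.and_eq_true] at h
    rintro p (hp | hp)
    · exact NExp.arr_ne_of_avoids h.1 σ p hp
    · exact NExp.arr_ne_of_avoids h.2 σ p hp
  | realLT e f | realEq e f =>
    simp only [BExp.avoids, Bool.and_eq_true] at h
    rintro p (hp | hp)
    · exact RExp.arr_ne_of_avoids h.1 σ p hp
    · exact RExp.arr_ne_of_avoids h.2 σ p hp
  | not b ih => exact ih h
  | and b d ihb ihd =>
    simp only [BExp.avoids, Bool.and_eq_true] at h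
    rintro p (hp | hp)
    · exact ihb h.1 p hp
    · exact ihd h.2 p hp

namespace Mem

/-- Replace a whole word array. -/
def setNA (M : Mem) (a : ℕ) (f : ℕ → ℕ) : Mem := { M with nat := Function.update M.nat a f }

/-- Replace a whole real array. -/
noncomputable def setRA (M : Mem) (a : ℕ) (f : ℕ → ℝ) : Mem :=
  { M with real := Function.update M.real a f }

@[simp] theorem setNA_nat (M : Mem) (a b : ℕ) (f : ℕ → ℕ) :
    (M.setNA a f).nat b = if b = a then f else M.nat b := by
  simp [setNA, Function.update_apply]

@[simp] theorem setNA_real (M : Mem) (a : ℕ) (f : ℕ → ℕ) : (M.setNA a f).real = M.real := rfl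

@[simp] theorem setRA_real (M : Mem) (a b : ℕ) (f : ℕ → ℝ) :
    (M.setRA a f).real b = if b = a then f else M.real b := by
  simp [setRA, Function.update_apply]

@[simp] theorem setRA_nat (M : Mem) (a : ℕ) (f : ℕ → ℝ) : (M.setRA a f).nat = M.nat := rfl

theorem storeN_eq (M : Mem) (a i v : ℕ) :
    M.storeN a i v = M.setNA a (Function.update (M.nat a) i v) := rfl

theorem storeR_eq (M : Mem) (a i : ℕ) (v : ℝ) :
    M.storeR a i v = M.setRA a (Function.update (M.real a) i v) := rfl

/-- `M'` agrees with `M` outside the listed word and real arrays. -/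
def EqOff (NS RS : List ℕ) (M M' : Mem) : Prop :=
  (∀ a, a ∉ NS → M'.nat a = M.nat a) ∧ ∀ a, a ∉ RS → M'.real a = M.real a

theorem EqOff.refl {NS RS : List ℕ} (M : Mem) : EqOff NS RS M M := ⟨fun _ _ => rfl, fun _ _ => rfl⟩

theorem EqOff.trans {NS RS : List ℕ} {M₁ M₂ M₃ : Mem} (h : EqOff NS RS M₁ M₂)
    (h' : EqOff NS RS M₂ M₃) : EqOff NS RS M₁ M₃ :=
  ⟨fun a ha => (h'.1 a ha).trans (h.1 a ha), fun a ha => (h'.2 a ha).trans (h.2 a ha)⟩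

theorem EqOff.mono {NS RS NS' RS' : List ℕ} {M M' : Mem} (h : EqOff NS RS M M')
    (hN : ∀ a ∈ NS, a ∈ NS') (hR : ∀ a ∈ RS, a ∈ RS') : EqOff NS' RS' M M' :=
  ⟨fun a ha => h.1 a fun h' => ha (hN a h'), fun a ha => h.2 a fun h' => ha (hR a h')⟩

theorem EqOff.setNA {NS RS : List ℕ} {M M' : Mem} (h : EqOff NS RS M M') {a : ℕ} (ha : a ∈ NS)
    (f : ℕ → ℕ) : EqOff NS RS M (M'.setNA a f) := by
  refine ⟨fun b hb => ?_, h.2⟩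
  have hba : b ≠ a := fun e => hb (e ▸ ha)
  rw [setNA_nat, if_neg hba, h.1 b hb]

theorem EqOff.setRA {NS RS : List ℕ} {M M' : Mem} (h : EqOff NS RS M M') {a : ℕ} (ha : a ∈ RS)
    (f : ℕ → ℝ) : EqOff NS RS M (M'.setRA a f) := by
  refine ⟨h.1, fun b hb => ?_⟩
  have hba : b ≠ a := fun e => hb (e ▸ ha)
  rw [setRA_real, if_neg hba, h.2 b hb]

end Mem

/-- The state with zero registers. -/
abbrev st (M : Mem) : State := ⟨fun _ => 0, fun _ => 0, M⟩

/-- The state of iteration `k` of a parallel loop. -/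
abbrev st1 (M : Mem) (k : ℕ) : State := (st M).setN 0 k

/-- The state of iteration `k, l` of two nested parallel loops. -/
abbrev st2 (M : Mem) (k l : ℕ) : State := ((st M).setN 0 k).setN 1 l

@[simp] theorem State.setN_nreg (σ : State) (x y v : ℕ) :
    (σ.setN x v).nreg y = if y = x then v else σ.nreg y := by
  simp [State.setN, Function.update_apply]
@[simp] theorem State.setN_mem (σ : State) (x v : ℕ) : (σ.setN x v).mem = σ.mem := rfl

/-- The command terminates from the memory `M` within work `W` and depth `D`, in a memory that
satisfies `Q`. -/
def T (B : ℕ) (c : Cmd) (M : Mem) (W D : ℕ) (Q : Mem → Prop) : Prop :=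
  ∃ (M' : Mem) (W' D' : ℕ) (R S : Set Addr),
    Exec B c (st M) (st M') W' D' R S ∧ W' ≤ W ∧ D' ≤ D ∧ Q M'

infixr:60 " ;; " => Cmd.seq

variable {B : ℕ}

theorem T.mono {c : Cmd} {M : Mem} {W D W' D' : ℕ} {P Q : Mem → Prop} (h : T B c M W D P)
    (hW : W ≤ W') (hD : D ≤ D') (hQ : ∀ M', P M' → Q M') : T B c M W' D' Q := by
  obtain ⟨M', w, d, R, S, hE, hw, hd, hP⟩ := h
  exact ⟨M', w, d, R, S, hE, hw.trans hW, hd.trans hD, hQ _ hP⟩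

theorem T.bind {c d : Cmd} {M : Mem} {W D W' D' : ℕ} {P Q : Mem → Prop} (h : T B c M W D P)
    (h' : ∀ M', P M' → T B d M' W' D' Q) : T B (c ;; d) M (W + W') (D + D') Q := by
  obtain ⟨M₁, w, d, R, S, hE, hw, hd, hP⟩ := h
  obtain ⟨M₂, w', d', R', S', hE', hw', hd', hQ⟩ := h' _ hP
  exact ⟨M₂, _, _, _, _, Exec.seq hE hE', Nat.add_le_add hw hw', Nat.add_le_add hd hd', hQ⟩

theorem T.next {c d : Cmd} {M : Mem} {W D W₁ D₁ : ℕ} {P Q : Mem → Prop} (h : T B c M W₁ D₁ P)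
    (h' : ∀ M', P M' → T B d M' (W - W₁) (D - D₁) Q) (hW : W₁ ≤ W := by omega)
    (hD : D₁ ≤ D := by omega) : T B (c ;; d) M W D Q :=
  (T.bind h h').mono (by omega) (by omega) fun _ h => h

theorem T_skip {M : Mem} : T B Cmd.skip M 1 1 (fun M' => M' = M) :=
  ⟨M, 1, 1, _, _, Exec.skip _, le_rfl, le_rfl, rfl⟩

theorem T_storeN {M : Mem} {a : ℕ} {i e : NExp} (hi : i.eval (st M) ≤ B)
    (he : e.eval (st M) ≤ B) (hs : i.size + e.size + 1 ≤ 200) :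
    T B (Cmd.storeN a i e) M 200 200
      (fun M' => M' = M.setNA a (Function.update (M.nat a) (i.eval (st M)) (e.eval (st M)))) :=
  ⟨_, _, _, _, _, Exec.storeN (st M) a i e hi he, hs, hs, rfl⟩

theorem T_storeR {M : Mem} {a : ℕ} {i : NExp} {e : RExp} (hi : i.eval (st M) ≤ B)
    (hs : i.size + e.size + 1 ≤ 200) :
    T B (Cmd.storeR a i e) M 200 200
      (fun M' => M' = M.setRA a (Function.update (M.real a) (i.eval (st M)) (e.eval (st M)))) :=
  ⟨_, _, _, _, _, Exec.storeR (st M) a i e hi, hs, hs, rfl⟩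

theorem T_ite {b : BExp} {c d : Cmd} {M : Mem} {W D : ℕ} {Q : Mem → Prop}
    (hs : b.size ≤ 200) (ht : b.Holds (st M) → T B c M W D Q)
    (hf : ¬ b.Holds (st M) → T B d M W D Q) : T B (Cmd.ite b c d) M (200 + W) (200 + D) Q := by
  by_cases hb : b.Holds (st M)
  · obtain ⟨M', w, d, R, S, hE, hw, hd, hQ⟩ := ht hb
    exact ⟨M', _, _, _, _, Exec.iteTrue hb hE, by omega, by omega, hQ⟩
  · obtain ⟨M', w, d, R, S, hE, hw, hd, hQ⟩ := hf hb
    exact ⟨M', _, _, _, _, Exec.iteFalse hb hE, by omega, by omega, hQ⟩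

theorem T_loop {b : BExp} {c : Cmd} {Q : Mem → Prop} (I : ℕ → Mem → Prop) (N Wb Db : ℕ)
    (hs : b.size ≤ 200)
    (hstep : ∀ j M, I j M → b.Holds (st M) → j < N ∧ T B c M Wb Db (I (j + 1)))
    (hexit : ∀ j M, I j M → ¬ b.Holds (st M) → Q M) :
    ∀ (k j : ℕ) (M : Mem), N ≤ j + k → I j M →
      T B (Cmd.loop b c) M (200 + k * (200 + Wb)) (200 + k * (200 + Db)) Q := by
  intro k
  induction k with
  | zero =>
    intro j M hj hI
    have hb : ¬ b.Holds (st M) := fun hb => by have := (hstep j M hI hb).1; omega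
    exact ⟨M, _, _, _, _, Exec.loopFalse hb, by omega, by omega, hexit j M hI hb⟩
  | succ k ih =>
    intro j M hj hI
    by_cases hb : b.Holds (st M)
    · obtain ⟨-, M₁, w, d, R, S, hE, hw, hd, hI₁⟩ := hstep j M hI hb
      obtain ⟨M₂, w', d', R', S', hE', hw', hd', hQ⟩ := ih (j + 1) M₁ (by omega) hI₁
      refine ⟨M₂, _, _, _, _, Exec.loopTrue hb hE hE', ?_, ?_, hQ⟩
      · rw [Nat.succ_mul]; omega
      · rw [Nat.succ_mul]; omega
    · exact ⟨M, _, _, _, _, Exec.loopFalse hb, by omega, by omega, hexit j M hI hb⟩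

/-- The scalar stored in cell `0` of a word array. -/
abbrev sc (a : ℕ) : NExp := NExp.load a (NExp.const 0)

/-- The scalar stored in cell `0` of a real array. -/
abbrev rs (a : ℕ) : RExp := RExp.load a (NExp.const 0)

/-- A sequential loop with the counter in cell `0` of the word array `c`. -/
def Cmd.forTo (c : ℕ) (e : NExp) (body : Cmd) : Cmd :=
  Cmd.storeN c (NExp.const 0) (NExp.const 0) ;;
    Cmd.loop (BExp.natLT (sc c) e)
      (body ;; Cmd.storeN c (NExp.const 0) (NExp.add (sc c) (NExp.const 1)))

theorem T_forTo {c : ℕ} {e : NExp} {body : Cmd} {M : Mem} (I : ℕ → Mem → Prop) (N Wb Db : ℕ)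
    (hN : N ≤ B) (hs : e.size ≤ 100)
    (he : ∀ j M, I j M → e.eval (st M) = N)
    (hset : ∀ j M f, I j M → I j (M.setNA c f))
    (hbody : ∀ j M, j < N → I j M → M.nat c 0 = j →
      T B body M Wb Db (fun M' => M'.nat c 0 = j ∧ I (j + 1) M'))
    (h0 : I 0 M) :
    T B (Cmd.forTo c e body) M (400 + N * (400 + Wb)) (400 + N * (400 + Db)) (I N) := by
  have h₁ : T B (Cmd.storeN c (NExp.const 0) (NExp.const 0)) M 200 200
      (fun M' => M'.nat c 0 = 0 ∧ I 0 M') := by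
    refine (T_storeN (by simp) (by simp) (by simp [NExp.size])).mono le_rfl le_rfl ?_
    rintro _ rfl
    exact ⟨by simp, hset _ _ _ h0⟩
  refine (T.bind h₁ fun M' hM' =>
    T_loop (Q := I N) (fun j M => M.nat c 0 = j ∧ j ≤ N ∧ I j M) N (Wb + 200) (Db + 200)
      (by simp [BExp.size, NExp.size]; omega) ?_ ?_ N 0 M' (by omega)
        ⟨hM'.1, Nat.zero_le _, hM'.2⟩).mono (by ring_nf; omega) (by ring_nf; omega) fun _ h => h
  · rintro j M ⟨hj, hjN, hI⟩ hb
    have hjN' : j < N := by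
      have h : M.nat c 0 < e.eval (st M) := hb
      rw [he j M hI] at h; omega
    refine ⟨hjN', T.bind (hbody j M hjN' hI hj) ?_⟩
    rintro M' ⟨hc, hI'⟩
    refine (T_storeN (by simp) (by simp [hc]; omega) (by simp [NExp.size])).mono le_rfl le_rfl ?_
    rintro _ rfl
    exact ⟨by simp [hc], hjN', hset _ _ _ hI'⟩
  · rintro j M ⟨hj, hjN, hI⟩ hb
    have h : ¬ M.nat c 0 < e.eval (st M) := hb
    rw [he j M hI] at h
    obtain rfl : j = N := by omega
    exact hI

/-- The command writes exactly the cells in `S`, all of them in the array `A`, which it does not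
read, and results in the memory `M'`, with the registers unchanged. -/
def Writes (B : ℕ) (A : Arr) (c : Cmd) (σ : State) (M' : Mem) (W D : ℕ) (S : Set Addr) : Prop :=
  ∃ (W' D' : ℕ) (R : Set Addr), Exec B c σ { σ with mem := M' } W' D' R S ∧ W' ≤ W ∧ D' ≤ D ∧
    (∀ p ∈ R, p.arr ≠ A) ∧ (∀ p ∈ S, p.arr = A) ∧ ∀ p ∉ S, M'.SameAt σ.mem p

theorem Mem.SameAt.refl (M : Mem) (p : Addr) : M.SameAt M p := by
  cases p <;> rfl

theorem Writes.storeN {a : ℕ} {i e : NExp} {σ : State} (hi : i.eval σ ≤ B) (he : e.eval σ ≤ B)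
    (hai : i.avoids (Arr.nat a) = true) (hae : e.avoids (Arr.nat a) = true) :
    Writes B (Arr.nat a) (Cmd.storeN a i e) σ (σ.mem.storeN a (i.eval σ) (e.eval σ))
      (i.size + e.size + 1) (i.size + e.size + 1) {Addr.nat a (i.eval σ)} := by
  refine ⟨_, _, _, Exec.storeN σ a i e hi he, le_rfl, le_rfl, ?_, ?_, ?_⟩
  · rintro p (hp | hp)
    · exact NExp.arr_ne_of_avoids hai σ p hp
    · exact NExp.arr_ne_of_avoids hae σ p hp
  · rintro p rfl; rfl
  · rintro (⟨b, j⟩ | ⟨b, j⟩) hp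
    · have : ¬ (b = a ∧ j = i.eval σ) := by simpa using hp
      simp only [Mem.SameAt, Mem.storeN_eq, Mem.setNA_nat]
      split_ifs with hb
      · subst hb
        rw [Function.update_of_ne (fun h => this ⟨rfl, h⟩)]
      · rfl
    · rfl

theorem Writes.storeR {a : ℕ} {i : NExp} {e : RExp} {σ : State} (hi : i.eval σ ≤ B)
    (hai : i.avoids (Arr.real a) = true) (hae : e.avoids (Arr.real a) = true) :
    Writes B (Arr.real a) (Cmd.storeR a i e) σ (σ.mem.storeR a (i.eval σ) (e.eval σ))
      (i.size + e.size + 1) (i.size + e.size + 1) {Addr.real a (i.eval σ)} := by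
  refine ⟨_, _, _, Exec.storeR σ a i e hi, le_rfl, le_rfl, ?_, ?_, ?_⟩
  · rintro p (hp | hp)
    · exact NExp.arr_ne_of_avoids hai σ p hp
    · exact RExp.arr_ne_of_avoids hae σ p hp
  · rintro p rfl; rfl
  · rintro (⟨b, j⟩ | ⟨b, j⟩) hp
    · rfl
    · have : ¬ (b = a ∧ j = i.eval σ) := by simpa using hp
      simp only [Mem.SameAt, Mem.storeR_eq, Mem.setRA_real]
      split_ifs with hb
      · subst hb
        rw [Function.update_of_ne (fun h => this ⟨rfl, h⟩)]
      · rfl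

open Classical in
theorem Writes.guard {A : Arr} {b : BExp} {c : Cmd} {σ : State} {M' : Mem} {W D : ℕ}
    {S : Set Addr} (hab : b.avoids A = true) (h : b.Holds σ → Writes B A c σ M' W D S)
    (hW : 1 ≤ W) (hD : 1 ≤ D) :
    Writes B A (Cmd.ite b c Cmd.skip) σ (if b.Holds σ then M' else σ.mem) (b.size + W)
      (b.size + D) (if b.Holds σ then S else ∅) := by
  by_cases hb : b.Holds σ
  · obtain ⟨w, d, R, hE, hw, hd, hR, hS, hk⟩ := h hb
    rw [if_pos hb, if_pos hb]
    refine ⟨_, _, _, Exec.iteTrue hb hE, by omega, by omega, ?_, hS, hk⟩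
    rintro p (hp | hp)
    · exact BExp.arr_ne_of_avoids hab σ p hp
    · exact hR p hp
  · rw [if_neg hb, if_neg hb]
    refine ⟨_, _, _, Exec.iteFalse hb (Exec.skip σ), by omega, by omega, ?_, by simp,
      fun p _ => Mem.SameAt.refl _ p⟩
    rintro p (hp | hp)
    · exact BExp.arr_ne_of_avoids hab σ p hp
    · exact absurd hp (Set.notMem_empty p)

theorem Writes.pfor {A : Arr} {x : ℕ} {e : NExp} {c : Cmd} {σ : State} {M' : Mem} {N : ℕ}
    {Mi : ℕ → Mem} {W : ℕ → ℕ} {D : ℕ} {S : ℕ → Set Addr} (he : e.eval σ = N) (hN : N ≤ B)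
    (hae : e.avoids A = true) (h : ∀ i < N, Writes B A c (σ.setN x i) (Mi i) (W i) D (S i))
    (hdisj : ∀ i < N, ∀ j < N, i ≠ j → Disjoint (S i) (S j))
    (hwritten : ∀ i < N, ∀ p ∈ S i, M'.SameAt (Mi i) p)
    (hkept : ∀ p, (∀ i < N, p ∉ S i) → M'.SameAt σ.mem p) :
    Writes B A (Cmd.pfor x e c) σ M' (e.size + 1 + ∑ i ∈ Finset.range N, (W i + 1))
      (e.size + 1 + D) (⋃ i ∈ Set.Iio N, S i) := by
  subst he
  choose! w d R hE hw hd hR hS hk using h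
  refine ⟨_, _, _, Exec.pfor hN hE ?_ hwritten hkept, ?_, ?_, ?_, ?_, ?_⟩
  · intro i hi j hj hij
    refine Set.disjoint_left.2 fun p hp hp' => ?_
    rcases hp' with hp' | hp'
    · exact hR j hj p hp' (hS i hi p hp)
    · exact Set.disjoint_left.1 (hdisj i hi j hj hij) hp hp'
  · gcongr with i hi
    exact hw i (Finset.mem_range.1 hi)
  · gcongr
    exact Finset.sup_le fun i hi => hd i (Finset.mem_range.1 hi)
  · rintro p (hp | hp)
    · exact NExp.arr_ne_of_avoids hae σ p hp
    · simp only [Set.mem_iUnion] at hp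
      obtain ⟨i, hi, hp⟩ := hp
      exact hR i hi p hp
  · intro p hp
    simp only [Set.mem_iUnion] at hp
    obtain ⟨i, hi, hp⟩ := hp
    exact hS i hi p hp
  · intro p hp
    simp only [Set.mem_iUnion, not_exists] at hp
    exact hkept p fun i hi => hp i hi

theorem T_of_writes {A : Arr} {c : Cmd} {M M' : Mem} {W D : ℕ} {S : Set Addr}
    (h : Writes B A c (st M) M' W D S) : T B c M W D (fun M₁ => M₁ = M') := by
  obtain ⟨w, d, R, hE, hw, hd, -⟩ := h
  exact ⟨M', w, d, R, S, hE, hw, hd, rfl⟩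

/-- A parallel loop of guarded stores to a word array. -/
abbrev scatN (e : NExp) (b : BExp) (a : ℕ) (i v : NExp) : Cmd :=
  Cmd.pfor 0 e (Cmd.ite b (Cmd.storeN a i v) Cmd.skip)

/-- A parallel loop of guarded stores to a real array. -/
abbrev scatR (e : NExp) (b : BExp) (a : ℕ) (i : NExp) (v : RExp) : Cmd :=
  Cmd.pfor 0 e (Cmd.ite b (Cmd.storeR a i v) Cmd.skip)

/-- The test that always succeeds. -/
abbrev tt : BExp := BExp.natEq (NExp.const 0) (NExp.const 0)

open Classical in
theorem T_scatN {e : NExp} {b : BExp} {a : ℕ} {i v : NExp} {M : Mem} (N : ℕ)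
    (act : ℕ → Prop) (idx val : ℕ → ℕ)
    (he : e.eval (st M) = N) (hN : N ≤ B)
    (hact : ∀ k < N, b.Holds (st1 M k) ↔ act k)
    (hidx : ∀ k < N, act k → i.eval (st1 M k) = idx k)
    (hval : ∀ k < N, act k → v.eval (st1 M k) = val k)
    (hidxB : ∀ k < N, act k → idx k ≤ B) (hvalB : ∀ k < N, act k → val k ≤ B)
    (hinj : ∀ k < N, act k → ∀ l < N, act l → idx k = idx l → k = l)
    (hav : (e.avoids (Arr.nat a) && b.avoids (Arr.nat a) && i.avoids (Arr.nat a) &&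
      v.avoids (Arr.nat a)) = true)
    (hs : e.size + b.size + i.size + v.size + 3 ≤ 200) :
    T B (scatN e b a i v) M (200 * (N + 1)) 200 (fun M' => ∃ f, M' = M.setNA a f ∧
      (∀ k < N, act k → f (idx k) = val k) ∧
      ∀ j, (∀ k < N, act k → idx k ≠ j) → f j = M.nat a j) := by
  simp only [Bool.and_eq_true] at hav
  obtain ⟨⟨⟨hae, hab⟩, hai⟩, hav⟩ := hav
  let f : ℕ → ℕ := fun j =>
    if h : ∃ k < N, act k ∧ idx k = j then val h.choose else M.nat a j
  have hf₁ : ∀ k < N, act k → f (idx k) = val k := by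
    intro k hk hak
    have h : ∃ l < N, act l ∧ idx l = idx k := ⟨k, hk, hak, rfl⟩
    have h' := h.choose_spec
    simp only [f]
    rw [dif_pos h, hinj _ h'.1 h'.2.1 k hk hak h'.2.2]
  have hf₂ : ∀ j, (∀ k < N, act k → idx k ≠ j) → f j = M.nat a j := by
    intro j hj
    simp only [f]
    rw [dif_neg]
    rintro ⟨k, hk, hak, h⟩
    exact hj k hk hak h
  have hbody : ∀ k < N, Writes B (Arr.nat a) (Cmd.ite b (Cmd.storeN a i v) Cmd.skip) (st1 M k)
      (if b.Holds (st1 M k) then M.storeN a (i.eval (st1 M k)) (v.eval (st1 M k)) else M)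
      (b.size + (i.size + v.size + 1)) (b.size + (i.size + v.size + 1))
      (if b.Holds (st1 M k) then {Addr.nat a (i.eval (st1 M k))} else ∅) := by
    intro k hk
    refine Writes.guard hab (fun hb => Writes.storeN ?_ ?_ hai hav) (by omega) (by omega)
    · have := (hact k hk).1 hb
      rw [hidx k hk this]; exact hidxB k hk this
    · have := (hact k hk).1 hb
      rw [hval k hk this]; exact hvalB k hk this
  have hS : ∀ k < N, ∀ p, p ∈ (if b.Holds (st1 M k) then
      ({Addr.nat a (i.eval (st1 M k))} : Set Addr) else ∅) ↔ act k ∧ p = Addr.nat a (idx k) := by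
    intro k hk p
    rw [hact k hk]
    by_cases h : act k
    · simp [h, hidx k hk h]
    · simp [h]
  refine (T_of_writes (Writes.pfor (M' := M.setNA a f) he hN hae hbody ?_ ?_ ?_)).mono
    ?_ ?_ ?_
  · intro k hk l hl hkl
    refine Set.disjoint_left.2 fun p hp hp' => ?_
    rw [hS k hk] at hp
    rw [hS l hl] at hp'
    refine hkl (hinj k hk hp.1 l hl hp'.1 ?_)
    have := hp.2.symm.trans hp'.2
    simpa using this
  · intro k hk p hp
    rw [hS k hk] at hp
    obtain ⟨hak, rfl⟩ := hp
    have hb := (hact k hk).2 hak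
    simp only [Mem.SameAt, Mem.setNA_nat, if_true, hf₁ k hk hak]
    rw [if_pos hb, Mem.storeN_eq, Mem.setNA_nat, if_pos rfl, hidx k hk hak, hval k hk hak,
      Function.update_self]
  · rintro (⟨c, j⟩ | ⟨c, j⟩) hp
    · simp only [Mem.SameAt, Mem.setNA_nat]
      split_ifs with hc
      · subst hc
        refine hf₂ j fun k hk hak hj => hp k hk ?_
        rw [hS k hk]
        exact ⟨hak, by rw [hj]⟩
      · rfl
    · rfl
  · simp only [Finset.sum_const, Finset.card_range, smul_eq_mul]
    nlinarith
  · omega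
  · rintro _ rfl
    exact ⟨f, rfl, hf₁, hf₂⟩

open Classical in
theorem T_scatR {e : NExp} {b : BExp} {a : ℕ} {i : NExp} {v : RExp} {M : Mem} (N : ℕ)
    (act : ℕ → Prop) (idx : ℕ → ℕ) (val : ℕ → ℝ)
    (he : e.eval (st M) = N) (hN : N ≤ B)
    (hact : ∀ k < N, b.Holds (st1 M k) ↔ act k)
    (hidx : ∀ k < N, act k → i.eval (st1 M k) = idx k)
    (hval : ∀ k < N, act k → v.eval (st1 M k) = val k)
    (hidxB : ∀ k < N, act k → idx k ≤ B)
    (hinj : ∀ k < N, act k → ∀ l < N, act l → idx k = idx l → k = l)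
    (hav : (e.avoids (Arr.real a) && b.avoids (Arr.real a) && i.avoids (Arr.real a) &&
      v.avoids (Arr.real a)) = true)
    (hs : e.size + b.size + i.size + v.size + 3 ≤ 200) :
    T B (scatR e b a i v) M (200 * (N + 1)) 200 (fun M' => ∃ f, M' = M.setRA a f ∧
      (∀ k < N, act k → f (idx k) = val k) ∧
      ∀ j, (∀ k < N, act k → idx k ≠ j) → f j = M.real a j) := by
  simp only [Bool.and_eq_true] at hav
  obtain ⟨⟨⟨hae, hab⟩, hai⟩, hav⟩ := hav
  let f : ℕ → ℝ := fun j =>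
    if h : ∃ k < N, act k ∧ idx k = j then val h.choose else M.real a j
  have hf₁ : ∀ k < N, act k → f (idx k) = val k := by
    intro k hk hak
    have h : ∃ l < N, act l ∧ idx l = idx k := ⟨k, hk, hak, rfl⟩
    have h' := h.choose_spec
    simp only [f]
    rw [dif_pos h, hinj _ h'.1 h'.2.1 k hk hak h'.2.2]
  have hf₂ : ∀ j, (∀ k < N, act k → idx k ≠ j) → f j = M.real a j := by
    intro j hj
    simp only [f]
    rw [dif_neg]
    rintro ⟨k, hk, hak, h⟩
    exact hj k hk hak h
  have hbody : ∀ k < N, Writes B (Arr.real a) (Cmd.ite b (Cmd.storeR a i v) Cmd.skip) (st1 M k)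
      (if b.Holds (st1 M k) then M.storeR a (i.eval (st1 M k)) (v.eval (st1 M k)) else M)
      (b.size + (i.size + v.size + 1)) (b.size + (i.size + v.size + 1))
      (if b.Holds (st1 M k) then {Addr.real a (i.eval (st1 M k))} else ∅) := by
    intro k hk
    refine Writes.guard hab (fun hb => Writes.storeR ?_ hai hav) (by omega) (by omega)
    have := (hact k hk).1 hb
    rw [hidx k hk this]; exact hidxB k hk this
  have hS : ∀ k < N, ∀ p, p ∈ (if b.Holds (st1 M k) then
      ({Addr.real a (i.eval (st1 M k))} : Set Addr) else ∅) ↔ act k ∧ p = Addr.real a (idx k) := by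
    intro k hk p
    rw [hact k hk]
    by_cases h : act k
    · simp [h, hidx k hk h]
    · simp [h]
  refine (T_of_writes (Writes.pfor (M' := M.setRA a f) he hN hae hbody ?_ ?_ ?_)).mono
    ?_ ?_ ?_
  · intro k hk l hl hkl
    refine Set.disjoint_left.2 fun p hp hp' => ?_
    rw [hS k hk] at hp
    rw [hS l hl] at hp'
    refine hkl (hinj k hk hp.1 l hl hp'.1 ?_)
    have := hp.2.symm.trans hp'.2
    simpa using this
  · intro k hk p hp
    rw [hS k hk] at hp
    obtain ⟨hak, rfl⟩ := hp
    have hb := (hact k hk).2 hak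
    simp only [Mem.SameAt, Mem.setRA_real, if_true, hf₁ k hk hak]
    rw [if_pos hb, Mem.storeR_eq, Mem.setRA_real, if_pos rfl, hidx k hk hak, hval k hk hak,
      Function.update_self]
  · rintro (⟨c, j⟩ | ⟨c, j⟩) hp
    · rfl
    · simp only [Mem.SameAt, Mem.setRA_real]
      split_ifs with hc
      · subst hc
        refine hf₂ j fun k hk hak hj => hp k hk ?_
        rw [hS k hk]
        exact ⟨hak, by rw [hj]⟩
      · rfl
  · simp only [Finset.sum_const, Finset.card_range, smul_eq_mul]
    nlinarith
  · omega
  · rintro _ rfl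
    exact ⟨f, rfl, hf₁, hf₂⟩

/-- A parallel loop that fills an initial segment of a word array. -/
abbrev mapN (e : NExp) (a : ℕ) (v : NExp) : Cmd := scatN e tt a (NExp.reg 0) v

/-- A parallel loop that fills an initial segment of a real array. -/
abbrev mapR (e : NExp) (a : ℕ) (v : RExp) : Cmd := scatR e tt a (NExp.reg 0) v

theorem T_mapN {e : NExp} {a : ℕ} {v : NExp} {M : Mem} (N : ℕ) (val : ℕ → ℕ)
    (he : e.eval (st M) = N) (hN : N ≤ B)
    (hval : ∀ k < N, v.eval (st1 M k) = val k) (hvalB : ∀ k < N, val k ≤ B)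
    (hav : (e.avoids (Arr.nat a) && v.avoids (Arr.nat a)) = true)
    (hs : e.size + v.size + 10 ≤ 200) :
    T B (mapN e a v) M (200 * (N + 1)) 200
      (fun M' => M' = M.setNA a (fun j => if j < N then val j else M.nat a j)) := by
  simp only [Bool.and_eq_true] at hav
  refine (T_scatN N (fun _ => True) (fun k => k) val he hN (by simp) (by simp)
    (fun k hk _ => hval k hk) (fun k hk _ => by omega) (fun k hk _ => hvalB k hk)
    (fun k _ _ l _ _ h => h) (by simp [hav.1, hav.2, BExp.avoids, NExp.avoids])
    (by simp [BExp.size, NExp.size]; omega)).mono le_rfl le_rfl ?_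
  rintro _ ⟨f, rfl, h₁, h₂⟩
  congr 1
  funext j
  split_ifs with hj
  · exact h₁ j hj trivial
  · exact h₂ j fun k hk _ h => hj (h ▸ hk)

theorem T_mapR {e : NExp} {a : ℕ} {v : RExp} {M : Mem} (N : ℕ) (val : ℕ → ℝ)
    (he : e.eval (st M) = N) (hN : N ≤ B)
    (hval : ∀ k < N, v.eval (st1 M k) = val k)
    (hav : (e.avoids (Arr.real a) && v.avoids (Arr.real a)) = true)
    (hs : e.size + v.size + 10 ≤ 200) :
    T B (mapR e a v) M (200 * (N + 1)) 200
      (fun M' => M' = M.setRA a (fun j => if j < N then val j else M.real a j)) := by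
  simp only [Bool.and_eq_true] at hav
  refine (T_scatR N (fun _ => True) (fun k => k) val he hN (by simp) (by simp)
    (fun k hk _ => hval k hk) (fun k hk _ => by omega)
    (fun k _ _ l _ _ h => h) (by simp [hav.1, hav.2, BExp.avoids, NExp.avoids])
    (by simp [BExp.size, NExp.size]; omega)).mono le_rfl le_rfl ?_
  rintro _ ⟨f, rfl, h₁, h₂⟩
  congr 1
  funext j
  split_ifs with hj
  · exact h₁ j hj trivial
  · exact h₂ j fun k hk _ h => hj (h ▸ hk)

/-- Two nested parallel loops of stores to a word array. -/
abbrev nestN (e e' : NExp) (a : ℕ) (i v : NExp) : Cmd :=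
  Cmd.pfor 0 e (Cmd.pfor 1 e' (Cmd.storeN a i v))

/-- Two nested parallel loops of stores to a real array. -/
abbrev nestR (e e' : NExp) (a : ℕ) (i : NExp) (v : RExp) : Cmd :=
  Cmd.pfor 0 e (Cmd.pfor 1 e' (Cmd.storeR a i v))

open Classical in
theorem T_nestN {e e' : NExp} {a : ℕ} {i v : NExp} {M : Mem} (N : ℕ) (len : ℕ → ℕ)
    (idx val : ℕ → ℕ → ℕ)
    (he : e.eval (st M) = N) (hN : N ≤ B)
    (he' : ∀ k < N, e'.eval (st1 M k) = len k) (hlB : ∀ k < N, len k ≤ B)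
    (hidx : ∀ k < N, ∀ l < len k, i.eval (st2 M k l) = idx k l)
    (hval : ∀ k < N, ∀ l < len k, v.eval (st2 M k l) = val k l)
    (hidxB : ∀ k < N, ∀ l < len k, idx k l ≤ B) (hvalB : ∀ k < N, ∀ l < len k, val k l ≤ B)
    (hinj : ∀ k < N, ∀ l < len k, ∀ k' < N, ∀ l' < len k', idx k l = idx k' l' → k = k' ∧ l = l')
    (hav : (e.avoids (Arr.nat a) && e'.avoids (Arr.nat a) && i.avoids (Arr.nat a) &&
      v.avoids (Arr.nat a)) = true)
    (hs : e.size + e'.size + i.size + v.size + 5 ≤ 150) :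
    T B (nestN e e' a i v) M (200 * (1 + ∑ k ∈ Finset.range N, (len k + 1))) 200
      (fun M' => ∃ f, M' = M.setNA a f ∧
      (∀ k < N, ∀ l < len k, f (idx k l) = val k l) ∧
      ∀ j, (∀ k < N, ∀ l < len k, idx k l ≠ j) → f j = M.nat a j) := by
  simp only [Bool.and_eq_true] at hav
  obtain ⟨⟨⟨hae, hae'⟩, hai⟩, hav⟩ := hav
  let f : ℕ → ℕ := fun j =>
    if h : ∃ p : ℕ × ℕ, p.1 < N ∧ p.2 < len p.1 ∧ idx p.1 p.2 = j then
      val h.choose.1 h.choose.2 else M.nat a j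
  have hf₁ : ∀ k < N, ∀ l < len k, f (idx k l) = val k l := by
    intro k hk l hl
    have h : ∃ p : ℕ × ℕ, p.1 < N ∧ p.2 < len p.1 ∧ idx p.1 p.2 = idx k l := ⟨(k, l), hk, hl, rfl⟩
    have h' := h.choose_spec
    have h'' := hinj _ h'.1 _ h'.2.1 k hk l hl h'.2.2
    simp only [f]
    rw [dif_pos h, h''.1, h''.2]
  have hf₂ : ∀ j, (∀ k < N, ∀ l < len k, idx k l ≠ j) → f j = M.nat a j := by
    intro j hj
    simp only [f]
    rw [dif_neg]
    rintro ⟨p, hk, hl, h⟩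
    exact hj _ hk _ hl h
  let Mk : ℕ → Mem := fun k => M.setNA a
    (fun j => if ∃ l < len k, idx k l = j then f j else M.nat a j)
  let S : ℕ → ℕ → Set Addr := fun k l => {Addr.nat a (idx k l)}
  have hin : ∀ k < N, Writes B (Arr.nat a) (Cmd.pfor 1 e' (Cmd.storeN a i v)) (st1 M k) (Mk k)
      (e'.size + 1 + ∑ l ∈ Finset.range (len k), (i.size + v.size + 1 + 1))
      (e'.size + 1 + (i.size + v.size + 1)) (⋃ l ∈ Set.Iio (len k), S k l) := by
    intro k hk
    refine Writes.pfor (Mi := fun l => M.storeN a (idx k l) (val k l)) (he' k hk) (hlB k hk) hae'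
      ?_ ?_ ?_ ?_
    · intro l hl
      have h := Writes.storeN (B := B) (a := a) (i := i) (e := v) (σ := st2 M k l)
        (by rw [hidx k hk l hl]; exact hidxB k hk l hl)
        (by rw [hval k hk l hl]; exact hvalB k hk l hl) hai hav
      rw [hidx k hk l hl, hval k hk l hl] at h
      exact h
    · intro l hl l' hl' hll
      simp only [S, Set.disjoint_singleton, ne_eq, Addr.nat.injEq, true_and]
      exact fun h => hll (hinj k hk l hl k hk l' hl' h).2
    · rintro l hl p rfl
      simp only [Mem.SameAt, Mk, Mem.storeN_eq, Mem.setNA_nat, if_true, Function.update_self]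
      rw [if_pos ⟨l, hl, rfl⟩, hf₁ k hk l hl]
    · rintro (⟨c, j⟩ | ⟨c, j⟩) hp
      · simp only [Mem.SameAt, Mk, Mem.setNA_nat]
        by_cases hc : c = a
        · subst hc
          rw [if_pos rfl, if_neg]
          · rfl
          · rintro ⟨l, hl, rfl⟩
            exact hp l hl rfl
        · rw [if_neg hc]; rfl
      · rfl
  have hS : ∀ k p, p ∈ (⋃ l ∈ Set.Iio (len k), S k l) ↔
      ∃ l < len k, p = Addr.nat a (idx k l) := by
    intro k p; simp [S]
  refine (T_of_writes (Writes.pfor (M' := M.setNA a f) he hN hae hin ?_ ?_ ?_)).mono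
    ?_ ?_ ?_
  · intro k hk k' hk' hkk
    refine Set.disjoint_left.2 fun p hp hp' => ?_
    rw [hS] at hp hp'
    obtain ⟨l, hl, rfl⟩ := hp
    obtain ⟨l', hl', h⟩ := hp'
    exact hkk (hinj k hk l hl k' hk' l' hl' (by simpa using h)).1
  · intro k hk p hp
    rw [hS] at hp
    obtain ⟨l, hl, rfl⟩ := hp
    simp only [Mem.SameAt, Mk, Mem.setNA_nat, if_true]
    rw [if_pos ⟨l, hl, rfl⟩]
  · rintro (⟨c, j⟩ | ⟨c, j⟩) hp
    · simp only [Mem.SameAt, Mem.setNA_nat]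
      split_ifs with hc
      · subst hc
        refine hf₂ j fun k hk l hl hj => hp k hk ?_
        rw [hS]
        exact ⟨l, hl, by rw [hj]⟩
      · rfl
    · rfl
  · have : ∀ k ∈ Finset.range N, e'.size + 1 + ∑ l ∈ Finset.range (len k),
        (i.size + v.size + 1 + 1) + 1 ≤ 200 * (len k + 1) := by
      intro k _
      simp only [Finset.sum_const, Finset.card_range, smul_eq_mul]
      have := Nat.mul_le_mul_left (len k) (show i.size + v.size + 1 + 1 ≤ 190 by omega)
      omega
    have := Finset.sum_le_sum this
    rw [mul_add, Finset.mul_sum]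
    omega
  · omega
  · rintro _ rfl
    exact ⟨f, rfl, hf₁, hf₂⟩

open Classical in
theorem T_nestR {e e' : NExp} {a : ℕ} {i : NExp} {v : RExp} {M : Mem} (N : ℕ) (len : ℕ → ℕ)
    (idx : ℕ → ℕ → ℕ) (val : ℕ → ℕ → ℝ)
    (he : e.eval (st M) = N) (hN : N ≤ B)
    (he' : ∀ k < N, e'.eval (st1 M k) = len k) (hlB : ∀ k < N, len k ≤ B)
    (hidx : ∀ k < N, ∀ l < len k, i.eval (st2 M k l) = idx k l)
    (hval : ∀ k < N, ∀ l < len k, v.eval (st2 M k l) = val k l)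
    (hidxB : ∀ k < N, ∀ l < len k, idx k l ≤ B)
    (hinj : ∀ k < N, ∀ l < len k, ∀ k' < N, ∀ l' < len k', idx k l = idx k' l' → k = k' ∧ l = l')
    (hav : (e.avoids (Arr.real a) && e'.avoids (Arr.real a) && i.avoids (Arr.real a) &&
      v.avoids (Arr.real a)) = true)
    (hs : e.size + e'.size + i.size + v.size + 5 ≤ 150) :
    T B (nestR e e' a i v) M (200 * (1 + ∑ k ∈ Finset.range N, (len k + 1))) 200
      (fun M' => ∃ f, M' = M.setRA a f ∧
      (∀ k < N, ∀ l < len k, f (idx k l) = val k l) ∧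
      ∀ j, (∀ k < N, ∀ l < len k, idx k l ≠ j) → f j = M.real a j) := by
  simp only [Bool.and_eq_true] at hav
  obtain ⟨⟨⟨hae, hae'⟩, hai⟩, hav⟩ := hav
  let f : ℕ → ℝ := fun j =>
    if h : ∃ p : ℕ × ℕ, p.1 < N ∧ p.2 < len p.1 ∧ idx p.1 p.2 = j then
      val h.choose.1 h.choose.2 else M.real a j
  have hf₁ : ∀ k < N, ∀ l < len k, f (idx k l) = val k l := by
    intro k hk l hl
    have h : ∃ p : ℕ × ℕ, p.1 < N ∧ p.2 < len p.1 ∧ idx p.1 p.2 = idx k l := ⟨(k, l), hk, hl, rfl⟩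
    have h' := h.choose_spec
    have h'' := hinj _ h'.1 _ h'.2.1 k hk l hl h'.2.2
    simp only [f]
    rw [dif_pos h, h''.1, h''.2]
  have hf₂ : ∀ j, (∀ k < N, ∀ l < len k, idx k l ≠ j) → f j = M.real a j := by
    intro j hj
    simp only [f]
    rw [dif_neg]
    rintro ⟨p, hk, hl, h⟩
    exact hj _ hk _ hl h
  let Mk : ℕ → Mem := fun k => M.setRA a
    (fun j => if ∃ l < len k, idx k l = j then f j else M.real a j)
  let S : ℕ → ℕ → Set Addr := fun k l => {Addr.real a (idx k l)}
  have hin : ∀ k < N, Writes B (Arr.real a) (Cmd.pfor 1 e' (Cmd.storeR a i v)) (st1 M k) (Mk k)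
      (e'.size + 1 + ∑ l ∈ Finset.range (len k), (i.size + v.size + 1 + 1))
      (e'.size + 1 + (i.size + v.size + 1)) (⋃ l ∈ Set.Iio (len k), S k l) := by
    intro k hk
    refine Writes.pfor (Mi := fun l => M.storeR a (idx k l) (val k l)) (he' k hk) (hlB k hk) hae'
      ?_ ?_ ?_ ?_
    · intro l hl
      have h := Writes.storeR (B := B) (a := a) (i := i) (e := v) (σ := st2 M k l)
        (by rw [hidx k hk l hl]; exact hidxB k hk l hl)
        hai hav
      rw [hidx k hk l hl, hval k hk l hl] at h
      exact h
    · intro l hl l' hl' hll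
      simp only [S, Set.disjoint_singleton, ne_eq, Addr.real.injEq, true_and]
      exact fun h => hll (hinj k hk l hl k hk l' hl' h).2
    · rintro l hl p rfl
      simp only [Mem.SameAt, Mk, Mem.storeR_eq, Mem.setRA_real, if_true, Function.update_self]
      rw [if_pos ⟨l, hl, rfl⟩, hf₁ k hk l hl]
    · rintro (⟨c, j⟩ | ⟨c, j⟩) hp
      · rfl
      · simp only [Mem.SameAt, Mk, Mem.setRA_real]
        by_cases hc : c = a
        · subst hc
          rw [if_pos rfl, if_neg]
          · rfl
          · rintro ⟨l, hl, rfl⟩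
            exact hp l hl rfl
        · rw [if_neg hc]; rfl
  have hS : ∀ k p, p ∈ (⋃ l ∈ Set.Iio (len k), S k l) ↔
      ∃ l < len k, p = Addr.real a (idx k l) := by
    intro k p; simp [S]
  refine (T_of_writes (Writes.pfor (M' := M.setRA a f) he hN hae hin ?_ ?_ ?_)).mono
    ?_ ?_ ?_
  · intro k hk k' hk' hkk
    refine Set.disjoint_left.2 fun p hp hp' => ?_
    rw [hS] at hp hp'
    obtain ⟨l, hl, rfl⟩ := hp
    obtain ⟨l', hl', h⟩ := hp'
    exact hkk (hinj k hk l hl k' hk' l' hl' (by simpa using h)).1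
  · intro k hk p hp
    rw [hS] at hp
    obtain ⟨l, hl, rfl⟩ := hp
    simp only [Mem.SameAt, Mk, Mem.setRA_real, if_true]
    rw [if_pos ⟨l, hl, rfl⟩]
  · rintro (⟨c, j⟩ | ⟨c, j⟩) hp
    · rfl
    · simp only [Mem.SameAt, Mem.setRA_real]
      split_ifs with hc
      · subst hc
        refine hf₂ j fun k hk l hl hj => hp k hk ?_
        rw [hS]
        exact ⟨l, hl, by rw [hj]⟩
      · rfl
  · have : ∀ k ∈ Finset.range N, e'.size + 1 + ∑ l ∈ Finset.range (len k),
        (i.size + v.size + 1 + 1) + 1 ≤ 200 * (len k + 1) := by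
      intro k _
      simp only [Finset.sum_const, Finset.card_range, smul_eq_mul]
      have := Nat.mul_le_mul_left (len k) (show i.size + v.size + 1 + 1 ≤ 190 by omega)
      omega
    have := Finset.sum_le_sum this
    rw [mul_add, Finset.mul_sum]
    omega
  · omega
  · rintro _ rfl
    exact ⟨f, rfl, hf₁, hf₂⟩

end PrimalGradient

namespace PrimalGradient

/-! ## Arrays of the data structure -/

/-- The height `L` of the summation trees, `2 ^ L`, the number `L + 2` of rounds of a prefix sum,
and the numbers of buckets for `τ`, for `z`, and in total. -/
abbrev aL : ℕ := 20
abbrev aP : ℕ := 21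
abbrev aS : ℕ := 22
abbrev aNT : ℕ := 23
abbrev aNB : ℕ := 24
abbrev aNZ : ℕ := 25

/-- The bucket of a row, its position in the list `J`, and the flag that `J` was returned. -/
abbrev aBk : ℕ := 30
abbrev aPos : ℕ := 31
abbrev aFresh : ℕ := 32

abbrev scC : ℕ := 40
abbrev scT : ℕ := 41
abbrev scD : ℕ := 42
abbrev scJ : ℕ := 43
abbrev scN : ℕ := 44
abbrev cmI : ℕ := 45
abbrev cmF : ℕ := 46
abbrev cmN : ℕ := 47
abbrev cmO : ℕ := 48
abbrev cmC : ℕ := 49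

abbrev ix : NExp := NExp.reg 0
abbrev cn (k : ℕ) : NExp := NExp.const k
abbrev ld (a : ℕ) (e : NExp) : NExp := NExp.load a e
abbrev rl (a : ℕ) (e : NExp) : RExp := RExp.load a e

/-! ## Prefix sums and compaction -/

/-- Replace the first entries of `scC` by their prefix sums. -/
def scan : Cmd :=
  Cmd.storeN scD (cn 0) (cn 1) ;;
  Cmd.forTo scJ (sc aS)
    (mapN (sc scN) scT (ld scC ix) ;;
     scatN (sc scN) (BExp.not (BExp.natLT ix (sc scD))) scT ix
       (NExp.add (ld scC ix) (ld scC (NExp.sub ix (sc scD)))) ;;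
     mapN (sc scN) scC (ld scT ix) ;;
     Cmd.storeN scD (cn 0) (NExp.add (sc scD) (sc scD)))

variable {B : ℕ}

theorem sum_Ico_double (f : ℕ → ℕ) {p d : ℕ} (hd : d ≤ p) :
    ∑ q ∈ Finset.Ico (p + 1 - d) (p + 1), f q + ∑ q ∈ Finset.Ico (p - d + 1 - d) (p - d + 1), f q =
      ∑ q ∈ Finset.Ico (p + 1 - 2 * d) (p + 1), f q := by
  rw [add_comm, show p - d + 1 = p + 1 - d by omega, Finset.sum_Ico_consecutive _ (by omega)
    (by omega), show p + 1 - d - d = p + 1 - 2 * d by omega]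

theorem scan_spec {M : Mem} {N S : ℕ} (hN : M.nat scN 0 = N) (hS : M.nat aS 0 = S)
    (hNS : N ≤ 2 ^ S) (hSB : 2 ^ S ≤ B)
    (hsum : ∀ p < N, ∑ q ∈ Finset.range (p + 1), M.nat scC q ≤ B) :
    T B scan M (2000 * ((N + 1) * (S + 1))) (2000 * (S + 1)) (fun M' =>
      Mem.EqOff [scC, scT, scD, scJ] [] M M' ∧
      ∀ p < N, M'.nat scC p = ∑ q ∈ Finset.range (p + 1), M.nat scC q) := by
  have hSB' : S ≤ B := Nat.lt_two_pow_self.le.trans hSB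
  have hNB : N ≤ B := hNS.trans hSB
  have h2 : 1 ≤ B := le_trans Nat.one_le_two_pow hSB
  have hsum' : ∀ p < N, ∀ d, ∑ q ∈ Finset.Ico d (p + 1), M.nat scC q ≤ B := fun p hp d =>
    (Finset.sum_le_sum_of_subset (fun q hq => by
      simp only [Finset.mem_Ico, Finset.mem_range] at *; omega)).trans (hsum p hp)
  unfold scan
  refine (T.bind (T_storeN (by simp) (by simp; omega) (by simp [NExp.size])) ?_).mono
    (W := 200 + (400 + S * (400 + (200 * (N + 1) + (200 * (N + 1) + (200 * (N + 1) + 200))))))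
    (D := 200 + (400 + S * (400 + (200 + (200 + (200 + 200)))))) ?_ ?_ (Q := fun M' =>
      Mem.EqOff [scC, scT, scD, scJ] [] M M' ∧
      ∀ p < N, M'.nat scC p = ∑ q ∈ Finset.range (p + 1), M.nat scC q) (fun _ h => h)
  · rintro _ rfl
    refine (T_forTo (fun j M' => Mem.EqOff [scC, scT, scD, scJ] [] M M' ∧ M'.nat scD 0 = 2 ^ j ∧
      ∀ p < N, M'.nat scC p = ∑ q ∈ Finset.Ico (p + 1 - 2 ^ j) (p + 1), M.nat scC q) S _ _ hSB'
      (by simp [NExp.size]) ?_ ?_ ?_ ?_).mono le_rfl le_rfl ?_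
    · rintro j M' ⟨h, -, -⟩
      simp [h.1 aS (by decide), hS]
    · rintro j M' f ⟨h, h', h''⟩
      exact ⟨h.setNA (by decide) f, by simpa using h', by simpa using h''⟩
    · rintro j M' hj ⟨hE, hd, hc⟩ hJ
      have hsN : M'.nat scN 0 = N := by rw [hE.1 scN (by decide), hN]
      have h2j : 2 ^ (j + 1) ≤ B := (Nat.pow_le_pow_right (by norm_num) hj).trans hSB
      refine T.bind (T_mapN N (fun p => M'.nat scC p) (by simp [hsN]) hNB (by simp) (fun p hp => ?_)
        (by decide) (by decide)) ?_
      · rw [hc p hp]; exact hsum' p hp _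
      rintro _ rfl
      refine T.bind (T_scatN N (fun p => 2 ^ j ≤ p) (fun p => p)
        (fun p => M'.nat scC p + M'.nat scC (p - 2 ^ j)) (by simp [hsN]) hNB (by simp [hd])
        (by simp) (by simp [hd]) (fun p hp _ => by omega) (fun p hp hp' => ?_)
        (fun _ _ _ _ _ _ h => h) (by decide) (by decide)) ?_
      · rw [hc p hp, hc _ (by omega), sum_Ico_double _ hp']
        exact hsum' p hp _
      rintro _ ⟨f, rfl, hf₁, hf₂⟩
      have hf : ∀ p < N, f p = ∑ q ∈ Finset.Ico (p + 1 - 2 ^ (j + 1)) (p + 1), M.nat scC q := by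
        intro p hp
        by_cases hp' : 2 ^ j ≤ p
        · rw [hf₁ p hp hp', hc p hp, hc _ (by omega), sum_Ico_double _ hp', pow_succ, mul_comm 2]
        · rw [hf₂ p (fun k _ hk h => hp' (h ▸ hk))]
          simp only [Mem.setNA_nat, if_true, if_pos hp]
          rw [hc p hp]
          congr 2
          rw [pow_succ]; omega
      refine T.bind (T_mapN N f (by simp [hsN]) hNB (by simp) (fun p hp => ?_)
        (by decide) (by decide)) ?_
      · rw [hf p hp]; exact hsum' p hp _
      rintro _ rfl
      refine (T_storeN (by simp) (by simp [hd]; rw [pow_succ] at h2j; omega) (by decide)).mono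
        le_rfl le_rfl ?_
      rintro _ rfl
      refine ⟨by simp [hJ], ((((hE.setNA (by decide) _).setNA (by decide) _).setNA
        (by decide) _).setNA (by decide) _), by simp [hd, pow_succ]; omega, ?_⟩
      intro p hp
      simp [hp, hf p hp]
    · refine ⟨(Mem.EqOff.refl M).setNA (by decide) _, by simp, fun p hp => ?_⟩
      simp
    · rintro M' ⟨h, -, h'⟩
      refine ⟨h, fun p hp => ?_⟩
      rw [h' p hp, Finset.range_eq_Ico]
      congr 2
      omega
  · ring_nf; nlinarith [Nat.zero_le (N * S)]
  · ring_nf; omega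

/-- The first `N` entries of an array. -/
def seg (f : ℕ → ℕ) (N : ℕ) : List ℕ := (List.range N).map f

@[simp] theorem length_seg (f : ℕ → ℕ) (N : ℕ) : (seg f N).length = N := by simp [seg]

theorem mem_seg {f : ℕ → ℕ} {N a : ℕ} : a ∈ seg f N ↔ ∃ k < N, f k = a := by simp [seg]

theorem nodup_seg {f : ℕ → ℕ} {N : ℕ} :
    (seg f N).Nodup ↔ ∀ k < N, ∀ l < N, f k = f l → k = l := by
  unfold seg
  rw [List.nodup_map_iff_inj_on List.nodup_range]
  simp only [List.mem_range]

theorem getElem?_filter_range (P : ℕ → Bool) {N p : ℕ} (hp : p < N) (h : P p = true) :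
    ((List.range N).filter P)[((List.range p).filter P).length]? = some p := by
  induction N with
  | zero => omega
  | succ N ih =>
    rw [List.range_succ, List.filter_append]
    rcases Nat.lt_succ_iff_lt_or_eq.1 hp with hp' | rfl
    · obtain ⟨h', -⟩ := List.getElem?_eq_some_iff.1 (ih hp')
      rw [List.getElem?_append_left h', ih hp']
    · simp [h]

theorem exists_rank_eq (P : ℕ → Bool) {N k : ℕ} (hk : k < ((List.range N).filter P).length) :
    ∃ p < N, P p = true ∧ ((List.range p).filter P).length = k ∧
      ((List.range N).filter P)[k] = p := by
  have hmem := List.getElem_mem hk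
  simp only [List.mem_filter, List.mem_range] at hmem
  refine ⟨_, hmem.1, hmem.2, ?_, rfl⟩
  have h := getElem?_filter_range P hmem.1 hmem.2
  obtain ⟨h', h''⟩ := List.getElem?_eq_some_iff.1 h
  exact (List.Nodup.getElem_inj_iff (List.nodup_range.filter P)).1 h''

theorem rank_inj (P : ℕ → Bool) {p q : ℕ} (hp : P p = true) (hq : P q = true)
    (h : ((List.range p).filter P).length = ((List.range q).filter P).length) : p = q := by
  have h₁ := getElem?_filter_range P (N := p + q + 1) (p := p) (by omega) hp
  have h₂ := getElem?_filter_range P (N := p + q + 1) (p := q) (by omega) hq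
  rw [h, h₂] at h₁
  exact (Option.some.inj h₁).symm

theorem sum_range_eq_rank (F : ℕ → ℕ) {N : ℕ} (hF : ∀ p < N, F p ≤ 1) :
    ∑ q ∈ Finset.range N, F q = ((List.range N).filter fun p => decide (F p = 1)).length := by
  induction N with
  | zero => simp
  | succ N ih =>
    rw [Finset.sum_range_succ, ih fun p hp => hF p (by omega), List.range_succ,
      List.filter_append, List.length_append]
    congr 1
    have := hF N (by omega)
    interval_cases h : F N <;> simp [h]

/-- Write the flagged entries among the first `cmN` entries of `cmI` to `cmO`, and their number
to `cmC`. -/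
def compact : Cmd :=
  Cmd.storeN scN (cn 0) (NExp.add (sc cmN) (cn 1)) ;;
  Cmd.storeN scC (cn 0) (cn 0) ;;
  scatN (sc cmN) tt scC (NExp.add ix (cn 1)) (ld cmF ix) ;;
  scan ;;
  scatN (sc cmN) (BExp.natEq (ld cmF ix) (cn 1)) cmO (ld scC ix) (ld cmI ix) ;;
  Cmd.storeN cmC (cn 0) (ld scC (sc cmN))

theorem compact_spec {M : Mem} {N S : ℕ} (hN : M.nat cmN 0 = N) (hS : M.nat aS 0 = S)
    (hNS : N + 1 ≤ 2 ^ S) (hSB : 2 ^ S ≤ B) (hF : ∀ p < N, M.nat cmF p ≤ 1)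
    (hI : ∀ p < N, M.nat cmI p ≤ B) :
    T B compact M (10000 * ((N + 1) * (S + 1))) (10000 * (S + 1)) (fun M' =>
      Mem.EqOff [scC, scT, scD, scJ, scN, cmO, cmC] [] M M' ∧
      seg (M'.nat cmO) (M'.nat cmC 0) =
        ((List.range N).filter fun p => decide (M.nat cmF p = 1)).map (M.nat cmI)) := by
  have h1 : 1 ≤ B := le_trans Nat.one_le_two_pow hSB
  have hsum : ∀ p ≤ N, ∑ q ∈ Finset.range p, M.nat cmF q =
      ((List.range p).filter fun p => decide (M.nat cmF p = 1)).length := fun p hp =>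
    sum_range_eq_rank _ fun q hq => hF q (by omega)
  have hle : ∀ p, ((List.range p).filter fun p => decide (M.nat cmF p = 1)).length ≤ p := fun p =>
    (List.length_filter_le _ _).trans (by simp)
  unfold compact
  refine (T.bind (T_storeN (by simp) (by simp; omega) (by decide)) ?_).mono
    (W := 200 + (200 + (200 * (N + 1) + (2000 * ((N + 1 + 1) * (S + 1)) + (200 * (N + 1) + 200)))))
    (D := 200 + (200 + (200 + (2000 * (S + 1) + (200 + 200))))) ?_ ?_ (fun _ h => h)
  · rintro _ rfl
    refine T.bind (T_storeN (by simp) (by simp) (by decide)) ?_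
    rintro _ rfl
    refine T.bind (T_scatN N (fun _ => True) (fun p => p + 1) (fun p => M.nat cmF p)
      (by simp [hN]) (by omega) (by simp) (by simp) (by simp) (fun p hp _ => by omega)
      (fun p hp _ => (hF p hp).trans h1) (fun _ _ _ _ _ _ h => by omega) (by decide)
      (by decide)) ?_
    rintro _ ⟨f, rfl, hf₁, hf₂⟩
    have hf0 : f 0 = 0 := by
      rw [hf₂ 0 (by simp)]; simp
    have hfs : ∀ p ≤ N, ∑ q ∈ Finset.range (p + 1), f q =
        ((List.range p).filter fun p => decide (M.nat cmF p = 1)).length := by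
      intro p hp
      rw [Finset.sum_range_succ', hf0, add_zero, ← hsum p hp]
      refine Finset.sum_congr rfl fun q hq => ?_
      rw [Finset.mem_range] at hq
      exact hf₁ q (by omega) trivial
    refine T.bind (scan_spec (N := N + 1) (S := S) (by simp [hN]) (by simp [hS]) hNS hSB
      (fun p hp => ?_)) ?_
    · simp only [Mem.setNA_nat, if_true]
      rw [hfs p (by omega)]
      have := hle p
      omega
    rintro M₁ ⟨hE, hc⟩
    simp only [Mem.setNA_nat, if_true] at hc
    have hc' : ∀ p ≤ N, M₁.nat scC p =
        ((List.range p).filter fun p => decide (M.nat cmF p = 1)).length := fun p hp => by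
      rw [hc p (by omega), hfs p hp]
    have hcmN : M₁.nat cmN 0 = N := by rw [hE.1 cmN (by decide)]; simp [hN]
    have hcmF : M₁.nat cmF = M.nat cmF := by rw [hE.1 cmF (by decide)]; simp
    have hcmI : M₁.nat cmI = M.nat cmI := by rw [hE.1 cmI (by decide)]; simp
    refine T.bind (T_scatN N (fun p => M.nat cmF p = 1)
      (fun p => ((List.range p).filter fun p => decide (M.nat cmF p = 1)).length) (M.nat cmI)
      (by simp [hcmN]) (by omega) (by simp [hcmF]) (fun p hp _ => ?_) (by simp [hcmI])
      (fun p hp _ => ?_) (fun p hp _ => hI p hp) (fun p _ hp q _ hq h => ?_) (by decide)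
      (by decide)) ?_
    · simp [hc' p hp.le]
    · have := hle p; omega
    · exact rank_inj (fun p => decide (M.nat cmF p = 1)) (by simpa using hp) (by simpa using hq) h
    rintro _ ⟨o, rfl, ho₁, -⟩
    refine (T_storeN (by simp) ?_ (by decide)).mono le_rfl le_rfl ?_
    · simp only [NExp.eval, Mem.setNA_nat]
      simp only [show (scC = cmO) = False by simp, show (cmN = cmO) = False by simp, if_false,
        hcmN, hc' N le_rfl]
      have := hle N; omega
    rintro _ rfl
    refine ⟨⟨fun a ha => ?_, fun a ha => ?_⟩, ?_⟩
    · simp only [List.mem_cons, List.not_mem_nil, or_false, not_or] at ha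
      simp only [Mem.setNA_nat, ha, if_false]
      rw [hE.1 a (by simp [ha])]
      simp [ha]
    · simp only [Mem.setNA_real]
      rw [hE.2 a ha]; rfl
    · have hcnt : M₁.nat scC N = ((List.range N).filter
        fun p => decide (M.nat cmF p = 1)).length := hc' N le_rfl
      simp only [Mem.setNA_nat, NExp.eval]
      simp [hcmN, hcnt]
      refine List.ext_getElem (by simp) fun k hk₁ hk₂ => ?_
      have hk : k < ((List.range N).filter fun p => decide (M.nat cmF p = 1)).length := by
        simpa using hk₂
      obtain ⟨p, hp, hP, hr, hg⟩ := exists_rank_eq _ hk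
      simp only [seg, List.getElem_map, List.getElem_range]
      rw [hg, ← ho₁ p hp (by simpa using hP), hr]
  · ring_nf; nlinarith [Nat.zero_le (N * S)]
  · ring_nf; omega

end PrimalGradient

namespace PrimalGradient

/-! ## Summation and maximum trees -/

abbrev itA : ℕ := 50
abbrev itN : ℕ := 51
abbrev pOwn : ℕ := 52
abbrev pAct : ℕ := 53
abbrev pAct' : ℕ := 54
abbrev pL : ℕ := 55
abbrev pP : ℕ := 56

/-- The sum tree and the maximum tree. -/
abbrev aSum : ℕ := 27
abbrev aMax : ℕ := 28

abbrev itS : ℕ := 30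
abbrev itM : ℕ := 31
abbrev pS : ℕ := 32
abbrev pM : ℕ := 33

/-- The address of node `u` of level `l` in a forest of height `L`. -/
def node (L l u : ℕ) : ℕ := u * (L + 1) + l

theorem node_inj {L l l' u u' : ℕ} (hl : l ≤ L) (hl' : l' ≤ L) (h : node L l u = node L l' u') :
    l = l' ∧ u = u' := by
  unfold node at h
  have h₁ : (u * (L + 1) + l) % (L + 1) = (u' * (L + 1) + l') % (L + 1) := by rw [h]
  rw [Nat.mul_comm u, Nat.mul_comm u', Nat.mul_add_mod, Nat.mul_add_mod, Nat.mod_eq_of_lt (by omega),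
    Nat.mod_eq_of_lt (by omega)] at h₁
  subst h₁
  exact ⟨rfl, Nat.eq_of_mul_eq_mul_right (by omega : 0 < L + 1) (by omega)⟩

theorem node_le {L l u U : ℕ} (hl : l ≤ L) (hu : u ≤ U) : node L l u ≤ U * (L + 1) + L := by
  unfold node
  exact Nat.add_le_add (Nat.mul_le_mul_right _ hu) hl

/-- The inner node `u` of level `l + 1` is consistent with its children. -/
def ConsAt (L : ℕ) (M : Mem) (l u : ℕ) : Prop :=
  M.real aSum (node L (l + 1) u) =
      M.real aSum (node L l (2 * u)) + M.real aSum (node L l (2 * u + 1)) ∧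
    M.real aMax (node L (l + 1) u) =
      max (M.real aMax (node L l (2 * u))) (M.real aMax (node L l (2 * u + 1)))

/-- All trees are consistent. -/
def Cons (L : ℕ) (M : Mem) : Prop := ∀ l < L, ∀ u, ConsAt L M l u

/-- The address of a node. -/
abbrev nd (l u : NExp) : NExp := NExp.add (NExp.mul u (NExp.add (sc aL) (cn 1))) l

/-- The ancestor of the `k`-th item on the current level. -/
abbrev pU : NExp := NExp.div (ld itA ix) (sc pP)

/-- The sibling to the left of `pU`. -/
abbrev pV : NExp := NExp.sub pU (cn 1)

/-- The left child of `pU`. -/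
abbrev pC : NExp := NExp.mul (cn 2) pU

/-- One level of `propagate`. -/
def propStep : Cmd :=
  scatN (sc itN) (BExp.natEq (ld pAct ix) (cn 1)) pOwn pU ix ;;
  mapN (sc itN) pAct' (ld pAct ix) ;;
  scatN (sc itN)
    (BExp.and (BExp.natEq pU (NExp.add (NExp.mul (cn 2) (NExp.div pU (cn 2))) (cn 1)))
      (BExp.and (BExp.natLT (ld pOwn pV) (sc itN))
        (BExp.natEq (NExp.div (ld itA (ld pOwn pV)) (sc pP)) pV))) pAct' ix (cn 0) ;;
  mapN (sc itN) pAct (ld pAct' ix) ;;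
  Cmd.storeN pP (cn 0) (NExp.add (sc pP) (sc pP)) ;;
  mapR (sc itN) pS (RExp.add (rl aSum (nd (sc pL) pC))
    (rl aSum (nd (sc pL) (NExp.add pC (cn 1))))) ;;
  mapR (sc itN) pM (rl aMax (nd (sc pL) pC)) ;;
  scatR (sc itN) (BExp.realLT (rl aMax (nd (sc pL) pC))
    (rl aMax (nd (sc pL) (NExp.add pC (cn 1))))) pM ix
    (rl aMax (nd (sc pL) (NExp.add pC (cn 1)))) ;;
  scatR (sc itN) (BExp.natEq (ld pAct ix) (cn 1)) aSum (nd (NExp.add (sc pL) (cn 1)) pU)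
    (rl pS ix) ;;
  scatR (sc itN) (BExp.natEq (ld pAct ix) (cn 1)) aMax (nd (NExp.add (sc pL) (cn 1)) pU)
    (rl pM ix)

/-- Write the values `itS`, `itM` to the leaves `itA` of the trees and update their ancestors. -/
def propagate : Cmd :=
  scatR (sc itN) tt aSum (nd (cn 0) (ld itA ix)) (rl itS ix) ;;
  scatR (sc itN) tt aMax (nd (cn 0) (ld itA ix)) (rl itM ix) ;;
  mapN (sc itN) pAct (cn 1) ;;
  Cmd.storeN pP (cn 0) (cn 1) ;;
  Cmd.forTo pL (sc aL) propStep

variable {B : ℕ}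

/-- Every ancestor on level `j` of an item has a unique active representative. -/
def Repr (N : ℕ) (a act : ℕ → ℕ) (j : ℕ) : Prop :=
  (∀ k < N, act k ≤ 1) ∧
  (∀ k < N, ∃ k' < N, act k' = 1 ∧ a k' / 2 ^ j = a k / 2 ^ j) ∧
  ∀ k < N, act k = 1 → ∀ l < N, act l = 1 → a k / 2 ^ j = a l / 2 ^ j → k = l

theorem div_pow_succ (a j : ℕ) : a / 2 ^ (j + 1) = a / 2 ^ j / 2 := by
  rw [pow_succ, Nat.div_div_eq_div_mul]

theorem Repr.succ {N j : ℕ} {a act act' : ℕ → ℕ} (h : Repr N a act j)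
    (h₀ : ∀ k < N, (a k / 2 ^ j = 2 * (a k / 2 ^ j / 2) + 1 ∧
      ∃ l < N, a l / 2 ^ j = a k / 2 ^ j - 1) → act' k = 0)
    (h₁ : ∀ k < N, ¬ (a k / 2 ^ j = 2 * (a k / 2 ^ j / 2) + 1 ∧
      ∃ l < N, a l / 2 ^ j = a k / 2 ^ j - 1) → act' k = act k) : Repr N a act' (j + 1) := by
  obtain ⟨hle, hex, huniq⟩ := h
  have key : ∀ k < N, act' k = 1 → act k = 1 ∧ ¬ (a k / 2 ^ j = 2 * (a k / 2 ^ j / 2) + 1 ∧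
      ∃ l < N, a l / 2 ^ j = a k / 2 ^ j - 1) := by
    intro k hk hk1
    by_cases hc : a k / 2 ^ j = 2 * (a k / 2 ^ j / 2) + 1 ∧ ∃ l < N, a l / 2 ^ j = a k / 2 ^ j - 1
    · rw [h₀ k hk hc] at hk1; omega
    · exact ⟨by rw [← h₁ k hk hc]; exact hk1, hc⟩
  refine ⟨fun k hk => ?_, fun k hk => ?_, fun k hk hak l hl hal hkl => ?_⟩
  · by_cases hc : a k / 2 ^ j = 2 * (a k / 2 ^ j / 2) + 1 ∧ ∃ l < N, a l / 2 ^ j = a k / 2 ^ j - 1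
    · rw [h₀ k hk hc]; omega
    · rw [h₁ k hk hc]; exact hle k hk
  · simp only [div_pow_succ]
    by_cases hs : ∃ l < N, a l / 2 ^ j = 2 * (a k / 2 ^ j / 2)
    · obtain ⟨l, hl, hlk⟩ := hs
      obtain ⟨l', hl', hact, hll⟩ := hex l hl
      refine ⟨l', hl', ?_, by omega⟩
      rw [h₁ l' hl' (fun hc => by omega), hact]
    · obtain ⟨l, hl, hact, hlk⟩ := hex k hk
      refine ⟨l, hl, ?_, by omega⟩
      rw [h₁ l hl, hact]
      rintro ⟨ho, l', hl', hll⟩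
      exact hs ⟨l', hl', by omega⟩
  · simp only [div_pow_succ] at hkl
    obtain ⟨hk1, hkn⟩ := key k hk hak
    obtain ⟨hl1, hln⟩ := key l hl hal
    refine huniq k hk hk1 l hl hl1 ?_
    by_contra hne
    rcases Nat.lt_or_gt_of_ne hne with h' | h'
    · refine hln ⟨?_, k, hk, ?_⟩ <;>
      · generalize a k / 2 ^ j = x at *
        generalize a l / 2 ^ j = y at *
        omega
    · refine hkn ⟨?_, l, hl, ?_⟩ <;>
      · generalize a k / 2 ^ j = x at *
        generalize a l / 2 ^ j = y at *
        omega

theorem propStep_spec {M : Mem} {N L A j : ℕ} {a : ℕ → ℕ}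
    (hN : M.nat itN 0 = N) (hL : M.nat aL 0 = L) (ha : ∀ k < N, M.nat itA k = a k)
    (haA : ∀ k < N, a k ≤ A) (hB : A * (L + 1) + L ≤ B) (hNB : N ≤ B) (hPB : 2 ^ L ≤ B)
    (hj : j < L) (hpL : M.nat pL 0 = j) (hpP : M.nat pP 0 = 2 ^ j)
    (hR : Repr N a (M.nat pAct) j)
    (hC : ∀ l < L, ∀ u, (l < j ∨ ∀ k < N, a k / 2 ^ (l + 1) ≠ u) → ConsAt L M l u) :
    T B propStep M (2000 * (N + 1)) 2000 (fun M' =>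
      Mem.EqOff [pOwn, pAct, pAct', pP] [aSum, aMax, pS, pM] M M' ∧
      M'.nat pP 0 = 2 ^ (j + 1) ∧ Repr N a (M'.nat pAct) (j + 1) ∧
      (∀ u, M'.real aSum (node L 0 u) = M.real aSum (node L 0 u) ∧
        M'.real aMax (node L 0 u) = M.real aMax (node L 0 u)) ∧
      ∀ l < L, ∀ u, (l < j + 1 ∨ ∀ k < N, a k / 2 ^ (l + 1) ≠ u) → ConsAt L M' l u) := by
  have hdA : ∀ k < N, ∀ i, a k / 2 ^ i ≤ A := fun k hk i => (Nat.div_le_self _ _).trans (haA k hk)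
  have hAB : A ≤ B := by nlinarith
  have h1 : 1 ≤ B := le_trans Nat.one_le_two_pow hPB
  have h2j : 2 ^ (j + 1) ≤ B := (Nat.pow_le_pow_right (by norm_num) hj).trans hPB
  unfold propStep
  refine (T.bind (T_scatN N (fun k => M.nat pAct k = 1) (fun k => a k / 2 ^ j) (fun k => k)
    (by simp [hN]) hNB (by simp) (fun k hk _ => by simp [ha k hk, hpP]) (by simp)
    (fun k hk _ => (hdA k hk j).trans hAB) (fun k hk _ => by omega)
    (fun k hk hk' l hl hl' h => hR.2.2 k hk hk' l hl hl' h) (by decide) (by decide)) ?_).mono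
    (W := 200 * (N + 1) + (200 * (N + 1) + (200 * (N + 1) + (200 * (N + 1) + (200 +
      (200 * (N + 1) + (200 * (N + 1) + (200 * (N + 1) + (200 * (N + 1) + 200 * (N + 1))))))))))
    (D := 200 + (200 + (200 + (200 + (200 + (200 + (200 + (200 + (200 + 200)))))))))
    (by omega) (by omega) (fun _ h => h)
  rintro _ ⟨own, rfl, hown, -⟩
  have htouch : ∀ v, (own v < N ∧ a (own v) / 2 ^ j = v) ↔ ∃ k < N, a k / 2 ^ j = v := by
    intro v
    refine ⟨fun h => ⟨_, h.1, h.2⟩, ?_⟩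
    rintro ⟨k, hk, rfl⟩
    obtain ⟨k', hk', hact, h⟩ := hR.2.1 k hk
    rw [← h, hown k' hk' hact]
    exact ⟨hk', rfl⟩
  refine T.bind (T_mapN N (M.nat pAct) (by simp [hN]) hNB (by simp)
    (fun k hk => (hR.1 k hk).trans h1) (by decide) (by decide)) ?_
  rintro _ rfl
  refine T.bind (T_scatN N (fun k => a k / 2 ^ j = 2 * (a k / 2 ^ j / 2) + 1 ∧
      ∃ l < N, a l / 2 ^ j = a k / 2 ^ j - 1) (fun k => k) (fun _ => 0)
    (by simp [hN]) hNB (fun k hk => ?_) (by simp) (by simp) (fun k hk _ => by omega)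
    (by simp) (fun _ _ _ _ _ _ h => h) (by decide) (by decide)) ?_
  · simp [ha k hk, hpP, hN]
    intro _
    rw [← htouch]
    constructor
    · rintro ⟨h, h'⟩
      exact ⟨h, by rw [ha _ h] at h'; exact h'⟩
    · rintro ⟨h, h'⟩
      exact ⟨h, by rw [ha _ h]; exact h'⟩
  rintro _ ⟨act', rfl, hact₀, hact₁⟩
  simp only [Mem.setNA_nat, if_true] at hact₁
  have hR' : Repr N a act' (j + 1) := by
    refine hR.succ hact₀ fun k hk hc => ?_
    rw [hact₁ k (fun l hl hl' h => hc (h ▸ hl')), if_pos hk]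
  refine T.bind (T_mapN N act' (by simp [hN]) hNB (by simp)
    (fun k hk => (hR'.1 k hk).trans h1) (by decide) (by decide)) ?_
  rintro _ rfl
  refine T.bind (T_storeN (by simp) (by simp [hpP]; rw [pow_succ] at h2j; omega) (by decide)) ?_
  rintro _ rfl
  have hpow : 2 ^ j + 2 ^ j = 2 ^ (j + 1) := by rw [pow_succ]; omega
  refine T.bind (T_mapR N (fun k => M.real aSum (node L j (2 * (a k / 2 ^ (j + 1)))) +
      M.real aSum (node L j (2 * (a k / 2 ^ (j + 1)) + 1)))
    (by simp [hN]) hNB (fun k hk => by simp [hpP, hpL, hL, ha k hk, hpow, node])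
    (by decide) (by decide)) ?_
  rintro _ rfl
  refine T.bind (T_mapR N (fun k => M.real aMax (node L j (2 * (a k / 2 ^ (j + 1)))))
    (by simp [hN]) hNB (fun k hk => by simp [hpP, hpL, hL, ha k hk, hpow, node])
    (by decide) (by decide)) ?_
  rintro _ rfl
  refine T.bind (T_scatR N (fun k => M.real aMax (node L j (2 * (a k / 2 ^ (j + 1)))) <
      M.real aMax (node L j (2 * (a k / 2 ^ (j + 1)) + 1))) (fun k => k)
    (fun k => M.real aMax (node L j (2 * (a k / 2 ^ (j + 1)) + 1)))
    (by simp [hN]) hNB (fun k hk => by simp [hpP, hpL, hL, ha k hk, hpow, node]) (by simp)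
    (fun k hk _ => by simp [hpP, hpL, hL, ha k hk, hpow, node]) (fun k hk _ => by omega)
    (fun _ _ _ _ _ _ h => h) (by decide) (by decide)) ?_
  rintro _ ⟨mx, rfl, hmx₁, hmx₀⟩
  have hmx : ∀ k < N, mx k = max (M.real aMax (node L j (2 * (a k / 2 ^ (j + 1)))))
      (M.real aMax (node L j (2 * (a k / 2 ^ (j + 1)) + 1))) := by
    intro k hk
    by_cases h : M.real aMax (node L j (2 * (a k / 2 ^ (j + 1)))) <
      M.real aMax (node L j (2 * (a k / 2 ^ (j + 1)) + 1))
    · rw [hmx₁ k hk h, max_eq_right h.le]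
    · rw [hmx₀ k (fun l hl hl' e => h (e ▸ hl')), max_eq_left (not_lt.1 h)]
      simp [hk]
  have hnB : ∀ k < N, node L (j + 1) (a k / 2 ^ (j + 1)) ≤ B := fun k hk =>
    (node_le (by omega) (hdA k hk _)).trans hB
  refine T.bind (T_scatR N (fun k => act' k = 1) (fun k => node L (j + 1) (a k / 2 ^ (j + 1)))
    (fun k => M.real aSum (node L j (2 * (a k / 2 ^ (j + 1)))) +
      M.real aSum (node L j (2 * (a k / 2 ^ (j + 1)) + 1)))
    (by simp [hN]) hNB (fun k hk => by simp [hk])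
    (fun k hk _ => by simp [hpP, hpL, hL, ha k hk, hpow, node])
    (fun k hk _ => by simp [hk]) (fun k hk _ => hnB k hk)
    (fun k hk hk' l hl hl' h => hR'.2.2 k hk hk' l hl hl'
      (node_inj (by omega) (by omega) h).2) (by decide) (by decide)) ?_
  rintro _ ⟨S', rfl, hS₁, hS₀⟩
  refine (T_scatR N (fun k => act' k = 1) (fun k => node L (j + 1) (a k / 2 ^ (j + 1))) mx
    (by simp [hN]) hNB (fun k hk => by simp [hk])
    (fun k hk _ => by simp [hpP, hpL, hL, ha k hk, hpow, node])
    (fun k hk _ => by simp) (fun k hk _ => hnB k hk)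
    (fun k hk hk' l hl hl' h => hR'.2.2 k hk hk' l hl hl'
      (node_inj (by omega) (by omega) h).2) (by decide) (by decide)).mono le_rfl le_rfl ?_
  rintro _ ⟨M', rfl, hM₁, hM₀⟩
  simp only [Mem.setRA_real, Mem.setNA_real, show (aSum = pM) = False by simp,
    show (aSum = pS) = False by simp, show (aMax = aSum) = False by simp,
    show (aMax = pM) = False by simp, show (aMax = pS) = False by simp, if_false] at hS₀ hM₀
  have hnew : ∀ u, (∃ k < N, a k / 2 ^ (j + 1) = u) →
      S' (node L (j + 1) u) = M.real aSum (node L j (2 * u)) +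
        M.real aSum (node L j (2 * u + 1)) ∧
      M' (node L (j + 1) u) = max (M.real aMax (node L j (2 * u)))
        (M.real aMax (node L j (2 * u + 1))) := by
    rintro u ⟨k, hk, rfl⟩
    obtain ⟨k', hk', hact, h⟩ := hR'.2.1 k hk
    rw [← h, hS₁ k' hk' hact, hM₁ k' hk' hact, hmx k' hk']
    exact ⟨rfl, rfl⟩
  have hold : ∀ l ≤ L, ∀ u, ¬ (l = j + 1 ∧ ∃ k < N, a k / 2 ^ (j + 1) = u) →
      S' (node L l u) = M.real aSum (node L l u) ∧ M' (node L l u) = M.real aMax (node L l u) := by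
    intro l hl u h
    have h' : ∀ k < N, act' k = 1 → node L (j + 1) (a k / 2 ^ (j + 1)) ≠ node L l u := by
      intro k hk _ e
      obtain ⟨e₁, e₂⟩ := node_inj (by omega) hl e
      exact h ⟨e₁.symm, k, hk, e₂⟩
    exact ⟨hS₀ _ h', hM₀ _ h'⟩
  refine ⟨?_, by simp [hpP, hpow], ?_, ?_, ?_⟩
  · exact ((((((((((Mem.EqOff.refl M).setNA (by decide) _).setNA (by decide) _).setNA
      (by decide) _).setNA (by decide) _).setNA (by decide) _).setRA (by decide) _).setRA
      (by decide) _).setRA (by decide) _).setRA (by decide) _).setRA (by decide) _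
  · refine ⟨fun k hk => ?_, fun k hk => ?_, fun k hk hk' l hl hl' => ?_⟩
    · simpa [hk] using hR'.1 k hk
    · obtain ⟨k', hk', h⟩ := hR'.2.1 k hk
      exact ⟨k', hk', by simpa [hk'] using h⟩
    · exact hR'.2.2 k hk (by simpa [hk] using hk') l hl (by simpa [hl] using hl')
  · intro u
    simpa using hold 0 (by omega) u (by omega)
  · intro l hl u hlu
    simp only [ConsAt, Mem.setRA_real, if_true, show (aSum = aMax) = False by simp, if_false]
    have hch : ∀ c, c / 2 = u → S' (node L l c) = M.real aSum (node L l c) ∧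
        M' (node L l c) = M.real aMax (node L l c) := by
      intro c hc
      refine hold l hl.le c ?_
      rintro ⟨rfl, k, hk, hkc⟩
      rcases hlu with hlu | hlu
      · omega
      · refine hlu k hk ?_
        rw [div_pow_succ, hkc, hc]
    obtain ⟨h₁, h₂⟩ := hch (2 * u) (by omega)
    obtain ⟨h₃, h₄⟩ := hch (2 * u + 1) (by omega)
    rw [h₁, h₂, h₃, h₄]
    by_cases ht : l = j ∧ ∃ k < N, a k / 2 ^ (j + 1) = u
    · obtain ⟨rfl, ht⟩ := ht
      exact hnew u ht
    · obtain ⟨h₅, h₆⟩ := hold (l + 1) (by omega) u (fun h => ht ⟨by omega, h.2⟩)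
      rw [h₅, h₆]
      refine hC l hl u ?_
      rcases hlu with hlu | hlu
      · by_cases hlj : l = j
        · right
          subst hlj
          intro k hk hk'
          exact ht ⟨rfl, k, hk, hk'⟩
        · left; omega
      · exact Or.inr hlu

theorem propagate_spec {M : Mem} {N L A : ℕ} {a : ℕ → ℕ}
    (hN : M.nat itN 0 = N) (hL : M.nat aL 0 = L) (ha : ∀ k < N, M.nat itA k = a k)
    (hinj : ∀ k < N, ∀ l < N, a k = a l → k = l)
    (haA : ∀ k < N, a k ≤ A) (hB : A * (L + 1) + L ≤ B) (hNB : N ≤ B) (hPB : 2 ^ L ≤ B)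
    (hC : Cons L M) :
    T B propagate M (4000 * ((N + 1) * (L + 1))) (4000 * (L + 1)) (fun M' =>
      Mem.EqOff [pOwn, pAct, pAct', pP, pL] [aSum, aMax, pS, pM] M M' ∧ Cons L M' ∧
      (∀ k < N, M'.real aSum (node L 0 (a k)) = M.real itS k ∧
        M'.real aMax (node L 0 (a k)) = M.real itM k) ∧
      ∀ u, (∀ k < N, a k ≠ u) → M'.real aSum (node L 0 u) = M.real aSum (node L 0 u) ∧
        M'.real aMax (node L 0 u) = M.real aMax (node L 0 u)) := by
  have h1 : 1 ≤ B := le_trans Nat.one_le_two_pow hPB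
  have hn0 : ∀ k < N, node L 0 (a k) ≤ B := fun k hk => (node_le (by omega) (haA k hk)).trans hB
  unfold propagate
  refine (T.bind (T_scatR N (fun _ => True) (fun k => node L 0 (a k)) (M.real itS)
    (by simp [hN]) hNB (by simp) (fun k hk _ => by simp [ha k hk, hL, node]) (by simp)
    (fun k hk _ => hn0 k hk)
    (fun k hk _ l hl _ h => hinj k hk l hl (node_inj (by omega) (by omega) h).2)
    (by decide) (by decide)) ?_).mono
    (W := 200 * (N + 1) + (200 * (N + 1) + (200 * (N + 1) + (200 +
      (400 + L * (400 + 2000 * (N + 1)))))))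
    (D := 200 + (200 + (200 + (200 + (400 + L * (400 + 2000)))))) ?_ ?_ (fun _ h => h)
  · rintro _ ⟨S', rfl, hS₁, hS₀⟩
    refine T.bind (T_scatR N (fun _ => True) (fun k => node L 0 (a k)) (M.real itM)
      (by simp [hN]) hNB (by simp) (fun k hk _ => by simp [ha k hk, hL, node]) (by simp)
      (fun k hk _ => hn0 k hk)
      (fun k hk _ l hl _ h => hinj k hk l hl (node_inj (by omega) (by omega) h).2)
      (by decide) (by decide)) ?_
    rintro _ ⟨M', rfl, hM₁, hM₀⟩
    have hold : ∀ l ≤ L, ∀ u, ¬ (l = 0 ∧ ∃ k < N, a k = u) →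
        S' (node L l u) = M.real aSum (node L l u) ∧
        M' (node L l u) = M.real aMax (node L l u) := by
      intro l hl u h
      have h' : ∀ k < N, True → node L 0 (a k) ≠ node L l u := by
        intro k hk _ e
        obtain ⟨e₁, e₂⟩ := node_inj (by omega) hl e
        exact h ⟨e₁.symm, k, hk, e₂⟩
      exact ⟨hS₀ _ h', by simpa using hM₀ _ h'⟩
    refine T.bind (T_mapN N (fun _ => 1) (by simp [hN]) hNB (by simp) (fun _ _ => h1) (by decide)
      (by decide)) ?_
    rintro _ rfl
    refine T.bind (T_storeN (by simp) (by simp; omega) (by decide)) ?_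
    rintro _ rfl
    refine (T_forTo (fun j M₁ => Mem.EqOff [pOwn, pAct, pAct', pP, pL] [aSum, aMax, pS, pM] M M₁ ∧
      M₁.nat pP 0 = 2 ^ j ∧ Repr N a (M₁.nat pAct) j ∧
      (∀ u, M₁.real aSum (node L 0 u) = S' (node L 0 u) ∧
        M₁.real aMax (node L 0 u) = M' (node L 0 u)) ∧
      ∀ l < L, ∀ u, (l < j ∨ ∀ k < N, a k / 2 ^ (l + 1) ≠ u) → ConsAt L M₁ l u) L _ _
      (Nat.lt_two_pow_self.le.trans hPB) (by decide) ?_ ?_ ?_ ?_).mono le_rfl le_rfl ?_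
    · rintro j M₁ ⟨hE, -⟩
      simp [hE.1 aL (by decide), hL]
    · rintro j M₁ f ⟨hE, h₁, h₂, h₃, h₄⟩
      exact ⟨hE.setNA (by decide) f, by simpa using h₁, by simpa using h₂, h₃, h₄⟩
    · rintro j M₁ hj ⟨hE, h₁, h₂, h₃, h₄⟩ hjL
      refine (propStep_spec (by rw [hE.1 itN (by decide), hN]) (by rw [hE.1 aL (by decide), hL])
        (fun k hk => by rw [hE.1 itA (by decide), ha k hk]) haA hB hNB hPB hj hjL h₁ h₂ h₄).mono
        le_rfl le_rfl ?_
      rintro M₂ ⟨hE', h₁', h₂', h₃', h₄'⟩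
      refine ⟨by rw [hE'.1 pL (by decide), hjL], hE.trans (hE'.mono (by decide) (by decide)), h₁', h₂',
        fun u => ?_, h₄'⟩
      rw [(h₃' u).1, (h₃' u).2]
      exact h₃ u
    · refine ⟨((((Mem.EqOff.refl M).setRA (by decide) _).setRA (by decide) _).setNA
        (by decide) _).setNA (by decide) _, by simp, ⟨?_, ?_, ?_⟩, by simp, ?_⟩
      · intro k hk; simp [hk]
      · intro k hk; exact ⟨k, hk, by simp [hk]⟩
      · intro k hk _ l hl _ h
        exact hinj k hk l hl (by simpa using h)
      · intro l hl u hlu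
        have hlu' : ∀ k < N, a k / 2 ^ (l + 1) ≠ u := hlu.resolve_left (by omega)
        simp only [ConsAt, Mem.setRA_real, Mem.setNA_real, if_true,
          show (aSum = aMax) = False by simp, if_false]
        have hch : ∀ c, c / 2 = u → S' (node L l c) = M.real aSum (node L l c) ∧
            M' (node L l c) = M.real aMax (node L l c) := by
          intro c hc
          refine hold l hl.le c ?_
          rintro ⟨rfl, k, hk, rfl⟩
          exact hlu' k hk (by simpa using hc)
        obtain ⟨g₁, g₂⟩ := hch (2 * u) (by omega)
        obtain ⟨g₃, g₄⟩ := hch (2 * u + 1) (by omega)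
        obtain ⟨g₅, g₆⟩ := hold (l + 1) (by omega) u (by omega)
        rw [g₁, g₂, g₃, g₄, g₅, g₆]
        exact hC l hl u
    · rintro M₁ ⟨hE, h₁, h₂, h₃, h₄⟩
      refine ⟨hE, fun l hl u => h₄ l hl u (Or.inl hl), fun k hk => ?_, fun u hu => ?_⟩
      · rw [(h₃ _).1, (h₃ _).2]
        exact ⟨hS₁ k hk trivial, by simpa using hM₁ k hk trivial⟩
      · rw [(h₃ _).1, (h₃ _).2]
        exact hold 0 (by omega) u fun h => by
          obtain ⟨k, hk, hku⟩ := h.2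
          exact hu k hk hku
  · ring_nf; nlinarith [Nat.zero_le (N * L)]
  · ring_nf; omega

end PrimalGradient

namespace PrimalGradient

/-! ## The layout of the data structure -/

/-- Tables of the buckets: the entries of the gradient, `τ̄`, and their quotients. -/
abbrev aX : ℕ := 20
abbrev aT : ℕ := 21
abbrev aR : ℕ := 22

/-- The value of `aY` of its bucket when a row was last synchronized. -/
abbrev aYS : ℕ := 23

/-- The sums of all steps, for every bucket. -/
abbrev aY : ℕ := 25

/-- The dimensions, the matrix in compressed row format, and the parameters. -/
structure Lay where
  m : ℕ
  n : ℕ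
  L : ℕ
  NT : ℕ
  NB : ℕ
  B : ℕ
  ptr : ℕ → ℕ
  len : ℕ → ℕ
  col : ℕ → ℕ → ℕ
  val : ℕ → ℕ → ℝ
  A : ℕ → ℕ → ℝ
  ε : ℝ
  lam : ℝ
  C : ℝ

namespace Lay

/-- The number of leaves of all trees. -/
def size (P : Lay) : ℕ := (P.n + 2) * P.NB * 2 ^ P.L

/-- The leaf of row `i` in the tree of column `c` and bucket `b`. -/
def leaf (P : Lay) (c b i : ℕ) : ℕ := (c * P.NB + b) * 2 ^ P.L + i

/-- The gradient in bucket `b`. -/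
noncomputable def xb (P : Lay) (b : ℕ) : ℝ :=
  P.lam * Real.sinh (P.lam * (1 / 2 + (b / P.NT : ℕ) * P.ε))

/-- The value of `τ̄` in bucket `b`. -/
noncomputable def tb (P : Lay) (b : ℕ) : ℝ :=
  P.n / P.m * Real.exp ((b - P.NT * (b / P.NT) : ℕ) * P.ε)

structure Ok (P : Lay) : Prop where
  hm : 0 < P.m
  hn : 0 < P.n
  hmL : P.m ≤ 2 ^ P.L
  hNB : 0 < P.NB
  ptr_succ : ∀ i < P.m, P.ptr (i + 1) = P.ptr i + P.len i
  len_le : ∀ i < P.m, P.len i ≤ P.n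
  col_lt : ∀ i < P.m, ∀ q < P.len i, P.col i q < P.n
  col_inj : ∀ i < P.m, ∀ q < P.len i, ∀ q' < P.len i, P.col i q = P.col i q' → q = q'
  val_eq : ∀ i < P.m, ∀ q < P.len i, P.val i q = P.A i (P.col i q)
  A_eq_zero : ∀ i < P.m, ∀ c < P.n, (∀ q < P.len i, P.col i q ≠ c) → P.A i c = 0
  size_le : P.size * (P.L + 1) + P.L ≤ P.B
  pow_le : 2 ^ (P.L + 2) ≤ P.B

variable {P : Lay}

theorem leaf_inj (P : Lay) {c b i c' b' i' : ℕ} (hb : b < P.NB) (hb' : b' < P.NB)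
    (hi : i < 2 ^ P.L) (hi' : i' < 2 ^ P.L) (h : P.leaf c b i = P.leaf c' b' i') :
    c = c' ∧ b = b' ∧ i = i' := by
  unfold leaf at h
  have key : ∀ {x x' y y' k : ℕ}, y < k → y' < k → x * k + y = x' * k + y' → x = x' ∧ y = y' := by
    intro x x' y y' k hy hy' h
    have h₁ : (x * k + y) % k = (x' * k + y') % k := by rw [h]
    rw [Nat.mul_comm x, Nat.mul_comm x', Nat.mul_add_mod, Nat.mul_add_mod, Nat.mod_eq_of_lt hy,
      Nat.mod_eq_of_lt hy'] at h₁
    subst h₁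
    exact ⟨Nat.eq_of_mul_eq_mul_right (by omega : 0 < k) (by omega), rfl⟩
  obtain ⟨h₁, h₂⟩ := key hi hi' h
  obtain ⟨h₃, h₄⟩ := key hb hb' h₁
  exact ⟨h₃, h₄, h₂⟩

theorem leaf_lt (P : Lay) {c b i : ℕ} (hc : c < P.n + 2) (hb : b < P.NB) (hi : i < 2 ^ P.L) :
    P.leaf c b i < P.size := by
  unfold leaf size
  have h₁ : c * P.NB + b + 1 ≤ (P.n + 2) * P.NB := by nlinarith
  nlinarith

theorem Ok.m_mul_le (h : P.Ok) : P.m * (P.n + 2) ≤ P.size := by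
  unfold size
  have h₁ := h.hmL
  have h₂ := h.hNB
  calc P.m * (P.n + 2) ≤ 2 ^ P.L * (P.n + 2) := Nat.mul_le_mul_right _ h₁
    _ = (P.n + 2) * 1 * 2 ^ P.L := by ring
    _ ≤ _ := by gcongr; exact h₂

theorem Ok.size_le' (h : P.Ok) : P.size ≤ P.B := by
  have := h.size_le; nlinarith

theorem Ok.m_le (h : P.Ok) : P.m ≤ P.B := by
  have := h.m_mul_le; have := h.size_le'; nlinarith

theorem Ok.n_le (h : P.Ok) : P.n ≤ P.B := by
  have := h.m_mul_le; have := h.size_le'; have := h.hm; nlinarith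

theorem Ok.one_le (h : P.Ok) : 1 ≤ P.B := le_trans Nat.one_le_two_pow h.pow_le

theorem Ok.pow_le' (h : P.Ok) : 2 ^ P.L ≤ P.B :=
  (Nat.pow_le_pow_right (by norm_num) (by omega)).trans h.pow_le

theorem Ok.NB_le (h : P.Ok) : P.NB ≤ P.B := by
  refine le_trans ?_ h.size_le'
  unfold size
  calc P.NB = 1 * P.NB * 1 := by ring
    _ ≤ _ := by gcongr; omega; exact Nat.one_le_two_pow

/-- The column of an entry of a row: the first two entries are in the columns for counting and
for the potential. -/
def colx (P : Lay) (i : ℕ) : ℕ → ℕ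
  | 0 => P.n
  | 1 => P.n + 1
  | q + 2 => P.col i q

theorem Ok.colx_lt (h : P.Ok) {i q : ℕ} (hi : i < P.m) (hq : q < P.len i + 2) :
    P.colx i q < P.n + 2 := by
  match q with
  | 0 => simp [colx]
  | 1 => simp [colx]
  | q + 2 => have := h.col_lt i hi q (by omega); simp only [colx]; omega

theorem Ok.colx_inj (h : P.Ok) {i q q' : ℕ} (hi : i < P.m) (hq : q < P.len i + 2)
    (hq' : q' < P.len i + 2) (he : P.colx i q = P.colx i q') : q = q' := by
  match q, q' with
  | 0, 0 | 1, 1 => rfl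
  | 0, 1 | 1, 0 => simp [colx] at he
  | 0, q + 2 | 1, q + 2 => have := h.col_lt i hi q (by omega); simp only [colx] at he; omega
  | q + 2, 0 | q + 2, 1 => have := h.col_lt i hi q (by omega); simp only [colx] at he; omega
  | q + 2, q' + 2 =>
    have := h.col_inj i hi q (by omega) q' (by omega) he
    omega

end Lay

/-- The part of the memory that does not change after the initialization. -/
structure Stat (P : Lay) (M : Mem) : Prop where
  m : M.nat inDim 0 = P.m
  n : M.nat inDim 1 = P.n
  ptr : ∀ i ≤ P.m, M.nat inPtr i = P.ptr i
  col : ∀ i < P.m, ∀ q < P.len i, M.nat inCol (P.ptr i + q) = P.col i q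
  val : ∀ i < P.m, ∀ q < P.len i, M.real inVal (P.ptr i + q) = P.val i q
  eps : M.real inScal 0 = P.ε
  lam : M.real inScal 1 = P.lam
  C : M.real inScal 2 = P.C
  L : M.nat aL 0 = P.L
  pw : M.nat aP 0 = 2 ^ P.L
  S : M.nat aS 0 = P.L + 2
  NT : M.nat aNT 0 = P.NT
  NB : M.nat aNB 0 = P.NB
  X : ∀ b < P.NB, M.real aX b = P.xb b
  T : ∀ b < P.NB, M.real aT b = P.tb b
  R : ∀ b < P.NB, M.real aR b = P.xb b / P.tb b

theorem Stat.eqOff {P : Lay} {M M' : Mem} {NS RS : List ℕ} (h : Stat P M)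
    (hE : Mem.EqOff NS RS M M')
    (hN : ∀ a ∈ [inDim, inPtr, inCol, aL, aP, aS, aNT, aNB], a ∉ NS := by decide)
    (hR : ∀ a ∈ [inScal, inVal, aX, aT, aR], a ∉ RS := by decide) : Stat P M' := by
  have e₁ : M'.nat inDim = M.nat inDim := hE.1 _ (hN _ (by simp))
  have e₂ : M'.nat inPtr = M.nat inPtr := hE.1 _ (hN _ (by simp))
  have e₃ : M'.nat inCol = M.nat inCol := hE.1 _ (hN _ (by simp))
  have e₄ : M'.nat aL = M.nat aL := hE.1 _ (hN _ (by simp))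
  have e₅ : M'.nat aP = M.nat aP := hE.1 _ (hN _ (by simp))
  have e₆ : M'.nat aS = M.nat aS := hE.1 _ (hN _ (by simp))
  have e₇ : M'.nat aNT = M.nat aNT := hE.1 _ (hN _ (by simp))
  have e₈ : M'.nat aNB = M.nat aNB := hE.1 _ (hN _ (by simp))
  have f₁ : M'.real inScal = M.real inScal := hE.2 _ (hR _ (by simp))
  have f₂ : M'.real inVal = M.real inVal := hE.2 _ (hR _ (by simp))
  have f₃ : M'.real aX = M.real aX := hE.2 _ (hR _ (by simp))
  have f₄ : M'.real aT = M.real aT := hE.2 _ (hR _ (by simp))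
  have f₅ : M'.real aR = M.real aR := hE.2 _ (hR _ (by simp))
  constructor
  · rw [e₁, h.m]
  · rw [e₁, h.n]
  · rw [e₂]; exact h.ptr
  · rw [e₃]; exact h.col
  · rw [f₂]; exact h.val
  · rw [f₁, h.eps]
  · rw [f₁, h.lam]
  · rw [f₁, h.C]
  · rw [e₄, h.L]
  · rw [e₅, h.pw]
  · rw [e₆, h.S]
  · rw [e₇, h.NT]
  · rw [e₈, h.NB]
  · rw [f₃]; exact h.X
  · rw [f₄]; exact h.T
  · rw [f₅]; exact h.R

/-- The argument arrays hold a list of `N` different rows. -/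
structure Rows (P : Lay) (M : Mem) (N : ℕ) (r : ℕ → ℕ) : Prop where
  len : M.nat inLen 0 = N
  idx : ∀ k < N, M.nat inIdx k = r k
  lt : ∀ k < N, r k < P.m
  inj : ∀ k < N, ∀ l < N, r k = r l → k = l

theorem Rows.eqOff {P : Lay} {M M' : Mem} {NS RS : List ℕ} {N : ℕ} {r : ℕ → ℕ} (h : Rows P M N r)
    (hE : Mem.EqOff NS RS M M') (hN : ∀ a ∈ [inLen, inIdx], a ∉ NS := by decide) :
    Rows P M' N r := by
  constructor
  · rw [hE.1 inLen (hN _ (by simp)), h.len]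
  · rw [hE.1 inIdx (hN _ (by simp))]; exact h.idx
  · exact h.lt
  · exact h.inj

theorem Rows.le {P : Lay} {M : Mem} {N : ℕ} {r : ℕ → ℕ} (h : Rows P M N r) : N ≤ P.m := by
  have := Finset.card_le_card_of_injOn (s := Finset.range N) (t := Finset.range P.m) r
    (fun k hk => by simpa using h.lt k (by simpa using hk))
    (fun k hk l hl => h.inj k (by simpa using hk) l (by simpa using hl))
  simpa using this

/-- The sum of the first `p` values of `w`. -/
def off (w : ℕ → ℕ) (p : ℕ) : ℕ := ∑ q ∈ Finset.range p, w q

theorem off_succ (w : ℕ → ℕ) (p : ℕ) : off w (p + 1) = off w p + w p := Finset.sum_range_succ _ _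

theorem off_mono (w : ℕ → ℕ) {p q : ℕ} (h : p ≤ q) : off w p ≤ off w q :=
  Finset.sum_le_sum_of_subset (Finset.range_mono h)

theorem off_add_lt (w : ℕ → ℕ) {p q N : ℕ} (hp : p < N) (hq : q < w p) : off w p + q < off w N :=
  lt_of_lt_of_le (by rw [off_succ]; omega) (off_mono w hp)

theorem off_inj (w : ℕ → ℕ) {p q p' q' : ℕ} (hq : q < w p) (hq' : q' < w p')
    (h : off w p + q = off w p' + q') : p = p' ∧ q = q' := by
  have key : ¬ p < p' ∧ ¬ p' < p := by
    constructor
    · intro hlt; have := off_add_lt w hlt hq; omega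
    · intro hlt; have := off_add_lt w hlt hq'; omega
  obtain rfl : p = p' := by omega
  exact ⟨rfl, by omega⟩

theorem exists_off (w : ℕ → ℕ) {N k : ℕ} (hk : k < off w N) :
    ∃ p < N, ∃ q < w p, k = off w p + q := by
  induction N with
  | zero => simp [off] at hk
  | succ N ih =>
    by_cases h : k < off w N
    · obtain ⟨p, hp, q, hq, e⟩ := ih h
      exact ⟨p, by omega, q, hq, e⟩
    · rw [off_succ] at hk
      exact ⟨N, by omega, k - off w N, by omega, by omega⟩

/-! ## Leaves -/

/-- The `k`-th row of the list, and its bucket. -/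
abbrev row : NExp := ld inIdx ix
abbrev rowLen : NExp := NExp.sub (ld inPtr (NExp.add row (cn 1))) (ld inPtr row)
abbrev leafE (c : NExp) : NExp :=
  NExp.add (NExp.mul (NExp.add (NExp.mul c (sc aNB)) (ld aBk row)) (sc aP)) row
abbrev colN : NExp := ld inDim (cn 1)

/-- List the leaves of all entries of the rows of the list. -/
def fullItems : Cmd :=
  Cmd.storeN scN (cn 0) (NExp.add (sc inLen) (cn 1)) ;;
  Cmd.storeN scC (cn 0) (cn 0) ;;
  scatN (sc inLen) tt scC (NExp.add ix (cn 1)) (NExp.add rowLen (cn 2)) ;;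
  scan ;;
  Cmd.storeN itN (cn 0) (ld scC (sc inLen)) ;;
  scatN (sc inLen) tt itA (ld scC ix) (leafE colN) ;;
  scatN (sc inLen) tt itA (NExp.add (ld scC ix) (cn 1)) (leafE (NExp.add colN (cn 1))) ;;
  nestN (sc inLen) rowLen itA (NExp.add (NExp.add (ld scC ix) (cn 2)) (NExp.reg 1))
    (leafE (ld inCol (NExp.add (ld inPtr row) (NExp.reg 1))))

/-- The number of entries of row `r k`, including the two additional ones. -/
def wid (P : Lay) (r : ℕ → ℕ) (k : ℕ) : ℕ := P.len (r k) + 2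

theorem off_wid_le {P : Lay} (hP : P.Ok) {M : Mem} {N : ℕ} {r : ℕ → ℕ} (hr : Rows P M N r) {p : ℕ}
    (hp : p ≤ N) : off (wid P r) p ≤ P.size := by
  refine le_trans ?_ hP.m_mul_le
  have : off (wid P r) p ≤ ∑ q ∈ Finset.range p, (P.n + 2) := by
    refine Finset.sum_le_sum fun q hq => ?_
    have := hP.len_le (r q) (hr.lt q (by simp at hq; omega))
    simp only [wid]; omega
  refine this.trans ?_
  simp only [Finset.sum_const, Finset.card_range, smul_eq_mul]
  exact Nat.mul_le_mul_right _ (hp.trans hr.le)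

theorem fullItems_spec {P : Lay} (hP : P.Ok) {M : Mem} {N : ℕ} {r : ℕ → ℕ} (hS : Stat P M)
    (hr : Rows P M N r) (hbk : ∀ k < N, M.nat aBk (r k) < P.NB) :
    T P.B fullItems M (10000 * ((off (wid P r) N + 1) * (P.L + 3))) (10000 * (P.L + 3)) (fun M' =>
      Mem.EqOff [scC, scT, scD, scJ, scN, itN, itA] [] M M' ∧
      M'.nat itN 0 = off (wid P r) N ∧ (∀ p < N, M'.nat scC p = off (wid P r) p) ∧
      ∀ p < N, ∀ q < wid P r p, M'.nat itA (off (wid P r) p + q) =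
        P.leaf (P.colx (r p) q) (M.nat aBk (r p)) (r p)) := by
  have hone := hP.one_le
  have hmB := hP.m_le
  have hNm := hr.le
  have hsB := hP.size_le'
  have hpow := hP.pow_le
  have hmL := hP.hmL
  have h2L : 2 ^ (P.L + 2) = 4 * 2 ^ P.L := by rw [pow_add]; ring
  have hm0 := hP.hm
  have hrow : ∀ k < N, M.nat inPtr (r k + 1) - M.nat inPtr (r k) = P.len (r k) := by
    intro k hk
    have h := hr.lt k hk
    rw [hS.ptr _ h, hS.ptr _ h.le, hP.ptr_succ _ h]; omega
  have hNoff : 2 * N ≤ off (wid P r) N := by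
    have : ∑ q ∈ Finset.range N, 2 ≤ off (wid P r) N :=
      Finset.sum_le_sum fun q _ => by simp [wid]
    simpa [mul_comm] using this
  unfold fullItems
  refine (T.bind (T_storeN (by simp) (by simp [hr.len]; omega) (by decide)) ?_).mono
    (W := 200 + (200 + (200 * (N + 1) + (2000 * ((N + 1 + 1) * (P.L + 2 + 1)) + (200 +
      (200 * (N + 1) + (200 * (N + 1) + 200 * (1 + ∑ k ∈ Finset.range N, (P.len (r k) + 1)))))))))
    (D := 200 + (200 + (200 + (2000 * (P.L + 2 + 1) + (200 + (200 + (200 + 200)))))))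
    ?_ ?_ (fun _ h => h)
  · rintro _ rfl
    refine T.bind (T_storeN (by simp) (by simp) (by decide)) ?_
    rintro _ rfl
    refine T.bind (T_scatN N (fun _ => True) (fun p => p + 1) (wid P r)
      (by simp [hr.len]) (by omega) (by simp) (by simp)
      (fun k hk _ => by simp [hr.idx k hk, hrow k hk, wid]) (fun p hp _ => by omega)
      (fun p hp _ => ?_) (fun _ _ _ _ _ _ h => by omega) (by decide) (by decide)) ?_
    · refine le_trans ?_ ((off_wid_le hP hr (p := p + 1) hp).trans hsB)
      rw [off_succ]; omega
    rintro _ ⟨f, rfl, hf₁, hf₂⟩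
    have hf0 : f 0 = 0 := by rw [hf₂ 0 (by simp)]; simp
    have hfs : ∀ p ≤ N, ∑ q ∈ Finset.range (p + 1), f q = off (wid P r) p := by
      intro p hp
      rw [Finset.sum_range_succ', hf0, add_zero]
      refine Finset.sum_congr rfl fun q hq => ?_
      rw [Finset.mem_range] at hq
      exact hf₁ q (by omega) trivial
    refine T.bind (scan_spec (N := N + 1) (S := P.L + 2) (by simp [hr.len]) (by simp [hS.S])
      (by omega) hpow (fun p hp => ?_)) ?_
    · simp only [Mem.setNA_nat, if_true]
      rw [hfs p (by omega)]
      exact (off_wid_le hP hr (by omega)).trans hsB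
    rintro M₁ ⟨hE, hc⟩
    simp only [Mem.setNA_nat, if_true] at hc
    replace hc : ∀ p ≤ N, M₁.nat scC p = off (wid P r) p := fun p hp => by
      rw [hc p (by omega), hfs p hp]
    have hE₁ : Mem.EqOff [scC, scT, scD, scJ, scN] [] M M₁ :=
      ((((Mem.EqOff.refl M).setNA (by decide) _).setNA (by decide) _).setNA (by decide) _).trans
        (hE.mono (by decide) (by decide))
    have hS₁ := hS.eqOff hE₁
    have hr₁ := hr.eqOff hE₁
    have hb₁ : M₁.nat aBk = M.nat aBk := hE₁.1 _ (by decide)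
    have hrow₁ : ∀ k < N, M₁.nat inPtr (r k + 1) - M₁.nat inPtr (r k) = P.len (r k) := by
      rw [hE₁.1 inPtr (by decide)]; exact hrow
    have hoB : ∀ p < N, ∀ q < wid P r p, off (wid P r) p + q ≤ P.B := fun p hp q hq =>
      ((off_add_lt _ hp hq).le.trans (off_wid_le hP hr le_rfl)).trans hsB
    have hlB : ∀ c < P.n + 2, ∀ k < N, P.leaf c (M.nat aBk (r k)) (r k) ≤ P.B := fun c hc k hk =>
      (P.leaf_lt hc (hbk k hk) ((hr.lt k hk).trans_le hmL)).le.trans hsB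
    refine T.bind (T_storeN (by simp) (by
      simp only [NExp.eval, hr₁.len, hc N le_rfl]
      exact (off_wid_le hP hr le_rfl).trans hsB) (by decide)) ?_
    rintro _ rfl
    refine T.bind (T_scatN N (fun _ => True) (fun p => off (wid P r) p)
      (fun p => P.leaf P.n (M.nat aBk (r p)) (r p))
      (by simp [hr₁.len]) (by omega) (by simp) (fun k hk _ => by simp [hc k hk.le])
      (fun k hk _ => by simp [hr₁.idx k hk, hS₁.n, hS₁.NB, hS₁.pw, Lay.leaf, hb₁])
      (fun p hp _ => hoB p hp 0 (by simp [wid])) (fun p hp _ => hlB _ (by omega) p hp)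
      (fun p hp _ q hq _ h => (off_inj (wid P r) (q := 0) (q' := 0) (by simp [wid])
        (by simp [wid]) h).1) (by decide) (by decide)) ?_
    rintro _ ⟨f₀, rfl, hi₀, -⟩
    refine T.bind (T_scatN N (fun _ => True) (fun p => off (wid P r) p + 1)
      (fun p => P.leaf (P.n + 1) (M.nat aBk (r p)) (r p))
      (by simp [hr₁.len]) (by omega) (by simp) (fun k hk _ => by simp [hc k hk.le])
      (fun k hk _ => by simp [hr₁.idx k hk, hS₁.n, hS₁.NB, hS₁.pw, Lay.leaf, hb₁])
      (fun p hp _ => hoB p hp 1 (by simp [wid])) (fun p hp _ => hlB _ (by omega) p hp)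
      (fun p hp _ q hq _ h => (off_inj (wid P r) (q := 1) (q' := 1) (by simp [wid])
        (by simp [wid]) h).1) (by decide) (by decide)) ?_
    rintro _ ⟨f₁, rfl, hi₁, hk₁⟩
    refine (T_nestN N (fun k => P.len (r k)) (fun p q => off (wid P r) p + 2 + q)
      (fun p q => P.leaf (P.col (r p) q) (M.nat aBk (r p)) (r p))
      (by simp [hr₁.len]) (by omega) (fun k hk => by simp [hr₁.idx k hk, hrow₁ k hk])
      (fun k hk => (hP.len_le _ (hr.lt k hk)).trans hP.n_le)
      (fun k hk l hl => by simp [hc k hk.le])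
      (fun k hk l hl => by
        simp [hr₁.idx k hk, hS₁.ptr _ (hr.lt k hk).le, hS₁.col _ (hr.lt k hk) l hl, hS₁.NB, hS₁.pw,
          Lay.leaf, hb₁])
      (fun k hk l hl => ?_) (fun k hk l hl => hlB _ ?_ k hk) (fun k hk l hl k' hk' l' hl' h => ?_)
      (by decide) (by decide)).mono le_rfl le_rfl ?_
    · rw [add_assoc]; exact hoB k hk _ (by simp [wid]; omega)
    · have := hP.col_lt _ (hr.lt k hk) l hl; omega
    · rw [add_assoc, add_assoc] at h
      have := off_inj (wid P r) (by simp [wid]; omega) (by simp [wid]; omega) h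
      omega
    rintro _ ⟨f₂, rfl, hi₂, hk₂⟩
    refine ⟨?_, by simp [hr₁.len, hc N le_rfl], fun p hp => by simp [hc p hp.le], ?_⟩
    · exact ((((hE₁.mono (NS' := [scC, scT, scD, scJ, scN, itN, itA]) (by decide)
        (by decide)).setNA (by decide) _).setNA (by decide) _).setNA (by decide) _).setNA
        (by decide) _
    · intro p hp q hq
      simp only [Mem.setNA_nat, if_true] at hk₁ hk₂ ⊢
      match q with
      | 0 =>
        rw [hk₂, add_zero, hk₁, hi₀ p hp trivial]
        · rfl
        · intro k hk _ h
          have := off_inj (wid P r) (q := 1) (q' := 0) (by simp [wid]) (by simp [wid]) h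
          omega
        · intro k hk l hl h
          rw [add_assoc] at h
          have := off_inj (wid P r) (by simp [wid]; omega) hq h
          omega
      | 1 =>
        rw [hk₂, hi₁ p hp trivial]
        · rfl
        · intro k hk l hl h
          rw [add_assoc] at h
          have := off_inj (wid P r) (by simp [wid]; omega) hq h
          omega
      | q + 2 =>
        have := hi₂ p hp q (by simp [wid] at hq; omega)
        rw [show off (wid P r) p + (q + 2) = off (wid P r) p + 2 + q by ring, this]
        rfl
  · have h₁ : ∑ k ∈ Finset.range N, (P.len (r k) + 1) ≤ off (wid P r) N :=
      Finset.sum_le_sum fun q _ => by simp [wid]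
    generalize off (wid P r) N = K at *
    generalize ∑ k ∈ Finset.range N, (P.len (r k) + 1) = K' at *
    have h₂ : (N + 2) * (P.L + 3) ≤ (K + 1) * (P.L + 3) + (P.L + 3) := by
      have := Nat.mul_le_mul_right (P.L + 3) (show N + 2 ≤ K + 1 + 1 by omega)
      linarith
    have h₃ : P.L + 3 ≤ (K + 1) * (P.L + 3) := Nat.le_mul_of_pos_left _ (by omega)
    have h₄ : (K + 1) * 3 ≤ (K + 1) * (P.L + 3) := Nat.mul_le_mul_left _ (by omega)
    rw [show N + 1 + 1 = N + 2 by ring, show P.L + 2 + 1 = P.L + 3 by ring]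
    omega
  · omega

end PrimalGradient

namespace PrimalGradient

variable {P : Lay} {M : Mem} {N : ℕ} {r : ℕ → ℕ}

/-- The value of row `i` in the sum tree of column `c`. -/
noncomputable def leafVal (P : Lay) (M : Mem) (c i : ℕ) : ℝ :=
  if c < P.n then M.real inG i * P.A i c else
    if c = P.n then 1 else Real.cosh (P.lam * M.real inZ i)

/-- The value of row `i` in the maximum trees: a row violates its accuracy as soon as this is
greater than `exp (-Y)`. -/
noncomputable def key (P : Lay) (M : Mem) (i : ℕ) : ℝ :=
  if M.real inG i = 0 then 0 else
    Real.exp (-(M.real aYS i + P.ε * M.real inW i / |M.real inG i|))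

/-- The leaves of the sum trees are right, the rows outside `Pl` being removed. -/
def SumLeaves (P : Lay) (M : Mem) (Pl : ℕ → Prop) : Prop :=
  ∀ c < P.n + 2, ∀ b < P.NB, ∀ i < 2 ^ P.L,
    ((i < P.m ∧ Pl i ∧ M.nat aBk i = b) →
      M.real aSum (node P.L 0 (P.leaf c b i)) = leafVal P M c i) ∧
    (¬ (i < P.m ∧ Pl i ∧ M.nat aBk i = b) → M.real aSum (node P.L 0 (P.leaf c b i)) = 0)

/-- The leaves of the maximum trees are right for the rows in `Pl`, and zero in the buckets not
containing the row, the rows outside `Ql` being removed. -/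
def MaxLeaves (P : Lay) (M : Mem) (Pl Ql : ℕ → Prop) : Prop :=
  ∀ b < P.NB, ∀ i < 2 ^ P.L,
    ((i < P.m ∧ Pl i ∧ M.nat aBk i = b) →
      M.real aMax (node P.L 0 (P.leaf P.n b i)) = key P M i) ∧
    (¬ (i < P.m ∧ Ql i ∧ M.nat aBk i = b) → M.real aMax (node P.L 0 (P.leaf P.n b i)) = 0)

theorem SumLeaves.congr {M' : Mem} {Pl : ℕ → Prop} (h : SumLeaves P M Pl)
    (hs : M'.real aSum = M.real aSum) (hb : ∀ i < P.m, Pl i → M'.nat aBk i = M.nat aBk i)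
    (hg : ∀ i < P.m, Pl i → M'.real inG i = M.real inG i)
    (hz : ∀ i < P.m, Pl i → M'.real inZ i = M.real inZ i) : SumLeaves P M' Pl := by
  intro c hc b hbN i hi
  have hiff : (i < P.m ∧ Pl i ∧ M'.nat aBk i = b) ↔ (i < P.m ∧ Pl i ∧ M.nat aBk i = b) :=
    and_congr_right fun him => and_congr_right fun hp => by rw [hb i him hp]
  rw [hiff, hs]
  refine ⟨fun h' => ?_, (h c hc b hbN i hi).2⟩
  rw [(h c hc b hbN i hi).1 h', leafVal, leafVal, hg i h'.1 h'.2.1, hz i h'.1 h'.2.1]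

theorem MaxLeaves.congr {M' : Mem} {Pl Ql : ℕ → Prop} (h : MaxLeaves P M Pl Ql)
    (hPQ : ∀ i, Pl i → Ql i)
    (hs : M'.real aMax = M.real aMax) (hb : ∀ i < P.m, Ql i → M'.nat aBk i = M.nat aBk i)
    (hg : ∀ i < P.m, Pl i → M'.real inG i = M.real inG i)
    (hw : ∀ i < P.m, Pl i → M'.real inW i = M.real inW i)
    (hy : ∀ i < P.m, Pl i → M'.real aYS i = M.real aYS i) : MaxLeaves P M' Pl Ql := by
  intro b hbN i hi
  have hiff : (i < P.m ∧ Ql i ∧ M'.nat aBk i = b) ↔ (i < P.m ∧ Ql i ∧ M.nat aBk i = b) :=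
    and_congr_right fun him => and_congr_right fun hp => by rw [hb i him hp]
  rw [hiff, hs]
  refine ⟨fun h' => ?_, (h b hbN i hi).2⟩
  have hbi := h'.2.2
  rw [hb i h'.1 (hPQ i h'.2.1)] at hbi
  rw [(h b hbN i hi).1 ⟨h'.1, h'.2.1, hbi⟩, key, key, hg i h'.1 h'.2.1, hw i h'.1 h'.2.1,
    hy i h'.1 h'.2.1]

theorem MaxLeaves.mono {Pl Ql Pl' : ℕ → Prop} (h : MaxLeaves P M Pl Ql)
    (hP : ∀ i, Pl' i → Pl i) : MaxLeaves P M Pl' Ql := fun b hb i hi =>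
  ⟨fun h' => (h b hb i hi).1 ⟨h'.1, hP i h'.2.1, h'.2.2⟩, (h b hb i hi).2⟩

/-- The key of the `k`-th row of the list. -/
abbrev keyE : RExp :=
  RExp.exp (RExp.sub (RExp.ofNat (cn 0)) (RExp.add (rl aYS row)
    (RExp.div (RExp.mul (rs inScal) (rl inW row))
      (RExp.sqrt (RExp.mul (rl inG row) (rl inG row))))))

/-- `cosh (λ z)` for the `k`-th row of the list. -/
abbrev coshE : RExp :=
  RExp.div (RExp.add (RExp.exp (RExp.mul (rl inScal (cn 1)) (rl inZ row)))
    (RExp.exp (RExp.sub (RExp.ofNat (cn 0)) (RExp.mul (rl inScal (cn 1)) (rl inZ row)))))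
    (RExp.ofNat (cn 2))

abbrev gNe : BExp := BExp.not (BExp.realEq (rl inG row) (RExp.ofNat (cn 0)))

/-- The values of all entries of the rows of the list. -/
def fullVals : Cmd :=
  scatR (sc inLen) tt itM (ld scC ix) (RExp.ofNat (cn 0)) ;;
  scatR (sc inLen) gNe itM (ld scC ix) keyE ;;
  scatR (sc inLen) tt itS (ld scC ix) (RExp.ofNat (cn 1)) ;;
  scatR (sc inLen) tt itS (NExp.add (ld scC ix) (cn 1)) coshE ;;
  nestR (sc inLen) rowLen itS (NExp.add (NExp.add (ld scC ix) (cn 2)) (NExp.reg 1))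
    (RExp.mul (rl inG row) (rl inVal (NExp.add (ld inPtr row) (NExp.reg 1))))

theorem eval_keyE (hS : Stat P M) {k i : ℕ} (hk : M.nat inIdx k = i) (hg : M.real inG i ≠ 0) :
    keyE.eval (st1 M k) = key P M i := by
  simp [key, hk, hg, hS.eps, Real.sqrt_mul_self_eq_abs]

theorem fullVals_spec (hP : P.Ok) (hS : Stat P M) (hr : Rows P M N r)
    (hC : ∀ p < N, M.nat scC p = off (wid P r) p) :
    T P.B fullVals M (2000 * (off (wid P r) N + 1)) 2000 (fun M' =>
      Mem.EqOff [] [itS, itM] M M' ∧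
      (∀ p < N, ∀ q < wid P r p,
        M'.real itS (off (wid P r) p + q) = leafVal P M (P.colx (r p) q) (r p)) ∧
      ∀ p < N, M'.real itM (off (wid P r) p) = key P M (r p)) := by
  have hmB := hP.m_le
  have hNm := hr.le
  have hsB := hP.size_le'
  have hrow : ∀ k < N, M.nat inPtr (r k + 1) - M.nat inPtr (r k) = P.len (r k) := by
    intro k hk
    have h := hr.lt k hk
    rw [hS.ptr _ h, hS.ptr _ h.le, hP.ptr_succ _ h]; omega
  have hNoff : 2 * N ≤ off (wid P r) N := by
    have : ∑ q ∈ Finset.range N, 2 ≤ off (wid P r) N :=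
      Finset.sum_le_sum fun q _ => by simp [wid]
    simpa [mul_comm] using this
  have hoB : ∀ p < N, ∀ q < wid P r p, off (wid P r) p + q ≤ P.B := fun p hp q hq =>
    ((off_add_lt _ hp hq).le.trans (off_wid_le hP hr le_rfl)).trans hsB
  have h0 : ∀ p, 0 < wid P r p := fun p => by simp [wid]
  have h1 : ∀ p, 1 < wid P r p := fun p => by simp [wid]
  have hinj0 : ∀ k < N, ∀ l < N, off (wid P r) k = off (wid P r) l → k = l :=
    fun k _ l _ h => (off_inj (wid P r) (h0 k) (h0 l) (by simpa using h)).1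
  unfold fullVals
  refine (T.bind (T_scatR N (fun _ => True) (off (wid P r)) (fun _ => 0) (by simp [hr.len])
    (by omega) (by simp) (fun k hk _ => by simp [hC k hk]) (by simp)
    (fun k hk _ => hoB k hk 0 (h0 k)) (fun k hk _ l hl _ h => hinj0 k hk l hl h)
    (by decide) (by decide)) ?_).mono
    (W := 200 * (N + 1) + (200 * (N + 1) + (200 * (N + 1) + (200 * (N + 1) +
      200 * (1 + ∑ k ∈ Finset.range N, (P.len (r k) + 1))))))
    (D := 200 + (200 + (200 + (200 + 200)))) ?_ (by omega) (fun _ h => h)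
  · rintro _ ⟨f₁, rfl, hf₁, -⟩
    refine T.bind (T_scatR N (fun k => M.real inG (r k) ≠ 0) (off (wid P r))
      (fun k => key P M (r k)) (by simp [hr.len])
      (by omega) (fun k hk => by simp [hr.idx k hk]) (fun k hk _ => by simp [hC k hk])
      (fun k hk hg => ?_)
      (fun k hk _ => hoB k hk 0 (h0 k)) (fun k hk _ l hl _ h => hinj0 k hk l hl h)
      (by decide) (by decide)) ?_
    · exact eval_keyE (hS.eqOff ((Mem.EqOff.refl M).setRA (NS := []) (RS := [itM])
        (by decide) f₁)) (hr.idx k hk) hg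
    rintro _ ⟨f₂, rfl, hf₂, hf₂'⟩
    simp only [Mem.setRA_real, if_true] at hf₂'
    have hM : ∀ p < N, f₂ (off (wid P r) p) = key P M (r p) := by
      intro p hp
      by_cases hg : M.real inG (r p) = 0
      · rw [hf₂', hf₁ p hp trivial, key, if_pos hg]
        intro k hk hgk h
        rw [hinj0 k hk p hp h] at hgk
        exact hgk hg
      · exact hf₂ p hp hg
    refine T.bind (T_scatR N (fun _ => True) (off (wid P r)) (fun _ => 1) (by simp [hr.len])
      (by omega) (by simp) (fun k hk _ => by simp [hC k hk]) (by simp)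
      (fun k hk _ => hoB k hk 0 (h0 k)) (fun k hk _ l hl _ h => hinj0 k hk l hl h)
      (by decide) (by decide)) ?_
    rintro _ ⟨f₃, rfl, hf₃, -⟩
    refine T.bind (T_scatR N (fun _ => True) (fun k => off (wid P r) k + 1)
      (fun k => Real.cosh (P.lam * M.real inZ (r k))) (by simp [hr.len])
      (by omega) (by simp) (fun k hk _ => by simp [hC k hk])
      (fun k hk _ => by simp [hr.idx k hk, hS.lam, Real.cosh_eq])
      (fun k hk _ => hoB k hk 1 (h1 k))
      (fun k hk _ l hl _ h => (off_inj (wid P r) (h1 k) (h1 l) h).1)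
      (by decide) (by decide)) ?_
    rintro _ ⟨f₄, rfl, hf₄, hf₄'⟩
    simp only [Mem.setRA_real, if_true] at hf₄'
    refine (T_nestR N (fun k => P.len (r k)) (fun p q => off (wid P r) p + 2 + q)
      (fun p q => M.real inG (r p) * P.val (r p) q)
      (by simp [hr.len]) (by omega) (fun k hk => by simp [hr.idx k hk, hrow k hk])
      (fun k hk => (hP.len_le _ (hr.lt k hk)).trans hP.n_le)
      (fun k hk l hl => by simp [hC k hk])
      (fun k hk l hl => by
        simp [hr.idx k hk, hS.ptr _ (hr.lt k hk).le, hS.val _ (hr.lt k hk) l hl])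
      (fun k hk l hl => ?_) (fun k hk l hl k' hk' l' hl' h => ?_)
      (by decide) (by decide)).mono le_rfl le_rfl ?_
    · rw [add_assoc]; exact hoB k hk _ (by simp [wid]; omega)
    · rw [add_assoc, add_assoc] at h
      have := off_inj (wid P r) (by simp [wid]; omega) (by simp [wid]; omega) h
      omega
    rintro _ ⟨f₅, rfl, hf₅, hf₅'⟩
    simp only [Mem.setRA_real, if_true] at hf₅'
    refine ⟨((((((Mem.EqOff.refl M).setRA (by decide) _).setRA (by decide) _).setRA
      (by decide) _).setRA (by decide) _).setRA (by decide) _), ?_, ?_⟩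
    · intro p hp q hq
      simp only [Mem.setRA_real, if_true]
      match q with
      | 0 =>
        rw [hf₅', hf₄', add_zero, hf₃ p hp trivial]
        · simp [Lay.colx, leafVal]
        · intro k hk _ h
          have := off_inj (wid P r) (h1 k) (h0 p) h
          omega
        · intro k hk l hl h
          rw [add_assoc] at h
          have := off_inj (wid P r) (by simp [wid]; omega) hq h
          omega
      | 1 =>
        rw [hf₅', hf₄ p hp trivial]
        · simp [Lay.colx, leafVal]
        · intro k hk l hl h
          rw [add_assoc] at h
          have := off_inj (wid P r) (by simp [wid]; omega) hq h
          omega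
      | q + 2 =>
        have hq' : q < P.len (r p) := by simp [wid] at hq; omega
        rw [show off (wid P r) p + (q + 2) = off (wid P r) p + 2 + q by ring, hf₅ p hp q hq',
          hP.val_eq _ (hr.lt p hp) q hq']
        simp [Lay.colx, leafVal, hP.col_lt _ (hr.lt p hp) q hq']
    · intro p hp
      simpa using hM p hp
  · have h₁ : ∑ k ∈ Finset.range N, (P.len (r k) + 1) ≤ off (wid P r) N :=
      Finset.sum_le_sum fun q _ => by simp [wid]
    omega

/-- The values zero. -/
def zeroVals : Cmd :=
  mapR (sc itN) itS (RExp.ofNat (cn 0)) ;; mapR (sc itN) itM (RExp.ofNat (cn 0))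

/-- `propagate` on the items of all entries of the rows of the list. -/
theorem propagate_full (hP : P.Ok) (hS : Stat P M) (hr : Rows P M N r)
    (hbk : ∀ k < N, M.nat aBk (r k) < P.NB) (hN : M.nat itN 0 = off (wid P r) N)
    (ha : ∀ p < N, ∀ q < wid P r p, M.nat itA (off (wid P r) p + q) =
      P.leaf (P.colx (r p) q) (M.nat aBk (r p)) (r p)) (hC : Cons P.L M) :
    T P.B propagate M (4000 * ((off (wid P r) N + 1) * (P.L + 1))) (4000 * (P.L + 1)) (fun M' =>
      Mem.EqOff [pOwn, pAct, pAct', pP, pL] [aSum, aMax, pS, pM] M M' ∧ Cons P.L M' ∧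
      (∀ p < N, ∀ q < wid P r p,
        M'.real aSum (node P.L 0 (P.leaf (P.colx (r p) q) (M.nat aBk (r p)) (r p))) =
          M.real itS (off (wid P r) p + q) ∧
        M'.real aMax (node P.L 0 (P.leaf (P.colx (r p) q) (M.nat aBk (r p)) (r p))) =
          M.real itM (off (wid P r) p + q)) ∧
      ∀ c b i, b < P.NB → i < 2 ^ P.L →
        (∀ p < N, ∀ q < wid P r p, ¬ (P.colx i q = c ∧ M.nat aBk i = b ∧ r p = i)) →
        M'.real aSum (node P.L 0 (P.leaf c b i)) = M.real aSum (node P.L 0 (P.leaf c b i)) ∧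
        M'.real aMax (node P.L 0 (P.leaf c b i)) = M.real aMax (node P.L 0 (P.leaf c b i))) := by
  have hlt : ∀ p < N, r p < 2 ^ P.L := fun p hp => (hr.lt p hp).trans_le hP.hmL
  refine (propagate_spec (A := P.size) (a := M.nat itA) hN hS.L (fun _ _ => rfl) ?_ ?_ hP.size_le
    ((off_wid_le hP hr le_rfl).trans hP.size_le') hP.pow_le' hC).mono le_rfl le_rfl ?_
  · intro k hk l hl h
    obtain ⟨p, hp, q, hq, rfl⟩ := exists_off _ hk
    obtain ⟨p', hp', q', hq', rfl⟩ := exists_off _ hl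
    rw [ha p hp q hq, ha p' hp' q' hq'] at h
    obtain ⟨h₁, -, h₂⟩ := P.leaf_inj (hbk p hp) (hbk p' hp') (hlt p hp) (hlt p' hp') h
    obtain rfl := hr.inj p hp p' hp' h₂
    rw [hP.colx_inj (hr.lt p hp) hq hq' h₁]
  · intro k hk
    obtain ⟨p, hp, q, hq, rfl⟩ := exists_off _ hk
    rw [ha p hp q hq]
    exact (P.leaf_lt (hP.colx_lt (hr.lt p hp) hq) (hbk p hp) (hlt p hp)).le
  · rintro M' ⟨hE, hC', h₁, h₂⟩
    refine ⟨hE, hC', fun p hp q hq => ?_, fun c b i hb hi h => h₂ _ fun k hk hk' => ?_⟩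
    · rw [← ha p hp q hq]
      exact h₁ _ (off_add_lt _ hp hq)
    · obtain ⟨p, hp, q, hq, rfl⟩ := exists_off _ hk
      rw [ha p hp q hq] at hk'
      obtain ⟨e₁, e₂, e₃⟩ := P.leaf_inj (hbk p hp) hb (hlt p hp) hi hk'
      refine h p hp q hq ⟨?_, ?_, e₃⟩
      · rw [← e₃]; exact e₁
      · rw [← e₃]; exact e₂

/-- Remove the rows of the list from all trees. -/
def removeRows : Cmd := fullItems ;; zeroVals ;; propagate

/-- Insert the rows of the list into all trees. -/
def insertRows : Cmd := fullItems ;; fullVals ;; propagate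

/-- The row `i` is in the list. -/
def InRows (N : ℕ) (r : ℕ → ℕ) (i : ℕ) : Prop := ∃ k < N, r k = i

abbrev treeN : List ℕ := [scC, scT, scD, scJ, scN, itN, itA, pOwn, pAct, pAct', pP, pL]
abbrev treeR : List ℕ := [aSum, aMax, pS, pM, itS, itM]

theorem removeRows_spec (hP : P.Ok) (hS : Stat P M) (hr : Rows P M N r)
    (hbk : ∀ i < P.m, M.nat aBk i < P.NB) (hC : Cons P.L M)
    (hSL : SumLeaves P M fun _ => True)
    (hML : MaxLeaves P M (fun i => ¬ InRows N r i) fun _ => True) :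
    T P.B removeRows M (20000 * ((off (wid P r) N + 1) * (P.L + 3))) (20000 * (P.L + 3))
      (fun M' => Mem.EqOff treeN treeR M M' ∧ Cons P.L M' ∧
        SumLeaves P M' (fun i => ¬ InRows N r i) ∧
        MaxLeaves P M' (fun i => ¬ InRows N r i) (fun i => ¬ InRows N r i)) := by
  have hbk' : ∀ k < N, M.nat aBk (r k) < P.NB := fun k hk => hbk _ (hr.lt k hk)
  have hoff := (off_wid_le hP hr le_rfl).trans hP.size_le'
  unfold removeRows
  refine (T.bind (fullItems_spec hP hS hr hbk') ?_).mono
    (W := 10000 * ((off (wid P r) N + 1) * (P.L + 3)) + (200 * (off (wid P r) N + 1) +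
      200 * (off (wid P r) N + 1) + 4000 * ((off (wid P r) N + 1) * (P.L + 1))))
    (D := 10000 * (P.L + 3) + (200 + 200 + 4000 * (P.L + 1))) ?_ (by omega) (fun _ h => h)
  · rintro M₁ ⟨hE₁, hN₁, -, ha₁⟩
    have hz : T P.B zeroVals M₁ (200 * (off (wid P r) N + 1) + 200 * (off (wid P r) N + 1))
        (200 + 200) (fun M' => Mem.EqOff [] [itS, itM] M₁ M' ∧
          (∀ k < off (wid P r) N, M'.real itS k = 0 ∧ M'.real itM k = 0)) := by
      refine T.bind (T_mapR (off (wid P r) N) (fun _ => 0) (by simp [hN₁]) hoff (by simp)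
        (by decide) (by decide)) ?_
      rintro _ rfl
      refine (T_mapR (off (wid P r) N) (fun _ => 0) (by simp [hN₁]) hoff (by simp)
        (by decide) (by decide)).mono le_rfl le_rfl ?_
      rintro _ rfl
      refine ⟨((Mem.EqOff.refl _).setRA (by decide) _).setRA (by decide) _, fun k hk => ?_⟩
      simp [hk]
    refine T.bind hz ?_
    rintro M₂ ⟨hE₂, hz⟩
    have hE₁₂ : Mem.EqOff treeN treeR M M₂ :=
      (hE₁.mono (by decide) (by decide)).trans (hE₂.mono (by decide) (by decide))
    have hEs : ∀ M', M'.real aSum = M.real aSum → M'.real aMax = M.real aMax → Cons P.L M' := by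
      intro M' h h' l hl u
      have := hC l hl u
      simpa only [ConsAt, h, h'] using this
    have e₂S : M₂.real aSum = M.real aSum := (hE₂.2 _ (by decide)).trans (hE₁.2 _ (by decide))
    have e₂M : M₂.real aMax = M.real aMax := (hE₂.2 _ (by decide)).trans (hE₁.2 _ (by decide))
    have e₂b : M₂.nat aBk = M.nat aBk := hE₁₂.1 _ (by decide)
    refine (propagate_full hP ((hS.eqOff hE₁).eqOff hE₂) ((hr.eqOff hE₁).eqOff hE₂)
      (by rw [e₂b]; exact hbk') (by rw [hE₂.1 itN (by decide), hN₁])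
      (by rw [e₂b, hE₂.1 itA (by decide)]; exact ha₁) (hEs M₂ e₂S e₂M)).mono le_rfl le_rfl ?_
    rintro M₃ ⟨hE₃, hC₃, hw, hk⟩
    rw [e₂b, e₂S, e₂M] at hk
    rw [e₂b] at hw
    have e₃ : ∀ a ∈ [inG, inZ, inW, aYS], M₃.real a = M.real a := by
      intro a ha
      fin_cases ha <;> exact (hE₃.2 _ (by decide)).trans (hE₁₂.2 _ (by decide))
    have e₃b : M₃.nat aBk = M.nat aBk := (hE₃.1 _ (by decide)).trans e₂b
    refine ⟨hE₁₂.trans (hE₃.mono (by decide) (by decide)), hC₃, ?_, ?_⟩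
    · intro c hc b hb i hi
      rw [e₃b, leafVal, e₃ inG (by simp), e₃ inZ (by simp)]
      obtain ⟨h₁, h₂⟩ := hSL c hc b hb i hi
      by_cases hin : ∃ p < N, ∃ q < wid P r p, P.colx i q = c ∧ M.nat aBk i = b ∧ r p = i
      · obtain ⟨p, hp, q, hq, rfl, rfl, rfl⟩ := hin
        refine ⟨fun h => absurd ⟨p, hp, rfl⟩ h.2.1, fun _ => ?_⟩
        rw [(hw p hp q hq).1]
        exact (hz _ (off_add_lt _ hp hq)).1
      · push Not at hin
        rw [(hk c b i hb hi fun p hp q hq h => hin p hp q hq h.1 h.2.1 h.2.2).1]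
        refine ⟨fun h => h₁ ⟨h.1, trivial, h.2.2⟩, fun h => ?_⟩
        by_cases him : i < P.m ∧ M.nat aBk i = b
        · have hir : InRows N r i := by
            by_contra hir
            exact h ⟨him.1, hir, him.2⟩
          obtain ⟨p, hp, rfl⟩ := hir
          rw [h₁ ⟨him.1, trivial, him.2⟩]
          have hq0 := hin p hp 0 (by simp [wid])
          have hq1 := hin p hp 1 (by simp [wid])
          simp only [Lay.colx] at hq0 hq1
          have hcn : c < P.n := by
            rcases Nat.lt_trichotomy c P.n with h | h | h
            · exact h
            · exact absurd rfl (hq0 h.symm him.2)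
            · exact absurd rfl (hq1 (by omega) him.2)
          rw [leafVal, if_pos hcn, hP.A_eq_zero _ him.1 c hcn, mul_zero]
          intro q hq hqc
          exact hin p hp (q + 2) (by simp [wid]; omega) hqc him.2 rfl
        · exact h₂ fun h => him ⟨h.1, h.2.2⟩
    · intro b hb i hi
      rw [e₃b, key, e₃ inG (by simp), e₃ inW (by simp), e₃ aYS (by simp)]
      obtain ⟨h₁, h₂⟩ := hML b hb i hi
      by_cases hin : ∃ p < N, ∃ q < wid P r p, P.colx i q = P.n ∧ M.nat aBk i = b ∧ r p = i
      · obtain ⟨p, hp, q, hq, hqc, rfl, rfl⟩ := hin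
        refine ⟨fun h => absurd ⟨p, hp, rfl⟩ h.2.1, fun _ => ?_⟩
        rw [← hqc, (hw p hp q hq).2]
        exact (hz _ (off_add_lt _ hp hq)).2
      · push Not at hin
        rw [(hk P.n b i hb hi fun p hp q hq h => hin p hp q hq h.1 h.2.1 h.2.2).2]
        refine ⟨h₁, fun h => h₂ fun h' => ?_⟩
        have hir : InRows N r i := by
          by_contra hir
          exact h ⟨h'.1, hir, h'.2.2⟩
        obtain ⟨p, hp, hpi⟩ := hir
        exact hin p hp 0 (by simp [wid]) rfl h'.2.2 hpi
  · generalize off (wid P r) N = K at *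
    nlinarith [Nat.zero_le (K * P.L)]

theorem insertRows_spec (hP : P.Ok) (hS : Stat P M) (hr : Rows P M N r)
    (hbk : ∀ i < P.m, M.nat aBk i < P.NB) (hC : Cons P.L M)
    (hSL : SumLeaves P M fun i => ¬ InRows N r i)
    (hML : MaxLeaves P M (fun i => ¬ InRows N r i) (fun i => ¬ InRows N r i)) :
    T P.B insertRows M (20000 * ((off (wid P r) N + 1) * (P.L + 3))) (20000 * (P.L + 3))
      (fun M' => Mem.EqOff treeN treeR M M' ∧ Cons P.L M' ∧
        SumLeaves P M' (fun _ => True) ∧ MaxLeaves P M' (fun _ => True) (fun _ => True)) := by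
  have hbk' : ∀ k < N, M.nat aBk (r k) < P.NB := fun k hk => hbk _ (hr.lt k hk)
  unfold insertRows
  refine (T.bind (fullItems_spec hP hS hr hbk') ?_).mono
    (W := 10000 * ((off (wid P r) N + 1) * (P.L + 3)) + (2000 * (off (wid P r) N + 1) +
      4000 * ((off (wid P r) N + 1) * (P.L + 1))))
    (D := 10000 * (P.L + 3) + (2000 + 4000 * (P.L + 1))) ?_ (by omega) (fun _ h => h)
  · rintro M₁ ⟨hE₁, hN₁, hc₁, ha₁⟩
    refine T.bind (fullVals_spec hP (hS.eqOff hE₁) (hr.eqOff hE₁) hc₁) ?_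
    rintro M₂ ⟨hE₂, hv, hkey⟩
    have hE₁₂ : Mem.EqOff treeN treeR M M₂ :=
      (hE₁.mono (by decide) (by decide)).trans (hE₂.mono (by decide) (by decide))
    have e₂S : M₂.real aSum = M.real aSum := (hE₂.2 _ (by decide)).trans (hE₁.2 _ (by decide))
    have e₂M : M₂.real aMax = M.real aMax := (hE₂.2 _ (by decide)).trans (hE₁.2 _ (by decide))
    have e₂b : M₂.nat aBk = M.nat aBk := hE₁₂.1 _ (by decide)
    have hC₂ : Cons P.L M₂ := by
      intro l hl u
      have := hC l hl u
      simpa only [ConsAt, e₂S, e₂M] using this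
    refine (propagate_full hP ((hS.eqOff hE₁).eqOff hE₂) ((hr.eqOff hE₁).eqOff hE₂)
      (by rw [e₂b]; exact hbk') (by rw [hE₂.1 itN (by decide), hN₁])
      (by rw [e₂b, hE₂.1 itA (by decide)]; exact ha₁) hC₂).mono le_rfl le_rfl ?_
    rintro M₃ ⟨hE₃, hC₃, hw, hk⟩
    rw [e₂b, e₂S, e₂M] at hk
    rw [e₂b] at hw
    have e₃ : ∀ a ∈ [inG, inZ, inW, aYS], M₃.real a = M₁.real a := by
      intro a ha
      fin_cases ha <;> exact (hE₃.2 _ (by decide)).trans (hE₂.2 _ (by decide))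
    have e₁ : ∀ a ∈ [inG, inZ, inW, aYS], M₁.real a = M.real a := by
      intro a ha
      fin_cases ha <;> exact hE₁.2 _ (by decide)
    have e₃b : M₃.nat aBk = M.nat aBk := (hE₃.1 _ (by decide)).trans e₂b
    refine ⟨hE₁₂.trans (hE₃.mono (by decide) (by decide)), hC₃, ?_, ?_⟩
    · intro c hc b hb i hi
      obtain ⟨h₁, h₂⟩ := hSL c hc b hb i hi
      by_cases hin : ∃ p < N, ∃ q < wid P r p, P.colx i q = c ∧ M.nat aBk i = b ∧ r p = i
      · obtain ⟨p, hp, q, hq, rfl, rfl, rfl⟩ := hin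
        rw [e₃b]
        refine ⟨fun h => ?_, fun h => absurd ⟨hr.lt p hp, trivial, rfl⟩ h⟩
        rw [(hw p hp q hq).1, hv p hp q hq, leafVal, leafVal, e₃ inG (by simp), e₃ inZ (by simp)]
      · push Not at hin
        rw [e₃b, leafVal, e₃ inG (by simp), e₃ inZ (by simp), e₁ inG (by simp), e₁ inZ (by simp),
          (hk c b i hb hi fun p hp q hq h => hin p hp q hq h.1 h.2.1 h.2.2).1]
        refine ⟨fun h => ?_, fun h => h₂ fun h' => h ⟨h'.1, trivial, h'.2.2⟩⟩
        by_cases hir : InRows N r i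
        · obtain ⟨p, hp, rfl⟩ := hir
          have hq0 := hin p hp 0 (by simp [wid])
          have hq1 := hin p hp 1 (by simp [wid])
          simp only [Lay.colx] at hq0 hq1
          have hcn : c < P.n := by
            rcases Nat.lt_trichotomy c P.n with h' | h' | h'
            · exact h'
            · exact absurd rfl (hq0 h'.symm h.2.2)
            · exact absurd rfl (hq1 (by omega) h.2.2)
          rw [h₂ fun h' => h'.2.1 ⟨p, hp, rfl⟩, if_pos hcn, hP.A_eq_zero _ h.1 c hcn, mul_zero]
          intro q hq hqc
          exact hin p hp (q + 2) (by simp [wid]; omega) hqc h.2.2 rfl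
        · rw [h₁ ⟨h.1, hir, h.2.2⟩, leafVal]
    · intro b hb i hi
      obtain ⟨h₁, h₂⟩ := hML b hb i hi
      by_cases hin : M.nat aBk i = b ∧ InRows N r i
      · obtain ⟨rfl, p, hp, rfl⟩ := hin
        rw [e₃b]
        refine ⟨fun h => ?_, fun h => absurd ⟨hr.lt p hp, trivial, rfl⟩ h⟩
        have := (hw p hp 0 (by simp [wid])).2
        rw [add_zero, hkey p hp] at this
        simp only [Lay.colx] at this
        rw [this, key, key, e₃ inG (by simp), e₃ inW (by simp), e₃ aYS (by simp)]
      · rw [e₃b, key, e₃ inG (by simp), e₃ inW (by simp), e₃ aYS (by simp), e₁ inG (by simp),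
          e₁ inW (by simp), e₁ aYS (by simp),
          (hk P.n b i hb hi fun p hp q hq h => hin ⟨h.2.1, p, hp, h.2.2⟩).2]
        refine ⟨fun h => ?_, fun h => h₂ fun h' => h ⟨h'.1, trivial, h'.2.2⟩⟩
        have hir : ¬ InRows N r i := fun hir => hin ⟨h.2.2, hir⟩
        rw [h₁ ⟨h.1, hir, h.2.2⟩, key]
  · generalize off (wid P r) N = K at *
    nlinarith [Nat.zero_le (K * P.L)]

/-- Recompute the keys of the rows of the list. -/
def keyRows : Cmd :=
  Cmd.storeN itN (cn 0) (sc inLen) ;;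
  mapN (sc inLen) itA (leafE colN) ;;
  mapR (sc inLen) itS (RExp.ofNat (cn 1)) ;;
  mapR (sc inLen) itM (RExp.ofNat (cn 0)) ;;
  scatR (sc inLen) gNe itM ix keyE ;;
  propagate

theorem keyRows_spec (hP : P.Ok) (hS : Stat P M) (hr : Rows P M N r)
    (hbk : ∀ i < P.m, M.nat aBk i < P.NB) (hC : Cons P.L M)
    (hSL : SumLeaves P M fun _ => True)
    (hML : MaxLeaves P M (fun i => ¬ InRows N r i) fun _ => True) :
    T P.B keyRows M (10000 * ((N + 1) * (P.L + 3))) (10000 * (P.L + 3))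
      (fun M' => Mem.EqOff treeN treeR M M' ∧ Cons P.L M' ∧
        SumLeaves P M' (fun _ => True) ∧ MaxLeaves P M' (fun _ => True) (fun _ => True)) := by
  have hbk' : ∀ k < N, M.nat aBk (r k) < P.NB := fun k hk => hbk _ (hr.lt k hk)
  have hmB := hP.m_le
  have hNm := hr.le
  have hNB : N ≤ P.B := by omega
  have hlt : ∀ p < N, r p < 2 ^ P.L := fun p hp => (hr.lt p hp).trans_le hP.hmL
  have hle : ∀ p < N, P.leaf P.n (M.nat aBk (r p)) (r p) ≤ P.size := fun p hp =>
    (P.leaf_lt (by omega) (hbk' p hp) (hlt p hp)).le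
  unfold keyRows
  refine (T.bind (T_storeN (by simp) (by simp [hr.len]; omega) (by decide)) ?_).mono
    (W := 200 + (200 * (N + 1) + (200 * (N + 1) + (200 * (N + 1) + (200 * (N + 1) +
      4000 * ((N + 1) * (P.L + 1)))))))
    (D := 200 + (200 + (200 + (200 + (200 + 4000 * (P.L + 1)))))) ?_ (by omega) (fun _ h => h)
  · rintro _ rfl
    refine T.bind (T_mapN N (fun k => P.leaf P.n (M.nat aBk (r k)) (r k)) (by simp [hr.len])
      hNB (fun k hk => by simp [hr.idx k hk, hS.n, hS.NB, hS.pw, Lay.leaf])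
      (fun k hk => (hle k hk).trans hP.size_le') (by decide) (by decide)) ?_
    rintro _ rfl
    refine T.bind (T_mapR N (fun _ => 1) (by simp [hr.len]) hNB (by simp) (by decide)
      (by decide)) ?_
    rintro _ rfl
    refine T.bind (T_mapR N (fun _ => 0) (by simp [hr.len]) hNB (by simp) (by decide)
      (by decide)) ?_
    rintro _ rfl
    refine T.bind (T_scatR N (fun k => M.real inG (r k) ≠ 0) (fun k => k)
      (fun k => key P M (r k)) (by simp [hr.len])
      hNB (fun k hk => by simp [hr.idx k hk]) (by simp)
      (fun k hk hg => ?_) (fun k hk _ => by omega) (fun k hk _ l hl _ h => h)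
      (by decide) (by decide)) ?_
    · exact eval_keyE (hS.eqOff (((((Mem.EqOff.refl M).setNA (NS := [itN, itA]) (RS := [itM, itS])
        (by decide) _).setNA (by decide) _).setRA (by decide) _).setRA (by decide) _))
        (by simp [hr.idx k hk]) (by simpa using hg)
    rintro _ ⟨f, rfl, hf, hf'⟩
    simp only [Mem.setRA_real, if_true] at hf'
    have hM : ∀ p < N, f p = key P M (r p) := by
      intro p hp
      by_cases hg : M.real inG (r p) = 0
      · rw [hf', if_pos hp, key, if_pos hg]
        rintro k hk hgk rfl
        exact hgk hg
      · exact hf p hp hg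
    refine (propagate_spec (N := N) (L := P.L) (A := P.size)
      (a := fun k => P.leaf P.n (M.nat aBk (r k)) (r k)) (by simp [hr.len]) (by simp [hS.L])
      (fun k hk => by simp [hk]) (fun k hk l hl h => ?_) hle hP.size_le hNB
      hP.pow_le' ?_).mono le_rfl le_rfl ?_
    · exact hr.inj k hk l hl (P.leaf_inj (hbk' k hk) (hbk' l hl) (hlt k hk) (hlt l hl) h).2.2
    · intro l hl u
      simpa [ConsAt] using hC l hl u
    rintro M₃ ⟨hE₃, hC₃, hw, hk⟩
    simp only [Mem.setRA_real, Mem.setNA_real, show (aSum = itM) = False by simp,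
      show (aSum = itS) = False by simp, show (aMax = itM) = False by simp,
      show (aMax = itS) = False by simp, show (itS = itM) = False by simp, if_false, if_true]
      at hw hk
    have hE : Mem.EqOff treeN treeR M M₃ := by
      refine (((((Mem.EqOff.refl M).setNA (by decide) _).setNA (by decide) _).setRA
        (by decide) _).setRA (by decide) _).setRA (by decide) _ |>.trans
        (hE₃.mono (by decide) (by decide))
    have e₃ : ∀ a ∈ [inG, inZ, inW, aYS], M₃.real a = M.real a := by
      intro a ha
      fin_cases ha <;> exact hE.2 _ (by decide)
    have e₃b : M₃.nat aBk = M.nat aBk := hE.1 _ (by decide)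
    refine ⟨hE, hC₃, ?_, ?_⟩
    · intro c hc b hb i hi
      obtain ⟨h₁, h₂⟩ := hSL c hc b hb i hi
      rw [e₃b, leafVal, e₃ inG (by simp), e₃ inZ (by simp)]
      by_cases hin : ∃ p < N, P.leaf P.n (M.nat aBk (r p)) (r p) = P.leaf c b i
      · obtain ⟨p, hp, he⟩ := hin
        obtain ⟨rfl, rfl, rfl⟩ := P.leaf_inj (hbk' p hp) hb (hlt p hp) hi he
        rw [(hw p hp).1]
        exact ⟨fun _ => by simp [hp], fun h => absurd ⟨hr.lt p hp, trivial, rfl⟩ h⟩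
      · push Not at hin
        rw [(hk _ hin).1]
        exact ⟨h₁, h₂⟩
    · intro b hb i hi
      obtain ⟨h₁, h₂⟩ := hML b hb i hi
      rw [e₃b, key, e₃ inG (by simp), e₃ inW (by simp), e₃ aYS (by simp)]
      by_cases hin : ∃ p < N, P.leaf P.n (M.nat aBk (r p)) (r p) = P.leaf P.n b i
      · obtain ⟨p, hp, he⟩ := hin
        obtain ⟨-, rfl, rfl⟩ := P.leaf_inj (hbk' p hp) hb (hlt p hp) hi he
        rw [(hw p hp).2]
        exact ⟨fun _ => by rw [hM p hp, key], fun h => absurd ⟨hr.lt p hp, trivial, rfl⟩ h⟩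
      · push Not at hin
        rw [(hk _ hin).2]
        refine ⟨fun h => h₁ ⟨h.1, ?_, h.2.2⟩, h₂⟩
        rintro ⟨p, hp, rfl⟩
        exact hin p hp (by rw [h.2.2])
  · nlinarith [Nat.zero_le (N * P.L)]

end PrimalGradient

namespace PrimalGradient

variable {P : Lay} {M : Mem} {N : ℕ} {r : ℕ → ℕ}

/-! ## The list of changed entries -/

abbrev jI : ℕ := 57
abbrev jL : ℕ := 58
abbrev jW : ℕ := 59
abbrev jNL : ℕ := 62
abbrev jH : ℕ := 63

/-- The entry `i` is in the list `J`. -/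
def JMem (M : Mem) (i : ℕ) : Prop := ∃ k < M.nat outLen 0, M.nat outJ k = i

/-- The list `J` and the positions in it are consistent. -/
def JOk (P : Lay) (M : Mem) : Prop :=
  ∀ k < M.nat outLen 0, M.nat outJ k < P.m ∧ M.nat aPos (M.nat outJ k) = k

theorem JOk.inj (h : JOk P M) {k l : ℕ} (hk : k < M.nat outLen 0) (hl : l < M.nat outLen 0)
    (he : M.nat outJ k = M.nat outJ l) : k = l := by
  rw [← (h k hk).2, ← (h l hl).2, he]

theorem JOk.len_le (h : JOk P M) : M.nat outLen 0 ≤ P.m := by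
  have := Finset.card_le_card_of_injOn (s := Finset.range (M.nat outLen 0))
    (t := Finset.range P.m) (M.nat outJ)
    (fun k hk => by simpa using (h k (by simpa using hk)).1)
    (fun k hk l hl => h.inj (by simpa using hk) (by simpa using hl))
  simpa using this

theorem JOk.mem_iff (h : JOk P M) (i : ℕ) :
    (M.nat aPos i < M.nat outLen 0 ∧ M.nat outJ (M.nat aPos i) = i) ↔ JMem M i := by
  refine ⟨fun h' => ⟨_, h'⟩, ?_⟩
  rintro ⟨k, hk, rfl⟩
  rw [(h k hk).2]
  exact ⟨hk, rfl⟩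

theorem length_eq_card {l : List ℕ} (hl : l.Nodup) {s : Finset ℕ} (h : ∀ a, a ∈ l ↔ a ∈ s) :
    l.length = s.card := by
  rw [← List.toFinset_card_of_nodup hl]
  congr 1
  ext a
  simp [h]

theorem mem_filter_map {f F : ℕ → ℕ} {N a : ℕ} :
    a ∈ ((List.range N).filter fun p => decide (F p = 1)).map f ↔
      ∃ k < N, F k = 1 ∧ f k = a := by
  simp [and_assoc]

theorem nodup_filter_map {f F : ℕ → ℕ} {N : ℕ}
    (h : ∀ k < N, F k = 1 → ∀ l < N, F l = 1 → f k = f l → k = l) :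
    (((List.range N).filter fun p => decide (F p = 1)).map f).Nodup := by
  refine List.Nodup.map_on ?_ (List.nodup_range.filter _)
  intro k hk l hl
  simp only [List.mem_filter, List.mem_range, decide_eq_true_eq] at hk hl
  exact h k hk.1 hk.2 l hl.1 hl.2

theorem compact_lay (hP : P.Ok) {K : ℕ} (hN : M.nat cmN 0 = N) (hS : M.nat aS 0 = P.L + 2)
    (hNK : N ≤ K) (hNP : N ≤ 2 * 2 ^ P.L) (hF : ∀ p < N, M.nat cmF p ≤ 1)
    (hI : ∀ p < N, M.nat cmI p ≤ P.B) :
    T P.B compact M (10000 * ((K + 1) * (P.L + 3))) (10000 * (P.L + 3)) (fun M' =>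
      Mem.EqOff [scC, scT, scD, scJ, scN, cmO, cmC] [] M M' ∧
      seg (M'.nat cmO) (M'.nat cmC 0) =
        ((List.range N).filter fun p => decide (M.nat cmF p = 1)).map (M.nat cmI)) := by
  have h2L : 2 ^ (P.L + 2) = 4 * 2 ^ P.L := by rw [pow_add]; ring
  have : 1 ≤ 2 ^ P.L := Nat.one_le_two_pow
  exact (compact_spec hN hS (by omega) hP.pow_le hF hI).mono
    (Nat.mul_le_mul_left _ (Nat.mul_le_mul_right _ (by omega))) le_rfl fun _ h => h

/-- The element at the position `jNL + k` is in the list of rows. -/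
abbrev tailE : NExp := ld outJ (NExp.add (sc jNL) ix)
abbrev inRowsE : BExp :=
  BExp.and (BExp.natLT (ld jI tailE) (sc inLen)) (BExp.natEq (ld inIdx (ld jI tailE)) tailE)

/-- Remove the rows with `jL = 1`, which are those that are in `J`, from `J`. -/
def jDelete : Cmd :=
  scatN (sc inLen) tt jI row ix ;;
  mapN (sc inLen) cmI row ;;
  mapN (sc inLen) cmF (ld jL ix) ;;
  Cmd.storeN cmN (cn 0) (sc inLen) ;;
  compact ;;
  Cmd.storeN cmN (cn 0) (sc cmC) ;;
  Cmd.storeN jNL (cn 0) (NExp.sub (sc outLen) (sc cmC)) ;;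
  mapN (sc cmN) cmI (ld aPos (ld cmO ix)) ;;
  mapN (sc cmN) cmF (cn 0) ;;
  scatN (sc cmN) (BExp.natLT (ld cmI ix) (sc jNL)) cmF ix (cn 1) ;;
  compact ;;
  mapN (sc cmC) jH (ld cmO ix) ;;
  mapN (sc cmN) cmI tailE ;;
  mapN (sc cmN) cmF (cn 1) ;;
  scatN (sc cmN) inRowsE cmF ix (cn 0) ;;
  compact ;;
  scatN (sc cmC) tt outJ (ld jH ix) (ld cmO ix) ;;
  scatN (sc cmC) tt aPos (ld cmO ix) (ld jH ix) ;;
  Cmd.storeN outLen (cn 0) (sc jNL)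

abbrev compN : List ℕ := [scC, scT, scD, scJ, scN, cmO, cmC]
abbrev jN : List ℕ := [scC, scT, scD, scJ, scN, cmO, cmC, cmI, cmF, cmN, jI, jNL, jH, outJ, outLen,
  aPos]

theorem jDelete_spec (hP : P.Ok) (hS : Stat P M) (hr : Rows P M N r) (hJ : JOk P M)
    (hL : ∀ k < N, M.nat jL k ≤ 1 ∧ (M.nat jL k = 1 ↔ JMem M (r k))) :
    T P.B jDelete M (40000 * ((N + 1) * (P.L + 3))) (40000 * (P.L + 3)) (fun M' =>
      Mem.EqOff jN [] M M' ∧ JOk P M' ∧ ∀ i, JMem M' i ↔ JMem M i ∧ ¬ InRows N r i) := by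
  classical
  have hone := hP.one_le
  have hmB := hP.m_le
  have hNm := hr.le
  have hNB : N ≤ P.B := by omega
  have hpow := hP.pow_le
  have hmL := hP.hmL
  have hm0 := hP.hm
  have h2L : 2 ^ (P.L + 2) = 4 * 2 ^ P.L := by rw [pow_add]; ring
  have hlenm := hJ.len_le
  have hrB : ∀ k < N, r k ≤ P.B := fun k hk => (hr.lt k hk).le.trans hmB
  set len := M.nat outLen 0 with hlen
  set J := M.nat outJ with hJdef
  set pos := M.nat aPos with hpos
  unfold jDelete
  have h3 : (N + 1) * 3 ≤ (N + 1) * (P.L + 3) := Nat.mul_le_mul_left _ (by omega)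
  refine T.next (T_scatN N (fun _ => True) r (fun k => k) (by simp [hr.len]) hNB (by simp)
    (fun k hk _ => by simp [hr.idx k hk]) (by simp) (fun k hk _ => hrB k hk)
    (fun k hk _ => by omega) (fun k hk _ l hl _ h => hr.inj k hk l hl h) (by decide)
    (by decide)) ?_
  rintro _ ⟨fI, rfl, hfI, -⟩
  refine T.next (T_mapN N r (by simp [hr.len]) hNB (fun k hk => by simp [hr.idx k hk]) hrB
    (by decide) (by decide)) ?_
  rintro _ rfl
  refine T.next (T_mapN N (M.nat jL) (by simp [hr.len]) hNB (by simp)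
    (fun k hk => (hL k hk).1.trans hone) (by decide) (by decide)) ?_
  rintro _ rfl
  refine T.next (T_storeN (by simp) (by simp [hr.len]; omega) (by decide)) ?_
  rintro _ rfl
  refine T.next (compact_lay hP (N := N) (K := N) (by simp [hr.len]) (by simp [hS.S]) le_rfl (by omega)
    (fun k hk => by simpa [hk] using (hL k hk).1)
    (fun k hk => by simpa [hk] using hrB k hk)) ?_
  rintro M₁ ⟨hE₁', hD⟩
  have hE₁ : Mem.EqOff (jI :: cmI :: cmF :: cmN :: compN) [] M M₁ :=
    (((((Mem.EqOff.refl M).setNA (by decide) _).setNA (by decide) _).setNA (by decide) _).setNA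
      (by decide) _).trans (hE₁'.mono (by decide) (by decide))
  have hDl : ∀ i, i ∈ seg (M₁.nat cmO) (M₁.nat cmC 0) ↔ InRows N r i ∧ JMem M i := by
    intro i
    rw [hD, mem_filter_map]
    simp only [Mem.setNA_nat]
    constructor
    · rintro ⟨k, hk, h₁, h₂⟩
      simp [hk] at h₁ h₂
      exact ⟨⟨k, hk, h₂⟩, h₂ ▸ (hL k hk).2.1 h₁⟩
    · rintro ⟨⟨k, hk, rfl⟩, h⟩
      exact ⟨k, hk, by simpa [hk] using (hL k hk).2.2 h, by simp [hk]⟩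
  have hDn : (seg (M₁.nat cmO) (M₁.nat cmC 0)).Nodup := by
    rw [hD]
    refine nodup_filter_map fun k hk _ l hl _ h => ?_
    simp [hk, hl] at h
    exact hr.inj k hk l hl h
  have hjI₁ : M₁.nat jI = fI := by rw [hE₁'.1 jI (by decide)]; simp
  set d := M₁.nat cmC 0 with hd
  have hdN : d ≤ N := by
    have h := congrArg List.length hD
    rw [length_seg, List.length_map] at h
    rw [h]
    exact (List.length_filter_le _ _).trans (by simp)
  set D := M₁.nat cmO with hDdef
  have hDmem : ∀ k < d, InRows N r (D k) ∧ JMem M (D k) := fun k hk =>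
    (hDl _).1 (mem_seg.2 ⟨k, hk, rfl⟩)
  have hDinj : ∀ k < d, ∀ l < d, D k = D l → k = l := nodup_seg.1 hDn
  have hDpos : ∀ k < d, pos (D k) < len ∧ J (pos (D k)) = D k := fun k hk =>
    (hJ.mem_iff _).2 (hDmem k hk).2
  -- the positions of the deleted rows
  have hdcard : d = ((Finset.range len).filter fun x => InRows N r (J x)).card := by
    have h := length_eq_card (l := seg (fun k => pos (D k)) d)
      (s := (Finset.range len).filter fun x => InRows N r (J x))
      (nodup_seg.2 fun k hk l hl h => hDinj k hk l hl (by
        rw [← (hDpos k hk).2, ← (hDpos l hl).2, h])) (fun a => by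
        rw [mem_seg, Finset.mem_filter, Finset.mem_range]
        constructor
        · rintro ⟨k, hk, rfl⟩
          refine ⟨(hDpos k hk).1, ?_⟩
          rw [(hDpos k hk).2]; exact (hDmem k hk).1
        · rintro ⟨ha, hin⟩
          obtain ⟨k, hk, hk'⟩ := mem_seg.1 ((hDl (J a)).2 ⟨hin, a, ha, rfl⟩)
          exact ⟨k, hk, by rw [hk']; exact (hJ a ha).2⟩)
    rwa [length_seg] at h
  have hdlen : d ≤ len := by
    rw [hdcard]
    exact (Finset.card_filter_le _ _).trans (by simp)
  have hb₁ : M₁.nat aPos = pos := hE₁.1 _ (by decide)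
  have hJ₁ : M₁.nat outJ = J := hE₁.1 _ (by decide)
  have hl₁ : M₁.nat outLen 0 = len := by rw [hE₁.1 outLen (by decide)]
  have hS₁ := hS.eqOff hE₁
  have hr₁ := hr.eqOff hE₁
  have hlenB : len ≤ P.B := by omega
  refine T.next (T_storeN (by simp) (by simp [← hd]; omega) (by decide)) ?_
  rintro _ rfl
  refine T.next (T_storeN (by simp) (by simp [← hd, hl₁]; omega) (by decide)) ?_
  rintro _ rfl
  refine T.next ((T_mapN d (fun k => pos (D k)) (by simp [← hd]) (by omega)
    (fun k hk => by simp [hb₁, ← hDdef]) (fun k hk => (hDpos k hk).1.le.trans hlenB) (by decide)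
    (by decide)).mono (W' := 200 * (N + 1)) (by omega) le_rfl fun _ h => h) ?_
  rintro _ rfl
  refine T.next ((T_mapN d (fun k => 0) (by simp [← hd]) (by omega)
    (fun k hk => by simp) (by simp) (by decide)
    (by decide)).mono (W' := 200 * (N + 1)) (by omega) le_rfl fun _ h => h) ?_
  rintro _ rfl
  refine T.next ((T_scatN d (fun k => pos (D k) < len - d) (fun k => k) (fun _ => 1)
    (by simp [← hd]) (by omega) (fun k hk => by simp [hk, ← hd, hl₁]) (by simp) (by simp)
    (fun k hk _ => by omega) (fun k hk _ => hone) (fun k hk _ l hl _ h => h)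
    (by decide) (by decide)).mono (W' := 200 * (N + 1)) (by omega) le_rfl fun _ h => h) ?_
  rintro _ ⟨fF, rfl, hfF, hfF'⟩
  have hF : ∀ k < d, fF k ≤ 1 ∧ (fF k = 1 ↔ pos (D k) < len - d) := by
    intro k hk
    by_cases h : pos (D k) < len - d
    · rw [hfF k hk h]; simp [h]
    · rw [hfF' k (by rintro l hl hl' rfl; exact h hl')]; simp [hk, h]
  refine T.next (compact_lay hP (N := d) (K := N) (by simp [← hd]) (by simp [hS₁.S])
    hdN (by omega) (fun k hk => by simpa using (hF k hk).1)
    (fun k hk => by simpa [hk] using (hDpos k hk).1.le.trans hlenB)) ?_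
  rintro M₂ ⟨hE₂', hH⟩
  have hE₂ : Mem.EqOff (jNL :: cmI :: cmF :: cmN :: compN) [] M₁ M₂ :=
    ((((((Mem.EqOff.refl M₁).setNA (by decide) _).setNA (by decide) _).setNA (by decide) _).setNA
      (by decide) _).setNA (by decide) _).trans (hE₂'.mono (by decide) (by decide))
  have hHm : ∀ x, x ∈ seg (M₂.nat cmO) (M₂.nat cmC 0) ↔ x < len - d ∧ InRows N r (J x) := by
    intro x
    rw [hH, mem_filter_map]
    simp only [Mem.setNA_nat]
    constructor
    · rintro ⟨k, hk, h₁, h₂⟩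
      simp [hk] at h₁ h₂
      have := (hF k hk).2.1 h₁
      rw [h₂] at this
      refine ⟨this, ?_⟩
      rw [← h₂, (hDpos k hk).2]
      exact (hDmem k hk).1
    · rintro ⟨hx, hin⟩
      obtain ⟨k, hk, hk'⟩ := mem_seg.1 ((hDl (J x)).2 ⟨hin, x, by omega, rfl⟩)
      have hpx : pos (D k) = x := by rw [hk']; exact (hJ x (by omega)).2
      exact ⟨k, hk, by simpa [hk] using (hF k hk).2.2 (by omega), by simpa [hk] using hpx⟩
  have hHn : (seg (M₂.nat cmO) (M₂.nat cmC 0)).Nodup := by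
    rw [hH]
    refine nodup_filter_map fun k hk _ l hl _ h => ?_
    simp [hk, hl] at h
    exact hDinj k hk l hl (by rw [← (hDpos k hk).2, ← (hDpos l hl).2, h])
  set h := M₂.nat cmC 0 with hh
  set H := M₂.nat cmO with hHdef
  have hhd : h ≤ d := by
    have h' := congrArg List.length hH
    rw [length_seg, List.length_map] at h'
    rw [h']
    exact (List.length_filter_le _ _).trans (by simp)
  have hHmem : ∀ k < h, H k < len - d ∧ InRows N r (J (H k)) := fun k hk =>
    (hHm _).1 (mem_seg.2 ⟨k, hk, rfl⟩)
  have hHinj : ∀ k < h, ∀ l < h, H k = H l → k = l := nodup_seg.1 hHn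
  have hJ₂ : M₂.nat outJ = J := (hE₂.1 _ (by decide)).trans hJ₁
  have hjI₂ : M₂.nat jI = fI := (hE₂.1 _ (by decide)).trans hjI₁
  have hb₂ : M₂.nat aPos = pos := (hE₂.1 _ (by decide)).trans hb₁
  have hS₂ := hS₁.eqOff hE₂
  have hr₂ := hr₁.eqOff hE₂
  have hd₂ : M₂.nat cmN 0 = d := by rw [hE₂'.1 cmN (by decide)]; simp [← hd]
  have hnl₂ : M₂.nat jNL 0 = len - d := by rw [hE₂'.1 jNL (by decide)]; simp [← hd, hl₁]
  refine T.next ((T_mapN h H (by simp [← hh]) (by omega) (by simp [← hHdef])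
    (fun k hk => by have := (hHmem k hk).1; omega) (by decide) (by decide)).mono
    (W' := 200 * (N + 1)) (by omega) le_rfl fun _ h => h) ?_
  rintro _ rfl
  refine T.next ((T_mapN d (fun k => J (len - d + k)) (by simp [hd₂]) (by omega)
    (fun k hk => by simp [hJ₂, hnl₂]) (fun k hk => by
      have := (hJ (len - d + k) (by omega)).1; rw [← hJdef] at this; omega) (by decide)
    (by decide)).mono (W' := 200 * (N + 1)) (by omega) le_rfl fun _ h => h) ?_
  rintro _ rfl
  refine T.next ((T_mapN d (fun _ => 1) (by simp [hd₂]) (by omega) (by simp) (fun _ _ => hone)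
    (by decide) (by decide)).mono (W' := 200 * (N + 1)) (by omega) le_rfl fun _ h => h) ?_
  rintro _ rfl
  refine T.next ((T_scatN d (fun k => InRows N r (J (len - d + k))) (fun k => k) (fun _ => 0)
    (by simp [hd₂]) (by omega) (fun k hk => ?_) (by simp) (by simp)
    (fun k hk _ => by omega) (by simp) (fun k hk _ l hl _ h => h)
    (by decide) (by decide)).mono (W' := 200 * (N + 1)) (by omega) le_rfl fun _ h => h) ?_
  · simp only [BExp.Holds, NExp.eval, Mem.setNA_nat, State.setN_mem, State.setN_nreg]
    simp only [show (jI = cmF) = False by simp, show (jI = cmI) = False by simp,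
      show (jI = jH) = False by simp, show (outJ = cmF) = False by simp,
      show (outJ = cmI) = False by simp, show (outJ = jH) = False by simp,
      show (jNL = cmF) = False by simp, show (jNL = cmI) = False by simp,
      show (jNL = jH) = False by simp, show (inLen = cmF) = False by simp,
      show (inLen = cmI) = False by simp, show (inLen = jH) = False by simp,
      show (inIdx = cmF) = False by simp, show (inIdx = cmI) = False by simp,
      show (inIdx = jH) = False by simp, if_false, if_true, hjI₂, hJ₂, hnl₂, hr₂.len]
    constructor
    · rintro ⟨h₁, h₂⟩
      rw [hr₂.idx _ h₁] at h₂
      exact ⟨_, h₁, h₂⟩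
    · rintro ⟨p, hp, hp'⟩
      rw [← hp', hfI p hp trivial, hr₂.idx p hp]
      exact ⟨hp, rfl⟩
  rintro _ ⟨fG, rfl, hfG, hfG'⟩
  have hG : ∀ k < d, fG k ≤ 1 ∧ (fG k = 1 ↔ ¬ InRows N r (J (len - d + k))) := by
    intro k hk
    by_cases h : InRows N r (J (len - d + k))
    · rw [hfG k hk h]; simp [h]
    · rw [hfG' k (by rintro l hl hl' rfl; exact h hl')]; simp [hk, h]
  refine T.next (compact_lay hP (N := d) (K := N) (by simp [hd₂]) (by simp [hS₂.S])
    hdN (by omega) (fun k hk => by simpa using (hG k hk).1)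
    (fun k hk => by
      have := (hJ (len - d + k) (by omega)).1
      have e : J (len - d + k) < P.m := this
      simp [hk]; omega)) ?_
  rintro M₃ ⟨hE₃', hV⟩
  have hE₃ : Mem.EqOff (jH :: cmI :: cmF :: compN) [] M₂ M₃ :=
    (((((Mem.EqOff.refl M₂).setNA (by decide) _).setNA (by decide) _).setNA (by decide) _).setNA
      (by decide) _).trans (hE₃'.mono (by decide) (by decide))
  have hVm : ∀ y, y ∈ seg (M₃.nat cmO) (M₃.nat cmC 0) ↔
      ∃ x, len - d ≤ x ∧ x < len ∧ ¬ InRows N r (J x) ∧ J x = y := by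
    intro y
    rw [hV, mem_filter_map]
    simp only [Mem.setNA_nat]
    constructor
    · rintro ⟨k, hk, h₁, h₂⟩
      simp [hk] at h₁ h₂
      exact ⟨len - d + k, by omega, by omega, (hG k hk).2.1 h₁, h₂⟩
    · rintro ⟨x, hx₁, hx₂, hx₃, rfl⟩
      have hxe : len - d + (x - (len - d)) = x := by omega
      refine ⟨x - (len - d), by omega, ?_, ?_⟩
      · simpa using (hG _ (by omega)).2.2 (by rw [hxe]; exact hx₃)
      · have : x - (len - d) < d := by omega
        simp [this, hxe]
  have hVn : (seg (M₃.nat cmO) (M₃.nat cmC 0)).Nodup := by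
    rw [hV]
    refine nodup_filter_map fun k hk _ l hl _ h => ?_
    simp [hk, hl] at h
    have := hJ.inj (k := len - d + k) (l := len - d + l) (by omega) (by omega) h
    omega
  have hcount : M₃.nat cmC 0 = h := by
    have h₁ := length_eq_card (s := ((Finset.range len).filter fun x => InRows N r (J x)).filter
      fun x => x < len - d) hHn (fun x => by
        rw [hHm]; simp only [Finset.mem_filter, Finset.mem_range]
        constructor
        · rintro ⟨a, b⟩; exact ⟨⟨by omega, b⟩, a⟩
        · rintro ⟨⟨-, b⟩, a⟩; exact ⟨a, b⟩)
    have h₂ := length_eq_card (s := (((Finset.range len).filter fun x => ¬ x < len - d).filter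
      fun x => ¬ InRows N r (J x)).image J) hVn (fun y => by
        rw [hVm]; simp only [Finset.mem_image, Finset.mem_filter, Finset.mem_range]
        constructor
        · rintro ⟨x, a, b, c, e⟩; exact ⟨x, ⟨⟨b, by omega⟩, c⟩, e⟩
        · rintro ⟨x, ⟨⟨b, a⟩, c⟩, e⟩; exact ⟨x, by omega, b, c, e⟩)
    rw [Finset.card_image_of_injOn (fun x hx y hy hxy => by
      simp only [Finset.coe_filter, Finset.mem_filter, Finset.mem_range, Set.mem_ofPred_eq] at hx hy
      exact hJ.inj hx.1.1 hy.1.1 hxy)] at h₂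
    have h₃ := Finset.card_filter_add_card_filter_not
      (s := (Finset.range len).filter fun x => InRows N r (J x)) (fun x => x < len - d)
    have h₄ := Finset.card_filter_add_card_filter_not
      (s := (Finset.range len).filter fun x => ¬ x < len - d) (fun x => InRows N r (J x))
    have h₅ := Finset.card_filter_add_card_filter_not
      (s := Finset.range len) (fun x => x < len - d)
    have h₆ : ((Finset.range len).filter fun x => x < len - d).card = len - d := by
      rw [show (Finset.range len).filter (fun x => x < len - d) = Finset.range (len - d) by
        ext x; simp only [Finset.mem_filter, Finset.mem_range]; omega, Finset.card_range]
    rw [length_seg] at h₁ h₂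
    rw [Finset.card_range] at h₅
    rw [Finset.filter_comm] at h₄
    omega
  rw [hcount] at hVm hVn
  set V := M₃.nat cmO with hVdef
  have hVmem : ∀ k < h, ∃ x, len - d ≤ x ∧ x < len ∧ ¬ InRows N r (J x) ∧ J x = V k := fun k hk =>
    (hVm _).1 (mem_seg.2 ⟨k, hk, rfl⟩)
  have hVinj : ∀ k < h, ∀ l < h, V k = V l → k = l := nodup_seg.1 hVn
  have hjH₃ : ∀ k < h, M₃.nat jH k = H k := fun k hk => by
    rw [hE₃'.1 jH (by decide)]; simp [hk]
  have hVB : ∀ k < h, V k < P.m := by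
    intro k hk
    obtain ⟨x, -, hx, -, hx'⟩ := hVmem k hk
    rw [← hx']; exact (hJ x hx).1
  have hJ₃ : M₃.nat outJ = J := (hE₃.1 _ (by decide)).trans hJ₂
  have hb₃ : M₃.nat aPos = pos := (hE₃.1 _ (by decide)).trans hb₂
  have hnl₃ : M₃.nat jNL 0 = len - d := by rw [hE₃.1 jNL (by decide), hnl₂]
  refine T.next ((T_scatN h (fun _ => True) H V (by simp [hcount]) (by omega) (by simp)
    (fun k hk _ => by simp [hjH₃ k hk]) (fun k hk _ => by simp [← hVdef])
    (fun k hk _ => by have := (hHmem k hk).1; omega) (fun k hk _ => by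
      have := hVB k hk; omega)
    (fun k hk _ l hl _ e => hHinj k hk l hl e) (by decide) (by decide)).mono
    (W' := 200 * (N + 1)) (by omega) le_rfl fun _ h => h) ?_
  rintro _ ⟨J', rfl, hJ'₁, hJ'₀⟩
  refine T.next ((T_scatN h (fun _ => True) V H (by simp [hcount]) (by omega) (by simp)
    (fun k hk _ => by simp [← hVdef]) (fun k hk _ => by simp [hjH₃ k hk])
    (fun k hk _ => by have := hVB k hk; omega) (fun k hk _ => by
      have := (hHmem k hk).1; omega)
    (fun k hk _ l hl _ e => hVinj k hk l hl e) (by decide) (by decide)).mono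
    (W' := 200 * (N + 1)) (by omega) le_rfl fun _ h => h) ?_
  rintro _ ⟨pos', rfl, hp'₁, hp'₀⟩
  simp only [Mem.setNA_nat, show (aPos = outJ) = False by simp, if_false, hJ₃, hb₃] at hJ'₀ hp'₀
  refine (T_storeN (by simp) (by simp [hnl₃]; omega) (by decide)).mono (by omega) (by omega) ?_
  rintro _ rfl
  have hkeep : ∀ x < len - d, ¬ InRows N r (J x) → J' x = J x ∧ pos' (J x) = x := by
    intro x hx hin
    refine ⟨hJ'₀ x fun k hk _ e => hin (e ▸ (hHmem k hk).2), ?_⟩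
    rw [hp'₀]
    · exact (hJ x (by omega)).2
    intro k hk _ e
    obtain ⟨y, hy, hy', -, hy''⟩ := hVmem k hk
    have := hJ.inj hy' (by omega) (hy''.trans e)
    omega
  have hmove : ∀ x < len - d, InRows N r (J x) → ∃ k < h, H k = x ∧ J' x = V k ∧ pos' (V k) = x := by
    intro x hx hin
    obtain ⟨k, hk, rfl⟩ := mem_seg.1 ((hHm x).2 ⟨hx, hin⟩)
    exact ⟨k, hk, rfl, hJ'₁ k hk trivial, hp'₁ k hk trivial⟩
  refine ⟨?_, ?_, ?_⟩
  · exact ((((hE₁.mono (NS' := jN) (RS' := []) (by decide) (by decide)).trans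
      (hE₂.mono (by decide) (by decide))).trans (hE₃.mono (by decide) (by decide))).setNA
      (by decide) _).setNA (by decide) _ |>.setNA (by decide) _
  · intro x hx
    simp [hnl₃] at hx ⊢
    by_cases hin : InRows N r (J x)
    · obtain ⟨k, hk, -, h₁, h₂⟩ := hmove x (by omega) hin
      rw [h₁, h₂]
      exact ⟨hVB k hk, rfl⟩
    · obtain ⟨h₁, h₂⟩ := hkeep x (by omega) hin
      rw [h₁, h₂]
      exact ⟨(hJ x (by omega)).1, rfl⟩
  · intro i
    simp [JMem, hnl₃]
    constructor
    · rintro ⟨x, hx, rfl⟩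
      by_cases hin : InRows N r (J x)
      · obtain ⟨k, hk, -, h₁, -⟩ := hmove x (by omega) hin
        obtain ⟨y, -, hy, hy', hy''⟩ := hVmem k hk
        rw [h₁, ← hy'']
        exact ⟨⟨y, hy, rfl⟩, hy'⟩
      · obtain ⟨h₁, -⟩ := hkeep x (by omega) hin
        rw [h₁]
        exact ⟨⟨x, by omega, rfl⟩, hin⟩
    · rintro ⟨⟨x, hx, rfl⟩, hin⟩
      by_cases hx' : x < len - d
      · exact ⟨x, by omega, (hkeep x hx' hin).1⟩
      · obtain ⟨k, hk, hk'⟩ := mem_seg.1 ((hVm (J x)).2 ⟨x, by omega, hx, hin, rfl⟩)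
        refine ⟨H k, by have := (hHmem k hk).1; omega, ?_⟩
        rw [hJ'₁ k hk trivial]
        exact hk'

/-- Insert the rows with `jW = 1`, which are not in `J`, into `J`. -/
def jInsert : Cmd :=
  mapN (sc inLen) cmI row ;;
  mapN (sc inLen) cmF (ld jW ix) ;;
  Cmd.storeN cmN (cn 0) (sc inLen) ;;
  compact ;;
  scatN (sc cmC) tt outJ (NExp.add (sc outLen) ix) (ld cmO ix) ;;
  scatN (sc cmC) tt aPos (ld cmO ix) (NExp.add (sc outLen) ix) ;;
  Cmd.storeN outLen (cn 0) (NExp.add (sc outLen) (sc cmC))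

theorem jInsert_spec (hP : P.Ok) (hS : Stat P M) (hr : Rows P M N r) (hJ : JOk P M)
    (hW : ∀ k < N, M.nat jW k ≤ 1) (hnot : ∀ k < N, ¬ JMem M (r k)) :
    T P.B jInsert M (12000 * ((N + 1) * (P.L + 3))) (12000 * (P.L + 3)) (fun M' =>
      Mem.EqOff jN [] M M' ∧ JOk P M' ∧
      ∀ i, JMem M' i ↔ JMem M i ∨ ∃ k < N, M.nat jW k = 1 ∧ r k = i) := by
  have hone := hP.one_le
  have hmB := hP.m_le
  have hNm := hr.le
  have hNB : N ≤ P.B := by omega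
  have hpow := hP.pow_le
  have hmL := hP.hmL
  have hm0 := hP.hm
  have h2L : 2 ^ (P.L + 2) = 4 * 2 ^ P.L := by rw [pow_add]; ring
  have hlenm := hJ.len_le
  have hrB : ∀ k < N, r k ≤ P.B := fun k hk => (hr.lt k hk).le.trans hmB
  have h2m : 2 * P.m ≤ P.B := by omega
  set len := M.nat outLen 0 with hlen
  unfold jInsert
  have h3 : (N + 1) * 3 ≤ (N + 1) * (P.L + 3) := Nat.mul_le_mul_left _ (by omega)
  refine T.next (T_mapN N r (by simp [hr.len]) hNB (fun k hk => by simp [hr.idx k hk]) hrB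
    (by decide) (by decide)) ?_
  rintro _ rfl
  refine T.next (T_mapN N (M.nat jW) (by simp [hr.len]) hNB (by simp)
    (fun k hk => (hW k hk).trans hone) (by decide) (by decide)) ?_
  rintro _ rfl
  refine T.next (T_storeN (by simp) (by simp [hr.len]; omega) (by decide)) ?_
  rintro _ rfl
  refine T.next (compact_lay hP (N := N) (K := N) (by simp [hr.len]) (by simp [hS.S]) le_rfl (by omega)
    (fun k hk => by simpa [hk] using hW k hk)
    (fun k hk => by simpa [hk] using hrB k hk)) ?_
  rintro M₁ ⟨hE₁', hD⟩
  have hE₁ : Mem.EqOff (cmI :: cmF :: cmN :: compN) [] M M₁ :=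
    ((((Mem.EqOff.refl M).setNA (by decide) _).setNA (by decide) _).setNA (by decide) _).trans
      (hE₁'.mono (by decide) (by decide))
  have hDl : ∀ i, i ∈ seg (M₁.nat cmO) (M₁.nat cmC 0) ↔ ∃ k < N, M.nat jW k = 1 ∧ r k = i := by
    intro i
    rw [hD, mem_filter_map]
    simp only [Mem.setNA_nat]
    constructor
    · rintro ⟨k, hk, h₁, h₂⟩
      simp [hk] at h₁ h₂
      exact ⟨k, hk, h₁, h₂⟩
    · rintro ⟨k, hk, h, rfl⟩
      exact ⟨k, hk, by simpa [hk] using h, by simp [hk]⟩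
  have hDn : (seg (M₁.nat cmO) (M₁.nat cmC 0)).Nodup := by
    rw [hD]
    refine nodup_filter_map fun k hk _ l hl _ h => ?_
    simp [hk, hl] at h
    exact hr.inj k hk l hl h
  set d := M₁.nat cmC 0 with hd
  have hdN : d ≤ N := by
    have h := congrArg List.length hD
    rw [length_seg, List.length_map] at h
    rw [h]
    exact (List.length_filter_le _ _).trans (by simp)
  set D := M₁.nat cmO with hDdef
  have hDmem : ∀ k < d, ∃ l < N, M.nat jW l = 1 ∧ r l = D k := fun k hk =>
    (hDl _).1 (mem_seg.2 ⟨k, hk, rfl⟩)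
  have hDlt : ∀ k < d, D k < P.m ∧ ¬ JMem M (D k) := by
    intro k hk
    obtain ⟨l, hl, -, h⟩ := hDmem k hk
    rw [← h]
    exact ⟨hr.lt l hl, hnot l hl⟩
  have hDinj : ∀ k < d, ∀ l < d, D k = D l → k = l := nodup_seg.1 hDn
  have hl₁ : M₁.nat outLen 0 = len := by rw [hE₁.1 outLen (by decide)]
  have hb₁ : M₁.nat aPos = M.nat aPos := hE₁.1 _ (by decide)
  have hJ₁ : M₁.nat outJ = M.nat outJ := hE₁.1 _ (by decide)
  refine T.next ((T_scatN d (fun _ => True) (fun k => len + k) D (by simp [← hd]) (by omega) (by simp)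
    (fun k hk _ => by simp [hl₁]) (fun k hk _ => by simp [← hDdef])
    (fun k hk _ => by omega) (fun k hk _ => by have := hDlt k hk; omega)
    (fun k hk _ l hl _ e => by omega) (by decide) (by decide)).mono
    (W' := 200 * (N + 1)) (by omega) le_rfl fun _ h => h) ?_
  rintro _ ⟨J', rfl, hJ'₁, hJ'₀⟩
  refine T.next ((T_scatN d (fun _ => True) D (fun k => len + k) (by simp [← hd]) (by omega) (by simp)
    (fun k hk _ => by simp [← hDdef]) (fun k hk _ => by simp [hl₁])
    (fun k hk _ => by have := hDlt k hk; omega) (fun k hk _ => by omega)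
    (fun k hk _ l hl _ e => hDinj k hk l hl e) (by decide) (by decide)).mono
    (W' := 200 * (N + 1)) (by omega) le_rfl fun _ h => h) ?_
  rintro _ ⟨pos', rfl, hp'₁, hp'₀⟩
  simp only [Mem.setNA_nat, show (aPos = outJ) = False by simp, if_false, hJ₁, hb₁] at hJ'₀ hp'₀
  refine (T_storeN (by simp) (by simp [← hd, hl₁]; omega) (by decide)).mono (by omega) (by omega) ?_
  rintro _ rfl
  have hold : ∀ x < len, J' x = M.nat outJ x ∧ pos' (M.nat outJ x) = x := by
    intro x hx
    refine ⟨hJ'₀ x fun k hk _ e => by omega, ?_⟩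
    rw [hp'₀, (hJ x hx).2]
    intro k hk _ e
    exact (hDlt k hk).2 ⟨x, hx, e.symm⟩
  refine ⟨?_, ?_, ?_⟩
  · exact (((hE₁.mono (NS' := jN) (RS' := []) (by decide) (by decide)).setNA
      (by decide) _).setNA (by decide) _).setNA (by decide) _
  · intro x hx
    simp [← hd, hl₁] at hx ⊢
    by_cases hxl : x < len
    · obtain ⟨h₁, h₂⟩ := hold x hxl
      rw [h₁, h₂]
      exact ⟨(hJ x hxl).1, rfl⟩
    · obtain ⟨k, rfl⟩ := Nat.exists_eq_add_of_le (not_lt.1 hxl)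
      rw [hJ'₁ k (by omega) trivial, hp'₁ k (by omega) trivial]
      exact ⟨(hDlt k (by omega)).1, rfl⟩
  · intro i
    rw [← hDl, mem_seg]
    simp [JMem, ← hd, hl₁]
    constructor
    · rintro ⟨x, hx, rfl⟩
      by_cases hxl : x < len
      · exact Or.inl ⟨x, hxl, (hold x hxl).1.symm⟩
      · obtain ⟨k, rfl⟩ := Nat.exists_eq_add_of_le (not_lt.1 hxl)
        exact Or.inr ⟨k, by omega, (hJ'₁ k (by omega) trivial).symm⟩
    · rintro (⟨x, hx, rfl⟩ | ⟨k, hk, rfl⟩)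
      · exact ⟨x, by omega, (hold x hx).1⟩
      · exact ⟨len + k, by omega, hJ'₁ k hk trivial⟩

end PrimalGradient

namespace PrimalGradient

variable {B : ℕ}

/-! ## Sequential loops -/

theorem T_loop_sum {b : BExp} {c : Cmd} {Q : Mem → Prop} (I : ℕ → Mem → Prop) (N : ℕ)
    (Wf : ℕ → ℕ) (Db : ℕ) (hs : b.size ≤ 200)
    (hstep : ∀ j M, I j M → b.Holds (st M) → j < N ∧ T B c M (Wf j) Db (I (j + 1)))
    (hexit : ∀ j M, I j M → ¬ b.Holds (st M) → Q M) :
    ∀ (k j : ℕ) (M : Mem), N ≤ j + k → I j M →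
      T B (Cmd.loop b c) M (200 + ∑ i ∈ Finset.range k, (200 + Wf (j + i)))
        (200 + k * (200 + Db)) Q := by
  intro k
  induction k with
  | zero =>
    intro j M hj hI
    have hb : ¬ b.Holds (st M) := fun hb => by have := (hstep j M hI hb).1; omega
    exact ⟨M, _, _, _, _, Exec.loopFalse hb, by omega, by omega, hexit j M hI hb⟩
  | succ k ih =>
    intro j M hj hI
    by_cases hb : b.Holds (st M)
    · obtain ⟨-, M₁, w, d, R, S, hE, hw, hd, hI₁⟩ := hstep j M hI hb
      obtain ⟨M₂, w', d', R', S', hE', hw', hd', hQ⟩ := ih (j + 1) M₁ (by omega) hI₁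
      refine ⟨M₂, _, _, _, _, Exec.loopTrue hb hE hE', ?_, ?_, hQ⟩
      · have : ∑ i ∈ Finset.range k, (200 + Wf (j + (i + 1))) =
            ∑ i ∈ Finset.range k, (200 + Wf (j + 1 + i)) :=
          Finset.sum_congr rfl fun i _ => by rw [show j + (i + 1) = j + 1 + i by omega]
        rw [Finset.sum_range_succ', this, add_zero]
        omega
      · rw [Nat.succ_mul]; omega
    · exact ⟨M, _, _, _, _, Exec.loopFalse hb, by omega, by omega, hexit j M hI hb⟩

/-- A sequential loop whose iterations have different costs. -/
theorem T_forTo_sum {c : ℕ} {e : NExp} {body : Cmd} {M : Mem} (I : ℕ → Mem → Prop) (N : ℕ)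
    (Wf : ℕ → ℕ) (Db : ℕ) (hN : N ≤ B) (hs : e.size ≤ 100)
    (he : ∀ j M, I j M → e.eval (st M) = N)
    (hset : ∀ j M f, I j M → I j (M.setNA c f))
    (hbody : ∀ j M, j < N → I j M → M.nat c 0 = j →
      T B body M (Wf j) Db (fun M' => M'.nat c 0 = j ∧ I (j + 1) M'))
    (h0 : I 0 M) :
    T B (Cmd.forTo c e body) M (400 + ∑ j ∈ Finset.range N, (400 + Wf j))
      (400 + N * (400 + Db)) (I N) := by
  have h₁ : T B (Cmd.storeN c (NExp.const 0) (NExp.const 0)) M 200 200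
      (fun M' => M'.nat c 0 = 0 ∧ I 0 M') := by
    refine (T_storeN (by simp) (by simp) (by simp [NExp.size])).mono le_rfl le_rfl ?_
    rintro _ rfl
    exact ⟨by simp, hset _ _ _ h0⟩
  refine (T.bind h₁ fun M' hM' =>
    T_loop_sum (Q := I N) (fun j M => M.nat c 0 = j ∧ j ≤ N ∧ I j M) N (fun j => Wf j + 200)
      (Db + 200) (by simp [BExp.size, NExp.size]; omega) ?_ ?_ N 0 M' (by omega)
        ⟨hM'.1, Nat.zero_le _, hM'.2⟩).mono ?_ (by ring_nf; omega) fun _ h => h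
  · rintro j M ⟨hj, hjN, hI⟩ hb
    have hjN' : j < N := by
      have h : M.nat c 0 < e.eval (st M) := hb
      rw [he j M hI] at h; omega
    refine ⟨hjN', T.bind (hbody j M hjN' hI hj) ?_⟩
    rintro M' ⟨hc, hI'⟩
    refine (T_storeN (by simp) (by simp [hc]; omega) (by simp [NExp.size])).mono le_rfl le_rfl ?_
    rintro _ rfl
    exact ⟨by simp [hc], hjN', hset _ _ _ hI'⟩
  · rintro j M ⟨hj, hjN, hI⟩ hb
    have h : ¬ M.nat c 0 < e.eval (st M) := hb
    rw [he j M hI] at h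
    obtain rfl : j = N := by omega
    exact hI
  · simp only [zero_add, show ∀ i, 200 + (Wf i + 200) = 400 + Wf i by intro i; omega]
    omega

/-- For every `k < e` find the largest value `j < e'` of the counter with `b`. -/
abbrev pick (e e' : NExp) (c a : ℕ) (b : BExp) : Cmd :=
  mapN e a (cn 0) ;; Cmd.forTo c e' (scatN e b a ix (sc c))

theorem T_pick {e e' : NExp} {c a : ℕ} {b : BExp} {M : Mem} (N K : ℕ) (act : ℕ → ℕ → Prop)
    (hN : N ≤ B) (hK : K ≤ B)
    (he : ∀ M', Mem.EqOff [c, a] [] M M' → e.eval (st M') = N)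
    (he' : ∀ M', Mem.EqOff [c, a] [] M M' → e'.eval (st M') = K)
    (hb : ∀ M', Mem.EqOff [c, a] [] M M' → ∀ k < N, b.Holds (st1 M' k) ↔ act k (M'.nat c 0))
    (hca : c ≠ a)
    (hav : (e.avoids (Arr.nat a) && b.avoids (Arr.nat a) && (sc c).avoids (Arr.nat a)) = true)
    (hs : e.size + b.size ≤ 150) (hs' : e'.size ≤ 100) :
    T B (pick e e' c a b) M (1000 * ((K + 1) * (N + 1))) (1000 * (K + 1)) (fun M' =>
      Mem.EqOff [c, a] [] M M' ∧ ∀ k < N, M'.nat a k ≤ K ∧ ∀ j < K, act k j →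
        act k (M'.nat a k) ∧ M'.nat a k < K ∧ j ≤ M'.nat a k) := by
  simp only [Bool.and_eq_true] at hav
  obtain ⟨⟨hae, hab⟩, hac⟩ := hav
  have hac' : a ≠ c := hca.symm
  refine (T.bind (T_mapN N (fun _ => 0) (he _ (Mem.EqOff.refl M)) hN (by simp) (by simp)
    (by simp [hae, NExp.avoids]) (by simp [NExp.size]; omega)) ?_).mono
    (W := 200 * (N + 1) + (400 + K * (400 + 200 * (N + 1))))
    (D := 200 + (400 + K * (400 + 200))) (by ring_nf; omega) (by omega) fun _ h => h
  rintro _ rfl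
  refine (T_forTo (fun j M' => Mem.EqOff [c, a] [] M M' ∧ ∀ k < N, M'.nat a k ≤ K ∧
    ∀ i < j, act k i → act k (M'.nat a k) ∧ M'.nat a k < j ∧ i ≤ M'.nat a k) K _ _ hK hs'
    (fun j M' h => he' M' h.1) ?_ ?_ ?_).mono le_rfl le_rfl fun _ h => h
  · rintro j M' f ⟨h₁, h₂⟩
    exact ⟨h₁.setNA (by simp) f, by simpa [hac'] using h₂⟩
  · rintro j M' hj ⟨h₁, h₂⟩ hc
    refine (T_scatN N (fun k => act k j) (fun k => k) (fun _ => j) (he M' h₁) hN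
      (fun k hk => by rw [hb M' h₁ k hk, hc]) (by simp) (by simp [hc])
      (fun k hk _ => by omega) (fun k hk _ => by omega) (fun k _ _ l _ _ h => h)
      (by simp [hae, hab, hac]; simp [NExp.avoids]) (by simp [NExp.size]; omega)).mono le_rfl le_rfl ?_
    rintro _ ⟨f, rfl, hf, hf'⟩
    simp only [Mem.setNA_nat, if_neg hca, if_true]
    refine ⟨hc, h₁.setNA (by simp) f, fun k hk => ?_⟩
    by_cases h : act k j
    · rw [hf k hk h]
      exact ⟨hj.le, fun i hi _ => ⟨h, by omega, by omega⟩⟩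
    · rw [hf' k (by rintro l hl hl' rfl; exact h hl')]
      refine ⟨(h₂ k hk).1, fun i hi hi' => ?_⟩
      have hij : i ≠ j := by rintro rfl; exact h hi'
      obtain ⟨h₃, h₄, h₅⟩ := (h₂ k hk).2 i (by omega) hi'
      exact ⟨h₃, by omega, h₅⟩
  · refine ⟨(Mem.EqOff.refl M).setNA (by simp) _, fun k hk => ⟨by simp [hk], by simp⟩⟩

/-- For every `k < e` sum up `v` over the values `j < e'` of the counter with `b`. -/
abbrev accR (e e' : NExp) (c a t : ℕ) (b : BExp) (v : RExp) : Cmd :=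
  mapR e a (RExp.ofNat (cn 0)) ;;
    Cmd.forTo c e' (mapR e t (rl a ix) ;; scatR e b a ix (RExp.add (rl t ix) v))

open Classical in
theorem T_accR {e e' : NExp} {c a t : ℕ} {b : BExp} {v : RExp} {M : Mem} (N K : ℕ)
    (act : ℕ → ℕ → Prop) (val : ℕ → ℕ → ℝ) (hN : N ≤ B) (hK : K ≤ B)
    (he : ∀ M', Mem.EqOff [c] [a, t] M M' → e.eval (st M') = N)
    (he' : ∀ M', Mem.EqOff [c] [a, t] M M' → e'.eval (st M') = K)
    (hb : ∀ M', Mem.EqOff [c] [a, t] M M' → M'.nat c 0 < K → ∀ k < N,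
      b.Holds (st1 M' k) ↔ act k (M'.nat c 0))
    (hv : ∀ M', Mem.EqOff [c] [a, t] M M' → M'.nat c 0 < K → ∀ k < N, act k (M'.nat c 0) →
      v.eval (st1 M' k) = val k (M'.nat c 0))
    (hat : a ≠ t)
    (hav : (e.avoids (Arr.real a) && e.avoids (Arr.real t) && b.avoids (Arr.real a) &&
      v.avoids (Arr.real a)) = true)
    (hs : e.size + b.size + v.size ≤ 150) (hs' : e'.size ≤ 100) :
    T B (accR e e' c a t b v) M (1000 * ((K + 1) * (N + 1))) (1000 * (K + 1)) (fun M' =>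
      Mem.EqOff [c] [a, t] M M' ∧ ∀ k < N, M'.real a k =
        ∑ j ∈ Finset.range K, if act k j then val k j else 0) := by
  simp only [Bool.and_eq_true] at hav
  obtain ⟨⟨⟨hae, hte⟩, hab⟩, hav⟩ := hav
  refine (T.bind (T_mapR N (fun _ => 0) (he _ (Mem.EqOff.refl M)) hN (by simp)
    (by simp [hae, NExp.avoids, RExp.avoids]) (by simp [NExp.size, RExp.size]; omega)) ?_).mono
    (W := 200 * (N + 1) + (400 + K * (400 + (200 * (N + 1) + 200 * (N + 1)))))
    (D := 200 + (400 + K * (400 + (200 + 200)))) (by ring_nf; omega) (by omega) fun _ h => h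
  rintro _ rfl
  refine (T_forTo (fun j M' => Mem.EqOff [c] [a, t] M M' ∧ ∀ k < N, M'.real a k =
        ∑ i ∈ Finset.range j, if act k i then val k i else 0) K _ _ hK hs'
    (fun j M' h => he' M' h.1) ?_ ?_ ?_).mono le_rfl le_rfl fun _ h => h
  · rintro j M' f ⟨h₁, h₂⟩
    exact ⟨h₁.setNA (by simp) f, by simpa using h₂⟩
  · rintro j M' hj ⟨h₁, h₂⟩ hc
    refine T.bind (T_mapR N (M'.real a) (he M' h₁) hN (by simp)
      (by simp [hte, NExp.avoids, RExp.avoids, hat.symm]) (by simp [NExp.size, RExp.size]; omega)) ?_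
    rintro _ rfl
    have h₁' := h₁.setRA (a := t) (by simp) fun j => if j < N then M'.real a j else M'.real t j
    refine (T_scatR N (fun k => act k j) (fun k => k) (fun k => M'.real a k + val k j)
      (he _ h₁') hN (fun k hk => by rw [hb _ h₁' (by simpa [hc]) k hk]; simp [hc]) (by simp)
      (fun k hk hk' => ?_) (fun k hk _ => by omega) (fun k _ _ l _ _ h => h)
      (by simp [hae, hab, hav, NExp.avoids, RExp.avoids, hat])
      (by simp [NExp.size, RExp.size]; omega)).mono le_rfl le_rfl ?_
    · have := hv _ h₁' (by simpa [hc]) k hk (by simpa [hc] using hk')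
      simp only [RExp.eval, this]
      simp [hk, hc]
    rintro _ ⟨f, rfl, hf, hf'⟩
    refine ⟨by simpa using hc, h₁'.setRA (by simp) f, fun k hk => ?_⟩
    simp only [Mem.setRA_real, if_true]
    rw [Finset.sum_range_succ, ← h₂ k hk]
    by_cases h : act k j
    · rw [hf k hk h, if_pos h]
    · rw [hf' k (by rintro l hl hl' rfl; exact h hl'), if_neg h]
      simp [hat]
  · exact ⟨(Mem.EqOff.refl M).setRA (by simp) _, fun k hk => by simp [hk]⟩

/-! ## Reading the trees -/

theorem Cons.sum_eq {L : ℕ} {M : Mem} (h : Cons L M) : ∀ l ≤ L, ∀ u,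
    M.real aSum (node L l u) =
      ∑ i ∈ Finset.range (2 ^ l), M.real aSum (node L 0 (u * 2 ^ l + i)) := by
  intro l
  induction l with
  | zero => intro _ u; simp
  | succ l ih =>
    intro hl u
    rw [(h l (by omega) u).1, ih (by omega), ih (by omega), pow_succ, mul_two,
      Finset.sum_range_add]
    congr 1 <;> refine Finset.sum_congr rfl fun i _ => ?_ <;> congr 2 <;> ring

theorem Cons.lt_max_iff {L : ℕ} {M : Mem} (h : Cons L M) {t : ℝ} : ∀ l ≤ L, ∀ u,
    t < M.real aMax (node L l u) ↔
      ∃ i < 2 ^ l, t < M.real aMax (node L 0 (u * 2 ^ l + i)) := by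
  intro l
  induction l with
  | zero => intro _ u; simp
  | succ l ih =>
    intro hl u
    rw [(h l (by omega) u).2, _root_.lt_max_iff, ih (by omega), ih (by omega), pow_succ]
    have e₁ : ∀ i, 2 * u * 2 ^ l + i = u * (2 ^ l * 2) + i := fun i => by ring
    have e₂ : ∀ i, (2 * u + 1) * 2 ^ l + i = u * (2 ^ l * 2) + (2 ^ l + i) := fun i => by ring
    simp only [e₁, e₂]
    constructor
    · rintro (⟨i, hi, h⟩ | ⟨i, hi, h⟩)
      · exact ⟨i, by omega, h⟩
      · exact ⟨2 ^ l + i, by omega, h⟩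
    · rintro ⟨i, hi, h⟩
      by_cases hi' : i < 2 ^ l
      · exact Or.inl ⟨i, hi', h⟩
      · obtain ⟨k, rfl⟩ := Nat.exists_eq_add_of_le (not_lt.1 hi')
        exact Or.inr ⟨k, by omega, h⟩

variable {P : Lay} {M : Mem}

/-- The sum over bucket `b` in column `c`. -/
noncomputable def root (P : Lay) (M : Mem) (c b : ℕ) : ℝ :=
  M.real aSum (node P.L P.L (c * P.NB + b))

theorem root_eq (hP : P.Ok) (hC : Cons P.L M) (hSL : SumLeaves P M fun _ => True) {c b : ℕ}
    (hc : c < P.n + 2) (hb : b < P.NB) :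
    root P M c b = ∑ i ∈ Finset.range P.m, if M.nat aBk i = b then leafVal P M c i else 0 := by
  rw [root, hC.sum_eq _ le_rfl]
  refine (Finset.sum_subset_zero_on_sdiff (Finset.range_mono hP.hmL) ?_ ?_).symm
  · intro i hi
    simp only [Finset.mem_sdiff, Finset.mem_range] at hi
    exact (hSL c hc b hb i hi.1).2 fun h => hi.2 h.1
  · intro i hi
    rw [Finset.mem_range] at hi
    obtain ⟨h₁, h₂⟩ := hSL c hc b hb i (hi.trans_le hP.hmL)
    split_ifs with h
    · exact (h₁ ⟨hi, trivial, h⟩).symm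
    · exact (h₂ fun h' => h h'.2.2).symm

theorem sum_root_mul (hP : P.Ok) (hC : Cons P.L M) (hSL : SumLeaves P M fun _ => True)
    (hbk : ∀ i < P.m, M.nat aBk i < P.NB) {c : ℕ} (hc : c < P.n + 2) (f : ℕ → ℝ) :
    ∑ b ∈ Finset.range P.NB, root P M c b * f b =
      ∑ i ∈ Finset.range P.m, leafVal P M c i * f (M.nat aBk i) := by
  rw [Finset.sum_congr rfl fun b hb => by rw [root_eq hP hC hSL hc (Finset.mem_range.1 hb)]]
  simp only [Finset.sum_mul]
  rw [Finset.sum_comm]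
  refine Finset.sum_congr rfl fun i hi => ?_
  rw [Finset.sum_eq_single (M.nat aBk i)]
  · simp
  · intro b _ hb; rw [if_neg hb.symm, zero_mul]
  · intro h; exact absurd (Finset.mem_range.2 (hbk i (Finset.mem_range.1 hi))) h

end PrimalGradient

namespace PrimalGradient

variable {P : Lay} {M : Mem} {N : ℕ} {r : ℕ → ℕ} {last : ℕ → ℝ}

/-! ## Changing the maintained approximation -/

/-- The entries of the previously returned vector, for the indices in `J`. -/
abbrev aOld : ℕ := 24

/-- The new values for the list of rows. -/
abbrev tX : ℕ := 34
abbrev tOld : ℕ := 35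

/-- The list `J` holds the entries in which the maintained vector differs from `last`. -/
def JInv (P : Lay) (M : Mem) (last : ℕ → ℝ) : Prop :=
  JOk P M ∧ ∀ i < P.m,
    (JMem M i → M.real aOld i = last i ∧ M.real outXbar i ≠ last i) ∧
    (¬ JMem M i → M.real outXbar i = last i)

theorem JInv.eqOff {M' : Mem} {NS RS : List ℕ} (h : JInv P M last) (hE : Mem.EqOff NS RS M M')
    (hN : ∀ a ∈ [outJ, outLen, aPos], a ∉ NS := by decide)
    (hR : ∀ a ∈ [aOld, outXbar], a ∉ RS := by decide) : JInv P M' last := by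
  have e₁ : M'.nat outJ = M.nat outJ := hE.1 _ (hN _ (by simp))
  have e₂ : M'.nat outLen = M.nat outLen := hE.1 _ (hN _ (by simp))
  have e₃ : M'.nat aPos = M.nat aPos := hE.1 _ (hN _ (by simp))
  have e₄ : M'.real aOld = M.real aOld := hE.2 _ (hR _ (by simp))
  have e₅ : M'.real outXbar = M.real outXbar := hE.2 _ (hR _ (by simp))
  simpa only [JInv, JOk, JMem, e₁, e₂, e₃, e₄, e₅] using h

abbrev inJE : BExp :=
  BExp.and (BExp.natLT (ld aPos row) (sc outLen)) (BExp.natEq (ld outJ (ld aPos row)) row)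

/-- Set the entries of the rows of the list to the values `tX`. -/
def touch : Cmd :=
  mapN (sc inLen) jL (cn 0) ;;
  scatN (sc inLen) inJE jL ix (cn 1) ;;
  mapR (sc inLen) tOld (rl outXbar row) ;;
  scatR (sc inLen) (BExp.natEq (ld jL ix) (cn 1)) tOld ix (rl aOld row) ;;
  scatR (sc inLen) tt aOld row (rl tOld ix) ;;
  scatR (sc inLen) tt outXbar row (rl tX ix) ;;
  scatR (sc inLen) tt aYS row (rl aY (ld aBk row)) ;;
  mapN (sc inLen) jW (cn 0) ;;
  scatN (sc inLen) (BExp.not (BExp.realEq (rl tX ix) (rl tOld ix))) jW ix (cn 1) ;;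
  jDelete ;;
  jInsert

abbrev touchN : List ℕ := jL :: jW :: jN
abbrev touchR : List ℕ := [tOld, aOld, outXbar, aYS]

theorem touch_spec (hP : P.Ok) (hS : Stat P M) (hr : Rows P M N r) (hJ : JInv P M last) :
    T P.B touch M (60000 * ((N + 1) * (P.L + 3))) (60000 * (P.L + 3)) (fun M' =>
      Mem.EqOff touchN touchR M M' ∧ JInv P M' last ∧
      (∀ k < N, M'.real outXbar (r k) = M.real tX k ∧
        M'.real aYS (r k) = M.real aY (M.nat aBk (r k))) ∧
      ∀ i, ¬ InRows N r i → M'.real outXbar i = M.real outXbar i ∧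
        M'.real aYS i = M.real aYS i) := by
  have hone := hP.one_le
  have hNB : N ≤ P.B := hr.le.trans hP.m_le
  have hrB : ∀ k < N, r k ≤ P.B := fun k hk => (hr.lt k hk).le.trans hP.m_le
  have hinj : ∀ k < N, True → ∀ l < N, True → r k = r l → k = l :=
    fun k hk _ l hl _ h => hr.inj k hk l hl h
  have h3 : (N + 1) * 3 ≤ (N + 1) * (P.L + 3) := Nat.mul_le_mul_left _ (by omega)
  unfold touch
  refine T.next (T_mapN N (fun _ => 0) (by simp [hr.len]) hNB (by simp) (by simp) (by decide)
    (by decide)) ?_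
  rintro _ rfl
  refine T.next (T_scatN N (fun k => JMem M (r k)) (fun k => k) (fun _ => 1)
    (by simp [hr.len]) hNB (fun k hk => ?_) (by simp) (by simp) (fun k hk _ => by omega)
    (fun k hk _ => hone) (fun k _ _ l _ _ h => h) (by decide) (by decide)) ?_
  · rw [← hJ.1.mem_iff]; simp [hr.idx k hk]
  rintro _ ⟨fL, rfl, hfL, hfL'⟩
  have hL : ∀ k < N, fL k ≤ 1 ∧ (fL k = 1 ↔ JMem M (r k)) := by
    intro k hk
    by_cases h : JMem M (r k)
    · rw [hfL k hk h]; simp [h]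
    · rw [hfL' k (by rintro l hl hl' rfl; exact h hl')]; simp [hk, h]
  refine T.next (T_mapR N (fun k => M.real outXbar (r k)) (by simp [hr.len]) hNB
    (fun k hk => by simp [hr.idx k hk]) (by decide) (by decide)) ?_
  rintro _ rfl
  refine T.next (T_scatR N (fun k => JMem M (r k)) (fun k => k) (fun k => M.real aOld (r k))
    (by simp [hr.len]) hNB (fun k hk => by rw [← (hL k hk).2]; simp) (by simp)
    (fun k hk _ => by simp [hr.idx k hk]) (fun k hk _ => by omega)
    (fun k _ _ l _ _ h => h) (by decide) (by decide)) ?_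
  rintro _ ⟨fO, rfl, hfO, hfO'⟩
  have hO : ∀ k < N, fO k = last (r k) := by
    intro k hk
    by_cases h : JMem M (r k)
    · rw [hfO k hk h, ((hJ.2 _ (hr.lt k hk)).1 h).1]
    · rw [hfO' k (by rintro l hl hl' rfl; exact h hl')]
      simpa [hk] using (hJ.2 _ (hr.lt k hk)).2 h
  refine T.next (T_scatR N (fun _ => True) r (fun k => last (r k))
    (by simp [hr.len]) hNB (by simp) (fun k hk _ => by simp [hr.idx k hk])
    (fun k hk _ => by simp [hO k hk]) (fun k hk _ => hrB k hk) hinj (by decide) (by decide)) ?_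
  rintro _ ⟨fA, rfl, hfA, hfA'⟩
  refine T.next (T_scatR N (fun _ => True) r (M.real tX)
    (by simp [hr.len]) hNB (by simp) (fun k hk _ => by simp [hr.idx k hk])
    (fun k hk _ => by simp) (fun k hk _ => hrB k hk) hinj (by decide) (by decide)) ?_
  rintro _ ⟨fX, rfl, hfX, hfX'⟩
  refine T.next (T_scatR N (fun _ => True) r (fun k => M.real aY (M.nat aBk (r k)))
    (by simp [hr.len]) hNB (by simp) (fun k hk _ => by simp [hr.idx k hk])
    (fun k hk _ => by simp [hr.idx k hk]) (fun k hk _ => hrB k hk) hinj (by decide)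
    (by decide)) ?_
  rintro _ ⟨fY, rfl, hfY, hfY'⟩
  refine T.next (T_mapN N (fun _ => 0) (by simp [hr.len]) hNB (by simp) (by simp) (by decide)
    (by decide)) ?_
  rintro _ rfl
  refine T.next (T_scatN N (fun k => M.real tX k ≠ last (r k)) (fun k => k) (fun _ => 1)
    (by simp [hr.len]) hNB (fun k hk => by simp [hO k hk]) (by simp) (by simp)
    (fun k hk _ => by omega)
    (fun k hk _ => hone) (fun k _ _ l _ _ h => h) (by decide) (by decide)) ?_
  rintro _ ⟨fW, rfl, hfW, hfW'⟩
  have hW : ∀ k < N, fW k ≤ 1 ∧ (fW k = 1 ↔ M.real tX k ≠ last (r k)) := by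
    intro k hk
    by_cases h : M.real tX k ≠ last (r k)
    · rw [hfW k hk h]; simp [h]
    · rw [hfW' k (by rintro l hl hl' rfl; exact h hl')]
      have : M.real tX k = last (r k) := not_not.1 h
      simp [hk, this]
  simp only [Mem.setRA_real, Mem.setNA_real, if_true, if_false, show (aYS = outXbar) = False by simp,
    show (aYS = aOld) = False by simp, show (aYS = tOld) = False by simp,
    show (outXbar = aOld) = False by simp, show (outXbar = tOld) = False by simp,
    show (aOld = tOld) = False by simp] at hfX' hfY' hfA'
  generalize hM₀ : (((((((((M.setNA jL fun j => if j < N then 0 else M.nat jL j).setNA jL fL).setRA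
    tOld _).setRA tOld fO).setRA aOld fA).setRA outXbar fX).setRA aYS fY).setNA jW _).setNA jW fW)
    = M₀
  have hE₀ : Mem.EqOff [jL, jW] touchR M M₀ := by
    rw [← hM₀]
    exact (((((((((Mem.EqOff.refl M).setNA (by decide) _).setNA (by decide) _).setRA
      (by decide) _).setRA (by decide) _).setRA (by decide) _).setRA (by decide) _).setRA
      (by decide) _).setNA (by decide) _).setNA (by decide) _
  have e₁ : M₀.nat outJ = M.nat outJ := hE₀.1 _ (by decide)
  have e₂ : M₀.nat outLen = M.nat outLen := hE₀.1 _ (by decide)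
  have e₃ : M₀.nat aPos = M.nat aPos := hE₀.1 _ (by decide)
  have eL : M₀.nat jL = fL := by rw [← hM₀]; simp
  have eW : M₀.nat jW = fW := by rw [← hM₀]; simp
  have eA : M₀.real aOld = fA := by rw [← hM₀]; simp
  have eX : M₀.real outXbar = fX := by rw [← hM₀]; simp
  have eY : M₀.real aYS = fY := by rw [← hM₀]; simp
  have hm₀ : ∀ i, JMem M₀ i ↔ JMem M i := fun i => by simp only [JMem, e₁, e₂]
  refine T.next (jDelete_spec hP (hS.eqOff hE₀) (hr.eqOff hE₀)
    (by simpa only [JOk, e₁, e₂, e₃] using hJ.1)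
    (fun k hk => by rw [eL, hm₀]; exact hL k hk)) ?_
  rintro M₁ ⟨hE₁, hJ₁, hm₁⟩
  have eW₁ : M₁.nat jW = fW := (hE₁.1 _ (by decide)).trans eW
  refine (jInsert_spec hP ((hS.eqOff hE₀).eqOff hE₁) ((hr.eqOff hE₀).eqOff hE₁) hJ₁
    (fun k hk => by rw [eW₁]; exact (hW k hk).1)
    (fun k hk h => ((hm₁ _).1 h).2 ⟨k, hk, rfl⟩)).mono (by omega) (by omega) ?_
  rintro M₂ ⟨hE₂, hJ₂, hm₂⟩
  have eA₂ : M₂.real aOld = fA := (hE₂.2 _ (by decide)).trans ((hE₁.2 _ (by decide)).trans eA)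
  have eX₂ : M₂.real outXbar = fX := (hE₂.2 _ (by decide)).trans ((hE₁.2 _ (by decide)).trans eX)
  have eY₂ : M₂.real aYS = fY := (hE₂.2 _ (by decide)).trans ((hE₁.2 _ (by decide)).trans eY)
  have hout : ∀ {i}, ¬ InRows N r i → ∀ k < N, True → r k ≠ i := fun h k hk _ e => h ⟨k, hk, e⟩
  refine ⟨?_, ⟨hJ₂, fun i hi => ?_⟩, fun k hk => ?_, fun i hi => ?_⟩
  · exact ((hE₀.mono (by decide) (by decide)).trans (hE₁.mono (by decide) (by decide))).trans
      (hE₂.mono (by decide) (by decide))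
  · rw [hm₂, hm₁, hm₀, eW₁, eA₂, eX₂]
    by_cases hin : InRows N r i
    · obtain ⟨k, hk, rfl⟩ := hin
      have hex : (∃ k' < N, fW k' = 1 ∧ r k' = r k) ↔ M.real tX k ≠ last (r k) := by
        rw [← (hW k hk).2]
        constructor
        · rintro ⟨k', hk', h, he⟩
          rwa [hr.inj k' hk' k hk he] at h
        · exact fun h => ⟨k, hk, h, rfl⟩
      have hnot : ¬ (JMem M (r k) ∧ ¬ InRows N r (r k)) := fun h => h.2 ⟨k, hk, rfl⟩
      rw [or_iff_right hnot, hex, hfA k hk trivial, hfX k hk trivial]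
      exact ⟨fun h => ⟨rfl, h⟩, fun h => not_not.1 h⟩
    · have hex : ¬ ∃ k' < N, fW k' = 1 ∧ r k' = i := by
        rintro ⟨k', hk', -, he⟩
        exact hin ⟨k', hk', he⟩
      rw [or_iff_left hex, and_iff_left hin, hfA' i (hout hin), hfX' i (hout hin)]
      exact hJ.2 i hi
  · rw [eX₂, eY₂]
    exact ⟨hfX k hk trivial, hfY k hk trivial⟩
  · rw [eX₂, eY₂]
    exact ⟨hfX' i (hout hi), hfY' i (hout hi)⟩

/-- Forget the list `J` if it has been returned. -/
def clear : Cmd :=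
  Cmd.ite (BExp.natEq (sc aFresh) (cn 1)) (Cmd.storeN outLen (cn 0) (cn 0)) Cmd.skip ;;
  Cmd.storeN aFresh (cn 0) (cn 0)

/-- Between two calls of `querySum` the list `J` holds the changed entries; it has been returned
if the flag `aFresh` is set. -/
def JState (P : Lay) (M : Mem) (last : ℕ → ℝ) : Prop :=
  if M.nat aFresh 0 = 1 then ∀ i < P.m, M.real outXbar i = last i else JInv P M last

theorem clear_spec {B : ℕ} (h : JState P M last) :
    T B clear M 1000 1000 (fun M' => Mem.EqOff [outLen, aFresh] [] M M' ∧ M'.nat aFresh 0 = 0 ∧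
      JInv P M' last) := by
  unfold clear
  refine T.next (T_ite (W := 200) (D := 200) (Q := fun M' => Mem.EqOff [outLen] [] M M' ∧
    JInv P M' last) (by decide) (fun hb => ?_) fun hb => ?_) ?_
  · have hb' : M.nat aFresh 0 = 1 := hb
    rw [JState, if_pos hb'] at h
    refine (T_storeN (by simp) (by simp) (by decide)).mono le_rfl le_rfl ?_
    rintro _ rfl
    refine ⟨(Mem.EqOff.refl M).setNA (by decide) _, ?_, ?_⟩
    · intro k hk; simp at hk
    · intro i hi
      have : ∀ f, ¬ JMem (M.setNA outLen (Function.update f 0 0)) i := by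
        rintro f ⟨k, hk, -⟩; simp at hk
      simp only [NExp.eval]
      exact ⟨fun h => absurd h (this _), fun _ => h i hi⟩
  · have hb' : ¬ M.nat aFresh 0 = 1 := hb
    rw [JState, if_neg hb'] at h
    refine T_skip.mono (by omega) (by omega) ?_
    rintro _ rfl
    exact ⟨Mem.EqOff.refl _, h⟩
  · rintro M₁ ⟨hE₁, hJ₁⟩
    refine (T_storeN (by simp) (by simp) (by decide)).mono (by omega) (by omega) ?_
    rintro _ rfl
    have hE := (Mem.EqOff.refl (NS := [aFresh]) (RS := []) M₁).setNA (a := aFresh) (by decide)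
      (Function.update (M₁.nat aFresh) 0 0)
    refine ⟨(hE₁.mono (by decide) (by decide)).setNA (by decide) _, by simp, ?_⟩
    exact hJ₁.eqOff hE

end PrimalGradient

namespace PrimalGradient

variable {P : Lay} {M : Mem} {N : ℕ} {r : ℕ → ℕ} {last X : ℕ → ℝ} {Pl : ℕ → Prop}

/-! ## The invariant of the data structure -/

/-- The memory represents the exact sum `X`; the keys of the rows outside `Pl` may be wrong. -/
structure Core (P : Lay) (M : Mem) (X : ℕ → ℝ) (Pl : ℕ → Prop) : Prop where
  stat : Stat P M
  cons : Cons P.L M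
  bk_lt : ∀ i < P.m, M.nat aBk i < P.NB
  sum : SumLeaves P M fun _ => True
  max : MaxLeaves P M Pl fun _ => True
  ys_le : ∀ i < P.m, M.real aYS i ≤ M.real aY (M.nat aBk i)
  exact : ∀ i < P.m,
    M.real outXbar i + M.real inG i * (M.real aY (M.nat aBk i) - M.real aYS i) = X i
  weight : ∀ i < P.m, 0 ≤ P.ε * M.real inW i
  bz : ∀ i < P.m, |1 / 2 + (M.nat aBk i / P.NT : ℕ) * P.ε - M.real inZ i| ≤ P.ε
  bt : ∀ i < P.m, Real.exp (-P.ε) * M.real inTau i ≤ P.tb (M.nat aBk i) ∧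
    P.tb (M.nat aBk i) ≤ Real.exp P.ε * M.real inTau i

theorem Cons.eqOff {L : ℕ} {M' : Mem} {NS RS : List ℕ} (h : Cons L M)
    (hE : Mem.EqOff NS RS M M') (hR : ∀ a ∈ [aSum, aMax], a ∉ RS := by decide) : Cons L M' := by
  intro l hl u
  have := h l hl u
  simpa only [ConsAt, hE.2 aSum (hR _ (by simp)), hE.2 aMax (hR _ (by simp))] using this

theorem Core.eqOff {M' : Mem} {NS RS : List ℕ} (h : Core P M X Pl) (hE : Mem.EqOff NS RS M M')
    (hN : ∀ a ∈ [inDim, inPtr, inCol, aL, aP, aS, aNT, aNB, aBk], a ∉ NS := by decide)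
    (hR : ∀ a ∈ [inScal, inVal, aX, aT, aR, aSum, aMax, aYS, aY, outXbar, inG, inTau, inZ, inW],
      a ∉ RS := by decide) : Core P M' X Pl := by
  have e₁ : M'.nat aBk = M.nat aBk := hE.1 _ (hN _ (by simp))
  have f : ∀ a ∈ [inScal, inVal, aX, aT, aR, aSum, aMax, aYS, aY, outXbar, inG, inTau, inZ, inW],
    M'.real a = M.real a := fun a ha => hE.2 _ (hR a ha)
  have fG := f inG (by simp)
  have fY := f aY (by simp)
  have fYS := f aYS (by simp)
  have fX := f outXbar (by simp)
  have fT := f inTau (by simp)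
  have fZ := f inZ (by simp)
  have fW := f inW (by simp)
  have fS := f aSum (by simp)
  have fM := f aMax (by simp)
  constructor
  · exact h.stat.eqOff hE (fun a ha => hN a (by simp at ha ⊢; tauto))
      (fun a ha => hR a (by simp at ha ⊢; tauto))
  · exact h.cons.eqOff hE (fun a ha => hR a (by simp at ha ⊢; tauto))
  · rw [e₁]; exact h.bk_lt
  · simpa only [SumLeaves, leafVal, e₁, fG, fZ, fS] using h.sum
  · simpa only [MaxLeaves, key, e₁, fG, fW, fM, fYS] using h.max
  · rw [e₁, fYS, fY]; exact h.ys_le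
  · rw [e₁, fYS, fY, fG, fX]; exact h.exact
  · rw [fW]; exact h.weight
  · rw [e₁, fZ]; exact h.bz
  · rw [e₁, fT]; exact h.bt

/-- The exact sum for the row `e`. -/
abbrev exactE (e : NExp) : RExp :=
  RExp.add (rl outXbar e) (RExp.mul (rl inG e) (RExp.sub (rl aY (ld aBk e)) (rl aYS e)))

theorem Core.eval_exactE (h : Core P M X Pl) {σ : State} (hσ : σ.mem = M) {e : NExp} {i : ℕ}
    (he : e.eval σ = i) (hi : i < P.m) : (exactE e).eval σ = X i := by
  rw [← h.exact i hi]
  simp [he, hσ]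

/-- After `touch` the memory represents the new exact sum, except for the keys. -/
theorem touch_core (hP : P.Ok) (hr : Rows P M N r) (hJ : JInv P M last)
    (hC : Core P M X fun _ => True) {X' : ℕ → ℝ} (hX : ∀ k < N, M.real tX k = X' (r k))
    (hX' : ∀ i, ¬ InRows N r i → X' i = X i) :
    T P.B touch M (60000 * ((N + 1) * (P.L + 3))) (60000 * (P.L + 3)) (fun M' =>
      Mem.EqOff touchN touchR M M' ∧ JInv P M' last ∧ Core P M' X' (fun i => ¬ InRows N r i) ∧
      (∀ i, InRows N r i → M'.real outXbar i = X' i) ∧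
      ∀ i, ¬ InRows N r i → M'.real outXbar i = M.real outXbar i) := by
  refine (touch_spec hP hC.stat hr hJ).mono le_rfl le_rfl ?_
  rintro M' ⟨hE, hJ', hin, hout⟩
  have e₁ : M'.nat aBk = M.nat aBk := hE.1 _ (by decide)
  have fG : M'.real inG = M.real inG := hE.2 _ (by decide)
  have fY : M'.real aY = M.real aY := hE.2 _ (by decide)
  have fT : M'.real inTau = M.real inTau := hE.2 _ (by decide)
  have fZ : M'.real inZ = M.real inZ := hE.2 _ (by decide)
  have fW : M'.real inW = M.real inW := hE.2 _ (by decide)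
  have fS : M'.real aSum = M.real aSum := hE.2 _ (by decide)
  have fM : M'.real aMax = M.real aMax := hE.2 _ (by decide)
  refine ⟨hE, hJ', ⟨hC.stat.eqOff hE, hC.cons.eqOff hE, by rw [e₁]; exact hC.bk_lt, ?_, ?_, ?_, ?_,
    by rw [fW]; exact hC.weight, by rw [e₁, fZ]; exact hC.bz, by rw [e₁, fT]; exact hC.bt⟩, ?_,
    fun i hi => (hout i hi).1⟩
  · simpa only [SumLeaves, leafVal, e₁, fG, fZ, fS] using hC.sum
  · refine (hC.max.mono (Pl' := fun i => ¬ InRows N r i) fun _ _ => trivial).congr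
      (fun _ _ => trivial) fM (fun i _ _ => by rw [e₁]) (fun i _ _ => by rw [fG])
      (fun i _ _ => by rw [fW]) fun i _ hi => (hout i hi).2
  · intro i hi
    rw [e₁, fY]
    by_cases h : InRows N r i
    · obtain ⟨k, hk, rfl⟩ := h
      rw [(hin k hk).2]
    · rw [(hout i h).2]; exact hC.ys_le i hi
  · intro i hi
    rw [e₁, fY, fG]
    by_cases h : InRows N r i
    · obtain ⟨k, hk, rfl⟩ := h
      rw [(hin k hk).2, (hin k hk).1, hX k hk, sub_self, mul_zero, add_zero]
    · rw [(hout i h).2, (hout i h).1, hX' i h]; exact hC.exact i hi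
  · rintro i ⟨k, hk, rfl⟩
    rw [(hin k hk).1, hX k hk]

theorem keyRows_core (hP : P.Ok) (hr : Rows P M N r)
    (hC : Core P M X fun i => ¬ InRows N r i) :
    T P.B keyRows M (10000 * ((N + 1) * (P.L + 3))) (10000 * (P.L + 3))
      (fun M' => Mem.EqOff treeN treeR M M' ∧ Core P M' X fun _ => True) := by
  refine (keyRows_spec hP hC.stat hr hC.bk_lt hC.cons hC.sum hC.max).mono le_rfl le_rfl ?_
  rintro M' ⟨hE, hC', hS', hM'⟩
  have e₁ : M'.nat aBk = M.nat aBk := hE.1 _ (by decide)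
  have fG : M'.real inG = M.real inG := hE.2 _ (by decide)
  have fY : M'.real aY = M.real aY := hE.2 _ (by decide)
  have fYS : M'.real aYS = M.real aYS := hE.2 _ (by decide)
  have fX : M'.real outXbar = M.real outXbar := hE.2 _ (by decide)
  have fT : M'.real inTau = M.real inTau := hE.2 _ (by decide)
  have fZ : M'.real inZ = M.real inZ := hE.2 _ (by decide)
  have fW : M'.real inW = M.real inW := hE.2 _ (by decide)
  exact ⟨hE, hC.stat.eqOff hE, hC', by rw [e₁]; exact hC.bk_lt, hS', hM',
    by rw [e₁, fYS, fY]; exact hC.ys_le, by rw [e₁, fYS, fY, fG, fX]; exact hC.exact,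
    by rw [fW]; exact hC.weight, by rw [e₁, fZ]; exact hC.bz, by rw [e₁, fT]; exact hC.bt⟩

/-- Set the entries of the rows of the list to the exact sum. -/
def syncRows : Cmd := mapR (sc inLen) tX (exactE row) ;; touch

theorem syncRows_core (hP : P.Ok) (hr : Rows P M N r) (hJ : JInv P M last)
    (hC : Core P M X fun _ => True) :
    T P.B syncRows M (61000 * ((N + 1) * (P.L + 3))) (61000 * (P.L + 3)) (fun M' =>
      Mem.EqOff touchN (tX :: touchR) M M' ∧ JInv P M' last ∧
      Core P M' X (fun i => ¬ InRows N r i) ∧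
      (∀ i, InRows N r i → M'.real outXbar i = X i) ∧
      ∀ i, ¬ InRows N r i → M'.real outXbar i = M.real outXbar i) := by
  have h3 : (N + 1) * 3 ≤ (N + 1) * (P.L + 3) := Nat.mul_le_mul_left _ (by omega)
  unfold syncRows
  refine T.next (T_mapR N (fun k => X (r k)) (by simp [hr.len]) (hr.le.trans hP.m_le)
    (fun k hk => hC.eval_exactE rfl (by simp [hr.idx k hk]) (hr.lt k hk)) (by decide)
    (by decide)) ?_
  rintro _ rfl
  generalize hM₁ : M.setRA tX _ = M₁
  have hE₁ : Mem.EqOff [] [tX] M M₁ := by rw [← hM₁]; exact (Mem.EqOff.refl M).setRA (by simp) _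
  refine (touch_core (X' := X) hP (hr.eqOff hE₁) (hJ.eqOff hE₁) (hC.eqOff hE₁)
    (fun k hk => by simp [← hM₁, hk]) (fun _ _ => rfl)).mono (by omega) (by omega) ?_
  rintro M₂ ⟨hE₂, h₁, h₂, h₃, h₄⟩
  refine ⟨(hE₁.mono (by decide) (by decide)).trans (hE₂.mono (by decide) (by decide)), h₁, h₂, h₃,
    fun i hi => ?_⟩
  rw [h₄ i hi, hE₁.2 _ (by decide)]

theorem lt_key_iff (hC : Core P M X fun _ => True) {i : ℕ} (hi : i < P.m) :
    Real.exp (-M.real aY (M.nat aBk i)) < key P M i ↔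
      P.ε * M.real inW i < |X i - M.real outXbar i| := by
  have h₁ := hC.ys_le i hi
  have h₂ := hC.weight i hi
  have h₃ : X i - M.real outXbar i =
      M.real inG i * (M.real aY (M.nat aBk i) - M.real aYS i) := by
    rw [← hC.exact i hi]; ring
  rw [h₃, abs_mul, abs_of_nonneg (sub_nonneg.2 h₁), key]
  split_ifs with hg
  · rw [hg, abs_zero, zero_mul]
    exact ⟨fun h => absurd (Real.exp_pos _) h.not_gt, fun h => absurd h h₂.not_gt⟩
  · have hg' : 0 < |M.real inG i| := abs_pos.2 hg
    rw [Real.exp_lt_exp, neg_lt_neg_iff, ← lt_sub_iff_add_lt', div_lt_iff₀' hg']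

/-! ## Finding the entries that are not accurate -/

abbrev eJ : ℕ := 64
abbrev eB : ℕ := 65
abbrev eT : ℕ := 36

/-- Keep the nodes `cmI` of level `l` with maximum above the threshold. -/
def filterNodes (e l : NExp) : Cmd :=
  mapN e cmF (cn 0) ;;
  scatN e (BExp.realLT (rs eT) (rl aMax (nd l (ld cmI ix)))) cmF ix (cn 1) ;;
  Cmd.storeN cmN (cn 0) e ;;
  compact

abbrev filterN : List ℕ := [cmF, cmN, scC, scT, scD, scJ, scN, cmO, cmC]

theorem filterNodes_spec (hP : P.Ok) (hS : Stat P M) {e l : NExp} {lv : ℕ} {f : ℕ → ℕ}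
    (he : ∀ M', Mem.EqOff [cmF] [] M M' → e.eval (st M') = N)
    (hl : ∀ M', Mem.EqOff [cmF] [] M M' → ∀ k, l.eval (st1 M' k) = lv)
    (hf : ∀ k < N, M.nat cmI k = f k) (hfB : ∀ k < N, f k ≤ P.B)
    (hinj : ∀ k < N, ∀ l < N, f k = f l → k = l) (hN : N ≤ 2 * 2 ^ P.L) {K : ℕ} (hNK : N ≤ K)
    (hav : (e.avoids (Arr.nat cmF) && l.avoids (Arr.nat cmF)) = true)
    (hs : e.size + l.size ≤ 100) :
    T P.B (filterNodes e l) M (11000 * ((K + 1) * (P.L + 3))) (11000 * (P.L + 3)) (fun M' =>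
      Mem.EqOff filterN [] M M' ∧ (seg (M'.nat cmO) (M'.nat cmC 0)).Nodup ∧
      ∀ u, u ∈ seg (M'.nat cmO) (M'.nat cmC 0) ↔
        ∃ k < N, f k = u ∧ M.real eT 0 < M.real aMax (node P.L lv u)) := by
  have hone := hP.one_le
  have h2L : 2 ^ (P.L + 2) = 4 * 2 ^ P.L := by rw [pow_add]; ring
  have hpow := hP.pow_le
  have hNB : N ≤ P.B := by omega
  have h3 : (K + 1) * 3 ≤ (K + 1) * (P.L + 3) := Nat.mul_le_mul_left _ (by omega)
  simp only [Bool.and_eq_true] at hav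
  have hE₁ := (Mem.EqOff.refl (NS := [cmF]) (RS := []) M).setNA (a := cmF) (by decide)
  unfold filterNodes
  refine T.next ((T_mapN N (fun _ => 0) (he _ (Mem.EqOff.refl M)) hNB (by simp) (by simp)
    (by simp [hav.1, NExp.avoids]) (by simp [NExp.size]; omega)).mono (W' := 200 * (K + 1))
    (by omega) le_rfl fun _ h => h) ?_
  rintro _ rfl
  have hE₁' := hE₁ fun j => if j < N then 0 else M.nat cmF j
  refine T.next ((T_scatN N (fun k => M.real eT 0 < M.real aMax (node P.L lv (f k)))
    (fun k => k) (fun _ => 1)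
    (he _ hE₁') hNB (fun k hk => by simp [hl _ hE₁', hf k hk, hS.L, node]) (by simp) (by simp)
    (fun k hk _ => by omega) (fun _ _ _ => hone) (fun _ _ _ _ _ _ h => h)
    (by simp [hav.1, hav.2, NExp.avoids, BExp.avoids, RExp.avoids])
    (by simp [NExp.size, BExp.size, RExp.size]; omega)).mono (W' := 200 * (K + 1))
    (by omega) le_rfl fun _ h => h) ?_
  rintro _ ⟨fF, rfl, hF, hF'⟩
  have hE₂ := hE₁'.setNA (a := cmF) (by decide) fF
  have hF₁ : ∀ k < N, fF k ≤ 1 ∧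
      (fF k = 1 ↔ M.real eT 0 < M.real aMax (node P.L lv (f k))) := by
    intro k hk
    by_cases h : M.real eT 0 < M.real aMax (node P.L lv (f k))
    · rw [hF k hk h]; simp [h]
    · rw [hF' k (by rintro l hl hl' rfl; exact h hl')]; simp [hk, h]
  refine T.next (T_storeN (by simp) (by rw [he _ hE₂]; exact hNB)
    (by simp [NExp.size]; omega)) ?_
  rintro _ rfl
  rw [he _ hE₂]
  refine (compact_lay hP (N := N) (K := K) (by simp) (by simp [hS.S])
    hNK hN (fun k hk => by simpa using (hF₁ k hk).1)
    (fun k hk => by simpa [hf k hk] using hfB k hk)).mono (by omega) (by omega) ?_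
  rintro M₂ ⟨hE₃, hseg⟩
  refine ⟨((hE₂.mono (by decide) (by decide)).setNA (by decide) _).trans
    (hE₃.mono (by decide) (by decide)), ?_, fun u => ?_⟩
  · rw [hseg]
    refine nodup_filter_map fun k hk _ l hl _ h => ?_
    simp [hf k hk, hf l hl] at h
    exact hinj k hk l hl h
  · rw [hseg, mem_filter_map]
    refine exists_congr fun k => and_congr_right fun hk => ?_
    simp only [Mem.setNA_nat, show (cmF = cmN) = False by simp, show (cmI = cmN) = False by simp,
      show (cmI = cmF) = False by simp, if_false, if_true, (hF₁ k hk).2, hf k hk]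
    constructor
    · rintro ⟨h, rfl⟩; exact ⟨rfl, h⟩
    · rintro ⟨rfl, h⟩; exact ⟨h, rfl⟩

/-- The root of the maximum tree of the bucket `eB`. -/
abbrev rootE : NExp := NExp.add (NExp.mul colN (sc aNB)) (sc eB)

/-- List the rows of the bucket `eB` that are not accurate. -/
def extract : Cmd :=
  Cmd.storeR eT (cn 0) (RExp.exp (RExp.sub (RExp.ofNat (cn 0)) (rl aY (sc eB)))) ;;
  mapN (cn 1) cmI rootE ;;
  filterNodes (cn 1) (sc aL) ;;
  Cmd.forTo eJ (sc aL) (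
    mapN (NExp.mul (cn 2) (sc cmC)) cmI (NExp.add (NExp.mul (cn 2) (ld cmO (NExp.div ix (cn 2))))
      (NExp.sub ix (NExp.mul (cn 2) (NExp.div ix (cn 2))))) ;;
    filterNodes (NExp.mul (cn 2) (sc cmC)) (NExp.sub (NExp.sub (sc aL) (sc eJ)) (cn 1))) ;;
  mapN (sc cmC) inIdx (NExp.sub (ld cmO ix) (NExp.mul rootE (sc aP))) ;;
  Cmd.storeN inLen (cn 0) (sc cmC)

abbrev extractN : List ℕ := [inIdx, inLen, eJ, cmI, cmF, cmN, scC, scT, scD, scJ, scN, cmO, cmC]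

open Classical in
/-- The rows of bucket `b` that are not accurate. -/
noncomputable def inaccurate (P : Lay) (M : Mem) (X : ℕ → ℝ) (b : ℕ) : Finset ℕ :=
  (Finset.range P.m).filter fun i =>
    M.nat aBk i = b ∧ P.ε * M.real inW i < |X i - M.real outXbar i|

theorem mem_inaccurate {b i : ℕ} : i ∈ inaccurate P M X b ↔
    i < P.m ∧ M.nat aBk i = b ∧ P.ε * M.real inW i < |X i - M.real outXbar i| := by
  simp [inaccurate]

theorem leaf_mem_inaccurate (hP : P.Ok) (hC : Core P M X fun _ => True) {b i : ℕ} (hb : b < P.NB)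
    (hi : i < 2 ^ P.L) : Real.exp (-M.real aY b) < M.real aMax (node P.L 0 (P.leaf P.n b i)) ↔
      i ∈ inaccurate P M X b := by
  obtain ⟨h₁, h₂⟩ := hC.max b hb i hi
  rw [mem_inaccurate]
  by_cases h : i < P.m ∧ M.nat aBk i = b
  · obtain ⟨him, rfl⟩ := h
    rw [h₁ ⟨him, trivial, rfl⟩, lt_key_iff hC him]
    tauto
  · rw [h₂ fun h' => h ⟨h'.1, h'.2.2⟩]
    exact ⟨fun h' => absurd (Real.exp_pos _) h'.not_gt, fun h' => absurd ⟨h'.1, h'.2.1⟩ h⟩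

theorem extract_spec (hP : P.Ok) (hC : Core P M X fun _ => True) {b : ℕ} (hb : b < P.NB)
    (hM : M.nat eB 0 = b) :
    T P.B extract M (30000 * (((inaccurate P M X b).card + 1) * ((P.L + 3) * (P.L + 3))))
      (30000 * ((P.L + 3) * (P.L + 3))) (fun M' =>
      Mem.EqOff extractN [eT] M M' ∧ ∃ E r, Rows P M' E r ∧
        (∀ i, InRows E r i ↔ i ∈ inaccurate P M X b) ∧ E ≤ (inaccurate P M X b).card) := by
  set V := inaccurate P M X b with hV
  set thr := Real.exp (-M.real aY b) with hthr
  set R := P.n * P.NB + b with hR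
  have hone := hP.one_le
  have hmL := hP.hmL
  have h2L : 2 ^ (P.L + 2) = 4 * 2 ^ P.L := by rw [pow_add]; ring
  have hpow := hP.pow_le
  have hV₁ : V.card ≤ P.m := by
    rw [hV, inaccurate]
    exact (Finset.card_filter_le _ _).trans (by simp)
  have hleaf : ∀ i, P.leaf P.n b i = R * 2 ^ P.L + i := fun i => rfl
  have hsz : ∀ i < 2 ^ P.L, R * 2 ^ P.L + i < P.size := fun i hi =>
    P.leaf_lt (by omega) hb hi
  have hRB : ∀ j ≤ P.L, ∀ u, u / 2 ^ j = R → u ≤ P.B := by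
    intro j hj u hu
    refine le_trans ?_ hP.size_le'
    have h₁ : u < (R + 1) * 2 ^ j := by
      rw [mul_comm, ← hu]; exact Nat.lt_mul_div_succ u (by positivity)
    have h₂ : (R + 1) * 2 ^ j ≤ (R + 1) * 2 ^ P.L :=
      Nat.mul_le_mul_left _ (Nat.pow_le_pow_right (by norm_num) hj)
    have h₃ := hsz (2 ^ P.L - 1) (by have : 0 < 2 ^ P.L := by positivity
                                     omega)
    have : 0 < 2 ^ P.L := by positivity
    have h₄ : (R + 1) * 2 ^ P.L = R * 2 ^ P.L + 2 ^ P.L := Nat.succ_mul _ _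
    omega
  let I : ℕ → Mem → Prop := fun j M' => Mem.EqOff extractN [eT] M M' ∧ M'.real eT 0 = thr ∧
    (seg (M'.nat cmO) (M'.nat cmC 0)).Nodup ∧ ∀ u, u ∈ seg (M'.nat cmO) (M'.nat cmC 0) ↔
      u / 2 ^ j = R ∧ thr < M.real aMax (node P.L (P.L - j) u)
  have hcard : ∀ j ≤ P.L, ∀ M', I j M' → M'.nat cmC 0 ≤ V.card := by
    rintro j hj M' ⟨-, -, hnd, hmem⟩
    classical
    rw [← length_seg (M'.nat cmO) (M'.nat cmC 0), ← List.toFinset_card_of_nodup hnd]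
    refine (Finset.card_le_card (t := V.image fun i => (R * 2 ^ P.L + i) / 2 ^ (P.L - j)) ?_).trans
      Finset.card_image_le
    intro u hu
    rw [List.mem_toFinset, hmem, hC.cons.lt_max_iff _ (by omega)] at hu
    obtain ⟨hu, i, hi, hlt⟩ := hu
    have hsplit : 2 ^ P.L = 2 ^ j * 2 ^ (P.L - j) := by rw [← pow_add]; congr 1; omega
    have hu₁ : R * 2 ^ j ≤ u := by rw [← hu]; exact Nat.div_mul_le_self u _
    have hu₂ : u < (R + 1) * 2 ^ j := by
      rw [mul_comm, ← hu]; exact Nat.lt_mul_div_succ u (by positivity)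
    have hle : R * 2 ^ P.L ≤ u * 2 ^ (P.L - j) + i := by
      rw [hsplit, ← mul_assoc]
      exact (Nat.mul_le_mul_right _ hu₁).trans (Nat.le_add_right _ _)
    have hlt' : u * 2 ^ (P.L - j) + i < (R + 1) * 2 ^ P.L := by
      rw [hsplit, ← mul_assoc]
      calc u * 2 ^ (P.L - j) + i < (u + 1) * 2 ^ (P.L - j) := by rw [Nat.succ_mul]; omega
        _ ≤ _ := Nat.mul_le_mul_right _ hu₂
    obtain ⟨i', hi'⟩ := Nat.exists_eq_add_of_le hle
    rw [Nat.succ_mul] at hlt'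
    rw [hi', ← hleaf, leaf_mem_inaccurate hP hC hb (by omega)] at hlt
    refine Finset.mem_image.2 ⟨i', hlt, ?_⟩
    rw [← hi', mul_comm, Nat.mul_add_div (by positivity), Nat.div_eq_of_lt hi, add_zero]
  set K := V.card with hK
  set Λ := P.L + 3 with hΛ
  have hKΛ : (K + 1) * Λ ≤ (K + 1) * (Λ * Λ) := Nat.mul_le_mul_left _ (Nat.le_mul_self _)
  have hK1 : (K + 1) * 3 ≤ (K + 1) * Λ := Nat.mul_le_mul_left _ (by omega)
  have hloopW : 400 + P.L * (400 + 23000 * ((K + 1) * Λ)) ≤ 24000 * ((K + 1) * (Λ * Λ)) - 24000 *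
      ((K + 1) * Λ) := by
    have e : (K + 1) * (Λ * Λ) = P.L * ((K + 1) * Λ) + 3 * ((K + 1) * Λ) := by rw [hΛ]; ring
    rw [e]
    have : P.L * (400 + 23000 * ((K + 1) * Λ)) = 400 * P.L + 23000 * (P.L * ((K + 1) * Λ)) := by
      ring
    rw [this]
    have : P.L * 1 ≤ P.L * ((K + 1) * Λ) := Nat.mul_le_mul_left _ (by omega)
    omega
  have hloopD : 400 + P.L * (400 + 12000 * Λ) ≤ 24000 * (Λ * Λ) - 24000 * Λ := by
    have e : Λ * Λ = P.L * Λ + 3 * Λ := by rw [hΛ]; ring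
    rw [e]
    have : P.L * (400 + 12000 * Λ) = 400 * P.L + 12000 * (P.L * Λ) := by ring
    rw [this]
    have : P.L * 1 ≤ P.L * Λ := Nat.mul_le_mul_left _ (by omega)
    omega
  have hΛΛ : Λ * 3 ≤ Λ * Λ := Nat.mul_le_mul_left _ (by omega)
  unfold extract
  refine T.next (T_storeR (by simp) (by decide)) ?_
  rintro _ rfl
  refine T.next (T_mapN 1 (fun _ => R) (by simp) hone
    (fun k hk => by simp [hC.stat.n, hC.stat.NB, hM, hR])
    (fun _ _ => hRB 0 (by omega) R (by simp)) (by decide) (by decide)) ?_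
  rintro _ rfl
  generalize hM₁ : Mem.setNA (M.setRA eT _) cmI _ = M₁
  have hE₁ : Mem.EqOff extractN [eT] M M₁ := by
    rw [← hM₁]; exact ((Mem.EqOff.refl M).setRA (by decide) _).setNA (by decide) _
  have hS₁ := hC.stat.eqOff hE₁
  have ht₁ : M₁.real eT 0 = thr := by rw [← hM₁]; simp [hthr, hM]
  refine T.next (filterNodes_spec hP hS₁ (e := cn 1) (l := sc aL) (N := 1) (f := fun _ => R)
    (lv := P.L) (K := K + 1) (by simp)
    (fun M' hE k => by simpa using (hS₁.eqOff hE).L) (fun k hk => by simp [← hM₁]; omega)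
    (fun _ _ => hRB 0 (by omega) R (by simp)) (fun k hk l hl _ => by omega) (by
      have : 0 < 2 ^ P.L := by positivity
      omega) (by omega) (by decide) (by decide) |>.mono (W' := 22000 * ((K + 1) * Λ)) (by
        rw [← hΛ]; ring_nf; omega) le_rfl fun _ h => h) ?_
  rintro M₂ ⟨hE₂, hnd₂, hmem₂⟩
  have hI₀ : I 0 M₂ := by
    refine ⟨hE₁.trans (hE₂.mono (by decide) (by decide)), ?_, hnd₂, fun u => ?_⟩
    · rw [hE₂.2 _ (by decide), ht₁]
    · rw [hmem₂, ht₁, hE₁.2 aMax (by decide), pow_zero, Nat.div_one, Nat.sub_zero]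
      constructor
      · rintro ⟨k, -, rfl, h⟩; exact ⟨rfl, h⟩
      · rintro ⟨rfl, h⟩; exact ⟨0, by omega, rfl, h⟩
  refine T.next ((T_forTo I P.L (23000 * ((K + 1) * Λ)) (12000 * Λ) (by
      have := hP.size_le; omega) (by decide) (fun j M' h => ?_) ?_ ?_ hI₀).mono
      hloopW hloopD fun _ h => h) ?_
  · simpa using (hC.stat.eqOff h.1).L
  · rintro j M' f ⟨h₁, h₂, h₃, h₄⟩
    exact ⟨h₁.setNA (by decide) f, by simpa using h₂, by simpa using h₃, by simpa using h₄⟩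
  · rintro j M' hj hI hjc
    have hcK := hcard j hj.le M' hI
    obtain ⟨h₁, h₂, h₃, h₄⟩ := hI
    have hS' := hC.stat.eqOff h₁
    set c := M'.nat cmC 0 with hc
    set F := M'.nat cmO with hF
    let f : ℕ → ℕ := fun k => 2 * F (k / 2) + (k - 2 * (k / 2))
    have hFm : ∀ p < c, F p / 2 ^ j = R ∧ thr < M.real aMax (node P.L (P.L - j) (F p)) :=
      fun p hp => (h₄ _).1 (mem_seg.2 ⟨p, hp, rfl⟩)
    have hfd : ∀ k, f k / 2 = F (k / 2) := fun k => by simp only [f]; omega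
    have hfR : ∀ k < 2 * c, f k / 2 ^ (j + 1) = R := by
      intro k hk
      rw [pow_succ', ← Nat.div_div_eq_div_mul, hfd]
      exact (hFm _ (by omega)).1
    have hfB : ∀ k < 2 * c, f k ≤ P.B := fun k hk => hRB (j + 1) (by omega) _ (hfR k hk)
    refine T.next ((T_mapN (2 * c) f (by simp [← hc]) (by omega) (by simp [f, ← hF]) hfB
      (by decide) (by decide)).mono (W' := 200 * (2 * K + 1)) (by omega) le_rfl fun _ h => h) ?_
    rintro _ rfl
    generalize hM'₁ : M'.setNA cmI _ = M''
    have hE'' : Mem.EqOff [cmI] [] M' M'' := by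
      rw [← hM'₁]; exact (Mem.EqOff.refl M').setNA (by decide) _
    have hjc' : M''.nat eJ 0 = j := by rw [hE''.1 _ (by decide), hjc]
    have hcc : M''.nat cmC 0 = c := by rw [hE''.1 _ (by decide)]
    refine (filterNodes_spec hP (hS'.eqOff hE'') (N := 2 * c) (f := f) (lv := P.L - j - 1)
      (K := 2 * K) (fun M₃ hE => ?_) (fun M₃ hE k => ?_) (fun k hk => by simp [← hM'₁, hk]) hfB
      (fun k hk l hl h => ?_) (by omega) (by omega) (by decide) (by decide)).mono ?_ ?_ ?_
    · simp [hE.1 cmC (by decide), hcc]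
    · simp [((hS'.eqOff hE'').eqOff hE).L, hE.1 eJ (by decide), hjc']
    · have h5 : F (k / 2) = F (l / 2) := by rw [← hfd, ← hfd, h]
      have h6 := nodup_seg.1 h₃ (k / 2) (by omega) (l / 2) (by omega) h5
      simp only [f, h5] at h
      omega
    · rw [← hΛ]
      have : (2 * K + 1) * Λ ≤ 2 * ((K + 1) * Λ) := by
        rw [← mul_assoc]; exact Nat.mul_le_mul_right _ (by omega)
      omega
    · omega
    · rintro M₃ ⟨hE₃, hnd₃, hmem₃⟩
      refine ⟨by rw [hE₃.1 _ (by decide), hjc'], (h₁.trans (hE''.mono (by decide) (by decide))).trans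
        (hE₃.mono (by decide) (by decide)), ?_, hnd₃, fun u => ?_⟩
      · rw [hE₃.2 _ (by decide), hE''.2 _ (by decide), h₂]
      · rw [hmem₃, hE''.2 eT (by decide), h₂, hE''.2 aMax (by decide), h₁.2 aMax (by decide),
          Nat.sub_sub]
        constructor
        · rintro ⟨k, hk, rfl, h⟩
          exact ⟨hfR k hk, h⟩
        · rintro ⟨hu, h⟩
          have hu' : u / 2 / 2 ^ j = R := by rw [Nat.div_div_eq_div_mul, ← pow_succ', hu]
          have hpar : thr < M.real aMax (node P.L (P.L - j) (u / 2)) := by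
            have := (hC.cons (P.L - (j + 1)) (by omega) (u / 2)).2
            rw [show P.L - (j + 1) + 1 = P.L - j by omega] at this
            rw [this, lt_max_iff]
            rcases Nat.mod_two_eq_zero_or_one u with h' | h'
            · left; rwa [show 2 * (u / 2) = u by omega]
            · right; rwa [show 2 * (u / 2) + 1 = u by omega]
          obtain ⟨p, hp, hp'⟩ := mem_seg.1 ((h₄ (u / 2)).2 ⟨hu', hpar⟩)
          refine ⟨2 * p + u % 2, by omega, ?_, h⟩
          simp only [f]
          rw [show (2 * p + u % 2) / 2 = p by omega, hp']
          omega
  rintro M₃ hI₃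
  have hcK := hcard P.L le_rfl M₃ hI₃
  obtain ⟨h₁, -, h₃, h₄⟩ := hI₃
  have hS₃ := hC.stat.eqOff h₁
  set c := M₃.nat cmC 0 with hc
  set F := M₃.nat cmO with hF
  have hFm : ∀ p < c, ∃ i < 2 ^ P.L, F p = R * 2 ^ P.L + i ∧ i ∈ V := by
    intro p hp
    obtain ⟨h₅, h₆⟩ := (h₄ (F p)).1 (mem_seg.2 ⟨p, hp, rfl⟩)
    have h₇ : F p = R * 2 ^ P.L + F p % 2 ^ P.L := by
      conv_lhs => rw [← Nat.div_add_mod (F p) (2 ^ P.L)]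
      rw [h₅, mul_comm]
    refine ⟨_, Nat.mod_lt _ (by positivity), h₇, ?_⟩
    rw [← leaf_mem_inaccurate hP hC hb (Nat.mod_lt _ (by positivity)), hleaf, ← h₇]
    simpa using h₆
  have hrow : ∀ p < c, F p - R * 2 ^ P.L ∈ V ∧ F p - R * 2 ^ P.L < P.m ∧
      F p = R * 2 ^ P.L + (F p - R * 2 ^ P.L) := by
    intro p hp
    obtain ⟨i, -, h₅, h₆⟩ := hFm p hp
    rw [h₅, Nat.add_sub_cancel_left]
    exact ⟨h₆, (mem_inaccurate.1 h₆).1, rfl⟩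
  have heB : M₃.nat eB 0 = b := by rw [h₁.1 _ (by decide), hM]
  have hmB := hP.m_le
  refine T.next ((T_mapN c (fun k => F k - R * 2 ^ P.L) (by simp [← hc]) (by omega)
    (fun k hk => by simp [hS₃.n, hS₃.NB, heB, hS₃.pw, hR, ← hF])
    (fun k hk => by have := (hrow k hk).2.1; omega) (by decide) (by decide)).mono
    (W' := 200 * (K + 1)) (by omega) le_rfl fun _ h => h) ?_
  rintro _ rfl
  refine (T_storeN (by simp) (by simp [← hc]; omega) (by decide)).mono (by omega) (by omega) ?_
  rintro _ rfl
  refine ⟨(h₁.setNA (by decide) _).setNA (by decide) _, c, fun k => F k - R * 2 ^ P.L,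
    ⟨by simp [hc], fun k hk => by simp [hk], fun k hk => (hrow k hk).2.1, fun k hk l hl h => ?_⟩,
    fun i => ?_, hcK⟩
  · refine nodup_seg.1 h₃ k hk l hl ?_
    rw [(hrow k hk).2.2, (hrow l hl).2.2, h]
  · constructor
    · rintro ⟨k, hk, rfl⟩
      exact (hrow k hk).1
    · intro hi
      have him := (mem_inaccurate.1 hi).1
      have hlt := (leaf_mem_inaccurate hP hC hb (him.trans_le hmL)).2 hi
      rw [hleaf] at hlt
      obtain ⟨p, hp, hp'⟩ := mem_seg.1 ((h₄ (R * 2 ^ P.L + i)).2 ⟨by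
        rw [mul_comm, Nat.mul_add_div (by positivity), Nat.div_eq_of_lt (by omega), add_zero],
        by simpa using hlt⟩)
      exact ⟨p, hp, by simp only; rw [hp', Nat.add_sub_cancel_left]⟩

end PrimalGradient

namespace PrimalGradient

variable {P : Lay} {M : Mem} {N : ℕ} {r : ℕ → ℕ} {last X : ℕ → ℝ} {Pl : ℕ → Prop}

theorem JState.eqOff {M' : Mem} {NS RS : List ℕ} (h : JState P M last) (hE : Mem.EqOff NS RS M M')
    (hN : ∀ a ∈ [outJ, outLen, aPos, aFresh], a ∉ NS := by decide)
    (hR : ∀ a ∈ [aOld, outXbar], a ∉ RS := by decide) : JState P M' last := by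
  unfold JState at h ⊢
  rw [hE.1 aFresh (hN _ (by simp))]
  split_ifs with hf
  · rw [if_pos hf] at h
    rw [hE.2 outXbar (hR _ (by simp))]
    exact h
  · rw [if_neg hf] at h
    exact h.eqOff hE (fun a ha => hN a (by simp at ha ⊢; tauto)) hR

theorem JState.of_jInv (h : JInv P M last) (hf : M.nat aFresh 0 = 0) : JState P M last := by
  rw [JState, if_neg (by omega)]; exact h

/-! ## Placing rows in buckets -/

abbrev bC : ℕ := 66
abbrev bZ : ℕ := 67
abbrev bT : ℕ := 68

/-- The grid of the buckets covers the allowed values of `z` and `τ`. -/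
structure Lay.Grid (P : Lay) : Prop where
  eps_pos : 0 < P.ε
  NT_pos : 0 < P.NT
  NB_eq : P.NB = P.NB / P.NT * P.NT
  top_z : 2 < 1 / 2 + (P.NB / P.NT : ℕ) * P.ε
  top_t : 2 < P.n / P.m * Real.exp (P.NT * P.ε)

abbrev zGridE : RExp :=
  RExp.add (RExp.div (RExp.ofNat (cn 1)) (RExp.ofNat (cn 2)))
    (RExp.mul (RExp.ofNat (sc bC)) (rs inScal))
abbrev tGridE : RExp :=
  RExp.mul (RExp.div (RExp.ofNat colN) (RExp.ofNat (sc inDim)))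
    (RExp.exp (RExp.mul (RExp.ofNat (sc bC)) (rs inScal)))

/-- Compute the buckets of the rows of the list. -/
def place : Cmd :=
  pick (sc inLen) (NExp.div (sc aNB) (sc aNT)) bC bZ (BExp.not (BExp.realLT (rl inZ row) zGridE)) ;;
  pick (sc inLen) (sc aNT) bC bT (BExp.not (BExp.realLT (rl inTau row) tGridE)) ;;
  scatN (sc inLen) tt aBk row (NExp.add (NExp.mul (ld bZ ix) (sc aNT)) (ld bT ix)) ;;
  scatR (sc inLen) tt aYS row (rl aY (ld aBk row))

abbrev placeN : List ℕ := [bC, bZ, bT, aBk]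

/-- The row `i` is in the bucket of its parameters. -/
structure Placed (P : Lay) (M : Mem) (i : ℕ) : Prop where
  lt : M.nat aBk i < P.NB
  bz : |1 / 2 + (M.nat aBk i / P.NT : ℕ) * P.ε - M.real inZ i| ≤ P.ε
  bt : Real.exp (-P.ε) * M.real inTau i ≤ P.tb (M.nat aBk i) ∧
    P.tb (M.nat aBk i) ≤ Real.exp P.ε * M.real inTau i

theorem place_spec (hP : P.Ok) (hG : P.Grid) (hS : Stat P M) (hr : Rows P M N r)
    (hz : ∀ k < N, M.real inZ (r k) ∈ Set.Icc (0.5 : ℝ) 2)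
    (ht : ∀ k < N, M.real inTau (r k) ∈ Set.Icc ((P.n : ℝ) / P.m) 2) :
    T P.B place M (5000 * ((P.NB + 1) * (N + 1))) (5000 * (P.NB + 1)) (fun M' =>
      Mem.EqOff placeN [aYS] M M' ∧
      (∀ k < N, Placed P M' (r k) ∧ M'.real aYS (r k) = M'.real aY (M'.nat aBk (r k))) ∧
      ∀ i, ¬ InRows N r i → M'.nat aBk i = M.nat aBk i ∧ M'.real aYS i = M.real aYS i) := by
  have hNB' : N ≤ P.B := hr.le.trans hP.m_le
  have hrB : ∀ k < N, r k ≤ P.B := fun k hk => (hr.lt k hk).le.trans hP.m_le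
  have hinj : ∀ k < N, True → ∀ l < N, True → r k = r l → k = l :=
    fun k hk _ l hl _ h => hr.inj k hk l hl h
  set NZ := P.NB / P.NT with hNZ
  have hNZB : NZ ≤ P.NB := Nat.div_le_self _ _
  have hNTB : P.NT ≤ P.NB := by
    rw [hG.NB_eq]
    refine Nat.le_mul_of_pos_left _ (Nat.pos_of_ne_zero fun h => ?_)
    have := hP.hNB
    rw [hG.NB_eq, h] at this
    omega
  have hNBB := hP.NB_le
  have hmul₁ : (NZ + 1) * (N + 1) ≤ (P.NB + 1) * (N + 1) := Nat.mul_le_mul_right _ (by omega)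
  have hmul₂ : (P.NT + 1) * (N + 1) ≤ (P.NB + 1) * (N + 1) := Nat.mul_le_mul_right _ (by omega)
  have hmul₃ : 2 * (N + 1) ≤ (P.NB + 1) * (N + 1) := Nat.mul_le_mul_right _ (by
    have := hP.hNB; omega)
  unfold place
  refine T.next ((T_pick N NZ (fun k j => ¬ M.real inZ (r k) < 1 / 2 + j * P.ε) hNB'
    (by omega) (fun M' hE => by simpa using (hr.eqOff hE).len)
    (fun M' hE => by simp [(hS.eqOff hE).NB, (hS.eqOff hE).NT, hNZ])
    (fun M' hE k hk => by
      simp [(hr.eqOff hE).idx k hk, (hS.eqOff hE).eps, hE.2 inZ (by decide)])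
    (by decide) (by decide) (by decide) (by decide)).mono
    (W' := 1000 * ((P.NB + 1) * (N + 1))) (D' := 1000 * (P.NB + 1)) (by omega) (by omega)
    fun _ h => h) ?_
  rintro M₁ ⟨hE₁, hz₁⟩
  have hr₁ := hr.eqOff hE₁
  have hS₁ := hS.eqOff hE₁
  refine T.next ((T_pick N P.NT
    (fun k j => ¬ M.real inTau (r k) < P.n / P.m * Real.exp (j * P.ε)) hNB'
    (by omega) (fun M' hE => by simpa using (hr₁.eqOff hE).len)
    (fun M' hE => by simp [(hS₁.eqOff hE).NT])
    (fun M' hE k hk => by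
      simp [(hr₁.eqOff hE).idx k hk, (hS₁.eqOff hE).eps, (hS₁.eqOff hE).m, (hS₁.eqOff hE).n,
        hE.2 inTau (by decide), hE₁.2 inTau (by decide)])
    (by decide) (by decide) (by decide) (by decide)).mono
    (W' := 1000 * ((P.NB + 1) * (N + 1))) (D' := 1000 * (P.NB + 1)) (by omega) (by omega)
    fun _ h => h) ?_
  rintro M₂ ⟨hE₂, ht₂⟩
  have hr₂ := hr₁.eqOff hE₂
  have hS₂ := hS₁.eqOff hE₂
  have ebZ : M₂.nat bZ = M₁.nat bZ := hE₂.1 _ (by decide)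
  set zc := M₁.nat bZ with hzc
  set tc := M₂.nat bT with htc
  have hε := hG.eps_pos
  have hnm : (0 : ℝ) < P.n / P.m := by
    have h₁ : (0 : ℝ) < P.n := by exact_mod_cast hP.hn
    have h₂ : (0 : ℝ) < P.m := by exact_mod_cast hP.hm
    positivity
  have hzk : ∀ k < N, zc k < NZ ∧ 1 / 2 + zc k * P.ε ≤ M.real inZ (r k) ∧
      M.real inZ (r k) < 1 / 2 + (zc k + 1 : ℕ) * P.ε := by
    intro k hk
    obtain ⟨hlo, hhi⟩ := hz k hk
    have hNZ0 : 0 < NZ := Nat.pos_of_ne_zero fun h => by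
      have := hG.top_z
      rw [← hNZ, h] at this
      norm_num at this
    obtain ⟨h₁, h₂⟩ := hz₁ k hk
    obtain ⟨h₃, h₄, -⟩ := h₂ 0 hNZ0 (by norm_num; norm_num at hlo; linarith)
    refine ⟨h₄, not_lt.1 h₃, ?_⟩
    by_contra hcon
    by_cases hlt : zc k + 1 < NZ
    · have := (h₂ _ hlt hcon).2.2
      omega
    · have he : zc k + 1 = NZ := by omega
      rw [he] at hcon
      have := hG.top_z
      rw [← hNZ] at this
      linarith
  have htk : ∀ k < N, tc k < P.NT ∧ P.n / P.m * Real.exp (tc k * P.ε) ≤ M.real inTau (r k) ∧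
      M.real inTau (r k) < P.n / P.m * Real.exp ((tc k + 1 : ℕ) * P.ε) := by
    intro k hk
    obtain ⟨hlo, hhi⟩ := ht k hk
    obtain ⟨h₁, h₂⟩ := ht₂ k hk
    obtain ⟨h₃, h₄, -⟩ := h₂ 0 hG.NT_pos (by simpa using hlo)
    refine ⟨h₄, not_lt.1 h₃, ?_⟩
    by_contra hcon
    by_cases hlt : tc k + 1 < P.NT
    · have := (h₂ _ hlt hcon).2.2
      omega
    · have he : tc k + 1 = P.NT := by omega
      rw [he] at hcon
      have := hG.top_t
      linarith
  have hbB : ∀ k < N, zc k * P.NT + tc k < P.NB := by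
    intro k hk
    have h₁ := (hzk k hk).1
    have h₂ := (htk k hk).1
    rw [hG.NB_eq]
    calc zc k * P.NT + tc k < (zc k + 1) * P.NT := by rw [Nat.succ_mul]; omega
      _ ≤ _ := Nat.mul_le_mul_right _ h₁
  refine T.next (T_scatN N (fun _ => True) r (fun k => zc k * P.NT + tc k) (by simp [hr₂.len]) hNB'
    (by simp) (fun k hk _ => by simp [hr₂.idx k hk])
    (fun k hk _ => by simp [ebZ, hS₂.NT, ← htc]) (fun k hk _ => hrB k hk)
    (fun k hk _ => by have := hbB k hk; omega) hinj (by decide) (by decide)) ?_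
  rintro _ ⟨fB, rfl, hfB, hfB'⟩
  refine (T_scatR N (fun _ => True) r (fun k => M₂.real aY (fB (r k))) (by simp [hr₂.len]) hNB'
    (by simp) (fun k hk _ => by simp [hr₂.idx k hk])
    (fun k hk _ => by simp [hr₂.idx k hk]) (fun k hk _ => hrB k hk)
    hinj (by decide) (by decide)).mono (by omega) (by omega) ?_
  rintro _ ⟨fY, rfl, hfY, hfY'⟩
  have hE₂' : Mem.EqOff placeN [] M M₂ :=
    (hE₁.mono (by decide) (by decide)).trans (hE₂.mono (by decide) (by decide))
  refine ⟨((hE₂'.mono (by decide) (by decide)).setNA (by decide) _).setRA (by decide) _,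
    fun k hk => ⟨⟨?_, ?_, ?_⟩, ?_⟩, fun i hi => ⟨?_, ?_⟩⟩
  · simpa [hfB k hk trivial] using hbB k hk
  · simp only [Mem.setRA_nat, Mem.setNA_nat, if_true, Mem.setRA_real, Mem.setNA_real,
      show (inZ = aYS) = False by simp, if_false]
    rw [hfB k hk trivial, mul_comm (zc k), Nat.mul_add_div hG.NT_pos, Nat.div_eq_of_lt (htk k hk).1,
      add_zero, hE₂'.2 _ (by decide)]
    obtain ⟨-, h₁, h₂⟩ := hzk k hk
    push_cast at h₂
    rw [abs_le]
    constructor <;> nlinarith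
  · simp only [Mem.setRA_nat, Mem.setNA_nat, if_true, Mem.setRA_real, Mem.setNA_real,
      show (inTau = aYS) = False by simp, if_false]
    rw [hfB k hk trivial, Lay.tb, mul_comm (zc k), Nat.mul_add_div hG.NT_pos,
      Nat.div_eq_of_lt (htk k hk).1, add_zero, hE₂'.2 _ (by decide), Nat.add_sub_cancel_left]
    obtain ⟨-, h₁, h₂⟩ := htk k hk
    constructor
    · push_cast at h₂
      rw [add_mul, one_mul, Real.exp_add, ← mul_assoc] at h₂
      rw [Real.exp_neg, inv_mul_le_iff₀ (Real.exp_pos _), mul_comm (Real.exp P.ε)]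
      exact h₂.le
    · refine h₁.trans ?_
      have h₃ : (1 : ℝ) ≤ Real.exp P.ε := Real.one_le_exp hε.le
      have h₄ := hnm.le.trans (ht k hk).1
      nlinarith
  · simp [hfY k hk trivial]
  · simp only [Mem.setRA_nat, Mem.setNA_nat, if_true]
    rw [hfB' i fun k hk _ e => hi ⟨k, hk, e⟩, hE₂.1 _ (by decide), hE₁.1 _ (by decide)]
  · simp only [Mem.setRA_real, if_true]
    rw [hfY' i fun k hk _ e => hi ⟨k, hk, e⟩, Mem.setNA_real, hE₂'.2 _ (by decide)]

/-- Insert the rows of the list with their parameters. -/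
def placeRows : Cmd := place ;; insertRows

abbrev placeRowsN : List ℕ := placeN ++ treeN
abbrev placeRowsR : List ℕ := aYS :: treeR

theorem placeRows_spec (hP : P.Ok) (hG : P.Grid) (hS : Stat P M) (hr : Rows P M N r)
    (hz : ∀ k < N, M.real inZ (r k) ∈ Set.Icc (0.5 : ℝ) 2)
    (ht : ∀ k < N, M.real inTau (r k) ∈ Set.Icc ((P.n : ℝ) / P.m) 2)
    (hC : Cons P.L M) (hbk : ∀ i < P.m, M.nat aBk i < P.NB)
    (hSL : SumLeaves P M fun i => ¬ InRows N r i)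
    (hML : MaxLeaves P M (fun i => ¬ InRows N r i) (fun i => ¬ InRows N r i)) :
    T P.B placeRows M (25000 * ((off (wid P r) N + 1) * (P.L + 3 + P.NB)))
      (25000 * (P.L + 3 + P.NB)) (fun M' => Mem.EqOff placeRowsN placeRowsR M M' ∧ Cons P.L M' ∧
        SumLeaves P M' (fun _ => True) ∧ MaxLeaves P M' (fun _ => True) (fun _ => True) ∧
      (∀ k < N, Placed P M' (r k) ∧ M'.real aYS (r k) = M'.real aY (M'.nat aBk (r k))) ∧
      ∀ i, ¬ InRows N r i → M'.nat aBk i = M.nat aBk i ∧ M'.real aYS i = M.real aYS i) := by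
  have hNoff : 2 * N ≤ off (wid P r) N := by
    have : ∑ q ∈ Finset.range N, 2 ≤ off (wid P r) N :=
      Finset.sum_le_sum fun q _ => by simp [wid]
    simpa [mul_comm] using this
  have h₁ : (P.NB + 1) * (N + 1) ≤ (off (wid P r) N + 1) * (1 + P.NB) := by
    rw [mul_comm, add_comm P.NB]; exact Nat.mul_le_mul_right _ (by omega)
  have h₂ : (off (wid P r) N + 1) * (P.L + 3 + P.NB) = (off (wid P r) N + 1) * (1 + P.NB) +
      (off (wid P r) N + 1) * (P.L + 2) := by ring
  have h₃ : (off (wid P r) N + 1) * (P.L + 3 + P.NB) = (off (wid P r) N + 1) * (P.L + 3) +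
      (off (wid P r) N + 1) * P.NB := by ring
  unfold placeRows
  refine T.next (place_spec hP hG hS hr hz ht) ?_
  rintro M₁ ⟨hE₁, h₄, h₅⟩
  have hb₁ : ∀ i < P.m, M₁.nat aBk i < P.NB := by
    intro i hi
    by_cases h : InRows N r i
    · obtain ⟨k, hk, rfl⟩ := h
      exact (h₄ k hk).1.lt
    · rw [(h₅ i h).1]; exact hbk i hi
  refine (insertRows_spec hP (hS.eqOff hE₁) (hr.eqOff hE₁) hb₁ (hC.eqOff hE₁)
    (hSL.congr (hE₁.2 _ (by decide)) (fun i _ h => (h₅ i h).1)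
      (fun i _ _ => by rw [hE₁.2 _ (by decide)]) (fun i _ _ => by rw [hE₁.2 _ (by decide)]))
    (hML.congr (fun _ h => h) (hE₁.2 _ (by decide)) (fun i _ h => (h₅ i h).1)
      (fun i _ _ => by rw [hE₁.2 _ (by decide)]) (fun i _ _ => by rw [hE₁.2 _ (by decide)])
      (fun i _ h => (h₅ i h).2))).mono (by omega) (by omega) ?_
  rintro M₂ ⟨hE₂, h₆, h₇, h₈⟩
  have e₁ : M₂.nat aBk = M₁.nat aBk := hE₂.1 _ (by decide)
  have e₂ : M₂.real aYS = M₁.real aYS := hE₂.2 _ (by decide)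
  have e₃ : M₂.real aY = M₁.real aY := hE₂.2 _ (by decide)
  have e₄ : M₂.real inZ = M₁.real inZ := hE₂.2 _ (by decide)
  have e₅ : M₂.real inTau = M₁.real inTau := hE₂.2 _ (by decide)
  refine ⟨(hE₁.mono (by decide) (by decide)).trans (hE₂.mono (by decide) (by decide)), h₆, h₇, h₈,
    fun k hk => ⟨⟨?_, ?_, ?_⟩, ?_⟩, fun i hi => ?_⟩
  · rw [e₁]; exact (h₄ k hk).1.lt
  · rw [e₁, e₄]; exact (h₄ k hk).1.bz
  · rw [e₁, e₅]; exact (h₄ k hk).1.bt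
  · rw [e₁, e₂, e₃]; exact (h₄ k hk).2
  · rw [e₁, e₂]; exact h₅ i hi

/-! ## The operation `Update` -/

def updateProg : Cmd :=
  clear ;;
  syncRows ;;
  removeRows ;;
  scatR (sc inLen) tt inG row (rl inArg1 ix) ;;
  scatR (sc inLen) tt inTau row (rl inArg2 ix) ;;
  scatR (sc inLen) tt inZ row (rl inArg3 ix) ;;
  placeRows

/-- The word and real arrays that hold the parameters and constants. -/
abbrev updateN : List ℕ := [outLen, aFresh] ++ touchN ++ treeN ++ placeN
abbrev updateR : List ℕ := [tX] ++ touchR ++ treeR ++ [inG, inTau, inZ]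

theorem updateProg_spec (hP : P.Ok) (hG : P.Grid) (hr : Rows P M N r) (hJ : JState P M last)
    (hC : Core P M X fun _ => True)
    (ht : ∀ k < N, M.real inArg2 k ∈ Set.Icc ((P.n : ℝ) / P.m) 2)
    (hz : ∀ k < N, M.real inArg3 k ∈ Set.Icc (0.5 : ℝ) 2) :
    T P.B updateProg M (150000 * ((off (wid P r) N + 1) * (P.L + 3 + P.NB)))
      (150000 * (P.L + 3 + P.NB)) (fun M' => Mem.EqOff updateN updateR M M' ∧
        Core P M' X (fun _ => True) ∧ JState P M' last ∧
        (∀ k < N, M'.real inG (r k) = M.real inArg1 k ∧ M'.real inTau (r k) = M.real inArg2 k ∧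
          M'.real inZ (r k) = M.real inArg3 k ∧ M'.real outXbar (r k) = X (r k)) ∧
        ∀ i, ¬ InRows N r i → M'.real inG i = M.real inG i ∧ M'.real inTau i = M.real inTau i ∧
          M'.real inZ i = M.real inZ i ∧ M'.real outXbar i = M.real outXbar i) := by
  have hNB' : N ≤ P.B := hr.le.trans hP.m_le
  have hrB : ∀ k < N, r k ≤ P.B := fun k hk => (hr.lt k hk).le.trans hP.m_le
  have hinj : ∀ k < N, True → ∀ l < N, True → r k = r l → k = l :=
    fun k hk _ l hl _ h => hr.inj k hk l hl h
  have hNoff : 2 * N ≤ off (wid P r) N := by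
    have : ∑ q ∈ Finset.range N, 2 ≤ off (wid P r) N :=
      Finset.sum_le_sum fun q _ => by simp [wid]
    simpa [mul_comm] using this
  have h₁ : (N + 1) * (P.L + 3) ≤ (off (wid P r) N + 1) * (P.L + 3) :=
    Nat.mul_le_mul_right _ (by omega)
  have h₂ : (N + 1) * 3 ≤ (N + 1) * (P.L + 3) := Nat.mul_le_mul_left _ (by omega)
  have h₃ : (off (wid P r) N + 1) * (P.L + 3 + P.NB) = (off (wid P r) N + 1) * (P.L + 3) +
      (off (wid P r) N + 1) * P.NB := by ring
  unfold updateProg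
  refine T.next (clear_spec hJ) ?_
  rintro M₁ ⟨hE₁, hf₁, hJ₁⟩
  have hr₁ := hr.eqOff hE₁
  refine T.next (syncRows_core hP hr₁ hJ₁ (hC.eqOff hE₁)) ?_
  rintro M₂ ⟨hE₂, hJ₂, hC₂, hin₂, hout₂⟩
  have hr₂ := hr₁.eqOff hE₂
  refine T.next (removeRows_spec hP hC₂.stat hr₂ hC₂.bk_lt hC₂.cons hC₂.sum hC₂.max) ?_
  rintro M₃ ⟨hE₃, hcons₃, hS₃, hM₃⟩
  have hr₃ := hr₂.eqOff hE₃
  have hst₃ := hC₂.stat.eqOff hE₃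
  have hE₁₃ : Mem.EqOff ([outLen, aFresh] ++ touchN ++ treeN) ([tX] ++ touchR ++ treeR) M M₃ :=
    ((hE₁.mono (by decide) (by decide)).trans (hE₂.mono (by decide) (by decide))).trans
      (hE₃.mono (by decide) (by decide))
  refine T.next (T_scatR N (fun _ => True) r (M.real inArg1) (by simp [hr₃.len]) hNB'
    (by simp) (fun k hk _ => by simp [hr₃.idx k hk])
    (fun k hk _ => by simp [hE₁₃.2 inArg1 (by decide)]) (fun k hk _ => hrB k hk)
    hinj (by decide) (by decide)) ?_
  rintro _ ⟨fG, rfl, hfG, hfG'⟩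
  refine T.next (T_scatR N (fun _ => True) r (M.real inArg2) (by simp [hr₃.len]) hNB'
    (by simp) (fun k hk _ => by simp [hr₃.idx k hk])
    (fun k hk _ => by simp [hE₁₃.2 inArg2 (by decide)]) (fun k hk _ => hrB k hk)
    hinj (by decide) (by decide)) ?_
  rintro _ ⟨fT, rfl, hfT, hfT'⟩
  refine T.next (T_scatR N (fun _ => True) r (M.real inArg3) (by simp [hr₃.len]) hNB'
    (by simp) (fun k hk _ => by simp [hr₃.idx k hk])
    (fun k hk _ => by simp [hE₁₃.2 inArg3 (by decide)]) (fun k hk _ => hrB k hk)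
    hinj (by decide) (by decide)) ?_
  rintro _ ⟨fZ, rfl, hfZ, hfZ'⟩
  simp only [Mem.setRA_real, show (inZ = inG) = False by simp, show (inZ = inTau) = False by simp,
    show (inTau = inG) = False by simp, if_false] at hfT' hfZ'
  generalize hM₄ : ((M₃.setRA inG fG).setRA inTau fT).setRA inZ fZ = M₄
  have hE₄ : Mem.EqOff [] [inG, inTau, inZ] M₃ M₄ := by
    rw [← hM₄]
    exact (((Mem.EqOff.refl M₃).setRA (by decide) _).setRA (by decide) _).setRA (by decide) _
  have eG : M₄.real inG = fG := by rw [← hM₄]; simp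
  have eT : M₄.real inTau = fT := by rw [← hM₄]; simp
  have eZ : M₄.real inZ = fZ := by rw [← hM₄]; simp
  have hout : ∀ {i}, ¬ InRows N r i → ∀ k < N, True → r k ≠ i := fun h k hk _ e => h ⟨k, hk, e⟩
  refine (placeRows_spec hP hG (hst₃.eqOff hE₄) (hr₃.eqOff hE₄)
    (fun k hk => by rw [eZ, hfZ k hk trivial]; exact hz k hk)
    (fun k hk => by rw [eT, hfT k hk trivial]; exact ht k hk) (hcons₃.eqOff hE₄)
    (by rw [hE₄.1 _ (by decide), hE₃.1 _ (by decide)]; exact hC₂.bk_lt)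
    (hS₃.congr (hE₄.2 _ (by decide)) (fun i _ _ => by rw [hE₄.1 _ (by decide)])
      (fun i _ h => by rw [eG, hfG' i (hout h)]) (fun i _ h => by rw [eZ, hfZ' i (hout h)]))
    (hM₃.congr (fun _ h => h) (hE₄.2 _ (by decide)) (fun i _ _ => by rw [hE₄.1 _ (by decide)])
      (fun i _ h => by rw [eG, hfG' i (hout h)]) (fun i _ _ => by rw [hE₄.2 _ (by decide)])
      (fun i _ _ => by rw [hE₄.2 _ (by decide)]))).mono (by omega) (by omega) ?_
  rintro M₅ ⟨hE₅, hcons₅, hS₅, hM₅, hpl, hnp⟩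
  have hE : Mem.EqOff updateN updateR M M₅ :=
    ((hE₁₃.mono (by decide) (by decide)).trans (hE₄.mono (by decide) (by decide))).trans
      (hE₅.mono (by decide) (by decide))
  have gG : M₅.real inG = fG := (hE₅.2 _ (by decide)).trans eG
  have gT : M₅.real inTau = fT := (hE₅.2 _ (by decide)).trans eT
  have gZ : M₅.real inZ = fZ := (hE₅.2 _ (by decide)).trans eZ
  have gX : M₅.real outXbar = M₂.real outXbar :=
    (hE₅.2 _ (by decide)).trans ((hE₄.2 _ (by decide)).trans (hE₃.2 _ (by decide)))
  have gY : M₅.real aY = M₂.real aY :=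
    (hE₅.2 _ (by decide)).trans ((hE₄.2 _ (by decide)).trans (hE₃.2 _ (by decide)))
  have gW : M₅.real inW = M₂.real inW :=
    (hE₅.2 _ (by decide)).trans ((hE₄.2 _ (by decide)).trans (hE₃.2 _ (by decide)))
  have kYS : M₄.real aYS = M₂.real aYS := (hE₄.2 _ (by decide)).trans (hE₃.2 _ (by decide))
  have kB : M₄.nat aBk = M₂.nat aBk := (hE₄.1 _ (by decide)).trans (hE₃.1 _ (by decide))
  have kG : M₃.real inG = M₂.real inG := hE₃.2 _ (by decide)
  have kT : M₃.real inTau = M₂.real inTau := hE₃.2 _ (by decide)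
  have kZ : M₃.real inZ = M₂.real inZ := hE₃.2 _ (by decide)
  rw [kYS, kB] at hnp
  refine ⟨hE, ?_, JState.of_jInv (((hJ₂.eqOff hE₃).eqOff hE₄).eqOff hE₅) ?_, fun k hk => ?_,
    fun i hi => ?_⟩
  · refine ⟨(hst₃.eqOff hE₄).eqOff hE₅, hcons₅, ?_, hS₅, hM₅, ?_, ?_, by rw [gW]; exact hC₂.weight,
      ?_, ?_⟩ <;> intro i hi <;> by_cases h : InRows N r i
    · obtain ⟨k, hk, rfl⟩ := h; exact (hpl k hk).1.lt
    · rw [(hnp i h).1]; exact hC₂.bk_lt i hi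
    · obtain ⟨k, hk, rfl⟩ := h; exact (hpl k hk).2.le
    · rw [(hnp i h).1, (hnp i h).2, gY]; exact hC₂.ys_le i hi
    · obtain ⟨k, hk, rfl⟩ := h
      rw [(hpl k hk).2, sub_self, mul_zero, add_zero, gX]; exact hin₂ _ ⟨k, hk, rfl⟩
    · rw [(hnp i h).1, (hnp i h).2, gY, gX, gG, hfG' i (hout h), kG]; exact hC₂.exact i hi
    · obtain ⟨k, hk, rfl⟩ := h; exact (hpl k hk).1.bz
    · rw [(hnp i h).1, gZ, hfZ' i (hout h), kZ]; exact hC₂.bz i hi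
    · obtain ⟨k, hk, rfl⟩ := h; exact (hpl k hk).1.bt
    · rw [(hnp i h).1, gT, hfT' i (hout h), kT]; exact hC₂.bt i hi
  · rw [hE₅.1 _ (by decide), hE₄.1 _ (by decide), hE₃.1 _ (by decide), hE₂.1 _ (by decide), hf₁]
  · rw [gG, gT, gZ, gX, hfG k hk trivial, hfT k hk trivial, hfZ k hk trivial]
    exact ⟨rfl, rfl, rfl, hin₂ _ ⟨k, hk, rfl⟩⟩
  · rw [gG, gT, gZ, gX, hfG' i (hout hi), hfT' i (hout hi), hfZ' i (hout hi),
      hE₁₃.2 inG (by decide), hE₁₃.2 inTau (by decide), hE₁₃.2 inZ (by decide), hout₂ i hi,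
      hE₁.2 _ (by decide)]
    exact ⟨rfl, rfl, rfl, rfl⟩

/-! ## The operation `SetAccuracy` -/

def setAccuracyProg : Cmd :=
  clear ;;
  syncRows ;;
  scatR (sc inLen) tt inW row (rl inArg1 ix) ;;
  keyRows

abbrev setAccuracyN : List ℕ := [outLen, aFresh] ++ touchN ++ treeN
abbrev setAccuracyR : List ℕ := [tX] ++ touchR ++ treeR ++ [inW]

theorem setAccuracyProg_spec (hP : P.Ok) (hG : P.Grid) (hr : Rows P M N r) (hJ : JState P M last)
    (hC : Core P M X fun _ => True) (hw : ∀ k < N, 0 ≤ M.real inArg1 k) :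
    T P.B setAccuracyProg M (100000 * ((N + 1) * (P.L + 3))) (100000 * (P.L + 3))
      (fun M' => Mem.EqOff setAccuracyN setAccuracyR M M' ∧
        Core P M' X (fun _ => True) ∧ JState P M' last ∧
        (∀ k < N, M'.real inW (r k) = M.real inArg1 k ∧ M'.real outXbar (r k) = X (r k)) ∧
        ∀ i, ¬ InRows N r i → M'.real inW i = M.real inW i ∧
          M'.real outXbar i = M.real outXbar i) := by
  have hNB' : N ≤ P.B := hr.le.trans hP.m_le
  have hrB : ∀ k < N, r k ≤ P.B := fun k hk => (hr.lt k hk).le.trans hP.m_le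
  have hinj : ∀ k < N, True → ∀ l < N, True → r k = r l → k = l :=
    fun k hk _ l hl _ h => hr.inj k hk l hl h
  have h₂ : (N + 1) * 3 ≤ (N + 1) * (P.L + 3) := Nat.mul_le_mul_left _ (by omega)
  unfold setAccuracyProg
  refine T.next (clear_spec hJ) ?_
  rintro M₁ ⟨hE₁, hf₁, hJ₁⟩
  have hr₁ := hr.eqOff hE₁
  refine T.next (syncRows_core hP hr₁ hJ₁ (hC.eqOff hE₁)) ?_
  rintro M₂ ⟨hE₂, hJ₂, hC₂, hin₂, hout₂⟩
  have hr₂ := hr₁.eqOff hE₂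
  have hE₁₂ : Mem.EqOff ([outLen, aFresh] ++ touchN ++ treeN) ([tX] ++ touchR ++ treeR) M M₂ :=
    (hE₁.mono (by decide) (by decide)).trans (hE₂.mono (by decide) (by decide))
  refine T.next (T_scatR N (fun _ => True) r (M.real inArg1) (by simp [hr₂.len]) hNB'
    (by simp) (fun k hk _ => by simp [hr₂.idx k hk])
    (fun k hk _ => by simp [hE₁₂.2 inArg1 (by decide)]) (fun k hk _ => hrB k hk)
    hinj (by decide) (by decide)) ?_
  rintro _ ⟨fW, rfl, hfW, hfW'⟩
  have hout : ∀ {i}, ¬ InRows N r i → ∀ k < N, True → r k ≠ i := fun h k hk _ e => h ⟨k, hk, e⟩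
  generalize hM₃ : M₂.setRA inW fW = M₃
  have hE₃ : Mem.EqOff [] [inW] M₂ M₃ := by
    rw [← hM₃]; exact (Mem.EqOff.refl M₂).setRA (by decide) _
  have eW : M₃.real inW = fW := by rw [← hM₃]; simp
  have hC₃ : Core P M₃ X fun i => ¬ InRows N r i := by
    have fB : M₃.nat aBk = M₂.nat aBk := hE₃.1 _ (by decide)
    have fY : M₃.real aY = M₂.real aY := hE₃.2 _ (by decide)
    have fYS : M₃.real aYS = M₂.real aYS := hE₃.2 _ (by decide)
    have fX : M₃.real outXbar = M₂.real outXbar := hE₃.2 _ (by decide)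
    have fG : M₃.real inG = M₂.real inG := hE₃.2 _ (by decide)
    have fT : M₃.real inTau = M₂.real inTau := hE₃.2 _ (by decide)
    have fZ : M₃.real inZ = M₂.real inZ := hE₃.2 _ (by decide)
    refine ⟨hC₂.stat.eqOff hE₃, hC₂.cons.eqOff hE₃, by rw [fB]; exact hC₂.bk_lt,
      hC₂.sum.congr (hE₃.2 _ (by decide)) (fun _ _ _ => by rw [fB]) (fun _ _ _ => by rw [fG])
        (fun _ _ _ => by rw [fZ]),
      hC₂.max.congr (fun _ _ => trivial) (hE₃.2 _ (by decide)) (fun _ _ _ => by rw [fB])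
        (fun _ _ _ => by rw [fG]) (fun i _ h => by rw [eW, hfW' i (hout h)])
        (fun _ _ _ => by rw [fYS]),
      by rw [fB, fY, fYS]; exact hC₂.ys_le, by rw [fX, fG, fB, fY, fYS]; exact hC₂.exact, ?_,
      by rw [fB, fZ]; exact hC₂.bz, by rw [fB, fT]; exact hC₂.bt⟩
    intro i hi
    rw [eW]
    by_cases h : InRows N r i
    · obtain ⟨k, hk, rfl⟩ := h
      rw [hfW k hk trivial]
      exact mul_nonneg hG.eps_pos.le (hw k hk)
    · rw [hfW' i (hout h)]; exact hC₂.weight i hi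
  refine (keyRows_core hP (hr₂.eqOff hE₃) hC₃).mono (by omega) (by omega) ?_
  rintro M₄ ⟨hE₄, hC₄⟩
  have gW : M₄.real inW = fW := (hE₄.2 _ (by decide)).trans eW
  have gX : M₄.real outXbar = M₂.real outXbar :=
    (hE₄.2 _ (by decide)).trans (hE₃.2 _ (by decide))
  refine ⟨((hE₁₂.mono (by decide) (by decide)).trans (hE₃.mono (by decide) (by decide))).trans
      (hE₄.mono (by decide) (by decide)), hC₄, JState.of_jInv ((hJ₂.eqOff hE₃).eqOff hE₄) ?_,
      fun k hk => ?_, fun i hi => ?_⟩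
  · rw [hE₄.1 _ (by decide), hE₃.1 _ (by decide), hE₂.1 _ (by decide), hf₁]
  · rw [gW, gX, hfW k hk trivial]
    exact ⟨rfl, hin₂ _ ⟨k, hk, rfl⟩⟩
  · rw [gW, gX, hfW' i (hout hi), hE₁₂.2 inW (by decide), hout₂ i hi, hE₁.2 _ (by decide)]
    exact ⟨rfl, rfl⟩

end PrimalGradient

namespace PrimalGradient

variable {P : Lay} {M : Mem} {N : ℕ} {r : ℕ → ℕ} {last X : ℕ → ℝ} {Pl : ℕ → Prop}

/-! ## The operation `QuerySum` -/

/-- The current step, for every bucket. -/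
abbrev yc : ℕ := 26
abbrev tY : ℕ := 37

def addStep : Cmd := mapR (sc aNB) tY (rl aY ix) ;; mapR (sc aNB) aY (RExp.add (rl tY ix) (rl yc ix))

theorem addStep_spec (hP : P.Ok) (hC : Core P M X fun _ => True)
    (hy : ∀ b < P.NB, 0 ≤ M.real yc b) :
    T P.B addStep M (400 * (P.NB + 1)) 400 (fun M' => Mem.EqOff [] [tY, aY] M M' ∧
      Core P M' (fun i => X i + M.real inG i * M.real yc (M.nat aBk i)) fun _ => True) := by
  unfold addStep
  refine T.next (T_mapR P.NB (M.real aY) (by simp [hC.stat.NB]) hP.NB_le (by simp) (by decide)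
    (by decide)) ?_
  rintro _ rfl
  refine (T_mapR P.NB (fun b => M.real aY b + M.real yc b) (by simp [hC.stat.NB]) hP.NB_le
    (fun k hk => by simp [hk]) (by decide) (by decide)).mono (by omega) (by omega) ?_
  rintro _ rfl
  generalize hM' : Mem.setRA (Mem.setRA M tY _) aY _ = M'
  have hE : Mem.EqOff [] [tY, aY] M M' := by
    rw [← hM']; exact ((Mem.EqOff.refl M).setRA (by decide) _).setRA (by decide) _
  have eY : ∀ i < P.m, M'.real aY (M.nat aBk i) =
      M.real aY (M.nat aBk i) + M.real yc (M.nat aBk i) := by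
    intro i hi
    rw [← hM']
    simp [hC.bk_lt i hi]
  have fB : M'.nat aBk = M.nat aBk := hE.1 _ (by decide)
  have fYS : M'.real aYS = M.real aYS := hE.2 _ (by decide)
  have fX : M'.real outXbar = M.real outXbar := hE.2 _ (by decide)
  have fG : M'.real inG = M.real inG := hE.2 _ (by decide)
  have fT : M'.real inTau = M.real inTau := hE.2 _ (by decide)
  have fZ : M'.real inZ = M.real inZ := hE.2 _ (by decide)
  have fW : M'.real inW = M.real inW := hE.2 _ (by decide)
  refine ⟨hE, hC.stat.eqOff hE, hC.cons.eqOff hE, by rw [fB]; exact hC.bk_lt,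
    hC.sum.congr (hE.2 _ (by decide)) (fun _ _ _ => by rw [fB]) (fun _ _ _ => by rw [fG])
      (fun _ _ _ => by rw [fZ]),
    hC.max.congr (fun _ _ => trivial) (hE.2 _ (by decide)) (fun _ _ _ => by rw [fB])
      (fun _ _ _ => by rw [fG]) (fun i _ h => by rw [fW])
      (fun _ _ _ => by rw [fYS]), fun i hi => ?_, fun i hi => ?_, by rw [fW]; exact hC.weight,
    by rw [fB, fZ]; exact hC.bz, by rw [fB, fT]; exact hC.bt⟩
  · rw [fB, fYS, eY i hi]
    have := hC.ys_le i hi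
    have := hy _ (hC.bk_lt i hi)
    linarith
  · rw [fB, fYS, fG, fX, eY i hi, ← hC.exact i hi]
    ring

def querySumProg : Cmd :=
  addStep ;;
  mapR (sc inLen) tX (RExp.add (exactE row) (rl inArg1 ix)) ;;
  touch ;;
  keyRows ;;
  Cmd.forTo eB (sc aNB) (extract ;; syncRows ;; keyRows) ;;
  Cmd.storeN aFresh (cn 0) (cn 1)

abbrev querySumN : List ℕ := [aFresh, eB] ++ extractN ++ touchN ++ treeN
abbrev querySumR : List ℕ := [tY, aY, tX, eT] ++ touchR ++ treeR

open Classical in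
/-- The rows that are extracted by `QuerySum`. -/
noncomputable def extracted (P : Lay) (M : Mem) (X xb : ℕ → ℝ) : Finset ℕ :=
  (Finset.range P.m).filter fun i => P.ε * M.real inW i < |X i - xb i|

theorem mem_extracted {xb : ℕ → ℝ} {i : ℕ} : i ∈ extracted P M X xb ↔
    i < P.m ∧ P.ε * M.real inW i < |X i - xb i| := by
  simp [extracted]

open Classical in
theorem querySumLoop_spec (hP : P.Ok) (hJ : JInv P M last) (hC : Core P M X fun _ => True) :
    T P.B (Cmd.forTo eB (sc aNB) (extract ;; syncRows ;; keyRows)) M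
      (110000 * (((extracted P M X (M.real outXbar)).card + P.NB + 1) * ((P.L + 3) * (P.L + 3))))
      (110000 * ((P.NB + 1) * ((P.L + 3) * (P.L + 3)))) (fun M' =>
      Mem.EqOff querySumN querySumR M M' ∧ Core P M' X (fun _ => True) ∧ JInv P M' last ∧
      ∀ i < P.m, M'.real outXbar i =
        if i ∈ extracted P M X (M.real outXbar) then X i else M.real outXbar i) := by
  set E := extracted P M X (M.real outXbar) with hE
  set Λ := (P.L + 3) * (P.L + 3) with hΛ
  have hΛ3 : (P.L + 3) ≤ Λ := Nat.le_mul_self _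
  have hΛ9 : 9 ≤ Λ := Nat.mul_le_mul (by omega : 3 ≤ P.L + 3) (by omega : 3 ≤ P.L + 3)
  let V : ℕ → Finset ℕ := fun b => E.filter fun i => M.nat aBk i = b
  have hsum : ∑ b ∈ Finset.range P.NB, (V b).card = E.card := by
    refine (Finset.card_eq_sum_card_fiberwise fun i hi => ?_).symm
    simp only [Finset.coe_range, Set.mem_Iio]
    exact hC.bk_lt i (mem_extracted.1 hi).1
  refine (T_forTo_sum (fun b M' => Mem.EqOff querySumN querySumR M M' ∧
    Core P M' X (fun _ => True) ∧ JInv P M' last ∧ ∀ i < P.m, M'.real outXbar i =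
        if i ∈ E ∧ M.nat aBk i < b then X i else M.real outXbar i) P.NB
    (fun b => 101000 * (((V b).card + 1) * Λ)) (101000 * Λ) hP.NB_le (by decide) ?_ ?_ ?_ ?_).mono
    ?_ ?_ ?_
  · rintro b M' ⟨-, h, -⟩
    simpa using h.stat.NB
  · rintro b M' f ⟨h₁, h₂, h₃, h₄⟩
    have hE' := (Mem.EqOff.refl (NS := [eB]) (RS := []) M').setNA (a := eB) (by decide) f
    exact ⟨h₁.setNA (by decide) f, h₂.eqOff hE', h₃.eqOff hE', by simpa using h₄⟩
  · rintro b M' hb ⟨h₁, h₂, h₃, h₄⟩ hbM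
    have fB : M'.nat aBk = M.nat aBk := h₁.1 _ (by decide)
    have fW : M'.real inW = M.real inW := h₁.2 _ (by decide)
    have hV : inaccurate P M' X b = V b := by
      ext i
      simp only [V, mem_inaccurate, Finset.mem_filter, hE, mem_extracted, fB, fW]
      constructor
      · rintro ⟨hi, hib, hlt⟩
        rw [h₄ i hi, if_neg (by omega)] at hlt
        exact ⟨⟨hi, hlt⟩, hib⟩
      · rintro ⟨⟨hi, hlt⟩, hib⟩
        refine ⟨hi, hib, ?_⟩
        rwa [h₄ i hi, if_neg (by omega)]
    have hex := extract_spec hP h₂ hb hbM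
    rw [hV, ← hΛ] at hex
    set K := (V b).card with hK
    have hKΛ : (K + 1) * 1 ≤ (K + 1) * Λ := Nat.mul_le_mul_left _ (by omega)
    refine T.next hex ?_
    rintro M₁ ⟨hE₁, N, r, hr₁, hin, hN⟩
    have hNΛ : (N + 1) * (P.L + 3) ≤ (K + 1) * Λ := Nat.mul_le_mul (by omega) hΛ3
    have hC₁ := h₂.eqOff hE₁
    refine T.next (syncRows_core hP hr₁ (h₃.eqOff hE₁) hC₁) ?_
    rintro M₂ ⟨hE₂, hJ₂, hC₂, hin₂, hout₂⟩
    refine (keyRows_core hP (hr₁.eqOff hE₂) hC₂).mono (by omega) (by omega) ?_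
    rintro M₃ ⟨hE₃, hC₃⟩
    refine ⟨?_, ((h₁.trans (hE₁.mono (by decide) (by decide))).trans
      (hE₂.mono (by decide) (by decide))).trans (hE₃.mono (by decide) (by decide)), hC₃,
      hJ₂.eqOff hE₃, fun i hi => ?_⟩
    · rw [hE₃.1 _ (by decide), hE₂.1 _ (by decide), hE₁.1 _ (by decide), hbM]
    · rw [hE₃.2 _ (by decide)]
      by_cases hir : InRows N r i
      · have hiV : i ∈ V b := (hin i).1 hir
        rw [hin₂ i hir, if_pos]
        simp only [V, Finset.mem_filter] at hiV
        exact ⟨hiV.1, by omega⟩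
      · have hiV : i ∉ V b := fun h => hir ((hin i).2 h)
        rw [hout₂ i hir, hE₁.2 _ (by decide), h₄ i hi]
        simp only [V, Finset.mem_filter, not_and] at hiV
        refine if_congr ⟨fun h => ⟨h.1, by omega⟩, fun h => ⟨h.1, ?_⟩⟩ rfl rfl
        have := hiV h.1
        omega
  · exact ⟨Mem.EqOff.refl M, hC, hJ, fun i hi => by simp⟩
  · have h₁ : ∀ b ∈ Finset.range P.NB, 400 + 101000 * (((V b).card + 1) * Λ) ≤
        102000 * (((V b).card + 1) * Λ) := by
      intro b _
      have : 1 * 9 ≤ ((V b).card + 1) * Λ := Nat.mul_le_mul (by omega) hΛ9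
      omega
    refine (Nat.add_le_add_left (Finset.sum_le_sum h₁) _).trans ?_
    rw [← Finset.mul_sum, ← Finset.sum_mul, Finset.sum_add_distrib, hsum, Finset.sum_const,
      Finset.card_range, smul_eq_mul, mul_one]
    have : (E.card + P.NB + 1) * Λ = (E.card + P.NB) * Λ + Λ := by ring
    omega
  · have : P.NB * (400 + 101000 * Λ) = 400 * P.NB + 101000 * (P.NB * Λ) := by ring
    have h₆ : (P.NB + 1) * Λ = P.NB * Λ + Λ := Nat.succ_mul _ _
    rw [this, h₆]
    have : P.NB * 1 ≤ P.NB * Λ := Nat.mul_le_mul_left _ (by omega)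
    omega
  · rintro M' ⟨h₁, h₂, h₃, h₄⟩
    refine ⟨h₁, h₂, h₃, fun i hi => ?_⟩
    rw [h₄ i hi]
    exact if_congr (and_iff_left (hC.bk_lt i hi)) rfl rfl

open Classical in
/-- `X'` is the new exact sum. -/
theorem querySumProg_spec (hP : P.Ok) (hr : Rows P M N r) (hJ : JInv P M last)
    (hC : Core P M X fun _ => True) (hy : ∀ b < P.NB, 0 ≤ M.real yc b) {v h X' xb : ℕ → ℝ}
    (hv : ∀ i < P.m, v i = M.real inG i * M.real yc (M.nat aBk i))
    (hh : ∀ k < N, h (r k) = M.real inArg1 k) (hh' : ∀ i, ¬ InRows N r i → h i = 0)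
    (hX' : ∀ i < P.m, X' i = X i + (v i + h i))
    (hxb : ∀ i < P.m, xb i = if InRows N r i then X' i else M.real outXbar i) :
    T P.B querySumProg M
      (200000 * (((extracted P M X' xb).card + N + P.NB + 1) * ((P.L + 3) * (P.L + 3))))
      (200000 * ((P.NB + 1) * ((P.L + 3) * (P.L + 3)))) (fun M' =>
      Mem.EqOff querySumN querySumR M M' ∧ Core P M' X' (fun _ => True) ∧ JInv P M' last ∧
      M'.nat aFresh 0 = 1 ∧
      ∀ i < P.m, M'.real outXbar i = if i ∈ extracted P M X' xb then X' i else xb i) := by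
  set E := extracted P M X' xb with hE
  set Λ := (P.L + 3) * (P.L + 3) with hΛ
  have hone := hP.one_le
  have hΛ3 : (P.L + 3) ≤ Λ := Nat.le_mul_self _
  have hΛ9 : 9 ≤ Λ := Nat.mul_le_mul (by omega : 3 ≤ P.L + 3) (by omega : 3 ≤ P.L + 3)
  have h₁ : (E.card + N + P.NB + 1) * Λ = (E.card + P.NB + 1) * Λ + N * Λ := by ring
  have h₂ : (N + 1) * (P.L + 3) ≤ N * Λ + Λ := by
    rw [← Nat.succ_mul]; exact Nat.mul_le_mul_left _ hΛ3
  have h₃ : (P.NB + 1) * 9 ≤ (E.card + P.NB + 1) * Λ := Nat.mul_le_mul (by omega) hΛ9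
  have h₄ : N * 9 ≤ N * Λ := Nat.mul_le_mul_left _ hΛ9
  have h₅ : 1 * Λ ≤ (E.card + P.NB + 1) * Λ := Nat.mul_le_mul_right _ (by omega)
  have h₆ : (P.NB + 1) * Λ = P.NB * Λ + Λ := Nat.succ_mul _ _
  unfold querySumProg
  refine T.next (addStep_spec hP hC hy) ?_
  rintro M₁ ⟨hE₁, hC₁⟩
  have hr₁ := hr.eqOff hE₁
  refine T.next (T_mapR N (fun k => X' (r k)) (by simp [hr₁.len]) (hr.le.trans hP.m_le)
    (fun k hk => ?_) (by decide) (by decide)) ?_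
  · rw [RExp.eval, hC₁.eval_exactE (i := r k) rfl (by simp [hr₁.idx k hk]) (hr.lt k hk),
      hX' _ (hr.lt k hk), hv _ (hr.lt k hk), hh k hk]
    simp [hE₁.2 inArg1 (by decide), add_assoc]
  rintro _ rfl
  generalize hM₂ : M₁.setRA tX _ = M₂
  have hE₂ : Mem.EqOff [] [tX] M₁ M₂ := by
    rw [← hM₂]; exact (Mem.EqOff.refl M₁).setRA (by decide) _
  have hX₁ : Core P M₂ (fun i => X i + M.real inG i * M.real yc (M.nat aBk i)) fun _ => True :=
    hC₁.eqOff hE₂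
  refine T.next (touch_core hP (hr₁.eqOff hE₂) ((hJ.eqOff hE₁).eqOff hE₂) hX₁
    (X' := fun i => if InRows N r i then X' i else X i + M.real inG i * M.real yc (M.nat aBk i))
    (fun k hk => by
      have : InRows N r (r k) := ⟨k, hk, rfl⟩
      simp [← hM₂, hk, this])
    (fun i hi => by rw [if_neg hi])) ?_
  rintro M₃ ⟨hE₃, hJ₃, hC₃, hin₃, hout₃⟩
  refine T.next (keyRows_core hP ((hr₁.eqOff hE₂).eqOff hE₃) hC₃) ?_
  rintro M₄ ⟨hE₄, hC₄⟩
  have hC₄' : Core P M₄ X' fun _ => True := by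
    refine { hC₄ with exact := fun i hi => ?_ }
    rw [hC₄.exact i hi]
    split_ifs with h'
    · rfl
    · rw [hX' i hi, hv i hi, hh' i h', add_zero]
  have hE₁₄ : Mem.EqOff querySumN querySumR M M₄ :=
    (((hE₁.mono (by decide) (by decide)).trans (hE₂.mono (by decide) (by decide))).trans
      (hE₃.mono (by decide) (by decide))).trans (hE₄.mono (by decide) (by decide))
  have hxb₄ : ∀ i < P.m, M₄.real outXbar i = xb i := by
    intro i hi
    rw [hE₄.2 _ (by decide), hxb i hi]
    split_ifs with h'
    · rw [hin₃ i h', if_pos h']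
    · rw [hout₃ i h', hE₂.2 _ (by decide), hE₁.2 _ (by decide)]
  have hE' : extracted P M₄ X' (M₄.real outXbar) = E := by
    ext i
    rw [hE, mem_extracted, mem_extracted, hE₁₄.2 inW (by decide)]
    exact and_congr_right fun hi => by rw [hxb₄ i hi]
  have hloop := querySumLoop_spec hP (hJ₃.eqOff hE₄) hC₄'
  rw [hE', ← hΛ] at hloop
  refine T.next hloop ?_
  rintro M₅ ⟨hE₅, hC₅, hJ₅, hx₅⟩
  refine (T_storeN (by simp) (by simp; omega) (by decide)).mono (by omega) (by omega) ?_
  rintro _ rfl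
  have hE₆ := (Mem.EqOff.refl (NS := [aFresh]) (RS := []) M₅).setNA (a := aFresh) (by decide)
    (Function.update (M₅.nat aFresh) 0 1)
  refine ⟨(hE₁₄.trans hE₅).setNA (by decide) _, hC₅.eqOff hE₆, hJ₅.eqOff hE₆, by simp,
    fun i hi => ?_⟩
  rw [← hxb₄ i hi]
  exact hx₅ i hi

end PrimalGradient

namespace PrimalGradient

/-! ## The maximizer over the unit ball of the mixed norm -/

theorem gradPsi_eq {m : ℕ} (lam : ℝ) (z : Fin m → ℝ) :
    gradPsi lam z = fun i => lam * Real.sinh (lam * z i) := by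
  funext i
  have h : ∀ j ∈ Finset.univ, HasDerivAt (fun s => Real.cosh (lam * Function.update z i s j))
      (if j = i then lam * Real.sinh (lam * z i) else 0) (z i) := by
    intro j _
    split_ifs with hj
    · subst hj
      simp only [Function.update_self]
      have h₁ := ((hasDerivAt_id (z j)).const_mul lam).cosh
      simpa [mul_comm] using h₁
    · simp only [Function.update_of_ne hj]
      exact hasDerivAt_const _ _
  have h₂ := HasDerivAt.fun_sum h
  rw [Finset.sum_ite_eq' Finset.univ i, if_pos (Finset.mem_univ i)] at h₂
  exact h₂.deriv

theorem mixedNorm_eq {m n : ℕ} (C : ℝ) (τ v : Fin m → ℝ) :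
    mixedNorm C n τ v =
      ‖v‖ + C * Real.log (4 * (m : ℝ) / (n : ℝ)) * Real.sqrt (∑ i, τ i * v i ^ 2) := rfl

theorem isFlat_of_root {m n : ℕ} {C K u R : ℝ} {τ x y : Fin m → ℝ}
    (hK : K = C * Real.log (4 * (m : ℝ) / (n : ℝ))) (hK0 : 0 < K) (hτ : ∀ i, 0 < τ i)
    (hx : ∀ i, 0 < x i) (hu : 0 < u)
    (hR : R = Real.sqrt (∑ i, τ i * min u (x i / τ i) ^ 2))
    (hroot : K * ∑ i, max (x i - τ i * u) 0 = R)
    (hy : ∀ i, y i = min u (x i / τ i) / (u + K * R)) : IsFlat C n τ x y := by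
  have hR0 : 0 ≤ R := hR ▸ Real.sqrt_nonneg _
  have hZ : 0 < u + K * R := by positivity
  have hmin : ∀ i, 0 ≤ min u (x i / τ i) := fun i =>
    le_min hu.le (div_nonneg (hx i).le (hτ i).le)
  have hsum : ∑ i, τ i * min u (x i / τ i) ^ 2 = R ^ 2 := by
    rw [hR, Real.sq_sqrt]
    exact Finset.sum_nonneg fun i _ => mul_nonneg (hτ i).le (sq_nonneg _)
  have hsplit : ∀ i, x i = max (x i - τ i * u) 0 + τ i * min u (x i / τ i) := by
    intro i
    have hti := hτ i
    rcases le_total u (x i / τ i) with h | h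
    · rw [min_eq_left h, max_eq_left]
      · ring
      · rw [le_div_iff₀ hti] at h; linarith
    · rw [min_eq_right h, max_eq_right]
      · field_simp; ring
      · rw [div_le_iff₀ hti] at h; linarith
  have hpos : ∑ i, max (x i - τ i * u) 0 = R / K := by
    rw [eq_div_iff hK0.ne', ← hroot]; ring
  constructor
  · rw [mixedNorm_eq, ← hK]
    have h₁ : ‖y‖ ≤ u / (u + K * R) := by
      rw [pi_norm_le_iff_of_nonneg (by positivity)]
      intro i
      rw [hy, Real.norm_eq_abs, abs_of_nonneg (div_nonneg (hmin i) hZ.le)]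
      exact div_le_div_of_nonneg_right (min_le_left _ _) hZ.le
    have h₂ : ∑ i, τ i * y i ^ 2 = (R / (u + K * R)) ^ 2 := by
      rw [div_pow, ← hsum, Finset.sum_div]
      refine Finset.sum_congr rfl fun i _ => ?_
      rw [hy, div_pow, mul_div_assoc]
    rw [h₂, Real.sqrt_sq (by positivity)]
    calc ‖y‖ + K * (R / (u + K * R)) ≤ u / (u + K * R) + K * (R / (u + K * R)) := by gcongr
      _ = 1 := by field_simp
  · intro w hw
    rw [mixedNorm_eq, ← hK] at hw
    set S := Real.sqrt (∑ i, τ i * w i ^ 2) with hS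
    have hxy : x ⬝ᵥ y = R / K := by
      have h₁ : x ⬝ᵥ y = ∑ i, (max (x i - τ i * u) 0 * u + τ i * min u (x i / τ i) ^ 2) /
          (u + K * R) := by
        refine Finset.sum_congr rfl fun i _ => ?_
        rw [hy]
        have : max (x i - τ i * u) 0 * min u (x i / τ i) = max (x i - τ i * u) 0 * u := by
          rcases le_total u (x i / τ i) with h | h
          · rw [min_eq_left h]
          · rw [max_eq_right, zero_mul, zero_mul]
            rw [div_le_iff₀ (hτ i)] at h; linarith
        have h := hsplit i
        rw [← this]
        generalize max (x i - τ i * u) 0 = p at *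
        generalize min u (x i / τ i) = q at *
        rw [h]
        ring
      rw [h₁, ← Finset.sum_div, Finset.sum_add_distrib, ← Finset.sum_mul, hsum, hpos]
      field_simp
    have hxw : x ⬝ᵥ w ≤ R / K * ‖w‖ + R * S := by
      have h₁ : x ⬝ᵥ w ≤ ∑ i, (max (x i - τ i * u) 0 * ‖w‖ +
          (Real.sqrt (τ i) * min u (x i / τ i)) * (Real.sqrt (τ i) * w i)) := by
        refine Finset.sum_le_sum fun i _ => ?_
        conv_lhs => rw [hsplit i]
        rw [add_mul]
        refine add_le_add ?_ (le_of_eq ?_)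
        · exact mul_le_mul_of_nonneg_left ((le_abs_self _).trans (norm_le_pi_norm w i))
            (le_max_right _ _)
        · calc τ i * min u (x i / τ i) * w i =
              (Real.sqrt (τ i) * Real.sqrt (τ i)) * min u (x i / τ i) * w i := by
                rw [Real.mul_self_sqrt (hτ i).le]
            _ = _ := by ring
      refine h₁.trans ?_
      rw [Finset.sum_add_distrib, ← Finset.sum_mul, hpos]
      gcongr
      refine (Real.sum_mul_le_sqrt_mul_sqrt _ _ _).trans (le_of_eq ?_)
      rw [hR, hS]
      congr 2 <;> refine Finset.sum_congr rfl fun i _ => ?_ <;>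
        rw [mul_pow, Real.sq_sqrt (hτ i).le]
    calc x ⬝ᵥ w ≤ R / K * ‖w‖ + R * S := hxw
      _ = R / K * (‖w‖ + K * S) := by field_simp
      _ ≤ R / K * 1 := by gcongr
      _ = x ⬝ᵥ y := by rw [hxy, mul_one]

/-! ## Finding the threshold -/

section Threshold

variable (N : ℕ) (w x t : ℕ → ℝ) (K u : ℝ)

noncomputable def posSum : ℝ :=
  ∑ b ∈ Finset.range N, if t b * u < x b then w b * (x b - t b * u) else 0

noncomputable def sqSum : ℝ :=
  (∑ b ∈ Finset.range N, if x b / t b < u then w b * (t b * (x b / t b * (x b / t b))) else 0) +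
    ∑ b ∈ Finset.range N, if ¬ x b / t b < u then w b * (t b * (u * u)) else 0

noncomputable def candX (c : ℕ) : ℝ :=
  ∑ b ∈ Finset.range N, if ¬ x b / t b < x c / t c then w b * x b else 0

noncomputable def candT (c : ℕ) : ℝ :=
  ∑ b ∈ Finset.range N, if ¬ x b / t b < x c / t c then w b * t b else 0

noncomputable def candQ (c : ℕ) : ℝ :=
  ∑ b ∈ Finset.range N,
    if x b / t b < x c / t c then w b * (t b * (x b / t b * (x b / t b))) else 0

/-- The solution `u` of `K (X - T u) = √(T u² + Q)`. -/
noncomputable def solveE (K X T Q : ℝ) : ℝ :=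
  (K * K * (X * X) - Q) / (K * K * (X * T) +
    Real.sqrt (K * K * (X * T) * (K * K * (X * T)) -
      (K * K * (T * T) - T) * (K * K * (X * X) - Q)))

variable {N w x t K u}

theorem solveE_eq {X T Q : ℝ} (hK : 0 < K) (hX : 0 < X) (hT : 0 < T) (hu : 0 < u)
    (hQ : 0 ≤ Q) (h : K * (X - T * u) = Real.sqrt (T * u ^ 2 + Q)) : solveE K X T Q = u := by
  have h0 : 0 ≤ X - T * u := by
    have : 0 ≤ K * (X - T * u) := h ▸ Real.sqrt_nonneg _
    exact nonneg_of_mul_nonneg_right this hK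
  have hsq : K ^ 2 * (X - T * u) ^ 2 = T * u ^ 2 + Q := by
    rw [← mul_pow, h, Real.sq_sqrt (by positivity)]
  have hb : 0 ≤ K * K * (X * T) - (K * K * (T * T) - T) * u := by
    have : K * K * (X * T) - (K * K * (T * T) - T) * u =
        K * K * T * (X - T * u) + T * u := by ring
    rw [this]; positivity
  have hD : K * K * (X * T) * (K * K * (X * T)) - (K * K * (T * T) - T) * (K * K * (X * X) - Q) =
      (K * K * (X * T) - (K * K * (T * T) - T) * u) ^ 2 := by
    linear_combination (-(K * K * (T * T) - T)) * hsq
  rw [solveE, hD, Real.sqrt_sq hb, div_eq_iff]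
  · linear_combination hsq
  · have : 0 < K * K * (X * T) := by positivity
    linarith

theorem sqSum_eq : sqSum N w x t u =
    ∑ b ∈ Finset.range N, w b * (t b * min u (x b / t b) ^ 2) := by
  rw [sqSum, ← Finset.sum_add_distrib]
  refine Finset.sum_congr rfl fun b _ => ?_
  by_cases h : x b / t b < u
  · rw [if_pos h, if_neg (not_not.2 h), min_eq_right h.le]; ring
  · rw [if_neg h, if_pos h, min_eq_left (not_lt.1 h)]; ring

theorem posSum_eq : posSum N w x t u =
    ∑ b ∈ Finset.range N, w b * max (x b - t b * u) 0 := by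
  refine Finset.sum_congr rfl fun b _ => ?_
  split_ifs with h
  · rw [max_eq_left (by linarith)]
  · rw [max_eq_right (by linarith), mul_zero]

theorem exists_root (hK : 0 < K) (hw : ∀ b < N, 0 ≤ w b) (hx : ∀ b < N, 0 < x b)
    (ht : ∀ b < N, 0 < t b) (hex : ∃ b < N, 0 < w b) :
    ∃ u, 0 < u ∧ K * posSum N w x t u = Real.sqrt (sqSum N w x t u) ∧
      0 < posSum N w x t u := by
  obtain ⟨b₀, hb₀, hwb⟩ := hex
  have hr : ∀ b < N, 0 < x b / t b := fun b hb => div_pos (hx b hb) (ht b hb)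
  set U := ∑ b ∈ Finset.range N, x b / t b with hU
  have hle : ∀ b < N, x b / t b ≤ U := fun b hb =>
    Finset.single_le_sum (f := fun b => x b / t b)
      (fun b hb => (hr b (Finset.mem_range.1 hb)).le) (Finset.mem_range.2 hb)
  have hsq : ∀ u, 0 < u → 0 < sqSum N w x t u := by
    intro u hu
    rw [sqSum_eq]
    refine Finset.sum_pos' (fun b hb => ?_) ⟨b₀, Finset.mem_range.2 hb₀, ?_⟩
    · rw [Finset.mem_range] at hb
      exact mul_nonneg (hw b hb) (mul_nonneg (ht b hb).le (sq_nonneg _))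
    · have := ht _ hb₀
      have : 0 < min u (x b₀ / t b₀) := lt_min hu (hr _ hb₀)
      positivity
  have hU0 : 0 < U := (hr _ hb₀).trans_le (hle _ hb₀)
  let φ : ℝ → ℝ := fun u => K * posSum N w x t u - Real.sqrt (sqSum N w x t u)
  have hφ : Continuous φ := by
    simp only [φ, posSum_eq, sqSum_eq]
    fun_prop
  have h0 : 0 < φ 0 := by
    simp only [φ, sqSum_eq, posSum_eq]
    have h₁ : ∑ b ∈ Finset.range N, w b * (t b * min 0 (x b / t b) ^ 2) = 0 := by
      refine Finset.sum_eq_zero fun b hb => ?_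
      rw [min_eq_left (hr b (Finset.mem_range.1 hb)).le]; ring
    rw [h₁, Real.sqrt_zero, sub_zero]
    refine mul_pos hK (Finset.sum_pos' (fun b hb => ?_) ⟨b₀, Finset.mem_range.2 hb₀, ?_⟩)
    · exact mul_nonneg (hw b (Finset.mem_range.1 hb)) (le_max_right _ _)
    · refine mul_pos hwb (lt_max_of_lt_left ?_)
      have := hx _ hb₀
      linarith
  have hlt : φ U < 0 := by
    have h₁ : posSum N w x t U = 0 := by
      refine Finset.sum_eq_zero fun b hb => ?_
      rw [Finset.mem_range] at hb
      have := hle b hb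
      rw [div_le_iff₀' (ht b hb)] at this
      exact if_neg this.not_gt
    simp only [φ, h₁, mul_zero, zero_sub, neg_lt_zero]
    exact Real.sqrt_pos.2 (hsq U hU0)
  obtain ⟨u, ⟨hu₀, -⟩, hu⟩ := intermediate_value_Icc' hU0.le hφ.continuousOn ⟨hlt.le, h0.le⟩
  have hu' : 0 < u := lt_of_le_of_ne hu₀ fun h => by
    rw [← h] at hu; exact h0.ne' hu
  have he : K * posSum N w x t u = Real.sqrt (sqSum N w x t u) := sub_eq_zero.1 hu
  refine ⟨u, hu', he, ?_⟩
  have : 0 < K * posSum N w x t u := he ▸ Real.sqrt_pos.2 (hsq u hu')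
  exact pos_of_mul_pos_right this hK.le

theorem exists_candidate (hK : 0 < K) (hw : ∀ b < N, 0 ≤ w b) (hx : ∀ b < N, 0 < x b)
    (ht : ∀ b < N, 0 < t b) (hex : ∃ b < N, 0 < w b) :
    ∃ c < N, 0 < solveE K (candX N w x t c) (candT N w x t c) (candQ N w x t c) ∧
      K * posSum N w x t (solveE K (candX N w x t c) (candT N w x t c) (candQ N w x t c)) =
        Real.sqrt
          (sqSum N w x t (solveE K (candX N w x t c) (candT N w x t c) (candQ N w x t c))) := by
  obtain ⟨u, hu, he, hp⟩ := exists_root hK hw hx ht hex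
  have hlt_iff : ∀ b < N, (t b * u < x b ↔ u < x b / t b) := fun b hb => by
    rw [lt_div_iff₀' (ht b hb)]
  obtain ⟨b₁, hb₁, hb₁'⟩ : ∃ b ∈ Finset.range N,
      0 < if t b * u < x b then w b * (x b - t b * u) else 0 := by
    by_contra hcon
    push Not at hcon
    exact hp.not_ge (Finset.sum_nonpos hcon)
  rw [Finset.mem_range] at hb₁
  have hb₂ : u < x b₁ / t b₁ ∧ 0 < w b₁ := by
    split_ifs at hb₁' with h
    · refine ⟨(hlt_iff _ hb₁).1 h, pos_of_mul_pos_left hb₁' (by linarith)⟩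
    · exact absurd hb₁' (lt_irrefl _)
  obtain ⟨c, hc, hcmin⟩ := Finset.exists_min_image
    ((Finset.range N).filter fun b => u < x b / t b) (fun b => x b / t b)
    ⟨b₁, Finset.mem_filter.2 ⟨Finset.mem_range.2 hb₁, hb₂.1⟩⟩
  simp only [Finset.mem_filter, Finset.mem_range] at hc hcmin
  have hS : ∀ b < N, (¬ x b / t b < x c / t c ↔ u < x b / t b) := fun b hb =>
    ⟨fun h => hc.2.trans_le (not_lt.1 h), fun h => not_lt.2 (hcmin b ⟨hb, h⟩)⟩
  refine ⟨c, hc.1, ?_⟩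
  set X := candX N w x t c with hX
  set Tc := candT N w x t c with hTc
  set Q := candQ N w x t c with hQ
  have hX' : X = ∑ b ∈ Finset.range N, if u < x b / t b then w b * x b else 0 :=
    Finset.sum_congr rfl fun b hb => if_congr (hS b (Finset.mem_range.1 hb)) rfl rfl
  have hT' : Tc = ∑ b ∈ Finset.range N, if u < x b / t b then w b * t b else 0 :=
    Finset.sum_congr rfl fun b hb => if_congr (hS b (Finset.mem_range.1 hb)) rfl rfl
  have hQ' : Q = ∑ b ∈ Finset.range N,
      if u < x b / t b then 0 else w b * (t b * (x b / t b * (x b / t b))) := by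
    refine Finset.sum_congr rfl fun b hb => ?_
    have := hS b (Finset.mem_range.1 hb)
    by_cases h : u < x b / t b
    · rw [if_pos h, if_neg (this.2 h)]
    · rw [if_neg h, if_pos (not_not.1 fun h' => h (this.1 h'))]
  have hXpos : 0 < X := by
    rw [hX']
    refine Finset.sum_pos' (fun b hb => ?_) ⟨b₁, Finset.mem_range.2 hb₁, ?_⟩
    · rw [Finset.mem_range] at hb
      split_ifs
      · exact mul_nonneg (hw b hb) (hx b hb).le
      · rfl
    · rw [if_pos hb₂.1]; exact mul_pos hb₂.2 (hx _ hb₁)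
  have hTpos : 0 < Tc := by
    rw [hT']
    refine Finset.sum_pos' (fun b hb => ?_) ⟨b₁, Finset.mem_range.2 hb₁, ?_⟩
    · rw [Finset.mem_range] at hb
      split_ifs
      · exact mul_nonneg (hw b hb) (ht b hb).le
      · rfl
    · rw [if_pos hb₂.1]; exact mul_pos hb₂.2 (ht _ hb₁)
  have hQ0 : 0 ≤ Q := by
    rw [hQ']
    refine Finset.sum_nonneg fun b hb => ?_
    rw [Finset.mem_range] at hb
    split_ifs
    · rfl
    · exact mul_nonneg (hw b hb) (mul_nonneg (ht b hb).le (mul_self_nonneg _))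
  have h₁ : posSum N w x t u = X - Tc * u := by
    rw [hX', hT', Finset.sum_mul, ← Finset.sum_sub_distrib]
    refine Finset.sum_congr rfl fun b hb => ?_
    rw [if_congr (hlt_iff b (Finset.mem_range.1 hb)) rfl rfl]
    split_ifs <;> ring
  have h₂ : sqSum N w x t u = Tc * u ^ 2 + Q := by
    rw [sqSum_eq, hT', hQ', Finset.sum_mul, ← Finset.sum_add_distrib]
    refine Finset.sum_congr rfl fun b hb => ?_
    split_ifs with h
    · rw [min_eq_left h.le]; ring
    · rw [min_eq_right (not_lt.1 h)]; ring
  have hsol : solveE K X Tc Q = u := solveE_eq hK hXpos hTpos hu hQ0 (by rw [← h₁, ← h₂, he])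
  rw [hsol]
  exact ⟨hu, he⟩

end Threshold

end PrimalGradient

namespace PrimalGradient

variable {P : Lay} {M : Mem} {N : ℕ} {r : ℕ → ℕ} {last X : ℕ → ℝ} {Pl : ℕ → Prop}

/-! ## The operation `QueryProduct` -/

abbrev qX : ℕ := 38
abbrev qT : ℕ := 39
abbrev qQ : ℕ := 40
abbrev qU : ℕ := 41
abbrev qP : ℕ := 42
abbrev qS : ℕ := 43
abbrev qS' : ℕ := 44
abbrev qK : ℕ := 45
abbrev qZ : ℕ := 46
abbrev qt : ℕ := 47
abbrev qb : ℕ := 69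

/-- The entries of the bucket that is given by the counter. -/
abbrev xE : RExp := rl aX (sc eB)
abbrev tE : RExp := rl aT (sc eB)
abbrev rE : RExp := rl aR (sc eB)
abbrev wE : RExp := rl aSum (nd (sc aL) rootE)

abbrev kE : RExp :=
  RExp.mul (rl inScal (cn 2)) (RExp.log (RExp.div (RExp.mul (RExp.ofNat (cn 4))
    (RExp.ofNat (sc inDim))) (RExp.ofNat colN)))

abbrev solveProg : RExp :=
  let K := rs qK
  let X := rl qX ix
  let T := rl qT ix
  let c := RExp.sub (RExp.mul (RExp.mul K K) (RExp.mul X X)) (rl qQ ix)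
  let b := RExp.mul (RExp.mul K K) (RExp.mul X T)
  RExp.div c (RExp.add b (RExp.sqrt (RExp.sub (RExp.mul b b)
    (RExp.mul (RExp.sub (RExp.mul (RExp.mul K K) (RExp.mul T T)) T) c))))

/-- For every bucket solve for the threshold, assuming that the thresholds of the buckets above it
are the larger ones. -/
def candidates : Cmd :=
  accR (sc aNB) (sc aNB) eB qX qt (BExp.not (BExp.realLT rE (rl aR ix))) (RExp.mul wE xE) ;;
  accR (sc aNB) (sc aNB) eB qT qt (BExp.not (BExp.realLT rE (rl aR ix))) (RExp.mul wE tE) ;;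
  accR (sc aNB) (sc aNB) eB qQ qt (BExp.realLT rE (rl aR ix))
    (RExp.mul wE (RExp.mul tE (RExp.mul rE rE))) ;;
  Cmd.storeR qK (cn 0) kE ;;
  mapR (sc aNB) qU solveProg

abbrev candidatesR : List ℕ := [qX, qT, qQ, qK, qU, qt]

/-- The number of rows with non-zero weight of a bucket, as a real number. -/
noncomputable abbrev cnt (P : Lay) (M : Mem) : ℕ → ℝ := root P M P.n

/-- The factor of the second part of the mixed norm. -/
noncomputable def Lay.K (P : Lay) : ℝ := P.C * Real.log (4 * (P.m : ℝ) / P.n)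

/-- The candidate for the threshold that belongs to a bucket. -/
noncomputable def cand (P : Lay) (M : Mem) (c : ℕ) : ℝ :=
  solveE P.K (candX P.NB (cnt P M) P.xb P.tb c) (candT P.NB (cnt P M) P.xb P.tb c)
    (candQ P.NB (cnt P M) P.xb P.tb c)

theorem root_congr {M' : Mem} (h : M'.real aSum = M.real aSum) : root P M' = root P M := by
  funext c b; rw [root, root, h]

theorem Stat.eval_wE (hS : Stat P M) {k j : ℕ} (hj : M.nat eB 0 = j) :
    wE.eval (st1 M k) = cnt P M j := by
  simp [hS.n, hS.NB, hS.L, hj, cnt, root, node]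

theorem candidates_spec (hP : P.Ok) (hS : Stat P M) :
    T P.B candidates M (5000 * ((P.NB + 1) * (P.NB + 1))) (5000 * (P.NB + 1)) (fun M' =>
      Mem.EqOff [eB] candidatesR M M' ∧ M'.real qK 0 = P.K ∧
        ∀ c < P.NB, M'.real qU c = cand P M c) := by
  classical
  have hB := hP.NB_le
  have hsq : 1 * (P.NB + 1) ≤ (P.NB + 1) * (P.NB + 1) := Nat.mul_le_mul_right _ (by omega)
  unfold candidates
  refine T.next (T_accR P.NB P.NB (fun k j => ¬ P.xb j / P.tb j < P.xb k / P.tb k)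
    (fun _ j => cnt P M j * P.xb j) hB hB (fun M' h => by simp [(hS.eqOff h).NB])
    (fun M' h => by simp [(hS.eqOff h).NB])
    (fun M' h hj k hk => by
      have S := hS.eqOff h
      simp [BExp.Holds, S.R _ hj, S.R _ hk])
    (fun M' h hj k hk _ => by
      have S := hS.eqOff h
      rw [RExp.eval, S.eval_wE rfl, cnt, root_congr (h.2 aSum (by decide))]
      simp [S.X _ hj])
    (by decide) (by decide) (by decide) (by decide)) ?_
  rintro M₁ ⟨hE₁, hX⟩
  have hS₁ := hS.eqOff hE₁
  have hw₁ : root P M₁ = root P M := root_congr (hE₁.2 aSum (by decide))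
  refine T.next (T_accR P.NB P.NB (fun k j => ¬ P.xb j / P.tb j < P.xb k / P.tb k)
    (fun _ j => cnt P M j * P.tb j) hB hB (fun M' h => by simp [(hS₁.eqOff h).NB])
    (fun M' h => by simp [(hS₁.eqOff h).NB])
    (fun M' h hj k hk => by
      have S := hS₁.eqOff h
      simp [BExp.Holds, S.R _ hj, S.R _ hk])
    (fun M' h hj k hk _ => by
      have S := hS₁.eqOff h
      rw [RExp.eval, S.eval_wE rfl, cnt, root_congr (h.2 aSum (by decide)), hw₁]
      simp [S.T _ hj])
    (by decide) (by decide) (by decide) (by decide)) ?_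
  rintro M₂ ⟨hE₂, hT⟩
  have hS₂ := hS₁.eqOff hE₂
  have hw₂ : root P M₂ = root P M := (root_congr (hE₂.2 aSum (by decide))).trans hw₁
  refine T.next (T_accR P.NB P.NB (fun k j => P.xb j / P.tb j < P.xb k / P.tb k)
    (fun _ j => cnt P M j * (P.tb j * (P.xb j / P.tb j * (P.xb j / P.tb j)))) hB hB
    (fun M' h => by simp [(hS₂.eqOff h).NB])
    (fun M' h => by simp [(hS₂.eqOff h).NB])
    (fun M' h hj k hk => by
      have S := hS₂.eqOff h
      simp [BExp.Holds, S.R _ hj, S.R _ hk])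
    (fun M' h hj k hk _ => by
      have S := hS₂.eqOff h
      rw [RExp.eval, S.eval_wE rfl, cnt, root_congr (h.2 aSum (by decide)), hw₂]
      simp [S.T _ hj, S.R _ hj])
    (by decide) (by decide) (by decide) (by decide)) ?_
  rintro M₃ ⟨hE₃, hQ⟩
  have hS₃ := hS₂.eqOff hE₃
  refine T.next (T_storeR (by simp) (by decide)) ?_
  rintro _ rfl
  generalize hM₄ : M₃.setRA qK _ = M₄
  have hE₄ : Mem.EqOff [] [qK] M₃ M₄ := by
    rw [← hM₄]; exact (Mem.EqOff.refl M₃).setRA (by decide) _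
  have hK : M₄.real qK 0 = P.K := by
    rw [← hM₄]; simp [hS₃.C, hS₃.m, hS₃.n, Lay.K]
  have hS₄ := hS₃.eqOff hE₄
  refine (T_mapR P.NB (cand P M) (by simp [hS₄.NB]) hB (fun k hk => ?_) (by decide)
    (by decide)).mono (by omega) (by omega) ?_
  · have gX : M₄.real qX k = candX P.NB (cnt P M) P.xb P.tb k := by
      rw [hE₄.2 _ (by decide), hE₃.2 _ (by decide), hE₂.2 _ (by decide), hX k hk]
      exact Finset.sum_congr rfl fun _ _ => by congr
    have gT : M₄.real qT k = candT P.NB (cnt P M) P.xb P.tb k := by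
      rw [hE₄.2 _ (by decide), hE₃.2 _ (by decide), hT k hk]
      exact Finset.sum_congr rfl fun _ _ => by congr
    have gQ : M₄.real qQ k = candQ P.NB (cnt P M) P.xb P.tb k := by
      rw [hE₄.2 _ (by decide), hQ k hk]
      exact Finset.sum_congr rfl fun _ _ => by congr
    simp [gX, gT, gQ, hK, cand, solveE]
  · rintro _ rfl
    refine ⟨((((hE₁.mono (by decide) (by decide)).trans (hE₂.mono (by decide) (by decide))).trans
      (hE₃.mono (by decide) (by decide))).trans (hE₄.mono (by decide) (by decide))).setRA
        (by decide) _, by simp [hK], fun c hc => by simp [hc]⟩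

/-- Evaluate both sides of the equation for the threshold for every candidate, and pick one that
satisfies it. -/
def choose : Cmd :=
  accR (sc aNB) (sc aNB) eB qP qt (BExp.realLT (RExp.mul tE (rl qU ix)) xE)
    (RExp.mul wE (RExp.sub xE (RExp.mul tE (rl qU ix)))) ;;
  accR (sc aNB) (sc aNB) eB qS qt (BExp.realLT rE (rl qU ix))
    (RExp.mul wE (RExp.mul tE (RExp.mul rE rE))) ;;
  accR (sc aNB) (sc aNB) eB qS' qt (BExp.not (BExp.realLT rE (rl qU ix)))
    (RExp.mul wE (RExp.mul tE (RExp.mul (rl qU ix) (rl qU ix)))) ;;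
  pick (cn 1) (sc aNB) eB qb (BExp.and (BExp.realLT (RExp.ofNat (cn 0)) (rl qU (sc eB)))
    (BExp.realEq (RExp.mul (rs qK) (rl qP (sc eB)))
      (RExp.sqrt (RExp.add (rl qS (sc eB)) (rl qS' (sc eB)))))) ;;
  Cmd.storeR qZ (cn 0) (RExp.add (rl qU (sc qb)) (RExp.mul (rs qK)
    (RExp.sqrt (RExp.add (rl qS (sc qb)) (rl qS' (sc qb))))))

abbrev chooseR : List ℕ := [qP, qS, qS', qt, qZ]

theorem choose_spec (hP : P.Ok) (hS : Stat P M) {w u : ℕ → ℝ} {K : ℝ} (hw : cnt P M = w)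
    (hK : M.real qK 0 = K) (hu : ∀ c < P.NB, M.real qU c = u c)
    (hex : ∃ c < P.NB, 0 < u c ∧ K * posSum P.NB w P.xb P.tb (u c) =
      Real.sqrt (sqSum P.NB w P.xb P.tb (u c))) :
    T P.B choose M (5000 * ((P.NB + 1) * (P.NB + 1))) (5000 * (P.NB + 1)) (fun M' =>
      Mem.EqOff [eB, qb] chooseR M M' ∧ ∃ u₀, M'.real qU (M'.nat qb 0) = u₀ ∧ 0 < u₀ ∧
        K * posSum P.NB w P.xb P.tb u₀ = Real.sqrt (sqSum P.NB w P.xb P.tb u₀) ∧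
        M'.real qZ 0 = u₀ + K * Real.sqrt (sqSum P.NB w P.xb P.tb u₀)) := by
  classical
  have hB := hP.NB_le
  have hone := hP.one_le
  have hsq : 1 * (P.NB + 1) ≤ (P.NB + 1) * (P.NB + 1) := Nat.mul_le_mul_right _ (by omega)
  unfold choose
  have hN2 : (P.NB + 1) * (1 + 1) ≤ (P.NB + 1) * (P.NB + 1) :=
    Nat.mul_le_mul_left _ (by have := hP.hNB; omega)
  refine T.next (T_accR P.NB P.NB (fun k j => P.tb j * u k < P.xb j)
    (fun k j => w j * (P.xb j - P.tb j * u k)) hB hB (fun M' h => by simp [(hS.eqOff h).NB])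
    (fun M' h => by simp [(hS.eqOff h).NB])
    (fun M' h hj k hk => by
      have S := hS.eqOff h
      simp [BExp.Holds, S.X _ hj, S.T _ hj, h.2 qU (by decide), hu k hk])
    (fun M' h hj k hk _ => by
      have S := hS.eqOff h
      rw [RExp.eval, S.eval_wE rfl, cnt, root_congr (h.2 aSum (by decide)), ← hw]
      simp [S.X _ hj, S.T _ hj, h.2 qU (by decide), hu k hk])
    (by decide) (by decide) (by decide) (by decide)) ?_
  rintro M₁ ⟨hE₁, hA₁⟩
  have hS₁ := hS.eqOff hE₁
  have hw₁ : root P M₁ P.n = w := by rw [← hw, root_congr (hE₁.2 aSum (by decide))]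
  have hu₁ : ∀ c < P.NB, M₁.real qU c = u c := by rw [hE₁.2 qU (by decide)]; exact hu
  refine T.next (T_accR P.NB P.NB (fun k j => P.xb j / P.tb j < u k)
    (fun _ j => w j * (P.tb j * (P.xb j / P.tb j * (P.xb j / P.tb j)))) hB hB
    (fun M' h => by simp [(hS₁.eqOff h).NB])
    (fun M' h => by simp [(hS₁.eqOff h).NB])
    (fun M' h hj k hk => by
      have S := hS₁.eqOff h
      simp [BExp.Holds, S.R _ hj, h.2 qU (by decide), hu₁ k hk])
    (fun M' h hj k hk _ => by
      have S := hS₁.eqOff h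
      rw [RExp.eval, S.eval_wE rfl, cnt, root_congr (h.2 aSum (by decide)), hw₁]
      simp [S.T _ hj, S.R _ hj])
    (by decide) (by decide) (by decide) (by decide)) ?_
  rintro M₂ ⟨hE₂, hA₂⟩
  have hS₂ := hS₁.eqOff hE₂
  have hw₂ : root P M₂ P.n = w := by rw [← hw₁, root_congr (hE₂.2 aSum (by decide))]
  have hu₂ : ∀ c < P.NB, M₂.real qU c = u c := by rw [hE₂.2 qU (by decide)]; exact hu₁
  refine T.next (T_accR P.NB P.NB (fun k j => ¬ P.xb j / P.tb j < u k)
    (fun k j => w j * (P.tb j * (u k * u k))) hB hB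
    (fun M' h => by simp [(hS₂.eqOff h).NB])
    (fun M' h => by simp [(hS₂.eqOff h).NB])
    (fun M' h hj k hk => by
      have S := hS₂.eqOff h
      simp [BExp.Holds, S.R _ hj, h.2 qU (by decide), hu₂ k hk])
    (fun M' h hj k hk _ => by
      have S := hS₂.eqOff h
      rw [RExp.eval, S.eval_wE rfl, cnt, root_congr (h.2 aSum (by decide)), hw₂]
      simp [S.T _ hj, h.2 qU (by decide), hu₂ k hk])
    (by decide) (by decide) (by decide) (by decide)) ?_
  rintro M₃ ⟨hE₃, hA₃⟩
  have hS₃ := hS₂.eqOff hE₃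
  have hu₃ : ∀ c < P.NB, M₃.real qU c = u c := by rw [hE₃.2 qU (by decide)]; exact hu₂
  have gP : ∀ c < P.NB, M₃.real qP c = posSum P.NB w P.xb P.tb (u c) := by
    intro c hc
    rw [hE₃.2 _ (by decide), hE₂.2 _ (by decide), hA₁ c hc]
    exact Finset.sum_congr rfl fun _ _ => by congr
  have gS : ∀ c < P.NB, M₃.real qS c + M₃.real qS' c = sqSum P.NB w P.xb P.tb (u c) := by
    intro c hc
    rw [hE₃.2 qS (by decide), hA₂ c hc, hA₃ c hc]
    exact congrArg₂ _ (Finset.sum_congr rfl fun _ _ => by congr)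
      (Finset.sum_congr rfl fun _ _ => by congr)
  have gK : M₃.real qK 0 = K := by
    rw [hE₃.2 _ (by decide), hE₂.2 _ (by decide), hE₁.2 _ (by decide), hK]
  refine T.next (T_pick 1 P.NB (fun _ j => 0 < M₃.real qU j ∧ M₃.real qK 0 * M₃.real qP j =
      Real.sqrt (M₃.real qS j + M₃.real qS' j)) hone hB (fun M' h => by simp)
    (fun M' h => by simp [(hS₃.eqOff h).NB])
    (fun M' h k hk => by
      simp [BExp.Holds, h.2 qU (by decide), h.2 qK (by decide), h.2 qP (by decide),
        h.2 qS (by decide), h.2 qS' (by decide)])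
    (by decide) (by decide) (by decide) (by decide)) ?_
  rintro M₄ ⟨hE₄, hpick⟩
  obtain ⟨c, hc, hc'⟩ := hex
  obtain ⟨⟨h₃, h₄⟩, h₂, -⟩ := (hpick 0 (by omega)).2 c hc
    (by rw [hu₃ c hc, gK, gP c hc, gS c hc]; exact hc')
  rw [hu₃ _ h₂] at h₃
  rw [gK, gP _ h₂, gS _ h₂] at h₄
  refine (T_storeR (by simp) (by decide)).mono (by omega) (by omega) ?_
  rintro _ rfl
  refine ⟨((((hE₁.mono (by decide) (by decide)).trans (hE₂.mono (by decide) (by decide))).trans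
      (hE₃.mono (by decide) (by decide))).trans (hE₄.mono (by decide) (by decide))).setRA
        (by decide) _, u (M₄.nat qb 0), ?_, h₃, h₄, ?_⟩
  · simp [hE₄.2 qU (by decide), hu₃ _ h₂]
  · simp [hE₄.2 qU (by decide), hE₄.2 qK (by decide), hE₄.2 qS (by decide),
      hE₄.2 qS' (by decide), hu₃ _ h₂, gS _ h₂, gK]

def queryProductProg : Cmd :=
  clear ;; candidates ;; choose ;;
  mapR (sc aNB) yc (RExp.div (rl aR ix) (rs qZ)) ;;
  scatR (sc aNB) (BExp.realLT (rl qU (sc qb)) (rl aR ix)) yc ix (RExp.div (rl qU (sc qb)) (rs qZ)) ;;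
  accR colN (sc aNB) eB outV qt tt
    (RExp.mul (rl aSum (nd (sc aL) (NExp.add (NExp.mul ix (sc aNB)) (sc eB)))) (rl yc (sc eB)))

abbrev queryProductN : List ℕ := [outLen, aFresh, eB, qb]
abbrev queryProductR : List ℕ := [qX, qT, qQ, qK, qU, qt, qP, qS, qS', qZ, yc, outV]

theorem leafVal_count (P : Lay) (M : Mem) (i : ℕ) : leafVal P M P.n i = 1 := by
  simp [leafVal]

theorem Lay.xb_pos (hl : 0 < P.lam) (he : 0 < P.ε) (b : ℕ) : 0 < P.xb b := by
  unfold Lay.xb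
  have : 0 < Real.sinh (P.lam * (1 / 2 + (b / P.NT : ℕ) * P.ε)) := by
    rw [Real.sinh_pos_iff]; positivity
  positivity

theorem Lay.Ok.tb_pos (hP : P.Ok) (b : ℕ) : 0 < P.tb b := by
  have := hP.hm
  have := hP.hn
  unfold Lay.tb
  positivity

/-- The vectors of the rows in terms of the buckets. -/
def rowVec (P : Lay) (M : Mem) (f : ℕ → ℝ) : Fin P.m → ℝ := fun i => f (M.nat aBk i)

theorem sum_cnt_mul (hP : P.Ok) (hC : Core P M X fun _ => True) (f : ℕ → ℝ) :
    ∑ b ∈ Finset.range P.NB, cnt P M b * f b = ∑ i : Fin P.m, rowVec P M f i := by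
  rw [cnt, sum_root_mul hP hC.cons hC.sum hC.bk_lt (by omega), Finset.sum_range]
  exact Finset.sum_congr rfl fun i _ => by rw [leafVal_count, one_mul]; rfl

theorem cnt_nonneg (hP : P.Ok) (hC : Core P M X fun _ => True) {b : ℕ} (hb : b < P.NB) :
    0 ≤ cnt P M b := by
  rw [cnt, root_eq hP hC.cons hC.sum (by omega) hb]
  refine Finset.sum_nonneg fun i _ => ?_
  rw [leafVal_count]
  split_ifs <;> norm_num

theorem exists_cnt_pos (hP : P.Ok) (hC : Core P M X fun _ => True) :
    ∃ b < P.NB, 0 < cnt P M b := by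
  have h := hC.bk_lt 0 hP.hm
  refine ⟨_, h, ?_⟩
  rw [cnt, root_eq hP hC.cons hC.sum (by omega) h]
  refine Finset.sum_pos' (fun i _ => ?_) ⟨0, Finset.mem_range.2 hP.hm, ?_⟩
  · rw [leafVal_count]; split_ifs <;> norm_num
  · rw [if_pos rfl, leafVal_count]; norm_num

theorem queryProductProg_spec (hP : P.Ok) (hK : 0 < P.K) (hl : 0 < P.lam) (hε : 0 < P.ε)
    (hJ : JState P M last) (hC : Core P M X fun _ => True) :
    T P.B queryProductProg M (20000 * ((P.NB + 1) * (P.NB + P.n + 1))) (20000 * (P.NB + 1))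
      (fun M' => Mem.EqOff queryProductN queryProductR M M' ∧ M'.nat aFresh 0 = 0 ∧
        JInv P M' last ∧ (∀ b < P.NB, 0 ≤ M'.real yc b) ∧
        IsFlat P.C P.n (rowVec P M' P.tb) (rowVec P M' P.xb) (rowVec P M' (M'.real yc)) ∧
        ∀ j < P.n, M'.real outV j =
          ∑ i ∈ Finset.range P.m, M.real inG i * P.A i j * M'.real yc (M'.nat aBk i)) := by
  classical
  have hB := hP.NB_le
  have hone := hP.one_le
  have hN := hP.hNB
  have hsq : (P.NB + 1) * (P.NB + P.n + 1) = (P.NB + 1) * (P.NB + 1) + (P.NB + 1) * P.n := by ring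
  have hsq' : 1 * (P.NB + 1) ≤ (P.NB + 1) * (P.NB + 1) := Nat.mul_le_mul_right _ (by omega)
  have hsq'' : (P.NB + 1) * (P.n + 1) = (P.NB + 1) * P.n + (P.NB + 1) := Nat.mul_succ _ _
  unfold queryProductProg
  refine T.next (clear_spec hJ) ?_
  rintro M₁ ⟨hE₁, hf₁, hJ₁⟩
  have hC₁ := hC.eqOff hE₁
  refine T.next (candidates_spec hP hC₁.stat) ?_
  rintro M₂ ⟨hE₂, hK₂, hu₂⟩
  have hC₂ := hC₁.eqOff hE₂
  have hw₂ : cnt P M₂ = cnt P M₁ := by rw [cnt, root_congr (hE₂.2 aSum (by decide))]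
  refine T.next (choose_spec hP hC₂.stat hw₂ hK₂ hu₂ (exists_candidate hK
    (fun b hb => cnt_nonneg hP hC₁ hb) (fun b _ => P.xb_pos hl hε b) (fun b _ => hP.tb_pos b)
    (exists_cnt_pos hP hC₁))) ?_
  rintro M₃ ⟨hE₃, u, hu₃, hu0, hroot, hZ₃⟩
  have hC₃ := hC₂.eqOff hE₃
  refine T.next (T_mapR P.NB (fun b => P.xb b / P.tb b / M₃.real qZ 0) (by simp [hC₃.stat.NB]) hB
    (fun k hk => by simp [hC₃.stat.R k hk]) (by decide) (by decide)) ?_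
  rintro _ rfl
  generalize hM₄ : M₃.setRA yc _ = M₄
  have hE₄ : Mem.EqOff [] [yc] M₃ M₄ := by
    rw [← hM₄]; exact (Mem.EqOff.refl M₃).setRA (by decide) _
  have hC₄ := hC₃.eqOff hE₄
  have hy₄ : ∀ b < P.NB, M₄.real yc b = P.xb b / P.tb b / M₃.real qZ 0 := by
    intro b hb; rw [← hM₄]; simp [hb]
  refine T.next (T_scatR P.NB (fun b => u < P.xb b / P.tb b) (fun b => b)
    (fun _ => u / M₃.real qZ 0) (by simp [hC₄.stat.NB]) hB
    (fun k hk => by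
      simp [BExp.Holds, hC₄.stat.R k hk, hE₄.2 qU (by decide), hE₄.1 qb (by decide), hu₃])
    (fun k _ _ => by simp)
    (fun k _ _ => by
      simp [hE₄.2 qU (by decide), hE₄.1 qb (by decide), hE₄.2 qZ (by decide), hu₃])
    (fun k hk _ => by omega) (fun k _ _ l _ _ h => h) (by decide) (by decide)) ?_
  rintro _ ⟨f, rfl, hf, hf'⟩
  have hf₅ : ∀ b < P.NB, f b = min u (P.xb b / P.tb b) / M₃.real qZ 0 := by
    intro b hb
    by_cases h : u < P.xb b / P.tb b
    · rw [hf b hb h, min_eq_left h.le]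
    · rw [hf' b (by rintro k hk h' rfl; exact h h'), hy₄ b hb, min_eq_right (not_lt.1 h)]
  generalize hM₅ : M₄.setRA yc f = M₅
  have hE₅ : Mem.EqOff [] [yc] M₄ M₅ := by
    rw [← hM₅]; exact (Mem.EqOff.refl M₄).setRA (by decide) _
  have hy₅ : M₅.real yc = f := by rw [← hM₅]; simp
  have hC₅ := hC₄.eqOff hE₅
  refine (T_accR P.n P.NB (fun _ _ => True) (fun k j => root P M₅ k j * f j) hP.n_le hB
    (fun M' h => by simp [(hC₅.stat.eqOff h).n]) (fun M' h => by simp [(hC₅.stat.eqOff h).NB])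
    (fun M' h hj k hk => by simp [BExp.Holds])
    (fun M' h hj k hk _ => by
      have S := hC₅.stat.eqOff h
      simp [S.NB, S.L, root, node, h.2 yc (by decide), h.2 aSum (by decide), hy₅])
    (by decide) (by decide) (by decide) (by decide)).mono (by omega) (by omega) ?_
  rintro M₆ ⟨hE₆, hV⟩
  have hC₆ := hC₅.eqOff hE₆
  have hJ₆ := ((((hJ₁.eqOff hE₂).eqOff hE₃).eqOff hE₄).eqOff hE₅).eqOff hE₆
  have hE : Mem.EqOff queryProductN queryProductR M M₆ :=
    (((((hE₁.mono (by decide) (by decide)).trans (hE₂.mono (by decide) (by decide))).trans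
    (hE₃.mono (by decide) (by decide))).trans (hE₄.mono (by decide) (by decide))).trans
    (hE₅.mono (by decide) (by decide))).trans (hE₆.mono (by decide) (by decide))
  have hy₆ : M₆.real yc = f := (hE₆.2 _ (by decide)).trans hy₅
  have hw₆ : cnt P M₁ = cnt P M₆ := by
    rw [cnt, cnt, root_congr (M := M₁) (M' := M₆)]
    rw [hE₆.2 _ (by decide), hE₅.2 _ (by decide), hE₄.2 _ (by decide), hE₃.2 _ (by decide),
      hE₂.2 _ (by decide)]
  rw [hw₆, posSum_eq, sqSum_eq, sum_cnt_mul hP hC₆, sum_cnt_mul hP hC₆] at hroot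
  rw [hw₆, sqSum_eq, sum_cnt_mul hP hC₆] at hZ₃
  have hZ0 : 0 ≤ M₃.real qZ 0 := by
    rw [hZ₃]
    have := Real.sqrt_nonneg
      (∑ i, rowVec P M₆ (fun b => P.tb b * min u (P.xb b / P.tb b) ^ 2) i)
    positivity
  refine ⟨hE, ?_, hJ₆, fun b hb => ?_, ?_, fun j hj => ?_⟩
  · rw [hE₆.1 _ (by decide), hE₅.1 _ (by decide), hE₄.1 _ (by decide), hE₃.1 _ (by decide),
      hE₂.1 _ (by decide), hf₁]
  · rw [hy₆, hf₅ b hb]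
    exact div_nonneg (le_min hu0.le
      (div_nonneg (P.xb_pos hl hε b).le (hP.tb_pos b).le)) hZ0
  · refine isFlat_of_root (u := u) (K := P.K) rfl hK (fun i => hP.tb_pos _) (fun i => P.xb_pos hl hε _)
      hu0 rfl hroot fun i => ?_
    rw [rowVec, hy₆, hf₅ _ (hC₆.bk_lt i i.2), hZ₃]
    rfl
  · rw [hV j hj]
    simp only [if_true]
    rw [sum_root_mul hP hC₅.cons hC₅.sum hC₅.bk_lt (by omega)]
    refine Finset.sum_congr rfl fun i _ => ?_
    rw [leafVal, if_pos hj, hy₆, hE₆.1 aBk (by decide), ← hE.2 inG (by decide),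
      hE₆.2 inG (by decide)]

/-! ## The operations `ComputeExactSum` and `Potential` -/

def computeExactProg : Cmd := mapR (sc inDim) outExact (exactE ix)

theorem computeExactProg_spec (hP : P.Ok) (hC : Core P M X fun _ => True) :
    T P.B computeExactProg M (200 * (P.m + 1)) 200 (fun M' =>
      Mem.EqOff [] [outExact] M M' ∧ ∀ i < P.m, M'.real outExact i = X i) := by
  refine (T_mapR P.m X (by simp [hC.stat.m]) hP.m_le
    (fun k hk => hC.eval_exactE rfl (by simp) hk) (by decide) (by decide)).mono le_rfl le_rfl ?_
  rintro _ rfl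
  exact ⟨(Mem.EqOff.refl M).setRA (by decide) _, fun i hi => by simp [hi]⟩

def potentialProg : Cmd :=
  accR (cn 1) (sc aNB) eB outPot qt tt
    (rl aSum (nd (sc aL) (NExp.add (NExp.mul (NExp.add colN (cn 1)) (sc aNB)) (sc eB))))

theorem potentialProg_spec (hP : P.Ok) (hC : Core P M X fun _ => True) :
    T P.B potentialProg M (2000 * (P.NB + 1)) (1000 * (P.NB + 1)) (fun M' =>
      Mem.EqOff [eB] [outPot, qt] M M' ∧
      M'.real outPot 0 = ∑ i ∈ Finset.range P.m, Real.cosh (P.lam * M.real inZ i)) := by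
  classical
  refine (T_accR 1 P.NB (fun _ _ => True) (fun _ j => root P M (P.n + 1) j) hP.one_le hP.NB_le
    (fun M' h => by simp) (fun M' h => by simp [(hC.stat.eqOff h).NB])
    (fun M' h hj k hk => by simp [BExp.Holds])
    (fun M' h hj k hk _ => by
      have S := hC.stat.eqOff h
      simp [S.n, S.NB, S.L, root, node, h.2 aSum (by decide)])
    (by decide) (by decide) (by decide) (by decide)).mono (by omega) (by omega) ?_
  rintro M' ⟨hE, hV⟩
  refine ⟨hE, ?_⟩
  rw [hV 0 (by omega)]
  simp only [if_true]
  have := sum_root_mul hP hC.cons hC.sum hC.bk_lt (c := P.n + 1) (by omega) fun _ => 1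
  simp only [mul_one] at this
  rw [this]
  exact Finset.sum_congr rfl fun i _ => by simp [leafVal]

end PrimalGradient

namespace PrimalGradient

variable {P : Lay} {M : Mem}

/-! ## The operation `Initialize` -/

/-- Count up in the cell `0` of `a` while `b` holds. -/
def countUp (a : ℕ) (b : BExp) : Cmd :=
  Cmd.storeN a (cn 0) (cn 0) ;; Cmd.loop b (Cmd.storeN a (cn 0) (NExp.add (sc a) (cn 1)))

theorem T_countUp {B a : ℕ} {b : BExp} (K : ℕ) (hK : K ≤ B) (hs : b.size ≤ 200)
    (hb : ∀ M', Mem.EqOff [a] [] M M' → (b.Holds (st M') ↔ M'.nat a 0 < K)) :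
    T B (countUp a b) M (600 * (K + 1)) (600 * (K + 1)) (fun M' =>
      Mem.EqOff [a] [] M M' ∧ M'.nat a 0 = K) := by
  unfold countUp
  refine (T.bind (T_storeN (by simp) (by simp) (by simp [NExp.size])) ?_).mono
    (W := 200 + (200 + K * (200 + 200))) (D := 200 + (200 + K * (200 + 200)))
    (by omega) (by omega) fun _ h => h
  rintro _ rfl
  refine T_loop (fun j M' => Mem.EqOff [a] [] M M' ∧ M'.nat a 0 = j ∧ j ≤ K) K 200 200 hs ?_ ?_
    K 0 _ (by omega) ⟨(Mem.EqOff.refl M).setNA (by simp) _, by simp, by omega⟩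
  · rintro j M' ⟨hE, hj, -⟩ h
    rw [hb M' hE] at h
    refine ⟨by omega, (T_storeN (by simp) (by simp [hj]; omega)
      (by simp [NExp.size])).mono le_rfl le_rfl ?_⟩
    rintro _ rfl
    exact ⟨hE.setNA (by simp) _, by simp [hj], by omega⟩
  · rintro j M' ⟨hE, hj, hj'⟩ h
    rw [hb M' hE] at h
    exact ⟨hE, by omega⟩

/-- Compute the height of the trees. -/
def height : Cmd :=
  Cmd.storeN aL (cn 0) (cn 0) ;;
  Cmd.storeN aP (cn 0) (cn 1) ;;
  Cmd.loop (BExp.natLT (sc aP) (sc inDim))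
    (Cmd.storeN aP (cn 0) (NExp.add (sc aP) (sc aP)) ;;
      Cmd.storeN aL (cn 0) (NExp.add (sc aL) (cn 1))) ;;
  Cmd.storeN aS (cn 0) (NExp.add (sc aL) (cn 2))

theorem height_spec {B m L : ℕ} (hm : M.nat inDim 0 = m) (hL : L = Nat.clog 2 m)
    (hB : 2 ^ (L + 2) ≤ B) :
    T B height M (1000 * (L + 1)) (1000 * (L + 1)) (fun M' =>
      Mem.EqOff [aL, aP, aS] [] M M' ∧ M'.nat aL 0 = L ∧ M'.nat aP 0 = 2 ^ L ∧
        M'.nat aS 0 = L + 2) := by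
  have hLB : L + 2 < B := Nat.lt_two_pow_self.trans_le hB
  have hpow : 2 ^ L ≤ B := (Nat.pow_le_pow_right (by norm_num) (by omega)).trans hB
  unfold height
  refine (T.bind (T_storeN (by simp) (by simp) (by decide)) ?_).mono
    (W := 200 + (200 + ((200 + L * (200 + (200 + 200))) + 200)))
    (D := 200 + (200 + ((200 + L * (200 + (200 + 200))) + 200)))
    (by omega) (by omega) fun _ h => h
  rintro _ rfl
  refine T.bind (T_storeN (by simp) (by simp; omega) (by decide)) ?_
  rintro _ rfl
  refine T.bind (T_loop (Q := fun M' => Mem.EqOff [aL, aP, aS] [] M M' ∧ M'.nat aL 0 = L ∧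
    M'.nat aP 0 = 2 ^ L) (fun j M' => Mem.EqOff [aL, aP, aS] [] M M' ∧ M'.nat aL 0 = j ∧
    M'.nat aP 0 = 2 ^ j ∧ j ≤ L) L (200 + 200) (200 + 200) (by decide) ?_ ?_ L 0 _ (by omega)
    ⟨((Mem.EqOff.refl M).setNA (by decide) _).setNA (by decide) _, by simp, by simp,
      by omega⟩) ?_
  · rintro j M' ⟨hE, h₁, h₂, h₃⟩ h
    have h' : M'.nat aP 0 < M'.nat inDim 0 := h
    rw [h₂, hE.1 inDim (by decide), hm, ← Nat.lt_clog_iff_pow_lt (by norm_num), ← hL] at h'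
    have hj : 2 ^ (j + 1) ≤ 2 ^ L := Nat.pow_le_pow_right (by norm_num) h'
    refine ⟨h', T.bind (T_storeN (by simp) ?_ (by decide)) ?_⟩
    · simp only [NExp.eval, h₂]; rw [← two_mul, ← pow_succ']; exact hj.trans hpow
    rintro _ rfl
    refine (T_storeN (by simp) (by simp [h₁]; omega) (by decide)).mono le_rfl le_rfl ?_
    rintro _ rfl
    refine ⟨(hE.setNA (by decide) _).setNA (by decide) _, by simp [h₁], ?_, by omega⟩
    simp [h₂, pow_succ, mul_two]
  · rintro j M' ⟨hE, h₁, h₂, h₃⟩ h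
    have h' : ¬ M'.nat aP 0 < M'.nat inDim 0 := h
    rw [h₂, hE.1 inDim (by decide), hm, ← Nat.lt_clog_iff_pow_lt (by norm_num), ← hL] at h'
    obtain rfl : j = L := by omega
    exact ⟨hE, h₁, h₂⟩
  · rintro M' ⟨hE, h₁, h₂⟩
    refine (T_storeN (by simp) (by simp [h₁]; omega) (by decide)).mono le_rfl le_rfl ?_
    rintro _ rfl
    exact ⟨hE.setNA (by decide) _, by simp [h₁], by simp [h₂], by simp [h₁]⟩

abbrev oneHalf : RExp := RExp.div (RExp.ofNat (cn 1)) (RExp.ofNat (cn 2))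

/-- Compute the number of buckets. -/
def grid : Cmd :=
  countUp aNT (BExp.not (BExp.realLT (RExp.ofNat (cn 2))
    (RExp.mul (RExp.div (RExp.ofNat colN) (RExp.ofNat (sc inDim)))
      (RExp.exp (RExp.mul (RExp.ofNat (sc aNT)) (rs inScal)))))) ;;
  countUp aNZ (BExp.not (BExp.realLT (RExp.ofNat (cn 2))
    (RExp.add oneHalf (RExp.mul (RExp.ofNat (sc aNZ)) (rs inScal))))) ;;
  Cmd.storeN aNB (cn 0) (NExp.mul (sc aNZ) (sc aNT))

/-- The number of buckets for `τ`. -/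
noncomputable def gridT (m n : ℕ) (ε : ℝ) : ℕ := ⌊Real.log (2 * m / n) / ε⌋₊ + 1

/-- The number of buckets for `z`. -/
noncomputable def gridZ (ε : ℝ) : ℕ := ⌊3 / 2 / ε⌋₊ + 1

theorem lt_gridT_iff {m n : ℕ} {ε : ℝ} (hm : 0 < m) (hn : 0 < n) (hmn : n ≤ 2 * m) (hε : 0 < ε)
    (k : ℕ) : ¬ (2 : ℝ) < n / m * Real.exp (k * ε) ↔ k < gridT m n ε := by
  have hm' : (0 : ℝ) < m := by positivity
  have hn' : (0 : ℝ) < n := by positivity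
  have h0 : 0 ≤ Real.log (2 * m / n) := by
    apply Real.log_nonneg
    rw [le_div_iff₀ hn', one_mul]
    exact_mod_cast hmn
  rw [gridT, Nat.lt_succ_iff, Nat.le_floor_iff (by positivity), le_div_iff₀ hε,
    Real.le_log_iff_exp_le (by positivity), not_lt, le_div_iff₀ hn', div_mul_eq_mul_div,
    div_le_iff₀ hm', mul_comm (n : ℝ)]

theorem lt_gridZ_iff {ε : ℝ} (hε : 0 < ε) (k : ℕ) :
    ¬ (2 : ℝ) < 1 / 2 + k * ε ↔ k < gridZ ε := by
  rw [gridZ, Nat.lt_succ_iff, Nat.le_floor_iff (by positivity), le_div_iff₀ hε]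
  constructor <;> intro h <;> linarith

theorem grid_spec {B m n : ℕ} {ε : ℝ} (hM₀ : M.nat inDim 0 = m) (hM₁ : M.nat inDim 1 = n)
    (hMε : M.real inScal 0 = ε) (hm : 0 < m) (hn : 0 < n) (hmn : n ≤ 2 * m) (hε : 0 < ε)
    (hB : gridZ ε * gridT m n ε ≤ B) :
    T B grid M (2000 * (gridZ ε * gridT m n ε + 1)) (2000 * (gridZ ε * gridT m n ε + 1))
      (fun M' => Mem.EqOff [aNT, aNZ, aNB] [] M M' ∧ M'.nat aNT 0 = gridT m n ε ∧
        M'.nat aNB 0 = gridZ ε * gridT m n ε) := by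
  have hT : 1 ≤ gridT m n ε := Nat.le_add_left _ _
  have hZ : 1 ≤ gridZ ε := Nat.le_add_left _ _
  have h₁ : gridT m n ε ≤ gridZ ε * gridT m n ε := Nat.le_mul_of_pos_left _ hZ
  have h₂ : gridZ ε ≤ gridZ ε * gridT m n ε := Nat.le_mul_of_pos_right _ hT
  unfold grid
  refine T.next (T_countUp (gridT m n ε) (by omega) (by decide) fun M' hE => ?_) ?_
  · rw [← lt_gridT_iff hm hn hmn hε]
    simp [BExp.Holds, hE.1 inDim (by decide), hE.2 inScal (by decide), hM₀, hM₁, hMε]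
  rintro M₁ ⟨hE₁, hT₁⟩
  refine T.next (T_countUp (gridZ ε) (by omega) (by decide) fun M' hE => ?_) ?_
  · rw [← lt_gridZ_iff hε]
    simp [BExp.Holds, hE.2 inScal (by decide), hE₁.2 inScal (by decide), hMε]
  rintro M₂ ⟨hE₂, hZ₂⟩
  have hT₂ : M₂.nat aNT 0 = gridT m n ε := by rw [hE₂.1 _ (by decide), hT₁]
  refine (T_storeN (by simp) (by simpa [hZ₂, hT₂] using hB) (by decide)).mono (by omega)
    (by omega) ?_
  rintro _ rfl
  exact ⟨((hE₁.mono (by decide) (by decide)).trans (hE₂.mono (by decide) (by decide))).setNA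
    (by decide) _, by simp [hT₂], by simp [hZ₂, hT₂]⟩

/-- Compute the tables of the buckets. -/
def tables : Cmd :=
  let a : RExp := RExp.mul (rl inScal (cn 1))
    (RExp.add oneHalf (RExp.mul (RExp.ofNat (NExp.div ix (sc aNT))) (rs inScal)))
  mapR (sc aNB) aX (RExp.mul (rl inScal (cn 1)) (RExp.div (RExp.sub (RExp.exp a)
    (RExp.exp (RExp.sub (RExp.ofNat (cn 0)) a))) (RExp.ofNat (cn 2)))) ;;
  mapR (sc aNB) aT (RExp.mul (RExp.div (RExp.ofNat colN) (RExp.ofNat (sc inDim)))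
    (RExp.exp (RExp.mul (RExp.ofNat (NExp.sub ix (NExp.mul (sc aNT) (NExp.div ix (sc aNT)))))
      (rs inScal)))) ;;
  mapR (sc aNB) aR (RExp.div (rl aX ix) (rl aT ix))

theorem tables_spec {B : ℕ} (hB : P.NB ≤ B) (hm : M.nat inDim 0 = P.m) (hn : M.nat inDim 1 = P.n)
    (hε : M.real inScal 0 = P.ε) (hl : M.real inScal 1 = P.lam) (hT : M.nat aNT 0 = P.NT)
    (hN : M.nat aNB 0 = P.NB) :
    T B tables M (1000 * (P.NB + 1)) 1000 (fun M' => Mem.EqOff [] [aX, aT, aR] M M' ∧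
      (∀ b < P.NB, M'.real aX b = P.xb b) ∧ (∀ b < P.NB, M'.real aT b = P.tb b) ∧
      ∀ b < P.NB, M'.real aR b = P.xb b / P.tb b) := by
  unfold tables
  refine T.next (T_mapR P.NB P.xb (by simp [hN]) hB (fun k hk => ?_) (by decide) (by decide)) ?_
  · simp [hε, hl, hT, Lay.xb, Real.sinh_eq]
  rintro _ rfl
  refine T.next (T_mapR P.NB P.tb (by simp [hN]) hB (fun k hk => ?_) (by decide) (by decide)) ?_
  · simp [hε, hT, hm, hn, Lay.tb]
  rintro _ rfl
  refine (T_mapR P.NB (fun b => P.xb b / P.tb b) (by simp [hN]) hB (fun k hk => by simp [hk])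
    (by decide) (by decide)).mono (by omega) (by omega) ?_
  rintro _ rfl
  exact ⟨(((Mem.EqOff.refl M).setRA (by decide) _).setRA (by decide) _).setRA (by decide) _,
    fun b hb => by simp [hb], fun b hb => by simp [hb], fun b hb => by simp [hb]⟩

/-- The memory holds the arguments of `Initialize`. -/
structure Loaded (P : Lay) (M : Mem) : Prop where
  m : M.nat inDim 0 = P.m
  n : M.nat inDim 1 = P.n
  ptr : ∀ i ≤ P.m, M.nat inPtr i = P.ptr i
  col : ∀ i < P.m, ∀ q < P.len i, M.nat inCol (P.ptr i + q) = P.col i q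
  val : ∀ i < P.m, ∀ q < P.len i, M.real inVal (P.ptr i + q) = P.val i q
  eps : M.real inScal 0 = P.ε
  lam : M.real inScal 1 = P.lam
  C : M.real inScal 2 = P.C
  z : ∀ i < P.m, M.real inZ i ∈ Set.Icc (0.5 : ℝ) 2
  τ : ∀ i < P.m, M.real inTau i ∈ Set.Icc ((P.n : ℝ) / P.m) 2
  w : ∀ i < P.m, 0 ≤ M.real inW i
  len : M.nat outLen 0 = 0
  fresh : M.nat aFresh 0 = 0
  bk : ∀ i, M.nat aBk i = 0
  sum : ∀ i, M.real aSum i = 0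
  max : ∀ i, M.real aMax i = 0

def initProg : Cmd :=
  height ;; grid ;; tables ;;
  mapR (sc inDim) outXbar (rl inX ix) ;;
  mapN (sc inDim) inIdx ix ;;
  Cmd.storeN inLen (cn 0) (sc inDim) ;;
  placeRows

abbrev initN : List ℕ := [aL, aP, aS, aNT, aNZ, aNB, inIdx, inLen] ++ placeRowsN
abbrev initR : List ℕ := [aX, aT, aR, outXbar] ++ placeRowsR

theorem initProg_spec (hP : P.Ok) (hG : P.Grid) (hmn : P.n ≤ 2 * P.m)
    (hL : P.L = Nat.clog 2 P.m) (hNT : P.NT = gridT P.m P.n P.ε)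
    (hNB : P.NB = gridZ P.ε * P.NT) (h : Loaded P M) :
    T P.B initProg M (50000 * ((off (wid P fun i => i) P.m + 1) * (P.L + 3 + P.NB)))
      (50000 * (P.L + 3 + P.NB)) (fun M' => Mem.EqOff initN initR M M' ∧
        Core P M' (M.real inX) (fun _ => True) ∧ JState P M' (M.real inX) ∧
        ∀ i < P.m, M'.real outXbar i = M.real inX i) := by
  have hB := hP.NB_le
  have hmB := hP.m_le
  set V := off (wid P fun i => i) P.m with hV
  have hNoff : 2 * P.m ≤ V := by
    have : ∑ q ∈ Finset.range P.m, 2 ≤ V := Finset.sum_le_sum fun q _ => by simp [wid]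
    simpa [mul_comm] using this
  have h₁ : 1 * (P.L + 3 + P.NB) ≤ (V + 1) * (P.L + 3 + P.NB) := Nat.mul_le_mul_right _ (by omega)
  have h₂ : (V + 1) * 3 ≤ (V + 1) * (P.L + 3 + P.NB) := Nat.mul_le_mul_left _ (by omega)
  unfold initProg
  refine T.next (height_spec h.m hL hP.pow_le) ?_
  rintro M₁ ⟨hE₁, hL₁, hP₁, hS₁⟩
  have hgrid := grid_spec (B := P.B) (M := M₁) (m := P.m) (n := P.n) (ε := P.ε)
    (by rw [hE₁.1 _ (by decide), h.m]) (by rw [hE₁.1 _ (by decide), h.n])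
    (by rw [hE₁.2 _ (by decide), h.eps]) hP.hm hP.hn hmn hG.eps_pos (by rw [← hNT, ← hNB]; exact hB)
  rw [← hNT, ← hNB] at hgrid
  refine T.next hgrid ?_
  rintro M₂ ⟨hE₂, hT₂, hN₂⟩
  refine T.next (tables_spec hB
    (by rw [hE₂.1 _ (by decide), hE₁.1 _ (by decide), h.m])
    (by rw [hE₂.1 _ (by decide), hE₁.1 _ (by decide), h.n])
    (by rw [hE₂.2 _ (by decide), hE₁.2 _ (by decide), h.eps])
    (by rw [hE₂.2 _ (by decide), hE₁.2 _ (by decide), h.lam]) hT₂ hN₂) ?_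
  rintro M₃ ⟨hE₃, hX₃, hT₃, hR₃⟩
  have hE₁₃ : Mem.EqOff [aL, aP, aS, aNT, aNZ, aNB] [aX, aT, aR] M M₃ :=
    ((hE₁.mono (by decide) (by decide)).trans (hE₂.mono (by decide) (by decide))).trans
      (hE₃.mono (by decide) (by decide))
  have hm₃ : M₃.nat inDim 0 = P.m := by rw [hE₁₃.1 _ (by decide), h.m]
  refine T.next (T_mapR P.m (M.real inX) (by simp [hm₃]) hmB
    (fun k hk => by simp [hE₁₃.2 inX (by decide)]) (by decide) (by decide)) ?_
  rintro _ rfl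
  refine T.next (T_mapN P.m (fun i => i) (by simp [hm₃]) hmB (by simp) (fun k hk => by omega)
    (by decide) (by decide)) ?_
  rintro _ rfl
  refine T.next (T_storeN (by simp) (by simp [hm₃]; omega) (by decide)) ?_
  rintro _ rfl
  generalize hM₄ : Mem.setNA _ inLen _ = M₄
  have hE₄ : Mem.EqOff [inIdx, inLen] [outXbar] M₃ M₄ := by
    rw [← hM₄]
    exact (((Mem.EqOff.refl M₃).setRA (by decide) _).setNA (by decide) _).setNA (by decide) _
  have hx₄ : ∀ i < P.m, M₄.real outXbar i = M.real inX i := by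
    intro i hi; rw [← hM₄]; simp [hi]
  have hr₄ : Rows P M₄ P.m fun i => i :=
    ⟨by rw [← hM₄]; simp [hm₃], fun k hk => by rw [← hM₄]; simp [hk], fun k hk => hk,
      fun _ _ _ _ h => h⟩
  have hE : Mem.EqOff ([aL, aP, aS, aNT, aNZ, aNB, inIdx, inLen]) ([aX, aT, aR, outXbar]) M M₄ :=
    (hE₁₃.mono (by decide) (by decide)).trans (hE₄.mono (by decide) (by decide))
  have hS₄ : Stat P M₄ := by
    constructor
    · rw [hE.1 _ (by decide), h.m]
    · rw [hE.1 _ (by decide), h.n]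
    · rw [hE.1 _ (by decide)]; exact h.ptr
    · rw [hE.1 _ (by decide)]; exact h.col
    · rw [hE.2 _ (by decide)]; exact h.val
    · rw [hE.2 _ (by decide), h.eps]
    · rw [hE.2 _ (by decide), h.lam]
    · rw [hE.2 _ (by decide), h.C]
    · rw [hE₄.1 _ (by decide), hE₃.1 _ (by decide), hE₂.1 _ (by decide), hL₁]
    · rw [hE₄.1 _ (by decide), hE₃.1 _ (by decide), hE₂.1 _ (by decide), hP₁]
    · rw [hE₄.1 _ (by decide), hE₃.1 _ (by decide), hE₂.1 _ (by decide), hS₁]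
    · rw [hE₄.1 _ (by decide), hE₃.1 _ (by decide), hT₂]
    · rw [hE₄.1 _ (by decide), hE₃.1 _ (by decide), hN₂]
    · rw [hE₄.2 _ (by decide)]; exact hX₃
    · rw [hE₄.2 _ (by decide)]; exact hT₃
    · rw [hE₄.2 _ (by decide)]; exact hR₃
  have fZ : M₄.real inZ = M.real inZ := hE.2 _ (by decide)
  have fT : M₄.real inTau = M.real inTau := hE.2 _ (by decide)
  have fS : M₄.real aSum = M.real aSum := hE.2 _ (by decide)
  have fM : M₄.real aMax = M.real aMax := hE.2 _ (by decide)
  have fB : M₄.nat aBk = M.nat aBk := hE.1 _ (by decide)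
  have hpr := placeRows_spec hP hG hS₄ hr₄ (fun k hk => by rw [fZ]; exact h.z k hk)
    (fun k hk => by rw [fT]; exact h.τ k hk)
    (fun l _ u => by simp [ConsAt, fS, fM, h.sum, h.max])
    (fun i _ => by rw [fB, h.bk]; exact hP.hNB)
    (fun c _ b _ i _ => ⟨fun h' => absurd ⟨i, h'.1, rfl⟩ h'.2.1, fun _ => by rw [fS, h.sum]⟩)
    (fun b _ i _ => ⟨fun h' => absurd ⟨i, h'.1, rfl⟩ h'.2.1, fun _ => by rw [fM, h.max]⟩)
  rw [← hV] at hpr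
  refine hpr.mono (by omega) (by omega) ?_
  rintro M₅ ⟨hE₅, hC₅, hSL, hML, hpl, -⟩
  have hE' : Mem.EqOff initN initR M M₅ :=
    (hE.mono (by decide) (by decide)).trans (hE₅.mono (by decide) (by decide))
  have hx₅ : ∀ i < P.m, M₅.real outXbar i = M.real inX i := by
    rw [hE₅.2 _ (by decide)]; exact hx₄
  have hlen : M₅.nat outLen 0 = 0 := by rw [hE'.1 _ (by decide), h.len]
  refine ⟨hE', ⟨hS₄.eqOff hE₅, hC₅, fun i hi => (hpl i hi).1.lt, hSL, hML,
    fun i hi => (hpl i hi).2.le, fun i hi => ?_, fun i hi => ?_, fun i hi => (hpl i hi).1.bz,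
    fun i hi => (hpl i hi).1.bt⟩, JState.of_jInv ⟨fun k hk => by omega, fun i hi =>
    ⟨?_, fun _ => hx₅ i hi⟩⟩ (by rw [hE'.1 _ (by decide), h.fresh]), hx₅⟩
  · rw [(hpl i hi).2, sub_self, mul_zero, add_zero, hx₅ i hi]
  · rw [hE'.2 inW (by decide)]; exact mul_nonneg hG.eps_pos.le (h.w i hi)
  · rintro ⟨k, hk, -⟩; omega

end PrimalGradient

namespace PrimalGradient

/-! ## The layout of an input -/

theorem getD_flatten_add {α : Type*} (d : α) (ls : List (List α)) (i q : ℕ) (hi : i < ls.length)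
    (hq : q < (ls[i]).length) :
    ls.flatten.getD ((((ls.take i).map List.length).sum) + q) d = (ls[i]).getD q d := by
  induction ls generalizing i with
  | nil => simp at hi
  | cons a ls ih =>
    cases i with
    | zero =>
      simp only [List.getElem_cons_zero] at hq
      simp [List.getD_eq_getElem?_getD, List.getElem?_append_left hq]
    | succ i =>
      simp only [List.getElem_cons_succ] at hq ⊢
      rw [← ih i (by simpa using hi) hq]
      simp only [List.getD_eq_getElem?_getD, List.flatten_cons, List.take_succ_cons, List.map_cons,
        List.sum_cons, add_assoc]
      rw [List.getElem?_append_right (by omega), Nat.add_sub_cancel_left]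

theorem lookup_of_mem {α : Type*} {d : ℕ} {l : List (Fin d × α)} (hl : (l.map Prod.fst).Nodup)
    {p : Fin d × α} (hp : p ∈ l) : l.lookup p.1 = some p.2 := by
  induction l with
  | nil => simp at hp
  | cons a l ih =>
    rw [List.map_cons, List.nodup_cons] at hl
    rcases List.mem_cons.1 hp with rfl | h
    · rw [List.lookup_cons, beq_self_eq_true]
    · have : p.1 ≠ a.1 := fun he => hl.1 (he ▸ List.mem_map_of_mem h)
      rw [List.lookup_cons, beq_false_of_ne this]
      exact ih hl.2 h

theorem lookup_of_forall_ne {α : Type*} {d : ℕ} {l : List (Fin d × α)} {i : Fin d}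
    (h : ∀ p ∈ l, p.1 ≠ i) : l.lookup i = none := by
  rw [List.lookup_eq_none_iff]
  exact fun p hp => bne_iff_ne.2 fun e => h p hp e.symm

theorem nnz_ofEntries {d : ℕ} {l : List (Fin d × ℝ)} (hl : IsSparse l) :
    nnz (ofEntries l) = l.length := by
  have : {i | ofEntries l i ≠ 0} = ((l.map Prod.fst).toFinset : Set (Fin d)) := by
    ext i
    simp only [Set.mem_ofPred_eq, List.coe_toFinset, List.mem_map]
    constructor
    · intro h
      by_contra hn
      push Not at hn
      exact h (by rw [ofEntries, lookup_of_forall_ne hn]; rfl)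
    · rintro ⟨p, hp, rfl⟩
      rw [ofEntries, lookup_of_mem hl.1 hp]
      exact hl.2 p hp
  rw [nnz, this, Set.ncard_coe_finset, List.toFinset_card_of_nodup hl.1, List.length_map]

namespace Input

variable {m n : ℕ} (inp : Input m n)

/-- The entries of a row. -/
def row (i : ℕ) : List (Fin n × ℝ) := if h : i < m then inp.rows ⟨i, h⟩ else []

/-- The exponent of the word bound. -/
noncomputable def lay : Lay where
  m := m
  n := n
  L := Nat.clog 2 m
  NT := gridT m n inp.ε
  NB := gridZ inp.ε * gridT m n inp.ε
  B := wordBound 12 m n inp.ε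
  ptr := off fun i => (inp.row i).length
  len := fun i => (inp.row i).length
  col := fun i q => ((inp.row i).map fun p => (p.1 : ℕ)).getD q 0
  val := fun i q => ((inp.row i).map Prod.snd).getD q 0
  A := fun i c => if h : c < n then ofEntries (inp.row i) ⟨c, h⟩ else 0
  ε := inp.ε
  lam := inp.lam
  C := inp.C

variable {inp}

theorem row_of_lt (i : Fin m) : inp.row i = inp.rows i := by simp [row]

theorem lay_A (i : Fin m) (j : Fin n) : inp.lay.A i j = inp.A i j := by
  simp [lay, row_of_lt, Input.A]

theorem Valid.n_le (h : inp.Valid) : n ≤ 2 * m := by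
  have hm : (0 : ℝ) < m := by exact_mod_cast h.m_pos
  have h₁ := h.τ_mem ⟨0, h.m_pos⟩
  have h₂ := h₁.1.trans h₁.2
  rw [div_le_iff₀ hm] at h₂
  exact_mod_cast h₂

theorem nodup_row (h : inp.Valid) (i : ℕ) : ((inp.row i).map Prod.fst).Nodup := by
  unfold row
  split_ifs with hi
  · exact (h.sparse _).1
  · simp

theorem length_row_le (h : inp.Valid) (i : ℕ) : (inp.row i).length ≤ n := by
  simpa using (nodup_row h i).length_le_card

theorem two_pow_clog_le {m : ℕ} (hm : 0 < m) : 2 ^ Nat.clog 2 m ≤ 2 * m := by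
  rcases Nat.lt_or_ge 1 m with h | h
  · have h₁ := Nat.pow_pred_clog_lt_self (b := 2) (by norm_num) h
    have h₂ : 0 < Nat.clog 2 m := Nat.clog_pos (by norm_num) h
    rw [show Nat.clog 2 m = (Nat.clog 2 m).pred + 1 by rw [Nat.pred_eq_sub_one]; omega, pow_succ]
    omega
  · obtain rfl : m = 1 := by omega
    simp

theorem gridZ_le {ε : ℝ} (hε : 0 < ε) : gridZ ε ≤ 2 * ⌈1 / ε⌉₊ + 1 := by
  rw [gridZ]
  refine Nat.add_le_add_right (Nat.floor_le_of_le ?_) 1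
  have := Nat.le_ceil (1 / ε)
  have : 0 < 1 / ε := by positivity
  rw [div_eq_mul_one_div]
  push_cast
  linarith

theorem gridT_le {m n : ℕ} {ε : ℝ} (hm : 0 < m) (hn : 0 < n) (hε : 0 < ε) :
    gridT m n ε ≤ 2 * m * ⌈1 / ε⌉₊ + 1 := by
  rw [gridT]
  have hm' : (0 : ℝ) < m := by positivity
  have hn' : (1 : ℝ) ≤ n := by exact_mod_cast hn
  refine Nat.add_le_add_right (Nat.floor_le_of_le ?_) 1
  have h₁ : Real.log (2 * m / n) ≤ 2 * m := by
    refine (Real.log_le_self (by positivity)).trans (div_le_self (by positivity) hn')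
  rw [div_eq_mul_one_div]
  push_cast
  have := Nat.le_ceil (1 / ε)
  have : 0 < 1 / ε := by positivity
  calc _ ≤ 2 * (m : ℝ) * (1 / ε) := by gcongr
    _ ≤ _ := by gcongr

theorem size_bounds {m n b : ℕ} {ε : ℝ} (hm : 0 < m) (hn : 0 < n) (hε : 0 < ε)
    (hb : b = m + n + ⌈1 / ε⌉₊ + 2) :
    (n + 2) * (gridZ ε * gridT m n ε) * 2 ^ Nat.clog 2 m * (Nat.clog 2 m + 1) +
      Nat.clog 2 m ≤ b ^ 12 ∧ 2 ^ (Nat.clog 2 m + 2) ≤ b ^ 12 := by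
  have hb4 : 4 ≤ b := by omega
  have hpow : 2 ^ Nat.clog 2 m ≤ b ^ 2 := by
    refine (two_pow_clog_le hm).trans ?_
    rw [sq]
    exact Nat.mul_le_mul (by omega) (by omega)
  have hNZ : gridZ ε ≤ b ^ 2 := by
    refine (gridZ_le hε).trans ?_
    have : 2 * b ≤ b ^ 2 := by rw [sq]; exact Nat.mul_le_mul_right _ (by omega)
    omega
  have hNT : gridT m n ε ≤ b ^ 3 := by
    refine (gridT_le hm hn hε).trans ?_
    have h₁ : 2 * m * ⌈1 / ε⌉₊ + 1 ≤ 2 * m * (⌈1 / ε⌉₊ + 1) := by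
      rw [Nat.mul_add]; omega
    refine h₁.trans ?_
    calc 2 * m * (⌈1 / ε⌉₊ + 1) ≤ b * b * b := by gcongr <;> omega
      _ = b ^ 3 := by ring
  have hL : Nat.clog 2 m + 1 ≤ b := by
    have := Nat.clog_le_of_le_pow (b := 2) (x := m) (y := m) Nat.lt_two_pow_self.le
    omega
  constructor
  · calc (n + 2) * (gridZ ε * gridT m n ε) * 2 ^ Nat.clog 2 m * (Nat.clog 2 m + 1) +
        Nat.clog 2 m ≤ b * (b ^ 2 * b ^ 3) * b ^ 2 * b + b := by gcongr <;> omega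
      _ = b ^ 9 * 1 + b * 1 := by ring
      _ ≤ b ^ 9 * b + b ^ 10 * b := by gcongr <;> first | omega | exact Nat.le_self_pow (by norm_num) b
      _ = b ^ 10 * 1 + b ^ 10 * b := by ring
      _ ≤ b ^ 10 * b + b ^ 10 * b := by gcongr; omega
      _ = b ^ 11 * 2 := by ring
      _ ≤ b ^ 11 * b := by gcongr; omega
      _ = b ^ 12 := by ring
  · calc 2 ^ (Nat.clog 2 m + 2) = 2 ^ Nat.clog 2 m * 4 := by rw [pow_add]; norm_num
      _ ≤ b ^ 2 * b := by gcongr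
      _ = b ^ 3 := by ring
      _ ≤ b ^ 12 := Nat.pow_le_pow_right (by omega) (by norm_num)

theorem lay_ok (h : inp.Valid) : inp.lay.Ok := by
  have hm := h.m_pos
  have hn := h.n_pos
  constructor
  · exact hm
  · exact hn
  · exact Nat.le_pow_clog (by norm_num) m
  · exact Nat.mul_pos (Nat.succ_pos _) (Nat.succ_pos _)
  · intro i _; exact off_succ _ i
  · intro i _; exact length_row_le h i
  · intro i _ q hq
    have hq' : q < (inp.row i).length := hq
    simp only [lay, List.getD_eq_getElem?_getD, List.getElem?_map, List.getElem?_eq_getElem hq',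
      Option.map_some, Option.getD_some]
    exact ((inp.row i)[q]).1.2
  · intro i _ q hq q' hq' he
    have hq₁ : q < (inp.row i).length := hq
    have hq₂ : q' < (inp.row i).length := hq'
    simp only [lay, List.getD_eq_getElem?_getD, List.getElem?_map, List.getElem?_eq_getElem hq₁,
      List.getElem?_eq_getElem hq₂, Option.map_some, Option.getD_some] at he
    refine (List.Nodup.getElem_inj_iff (nodup_row h i) (hi := by simpa using hq₁)
      (hj := by simpa using hq₂)).1 ?_
    simpa using Fin.ext he
  · intro i _ q hq
    have hq' : q < (inp.row i).length := hq
    simp only [lay, List.getD_eq_getElem?_getD, List.getElem?_map, List.getElem?_eq_getElem hq',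
      Option.map_some, Option.getD_some]
    rw [dif_pos ((inp.row i)[q]).1.2, ofEntries, Fin.eta,
      lookup_of_mem (nodup_row h i) (List.getElem_mem hq')]
    rfl
  · intro i _ c hc hne
    have hc' : c < n := hc
    simp only [lay]
    rw [dif_pos hc', ofEntries, lookup_of_forall_ne]
    · rfl
    · intro p hp he
      obtain ⟨q, hq, rfl⟩ := List.getElem_of_mem hp
      refine hne q hq ?_
      simp only [lay, List.getD_eq_getElem?_getD, List.getElem?_map, List.getElem?_eq_getElem hq,
        Option.map_some, Option.getD_some, he]
  · exact (size_bounds hm hn h.ε_pos rfl).1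
  · exact (size_bounds hm hn h.ε_pos rfl).2

theorem lay_grid (h : inp.Valid) : inp.lay.Grid := by
  have hdiv : gridZ inp.ε * gridT m n inp.ε / gridT m n inp.ε = gridZ inp.ε :=
    Nat.mul_div_cancel _ (Nat.succ_pos _)
  constructor
  · exact h.ε_pos
  · exact Nat.succ_pos _
  · simp only [lay, hdiv]
  · simp only [lay, hdiv]
    exact not_not.1 fun hn => lt_irrefl _ ((lt_gridZ_iff h.ε_pos _).1 hn)
  · simp only [lay]
    exact not_not.1 fun hn => lt_irrefl _
      ((lt_gridT_iff h.m_pos h.n_pos h.n_le h.ε_pos _).1 hn)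

theorem lay_K_pos (h : inp.Valid) : 0 < inp.lay.K := by
  have hm : (0 : ℝ) < m := by exact_mod_cast h.m_pos
  have hn : (0 : ℝ) < n := by exact_mod_cast h.n_pos
  have hmn : (n : ℝ) ≤ 2 * m := by exact_mod_cast h.n_le
  refine mul_pos h.C_pos (Real.log_pos ?_)
  show 1 < 4 * (m : ℝ) / n
  rw [lt_div_iff₀ hn]
  linarith

theorem ofFn_getD {d : ℕ} (f : Fin d → ℝ) (i : Fin d) : (List.ofFn f).getD i 0 = f i := by
  simp [List.getD_eq_getElem?_getD]

theorem lay_loaded (h : inp.Valid) : Loaded inp.lay inp.load := by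
  have hrow : ∀ i (hi : i < m), (List.ofFn inp.rows)[i]'(by simpa using hi) = inp.row i := by
    intro i hi; simp [row, hi]
  have hptr : ∀ i ≤ m, (((List.ofFn inp.rows).take i).map List.length).sum =
      off (fun i => (inp.row i).length) i := by
    intro i hi
    induction i with
    | zero => simp [off]
    | succ i ih =>
      have hi' : i < (List.ofFn inp.rows).length := by simp; omega
      rw [List.take_add_one, List.getElem?_eq_getElem hi', off_succ, ← ih (by omega),
        hrow i (by omega)]
      simp
  have hget : ∀ {α : Type} (f : Fin n × ℝ → α) (d : α), ∀ i < m, ∀ q < (inp.row i).length,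
      ((List.ofFn inp.rows).flatten.map f).getD (off (fun i => (inp.row i).length) i + q) d =
        ((inp.row i).map f).getD q d := by
    intro α f d i hi q hq
    rw [← hptr i hi.le, List.map_flatten]
    have := getD_flatten_add d ((List.ofFn inp.rows).map (List.map f)) i q (by simpa using hi)
      (by simpa [row, hi] using hq)
    rw [List.getElem_map, hrow i hi] at this
    rw [← this]
    congr 3
    rw [← List.map_take, List.map_map]
    simp [Function.comp_def]
  constructor
  case ptr =>
    intro i hi
    have hi' : i ≤ m := hi
    rw [show inp.load.nat inPtr i = ((List.range (m + 1)).map fun i =>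
      (((List.ofFn inp.rows).take i).map List.length).sum).getD i 0 by
        simp [Input.load, Mem.putN, Mem.putR]]
    rw [List.getD_eq_getElem?_getD, List.getElem?_map, List.getElem?_range (by omega)]
    exact hptr i hi'
  case col =>
    intro i hi q hq
    rw [show inp.load.nat inCol = fun i =>
      ((List.ofFn inp.rows).flatten.map fun p => (p.1 : ℕ)).getD i 0 by
        simp [Input.load, Mem.putN, Mem.putR]]
    exact hget _ 0 i hi q hq
  case val =>
    intro i hi q hq
    rw [show inp.load.real inVal = fun i => ((List.ofFn inp.rows).flatten.map Prod.snd).getD i 0 by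
        simp [Input.load, Mem.putN, Mem.putR]]
    exact hget _ 0 i hi q hq
  case z =>
    intro i hi
    have := h.z_mem ⟨i, hi⟩
    rw [← ofFn_getD inp.z] at this
    simpa [Input.load, Mem.putN, Mem.putR] using this
  case τ =>
    intro i hi
    have := h.τ_mem ⟨i, hi⟩
    rw [← ofFn_getD inp.τ] at this
    simpa [Input.load, Mem.putN, Mem.putR, lay] using this
  case w =>
    intro i hi
    have := (h.w_mem ⟨i, hi⟩).1
    rw [← ofFn_getD inp.w] at this
    simpa [Input.load, Mem.putN, Mem.putR] using this
  all_goals simp [Input.load, Mem.putN, Mem.putR, Mem.zero, lay]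

end Input

end PrimalGradient

namespace PrimalGradient

variable {m n : ℕ} {inp : Input m n}

/-! ## Bounds on the cost -/

theorem length_pos (h : inp.Valid) (i : Fin m) : 0 < (inp.rows i).length := by
  rw [List.length_pos_iff]
  intro he
  refine h.row_ne_zero i ?_
  funext j
  show ofEntries (inp.rows i) j = 0
  rw [he]; rfl

theorem nnz_row (h : inp.Valid) (i : Fin m) : nnz (inp.A i) = (inp.rows i).length :=
  nnz_ofEntries (h.sparse i)

/-- The factor by which the cost exceeds the number of entries that are involved. -/
noncomputable def Input.fac (inp : Input m n) : ℕ := inp.lay.L + 3 + inp.lay.NB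

theorem fac_le (h : inp.Valid) :
    (inp.fac : ℝ) ≤ 3 * (2 + Real.log m + 1 / inp.ε) ^ 3 := by
  have hm := h.m_pos
  have hm' : (1 : ℝ) ≤ m := by exact_mod_cast hm
  have hn' : (1 : ℝ) ≤ n := by exact_mod_cast h.n_pos
  have hε := h.ε_pos
  have hlog : 0 ≤ Real.log m := Real.log_nonneg hm'
  have hinv : 0 < 1 / inp.ε := by positivity
  set s := 2 + Real.log m + 1 / inp.ε with hs
  have hs2 : 2 ≤ s := by linarith
  have h₁ : (inp.lay.L : ℝ) ≤ 3 / 2 * Real.log m + 1 := by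
    show ((Nat.clog 2 m : ℕ) : ℝ) ≤ _
    rcases Nat.lt_or_ge 1 m with h₁ | h₁
    · have h₂ : 0 < Nat.clog 2 m := Nat.clog_pos (by norm_num) h₁
      have h₃ := Nat.pow_pred_clog_lt_self (b := 2) (by norm_num) h₁
      obtain ⟨l, hl⟩ := Nat.exists_eq_succ_of_ne_zero h₂.ne'
      rw [hl, Nat.pred_succ] at h₃
      rw [hl]
      have h₄ : Real.log ((2 : ℝ) ^ l) ≤ Real.log m :=
        Real.log_le_log (by positivity) (by exact_mod_cast h₃.le)
      rw [Real.log_pow] at h₄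
      have := Real.log_two_gt_d9
      push_cast
      nlinarith [(Nat.cast_nonneg l : (0 : ℝ) ≤ l)]
    · obtain rfl : m = 1 := by omega
      simp
  have hZ : (gridZ inp.ε : ℝ) ≤ 3 / 2 * s := by
    rw [gridZ]
    push_cast
    have := Nat.floor_le (a := 3 / 2 / inp.ε) (by positivity)
    rw [div_eq_mul_one_div] at this
    rw [div_eq_mul_one_div (3 / 2) inp.ε]
    linarith
  have hT : (gridT m n inp.ε : ℝ) ≤ 5 / 4 * s ^ 2 := by
    rw [gridT]
    push_cast
    have h₂ : Real.log (2 * m / n) ≤ s := by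
      calc Real.log (2 * m / n) ≤ Real.log (2 * m) :=
            Real.log_le_log (by positivity) (div_le_self (by positivity) hn')
        _ = Real.log 2 + Real.log m := Real.log_mul (by norm_num) (by positivity)
        _ ≤ s := by have := Real.log_two_lt_d9; linarith
    have h₃ : (⌊Real.log (2 * m / n) / inp.ε⌋₊ : ℝ) ≤ s * s := by
      calc (⌊Real.log (2 * m / n) / inp.ε⌋₊ : ℝ) ≤ ⌊s * s⌋₊ := by
            refine Nat.cast_le.2 (Nat.floor_le_floor ?_)
            rw [div_eq_mul_one_div]
            calc _ ≤ s * (1 / inp.ε) := by gcongr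
              _ ≤ s * s := by gcongr; linarith
        _ ≤ s * s := Nat.floor_le (by positivity)
    nlinarith
  have hB : (inp.lay.NB : ℝ) ≤ 15 / 8 * s ^ 3 := by
    show ((gridZ inp.ε * gridT m n inp.ε : ℕ) : ℝ) ≤ _
    push_cast
    calc (gridZ inp.ε : ℝ) * gridT m n inp.ε ≤ (3 / 2 * s) * (5 / 4 * s ^ 2) := by gcongr
      _ = 15 / 8 * s ^ 3 := by ring
  rw [Input.fac]
  push_cast
  have h4 : 4 ≤ s ^ 2 := by nlinarith
  have h5 : 4 * s ≤ s ^ 3 := by nlinarith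
  linarith

theorem three_le_fac : 3 ≤ inp.fac := by rw [Input.fac]; omega

/-- The bound for the factor hidden by `Õ`. -/
theorem mul_fac_le (h : inp.Valid) :
    400000 * (inp.fac : ℝ) ^ 3 * (1 + 1 / inp.ε ^ 2) ≤ polyFactor (10 ^ 9) 12 m inp.ε := by
  have hm' : (1 : ℝ) ≤ m := by exact_mod_cast h.m_pos
  have hlog : 0 ≤ Real.log m := Real.log_nonneg hm'
  have hinv : 0 < 1 / inp.ε := one_div_pos.2 h.ε_pos
  have hfac := fac_le h
  rw [polyFactor, ← one_div_pow]
  set s := 2 + Real.log m + 1 / inp.ε with hs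
  have hs2 : 2 ≤ s := by linarith
  have h₁ : 1 + (1 / inp.ε) ^ 2 ≤ s ^ 2 := by
    have : (1 + 1 / inp.ε) ^ 2 ≤ s ^ 2 := by gcongr; linarith
    nlinarith
  calc 400000 * (inp.fac : ℝ) ^ 3 * (1 + (1 / inp.ε) ^ 2) ≤
      400000 * (3 * s ^ 3) ^ 3 * s ^ 2 := by gcongr
    _ = 10800000 * s ^ 11 * 1 := by ring
    _ ≤ 10 ^ 9 * s ^ 11 * s := by gcongr; norm_num; linarith
    _ = _ := by push_cast; ring

theorem mul_fac_le' (h : inp.Valid) :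
    1000000 * (inp.fac : ℝ) ≤ polyFactor (10 ^ 9) 12 m inp.ε := by
  have h₃ : (3 : ℝ) ≤ inp.fac := by exact_mod_cast three_le_fac
  refine le_trans ?_ (mul_fac_le h)
  have hinv : 0 ≤ 1 / inp.ε ^ 2 := by have := h.ε_pos; positivity
  have h₉ : 9 ≤ (inp.fac : ℝ) ^ 2 := by nlinarith
  have : 9 * (inp.fac : ℝ) ≤ (inp.fac : ℝ) ^ 3 := by
    rw [pow_succ]; exact mul_le_mul_of_nonneg_right h₉ (by linarith)
  nlinarith [mul_nonneg (pow_nonneg (by linarith : (0 : ℝ) ≤ inp.fac) 3) hinv]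

/-! ## Lists of rows -/

section Lists

variable {α : Type*} {l : List (Fin m × α)}

/-- The indices of the entries of a list. -/
def keyAt (l : List (Fin m × α)) (k : ℕ) : ℕ := (l.map fun p => (p.1 : ℕ)).getD k 0

theorem map_getD {β γ : Type*} (f : β → γ) {l : List β} {k : ℕ} (hk : k < l.length) (d : γ) :
    (l.map f).getD k d = f l[k] := by
  simp [List.getD_eq_getElem?_getD, hk]

theorem keyAt_eq {k : ℕ} (hk : k < l.length) : keyAt l k = l[k].1 := map_getD _ hk _

theorem inRows_keyAt {i : ℕ} : InRows l.length (keyAt l) i ↔ ∃ p ∈ l, (p.1 : ℕ) = i := by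
  constructor
  · rintro ⟨k, hk, rfl⟩
    exact ⟨l[k], List.getElem_mem hk, (keyAt_eq hk).symm⟩
  · rintro ⟨p, hp, rfl⟩
    obtain ⟨k, hk, rfl⟩ := List.getElem_of_mem hp
    exact ⟨k, hk, keyAt_eq hk⟩

theorem rows_of_list {M : Mem} (hl : (l.map Prod.fst).Nodup) (h₁ : M.nat inLen 0 = l.length)
    (h₂ : M.nat inIdx = keyAt l) : Rows inp.lay M l.length (keyAt l) := by
  refine ⟨h₁, fun k _ => by rw [h₂], fun k hk => ?_, fun k hk j hj he => ?_⟩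
  · rw [keyAt_eq hk]; exact l[k].1.2
  · rw [keyAt_eq hk, keyAt_eq hj] at he
    refine (List.Nodup.getElem_inj_iff hl (hi := by simpa using hk) (hj := by simpa using hj)).1 ?_
    simpa using Fin.ext he

theorem off_wid_keyAt_le (h : inp.Valid) :
    off (wid inp.lay (keyAt l)) l.length ≤ 3 * (l.map fun p => nnz (inp.A p.1)).sum := by
  have : off (wid inp.lay (keyAt l)) l.length = (l.map fun p => (inp.rows p.1).length + 2).sum := by
    rw [off, Finset.sum_range, ← Fin.sum_univ_fun_getElem]
    refine Finset.sum_congr rfl fun k _ => ?_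
    rw [wid, keyAt_eq k.2]
    show (inp.row l[k].1).length + 2 = _
    rw [Input.row_of_lt]
    rfl
  rw [this, ← List.sum_map_mul_left]
  refine List.sum_le_sum fun p _ => ?_
  rw [nnz_row h]
  have := length_pos h p.1
  omega

end Lists

theorem off_wid_le_nnzA (h : inp.Valid) :
    off (wid inp.lay fun i => i) m + 1 ≤ 4 * inp.nnzA := by
  have h₁ : off (wid inp.lay fun i => i) m = ∑ i : Fin m, ((inp.rows i).length + 2) := by
    rw [off, Finset.sum_range]
    refine Finset.sum_congr rfl fun k _ => ?_
    show (inp.row k).length + 2 = _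
    rw [Input.row_of_lt]
  have h₂ : ∑ i : Fin m, ((inp.rows i).length + 2) ≤ ∑ i : Fin m, 3 * nnz (inp.A i) := by
    refine Finset.sum_le_sum fun i _ => ?_
    rw [nnz_row h]
    have := length_pos h i
    omega
  have h₃ : 1 ≤ inp.nnzA := by
    refine le_trans ?_ (Finset.single_le_sum (f := fun i => nnz (inp.A i)) (fun _ _ => Nat.zero_le _)
      (Finset.mem_univ ⟨0, h.m_pos⟩))
    simp only [nnz_row h]
    exact length_pos h _
  rw [← Finset.mul_sum] at h₂
  rw [Input.nnzA] at h₃ ⊢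
  omega

/-! ## The state after a history -/

/-- The outcome of an operation; `v` is the vector of the last call of `queryProduct`. -/
structure Res (m : ℕ) where
  mem : Mem
  work : ℕ
  depth : ℕ
  v : Fin m → ℝ

/-- The outcome of a history, with the exact sum and the vector that was returned last. -/
structure Stage (m : ℕ) extends Res m where
  X : Fin m → ℝ
  last : Fin m → ℝ

/-- A vector as a function on all natural numbers. -/
noncomputable def ext (x : Fin m → ℝ) (i : ℕ) : ℝ := if h : i < m then x ⟨i, h⟩ else 0

@[simp] theorem ext_apply (x : Fin m → ℝ) (i : Fin m) : ext x i = x i := by simp [ext]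

theorem ext_of_lt (x : Fin m → ℝ) {i : ℕ} (hi : i < m) : ext x i = x ⟨i, hi⟩ := by simp [ext, hi]

/-- The sum after an operation. -/
noncomputable def nextX (s : Stage m) : Op m → Fin m → ℝ
  | Op.querySum h => s.X + (s.v + ofEntries h)
  | _ => s.X

noncomputable def nextLast (s : Stage m) (M : Mem) : Op m → Fin m → ℝ
  | Op.querySum _ => M.vec outXbar m
  | _ => s.last

noncomputable def Stage.next (s : Stage m) (o : Op m) (R : Res m) : Stage m :=
  { R with X := nextX s o, last := nextLast s R.mem o }

/-- The memory holds the parameters. -/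
structure Agrees (p : Params m) (M : Mem) : Prop where
  g : ∀ i : Fin m, M.real inG i = p.g i
  τ : ∀ i : Fin m, M.real inTau i = p.τ i
  z : ∀ i : Fin m, M.real inZ i = p.z i
  w : ∀ i : Fin m, M.real inW i = p.w i

theorem Agrees.eqOff {p : Params m} {M M' : Mem} {NS RS : List ℕ} (h : Agrees p M)
    (hE : Mem.EqOff NS RS M M') (hR : ∀ a ∈ [inG, inTau, inZ, inW], a ∉ RS := by decide) :
    Agrees p M' := by
  constructor
  · rw [hE.2 inG (hR _ (by simp))]; exact h.g
  · rw [hE.2 inTau (hR _ (by simp))]; exact h.τ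
  · rw [hE.2 inZ (hR _ (by simp))]; exact h.z
  · rw [hE.2 inW (hR _ (by simp))]; exact h.w

/-- The invariant of the data structure. -/
structure Good (inp : Input m n) (H : History m) (s : Stage m) : Prop where
  core : Core inp.lay s.mem (ext s.X) fun _ => True
  agrees : Agrees (current inp H) s.mem
  idle : ¬ Pending H → JState inp.lay s.mem (ext s.last)
  pending : Pending H → JInv inp.lay s.mem (ext s.last) ∧
    (∀ b < inp.lay.NB, 0 ≤ s.mem.real yc b) ∧
    ∀ i : Fin m, s.v i = s.mem.real inG i * s.mem.real yc (s.mem.nat aBk i)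

/-- The operations do what they should, given the stage before. -/
def Meets (inp : Input m n) (H : History m) (s : Stage m) (R : Res m) : Op m → Prop
  | Op.update u =>
      (R.work : ℝ) ≤ polyFactor (10 ^ 9) 12 m inp.ε *
        (1 + (u.map fun p => (nnz (inp.A p.1) : ℝ)).sum) ∧
      (R.depth : ℝ) ≤ polyFactor (10 ^ 9) 12 m inp.ε ∧
      (∀ p ∈ u, R.mem.vec outXbar m p.1 = s.X p.1) ∧
      ∀ i, (∀ p ∈ u, p.1 ≠ i) → R.mem.vec outXbar m i = s.mem.vec outXbar m i
  | Op.setAccuracy u =>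
      (R.work : ℝ) ≤ polyFactor (10 ^ 9) 12 m inp.ε * (1 + u.length) ∧
      (R.depth : ℝ) ≤ polyFactor (10 ^ 9) 12 m inp.ε ∧
      (∀ p ∈ u, R.mem.vec outXbar m p.1 = s.X p.1) ∧
      ∀ i, (∀ p ∈ u, p.1 ≠ i) → R.mem.vec outXbar m i = s.mem.vec outXbar m i
  | Op.queryProduct =>
      R.work ≤ 200000 * inp.fac ^ 3 * n ∧ R.depth ≤ 200000 * inp.fac ^ 3 ∧
      IsStep inp (current inp H) R.v ∧ R.mem.vec outV n = inp.A.transpose.mulVec R.v ∧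
      R.mem.vec outXbar m = s.mem.vec outXbar m
  | Op.querySum h =>
      ∃ E : Finset (Fin m),
      R.work ≤ 200000 * inp.fac ^ 3 * (E.card + h.length + n) ∧ R.depth ≤ 200000 * inp.fac ^ 3 ∧
      (∀ i ∈ E, R.mem.vec outXbar m i = nextX s (Op.querySum h) i ∧ (∀ p ∈ h, p.1 ≠ i) ∧
        inp.ε * (current inp H).w i < |nextX s (Op.querySum h) i - s.mem.vec outXbar m i|) ∧
      (∀ i ∉ E, (∀ p ∈ h, p.1 ≠ i) → R.mem.vec outXbar m i = s.mem.vec outXbar m i) ∧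
      (∀ p ∈ h, R.mem.vec outXbar m p.1 = nextX s (Op.querySum h) p.1) ∧
      (∀ i, |R.mem.vec outXbar m i - nextX s (Op.querySum h) i| ≤ inp.ε * (current inp H).w i) ∧
      R.mem.ListsJ {i | R.mem.vec outXbar m i ≠ s.last i}
  | Op.computeExactSum =>
      R.mem.vec outExact m = s.X ∧ (R.work : ℝ) ≤ polyFactor (10 ^ 9) 12 m inp.ε * m ∧
      (R.depth : ℝ) ≤ polyFactor (10 ^ 9) 12 m inp.ε ∧
      R.mem.vec outXbar m = s.mem.vec outXbar m
  | Op.potential =>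
      R.mem.real outPot 0 = Psi inp.lam (current inp H).z ∧
      (R.work : ℝ) ≤ polyFactor (10 ^ 9) 12 m inp.ε ∧
      (R.depth : ℝ) ≤ polyFactor (10 ^ 9) 12 m inp.ε ∧
      R.mem.vec outXbar m = s.mem.vec outXbar m

/-- The programs. -/
def structureProgs : DataStructure where
  init := initProg
  update := updateProg
  setAccuracy := setAccuracyProg
  queryProduct := queryProductProg
  querySum := querySumProg
  computeExactSum := computeExactProg
  potential := potentialProg

theorem T.runs {B : ℕ} {c : Cmd} {M : Mem} {W D : ℕ} {Q : Mem → Prop} (h : T B c M W D Q) :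
    ∃ M' w d, Runs B c M M' w d ∧ w ≤ W ∧ d ≤ D ∧ Q M' := by
  obtain ⟨M', w, d, R, S, hE, hw, hd, hQ⟩ := h
  exact ⟨M', w, d, ⟨_, R, S, hE, rfl⟩, hw, hd, hQ⟩

theorem load_eqOff (M : Mem) (o : Op m) :
    Mem.EqOff [inLen, inIdx] [inArg1, inArg2, inArg3] M (o.load M) := by
  have h := Mem.EqOff.refl (NS := [inLen, inIdx]) (RS := [inArg1, inArg2, inArg3]) M
  cases o with
  | update u =>
    exact ((((h.setNA (by decide) _).setNA (by decide) _).setRA (by decide) _).setRA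
      (by decide) _).setRA (by decide) _
  | setAccuracy u => exact ((h.setNA (by decide) _).setNA (by decide) _).setRA (by decide) _
  | querySum u => exact ((h.setNA (by decide) _).setNA (by decide) _).setRA (by decide) _
  | _ => exact h

end PrimalGradient

namespace PrimalGradient

variable {m n : ℕ} {inp : Input m n} {H : History m} {s : Stage m}

/-! ## The operations keep the invariant -/

/-- An operation meets its specification and keeps the invariant. -/
def Works (inp : Input m n) (H : History m) (s : Stage m) (o : Op m) (R : Res m) : Prop :=
  Runs (wordBound 12 m n inp.ε) (structureProgs.prog o) (o.load s.mem) R.mem R.work R.depth ∧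
    Meets inp H s R o ∧ Good inp (o :: H) (s.next o R)

theorem Core.congr_exact {P : Lay} {M : Mem} {X X' : ℕ → ℝ} {Pl : ℕ → Prop} (hC : Core P M X Pl)
    (h : ∀ i < P.m, X i = X' i) : Core P M X' Pl :=
  { hC with exact := fun i hi => (hC.exact i hi).trans (h i hi) }

theorem JState.congr_last {P : Lay} {M : Mem} {l l' : ℕ → ℝ} (hJ : JState P M l)
    (h : ∀ i < P.m, l i = l' i) : JState P M l' := by
  unfold JState at hJ ⊢
  split_ifs with hf
  · rw [if_pos hf] at hJ
    exact fun i hi => (hJ i hi).trans (h i hi)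
  · rw [if_neg hf] at hJ
    exact ⟨hJ.1, fun i hi => by rw [← h i hi]; exact hJ.2 i hi⟩

theorem exists_init (h : inp.Valid) : ∃ R : Res m,
    Runs (wordBound 12 m n inp.ε) initProg inp.load R.mem R.work R.depth ∧
    (R.work : ℝ) ≤ polyFactor (10 ^ 9) 12 m inp.ε * inp.nnzA ∧
    (R.depth : ℝ) ≤ polyFactor (10 ^ 9) 12 m inp.ε ∧
    Good inp [] { R with X := inp.x, last := inp.x } ∧ R.mem.vec outXbar m = inp.x := by
  have hL := Input.lay_loaded h
  obtain ⟨M, w, d, hR, hw, hd, hE, hC, hJ, hx⟩ := (initProg_spec (Input.lay_ok h)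
    (Input.lay_grid h) h.n_le rfl rfl rfl hL).runs
  have hX : ∀ i : Fin m, inp.load.real inX i = inp.x i := fun i => by
    simpa [Input.load, Mem.putN, Mem.putR] using Input.ofFn_getD inp.x i
  have hX' : ∀ i < inp.lay.m, inp.load.real inX i = ext inp.x i := fun i hi => by
    rw [ext_of_lt _ (show i < m from hi)]; exact hX ⟨i, hi⟩
  have hfac := mul_fac_le' h
  have hoff := off_wid_le_nnzA h
  refine ⟨⟨M, w, d, 0⟩, hR, ?_, ?_, ⟨hC.congr_exact hX', ⟨fun i => ?_, fun i => ?_, fun i => ?_,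
    fun i => ?_⟩, fun _ => ?_, fun hp => absurd hp id⟩, ?_⟩
  · have h₁ : w ≤ 200000 * inp.fac * inp.nnzA := by
      refine hw.trans ?_
      calc _ ≤ 50000 * ((4 * inp.nnzA) * inp.fac) := by
            exact Nat.mul_le_mul_left _ (Nat.mul_le_mul_right _ hoff)
        _ = _ := by ring
    calc (w : ℝ) ≤ ((200000 * inp.fac * inp.nnzA : ℕ) : ℝ) := by exact_mod_cast h₁
      _ = 200000 * inp.fac * inp.nnzA := by push_cast; ring
      _ ≤ _ := by
        refine mul_le_mul_of_nonneg_right (le_trans ?_ hfac) (Nat.cast_nonneg _)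
        have : (0 : ℝ) ≤ inp.fac := Nat.cast_nonneg _
        linarith
  · refine le_trans ?_ hfac
    have : (d : ℝ) ≤ ((50000 * inp.fac : ℕ) : ℝ) := by exact_mod_cast hd
    push_cast at this
    have : (0 : ℝ) ≤ inp.fac := Nat.cast_nonneg _
    linarith
  · rw [show M.real inG = inp.load.real inG from hE.2 _ (by decide)]
    simpa [Input.load, Mem.putN, Mem.putR, current] using Input.ofFn_getD inp.g i
  · rw [show M.real inTau = inp.load.real inTau from hE.2 _ (by decide)]
    simpa [Input.load, Mem.putN, Mem.putR, current] using Input.ofFn_getD inp.τ i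
  · rw [show M.real inZ = inp.load.real inZ from hE.2 _ (by decide)]
    simpa [Input.load, Mem.putN, Mem.putR, current] using Input.ofFn_getD inp.z i
  · rw [show M.real inW = inp.load.real inW from hE.2 _ (by decide)]
    simpa [Input.load, Mem.putN, Mem.putR, current] using Input.ofFn_getD inp.w i
  · exact hJ.congr_last hX'
  · funext i
    exact (hx i i.2).trans (hX i)

theorem exists_update (h : inp.Valid) (hs : Good inp H s) (hH : ¬ Pending H)
    {u : List (Fin m × ℝ × ℝ × ℝ)} (hu : ValidArgs n (Op.update u)) :
    ∃ R, Works inp H s (Op.update u) R := by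
  have hE₀ := load_eqOff s.mem (Op.update u)
  have hr : Rows inp.lay ((Op.update u).load s.mem) u.length (keyAt u) :=
    rows_of_list hu.1 (by simp [Op.load, Mem.putN, Mem.putR])
      (by funext k; simp [Op.load, Mem.putN, Mem.putR, keyAt])
  have hA₁ : ∀ k (hk : k < u.length), ((Op.update u).load s.mem).real inArg1 k = u[k].2.1 :=
    fun k hk => by
      rw [← map_getD (fun p : Fin m × ℝ × ℝ × ℝ => p.2.1) hk 0]; simp [Op.load, Mem.putN, Mem.putR]
  have hA₂ : ∀ k (hk : k < u.length), ((Op.update u).load s.mem).real inArg2 k = u[k].2.2.1 :=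
    fun k hk => by
      rw [← map_getD (fun p : Fin m × ℝ × ℝ × ℝ => p.2.2.1) hk 0]
      simp [Op.load, Mem.putN, Mem.putR]
  have hA₃ : ∀ k (hk : k < u.length), ((Op.update u).load s.mem).real inArg3 k = u[k].2.2.2 :=
    fun k hk => by
      rw [← map_getD (fun p : Fin m × ℝ × ℝ × ℝ => p.2.2.2) hk 0]
      simp [Op.load, Mem.putN, Mem.putR]
  obtain ⟨M, w, d, hR, hw, hd, hE, hC, hJ, hin, hout⟩ := (updateProg_spec (Input.lay_ok h)
    (Input.lay_grid h) hr ((hs.idle hH).eqOff hE₀) (hs.core.eqOff hE₀)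
    (fun k hk => by rw [hA₂ k hk]; exact (hu.2 _ (List.getElem_mem hk)).1)
    (fun k hk => by rw [hA₃ k hk]; exact (hu.2 _ (List.getElem_mem hk)).2)).runs
  have hin' : ∀ p ∈ u, M.real inG p.1 = p.2.1 ∧ M.real inTau p.1 = p.2.2.1 ∧
      M.real inZ p.1 = p.2.2.2 ∧ M.real outXbar p.1 = s.X p.1 := by
    intro p hp
    obtain ⟨k, hk, rfl⟩ := List.getElem_of_mem hp
    have := hin k hk
    rwa [hA₁ k hk, hA₂ k hk, hA₃ k hk, keyAt_eq hk, ext_apply] at this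
  have hout' : ∀ i : Fin m, (∀ p ∈ u, p.1 ≠ i) → M.real inG i = (current inp H).g i ∧
      M.real inTau i = (current inp H).τ i ∧ M.real inZ i = (current inp H).z i ∧
      M.real outXbar i = s.mem.real outXbar i := by
    intro i hi
    have := hout i fun hi' => by
      obtain ⟨p, hp, he⟩ := inRows_keyAt.1 hi'
      exact hi p hp (Fin.ext he)
    rwa [hE₀.2 inG (by decide), hE₀.2 inTau (by decide), hE₀.2 inZ (by decide),
      hE₀.2 outXbar (by decide), hs.agrees.g, hs.agrees.τ, hs.agrees.z] at this
  have hfac := mul_fac_le' h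
  have hoff := off_wid_keyAt_le (inp := inp) (l := u) h
  have hfac0 : (0 : ℝ) ≤ inp.fac := Nat.cast_nonneg _
  refine ⟨⟨M, w, d, 0⟩, hR, ⟨?_, ?_, fun p hp => (hin' p hp).2.2.2,
    fun i hi => (hout' i hi).2.2.2⟩, hC, ⟨fun i => ?_, fun i => ?_, fun i => ?_, fun i => ?_⟩,
    fun _ => hJ, fun hp => absurd hp id⟩
  · set S := (u.map fun p => nnz (inp.A p.1)).sum with hS
    have hS' : (u.map fun p => (nnz (inp.A p.1) : ℝ)).sum = (S : ℝ) := by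
      rw [hS, Nat.cast_list_sum, List.map_map]; rfl
    have h₁ : w ≤ 450000 * inp.fac * (1 + S) := by
      refine hw.trans ?_
      calc _ ≤ 150000 * ((3 * (1 + S)) * inp.fac) := by
            exact Nat.mul_le_mul_left _ (Nat.mul_le_mul_right _ (by omega))
        _ = _ := by ring
    rw [hS']
    calc (w : ℝ) ≤ ((450000 * inp.fac * (1 + S) : ℕ) : ℝ) := by exact_mod_cast h₁
      _ = 450000 * inp.fac * (1 + S) := by push_cast; ring
      _ ≤ _ := by
        refine mul_le_mul_of_nonneg_right (le_trans ?_ hfac) (by positivity)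
        linarith
  · refine le_trans ?_ hfac
    have : (d : ℝ) ≤ ((150000 * inp.fac : ℕ) : ℝ) := by exact_mod_cast hd
    push_cast at this
    show (d : ℝ) ≤ _
    linarith
  · by_cases hi : ∀ p ∈ u, p.1 ≠ i
    · simpa [Stage.next, current, lookup_of_forall_ne hi] using (hout' i hi).1
    · push Not at hi
      obtain ⟨p, hp, rfl⟩ := hi
      simpa [Stage.next, current, lookup_of_mem hu.1 hp] using (hin' p hp).1
  · by_cases hi : ∀ p ∈ u, p.1 ≠ i
    · simpa [Stage.next, current, lookup_of_forall_ne hi] using (hout' i hi).2.1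
    · push Not at hi
      obtain ⟨p, hp, rfl⟩ := hi
      simpa [Stage.next, current, lookup_of_mem hu.1 hp] using (hin' p hp).2.1
  · by_cases hi : ∀ p ∈ u, p.1 ≠ i
    · simpa [Stage.next, current, lookup_of_forall_ne hi] using (hout' i hi).2.2.1
    · push Not at hi
      obtain ⟨p, hp, rfl⟩ := hi
      simpa [Stage.next, current, lookup_of_mem hu.1 hp] using (hin' p hp).2.2.1
  · rw [show (s.next (Op.update u) ⟨M, w, d, 0⟩).mem.real inW = s.mem.real inW from
      (hE.2 _ (by decide)).trans (hE₀.2 _ (by decide))]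
    exact hs.agrees.w i

theorem exists_setAccuracy (h : inp.Valid) (hs : Good inp H s) (hH : ¬ Pending H)
    {u : List (Fin m × ℝ)} (hu : ValidArgs n (Op.setAccuracy u)) :
    ∃ R, Works inp H s (Op.setAccuracy u) R := by
  have hE₀ := load_eqOff s.mem (Op.setAccuracy u)
  have hr : Rows inp.lay ((Op.setAccuracy u).load s.mem) u.length (keyAt u) :=
    rows_of_list hu.1 (by simp [Op.load, Mem.putN, Mem.putR])
      (by funext k; simp [Op.load, Mem.putN, Mem.putR, keyAt])
  have hA₁ : ∀ k (hk : k < u.length), ((Op.setAccuracy u).load s.mem).real inArg1 k = u[k].2 :=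
    fun k hk => by
      rw [← map_getD (Prod.snd : Fin m × ℝ → ℝ) hk 0]; simp [Op.load, Mem.putN, Mem.putR]
  obtain ⟨M, w, d, hR, hw, hd, hE, hC, hJ, hin, hout⟩ := (setAccuracyProg_spec (Input.lay_ok h)
    (Input.lay_grid h) hr ((hs.idle hH).eqOff hE₀) (hs.core.eqOff hE₀)
    (fun k hk => by rw [hA₁ k hk]; exact (hu.2 _ (List.getElem_mem hk)).1)).runs
  have hin' : ∀ p ∈ u, M.real inW p.1 = p.2 ∧ M.real outXbar p.1 = s.X p.1 := by
    intro p hp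
    obtain ⟨k, hk, rfl⟩ := List.getElem_of_mem hp
    have := hin k hk
    rwa [hA₁ k hk, keyAt_eq hk, ext_apply] at this
  have hout' : ∀ i : Fin m, (∀ p ∈ u, p.1 ≠ i) → M.real inW i = (current inp H).w i ∧
      M.real outXbar i = s.mem.real outXbar i := by
    intro i hi
    have := hout i fun hi' => by
      obtain ⟨p, hp, he⟩ := inRows_keyAt.1 hi'
      exact hi p hp (Fin.ext he)
    rwa [hE₀.2 inW (by decide), hE₀.2 outXbar (by decide), hs.agrees.w] at this
  have hfac := mul_fac_le' h
  have hfac0 : (0 : ℝ) ≤ inp.fac := Nat.cast_nonneg _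
  have hLfac : inp.lay.L + 3 ≤ inp.fac := Nat.le_add_right _ _
  have hfr : ∀ a ∈ [inG, inTau, inZ], M.real a = s.mem.real a := by
    intro a ha
    simp only [List.mem_cons, List.not_mem_nil, or_false] at ha
    rcases ha with rfl | rfl | rfl <;>
      exact (hE.2 _ (by decide)).trans (hE₀.2 _ (by decide))
  refine ⟨⟨M, w, d, 0⟩, hR, ⟨?_, ?_, fun p hp => (hin' p hp).2,
    fun i hi => (hout' i hi).2⟩, hC, ⟨fun i => ?_, fun i => ?_, fun i => ?_, fun i => ?_⟩,
    fun _ => hJ, fun hp => absurd hp id⟩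
  · have h₁ : w ≤ 100000 * inp.fac * (1 + u.length) := by
      refine hw.trans ?_
      calc _ ≤ 100000 * ((u.length + 1) * inp.fac) := by gcongr
        _ = _ := by ring
    calc (w : ℝ) ≤ ((100000 * inp.fac * (1 + u.length) : ℕ) : ℝ) := by exact_mod_cast h₁
      _ = 100000 * inp.fac * (1 + u.length) := by push_cast; ring
      _ ≤ _ := by
        refine mul_le_mul_of_nonneg_right (le_trans ?_ hfac) (by positivity)
        linarith
  · refine le_trans ?_ hfac
    have : (d : ℝ) ≤ ((100000 * inp.fac : ℕ) : ℝ) := by exact_mod_cast hd.trans (by gcongr)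
    push_cast at this
    show (d : ℝ) ≤ _
    linarith
  · exact (congrFun (hfr inG (by simp)) i).trans (hs.agrees.g i)
  · exact (congrFun (hfr inTau (by simp)) i).trans (hs.agrees.τ i)
  · exact (congrFun (hfr inZ (by simp)) i).trans (hs.agrees.z i)
  · by_cases hi : ∀ p ∈ u, p.1 ≠ i
    · simpa [Stage.next, current, lookup_of_forall_ne hi] using (hout' i hi).1
    · push Not at hi
      obtain ⟨p, hp, rfl⟩ := hi
      simpa [Stage.next, current, lookup_of_mem hu.1 hp] using (hin' p hp).1

end PrimalGradient

namespace PrimalGradient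

variable {m n : ℕ} {inp : Input m n} {H : History m} {s : Stage m}

theorem exists_queryProduct (h : inp.Valid) (hs : Good inp H s) (hH : ¬ Pending H) :
    ∃ R, Works inp H s Op.queryProduct R := by
  obtain ⟨M, w, d, hR, hw, hd, hE, -, hJ, hy, hflat, hV⟩ := (queryProductProg_spec (Input.lay_ok h)
    (Input.lay_K_pos h) h.lam_pos h.ε_pos (hs.idle hH) hs.core).runs
  have hC : Core inp.lay M (ext s.X) fun _ => True := hs.core.eqOff hE
  have hA : Agrees (current inp H) M := hs.agrees.eqOff hE
  have hn := h.n_pos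
  have hNB : inp.lay.NB + 1 ≤ inp.fac := by rw [Input.fac]; omega
  have hfac : 0 < inp.fac := by omega
  refine ⟨⟨M, w, d, fun i => M.real inG i * M.real yc (M.nat aBk i)⟩, hR,
    ⟨?_, ?_, ⟨fun i => inp.lay.tb (M.nat aBk i),
      fun i => 1 / 2 + (M.nat aBk i / inp.lay.NT : ℕ) * inp.ε,
      fun i => M.real yc (M.nat aBk i), fun i => ?_, ?_, ?_, ?_⟩, ?_, ?_⟩, hC, hA,
    fun hp => absurd trivial hp, fun _ => ⟨hJ, hy, fun i => rfl⟩⟩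
  · refine hw.trans ?_
    have h₁ : inp.lay.NB + n + 1 ≤ inp.fac * n := by
      obtain ⟨k, rfl⟩ := Nat.exists_eq_succ_of_ne_zero hn.ne'
      have : inp.fac * (k + 1) = inp.fac * k + inp.fac := Nat.mul_succ _ _
      have h₂ : 1 * k ≤ inp.fac * k := Nat.mul_le_mul_right _ hfac
      have h₃ : inp.lay.NB + 3 ≤ inp.fac := by rw [Input.fac]; omega
      simp only [Nat.succ_eq_add_one]
      omega
    calc _ ≤ 200000 * (inp.fac * (inp.fac * n)) :=
          Nat.mul_le_mul (by norm_num) (Nat.mul_le_mul hNB h₁)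
      _ = 200000 * inp.fac ^ 2 * n := by ring
      _ ≤ _ := by gcongr <;> omega
  · refine hd.trans (Nat.mul_le_mul (by norm_num) (hNB.trans ?_))
    exact Nat.le_self_pow (by norm_num) _
  · rw [← hA.τ i]
    exact hC.bt i i.2
  · rw [pi_norm_le_iff_of_nonneg h.ε_pos.le]
    intro i
    rw [Pi.sub_apply, Real.norm_eq_abs, ← hA.z i]
    exact hC.bz i i.2
  · rw [gradPsi_eq]
    exact hflat
  · funext i
    rw [Matrix.mulVec_diagonal, ← hA.g i]
  · funext j
    refine (hV j j.2).trans ?_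
    rw [Finset.sum_range]
    refine Finset.sum_congr rfl fun (i : Fin m) _ => ?_
    show _ = inp.A i j * (M.real inG i * M.real yc (M.nat aBk i))
    rw [show inp.A i j = inp.lay.A i j from (Input.lay_A (inp := inp) i j).symm,
      ← hE.2 inG (by decide)]
    ring
  · funext i
    exact congrFun (hE.2 outXbar (by decide)) i

theorem listsJ_of_jInv {P : Lay} {M : Mem} {last : ℕ → ℝ} (hJ : JInv P M last) :
    M.ListsJ {i : Fin P.m | M.real outXbar i ≠ last i} := by
  have hlt : ∀ k : Fin (M.nat outLen 0), M.nat outJ k < P.m := fun k => (hJ.1 k k.2).1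
  refine ⟨List.ofFn fun k : Fin (M.nat outLen 0) => ⟨M.nat outJ k, hlt k⟩, ?_, fun i => ?_,
    by simp, fun p => by simp⟩
  · rw [List.nodup_ofFn]
    exact fun k l hkl => Fin.ext (hJ.1.inj k.2 l.2 (Fin.mk.inj_iff.1 hkl))
  · rw [List.mem_ofFn]
    constructor
    · rintro ⟨k, rfl⟩
      exact ((hJ.2 _ (hlt k)).1 ⟨k, k.2, rfl⟩).2
    · intro hi
      by_contra hn
      refine hi ((hJ.2 i i.2).2 ?_)
      rintro ⟨k, hk, he⟩
      exact hn ⟨⟨k, hk⟩, Fin.ext he⟩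

theorem exists_querySum (h : inp.Valid) (hs : Good inp H s) (hH : Pending H)
    {u : List (Fin m × ℝ)} (hu : IsSparse u) : ∃ R, Works inp H s (Op.querySum u) R := by
  classical
  have hE₀ := load_eqOff s.mem (Op.querySum u)
  have hr : Rows inp.lay ((Op.querySum u).load s.mem) u.length (keyAt u) :=
    rows_of_list hu.1 (by simp [Op.load, Mem.putN, Mem.putR])
      (by funext k; simp [Op.load, Mem.putN, Mem.putR, keyAt])
  have hA₁ : ∀ k (hk : k < u.length), ((Op.querySum u).load s.mem).real inArg1 k = u[k].2 :=
    fun k hk => by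
      rw [← map_getD (Prod.snd : Fin m × ℝ → ℝ) hk 0]; simp [Op.load, Mem.putN, Mem.putR]
  obtain ⟨hJ₀, hy, hv⟩ := hs.pending hH
  set X' := nextX s (Op.querySum u) with hX'
  have hC₀ : Core inp.lay ((Op.querySum u).load s.mem) (ext s.X) fun _ => True := hs.core.eqOff hE₀
  have fx : ((Op.querySum u).load s.mem).real outXbar = s.mem.real outXbar := hE₀.2 _ (by decide)
  set xb : ℕ → ℝ := fun i => if InRows u.length (keyAt u) i then ext X' i else
    ((Op.querySum u).load s.mem).real outXbar i with hxb
  obtain ⟨M, w, d, hR, hw, hd, hE, hC, hJ, hf, hx⟩ := (querySumProg_spec (Input.lay_ok h) hr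
    (hJ₀.eqOff hE₀) hC₀ (by rw [hE₀.2 yc (by decide)]; exact hy) (v := ext s.v)
    (h := ext (ofEntries u)) (X' := ext X') (xb := xb) (fun i hi => by
      rw [ext_of_lt _ (show i < m from hi), hv, hE₀.2 inG (by decide), hE₀.2 yc (by decide),
        hE₀.1 aBk (by decide)])
    (fun k hk => by
      rw [keyAt_eq hk, ext_apply, hA₁ k hk, ofEntries, lookup_of_mem hu.1 (List.getElem_mem hk)]
      rfl)
    (fun i hi => by
      by_cases him : i < m
      · rw [ext_of_lt _ him, ofEntries, lookup_of_forall_ne]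
        · rfl
        · rintro p hp he
          exact hi (inRows_keyAt.2 ⟨p, hp, by rw [he]⟩)
      · rw [ext, dif_neg him])
    (fun i hi => by
      simp only [ext_of_lt _ (show i < m from hi), hX', nextX, Pi.add_apply])
    (fun i hi => rfl)).runs
  have hA : Agrees (current inp H) M := (hs.agrees.eqOff hE₀).eqOff hE
  set Ex := extracted inp.lay ((Op.querySum u).load s.mem) (ext X') xb with hEx
  set E : Finset (Fin m) := Finset.univ.filter fun i => (i : ℕ) ∈ Ex with hEdef
  have hmem : ∀ i : Fin m, i ∈ E ↔ inp.ε * (current inp H).w i < |X' i - xb i| := by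
    intro i
    rw [hEdef, Finset.mem_filter, hEx, mem_extracted, hE₀.2 inW (by decide), hs.agrees.w, ext_apply]
    exact ⟨fun h => h.2.2, fun h => ⟨Finset.mem_univ _, i.2, h⟩⟩
  have hw0 : ∀ i : Fin m, 0 ≤ inp.ε * (current inp H).w i := fun i => by
    rw [← hs.agrees.w]; exact hs.core.weight i i.2
  have hx' : ∀ i : Fin m, M.real outXbar i = if i ∈ E then X' i else xb i := by
    intro i
    rw [hx i i.2, ext_apply]
    exact if_congr (by simp [hEdef]) rfl rfl
  have hkey : ∀ p ∈ u, xb p.1 = X' p.1 := fun p hp => by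
    rw [hxb]
    simp only
    rw [if_pos (inRows_keyAt.2 ⟨p, hp, rfl⟩), ext_apply]
  have hnot : ∀ i : Fin m, (∀ p ∈ u, p.1 ≠ i) → xb i = s.mem.real outXbar i := fun i hi => by
    rw [hxb]
    simp only
    rw [if_neg, fx]
    intro hi'
    obtain ⟨p, hp, he⟩ := inRows_keyAt.1 hi'
    exact hi p hp (Fin.ext he)
  have hcard : Ex.card ≤ E.card := by
    have : Ex ⊆ E.image Fin.val := by
      intro i hi
      have him : i < m := (mem_extracted.1 hi).1
      exact Finset.mem_image.2 ⟨⟨i, him⟩, by simpa [hEdef] using hi, rfl⟩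
    exact (Finset.card_le_card this).trans Finset.card_image_le
  have hn := h.n_pos
  have hNB : inp.lay.NB + 1 ≤ inp.fac := by rw [Input.fac]; omega
  have hL : inp.lay.L + 3 ≤ inp.fac := by rw [Input.fac]; omega
  have hfac : 0 < inp.fac := by omega
  have hout : ∀ i : Fin m, i ∈ E → ∀ p ∈ u, p.1 ≠ i := by
    rintro i hi p hp rfl
    rw [hmem, hkey p hp, sub_self, abs_zero] at hi
    exact absurd hi (hw0 _).not_gt
  refine ⟨⟨M, w, d, 0⟩, hR, ⟨E, ?_, ?_, fun i hi => ⟨?_, hout i hi, ?_⟩, fun i hi hi' => ?_,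
    fun p hp => ?_, fun i => ?_, ?_⟩, hC, hA, fun _ => ?_, fun hp => absurd hp id⟩
  · refine hw.trans ?_
    have h₁ : Ex.card + u.length + inp.lay.NB + 1 ≤ inp.fac * (E.card + u.length + n) := by
      have h₂ : 1 * (E.card + u.length) ≤ inp.fac * (E.card + u.length) :=
        Nat.mul_le_mul_right _ hfac
      have h₃ : inp.fac * 1 ≤ inp.fac * n := Nat.mul_le_mul_left _ hn
      rw [Nat.mul_add]
      omega
    calc _ ≤ 200000 * ((inp.fac * (E.card + u.length + n)) * (inp.fac * inp.fac)) := by gcongr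
      _ = _ := by ring
  · refine hd.trans ?_
    calc _ ≤ 200000 * (inp.fac * (inp.fac * inp.fac)) := by gcongr
      _ = _ := by ring
  · exact (hx' i).trans (if_pos hi)
  · have := (hmem i).1 hi
    rwa [hnot i (hout i hi)] at this
  · exact ((hx' i).trans (if_neg hi)).trans (hnot i hi')
  · refine (hx' p.1).trans ?_
    rw [hkey p hp, ite_self]
  · rw [show Mem.vec M outXbar m i = _ from hx' i]
    split_ifs with hi
    · rw [sub_self, abs_zero]; exact hw0 i
    · rw [abs_sub_comm]; exact not_lt.1 fun hlt => hi ((hmem i).2 hlt)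
  · have hl : M.ListsJ {i : Fin m | M.real outXbar i ≠ ext s.last i} := listsJ_of_jInv hJ
    simp only [ext_apply] at hl
    exact hl
  · show JState inp.lay M (ext (M.vec outXbar m))
    rw [JState, if_pos hf]
    intro i hi
    rw [ext_of_lt _ (show i < m from hi)]
    rfl

theorem exists_computeExactSum (h : inp.Valid) (hs : Good inp H s) (hH : ¬ Pending H) :
    ∃ R, Works inp H s Op.computeExactSum R := by
  obtain ⟨M, w, d, hR, hw, hd, hE, hx⟩ := (computeExactProg_spec (Input.lay_ok h) hs.core).runs
  have hfac := mul_fac_le' h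
  have h3 : (3 : ℝ) ≤ inp.fac := by exact_mod_cast three_le_fac
  have hm : (1 : ℝ) ≤ m := by exact_mod_cast h.m_pos
  refine ⟨⟨M, w, d, 0⟩, hR, ⟨?_, ?_, ?_, ?_⟩, hs.core.eqOff hE, hs.agrees.eqOff hE,
    fun _ => (hs.idle hH).eqOff hE, fun hp => absurd hp id⟩
  · funext i
    exact (hx i i.2).trans (ext_apply _ _)
  · have h₁ : (w : ℝ) ≤ ((200 * (m + 1) : ℕ) : ℝ) := by exact_mod_cast hw
    push_cast at h₁
    show (w : ℝ) ≤ _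
    nlinarith
  · have h₁ : (d : ℝ) ≤ ((200 : ℕ) : ℝ) := by exact_mod_cast hd
    push_cast at h₁
    show (d : ℝ) ≤ _
    linarith
  · funext i
    exact congrFun (hE.2 outXbar (by decide)) i

theorem exists_potential (h : inp.Valid) (hs : Good inp H s) (hH : ¬ Pending H) :
    ∃ R, Works inp H s Op.potential R := by
  obtain ⟨M, w, d, hR, hw, hd, hE, hx⟩ := (potentialProg_spec (Input.lay_ok h) hs.core).runs
  have hfac := mul_fac_le' h
  have hNB : inp.lay.NB + 1 ≤ inp.fac := by rw [Input.fac]; omega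
  have h0 : (0 : ℝ) ≤ inp.fac := Nat.cast_nonneg _
  refine ⟨⟨M, w, d, 0⟩, hR, ⟨?_, ?_, ?_, ?_⟩, hs.core.eqOff hE, hs.agrees.eqOff hE,
    fun _ => (hs.idle hH).eqOff hE, fun hp => absurd hp id⟩
  · refine hx.trans ?_
    rw [Finset.sum_range]
    exact Finset.sum_congr rfl fun i _ => by
      rw [show s.mem.real inZ i = _ from hs.agrees.z i]; rfl
  · have h₁ : (w : ℝ) ≤ ((2000 * inp.fac : ℕ) : ℝ) := by exact_mod_cast hw.trans (by gcongr)
    push_cast at h₁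
    show (w : ℝ) ≤ _
    linarith
  · have h₁ : (d : ℝ) ≤ ((1000 * inp.fac : ℕ) : ℝ) := by exact_mod_cast hd.trans (by gcongr)
    push_cast at h₁
    show (d : ℝ) ≤ _
    linarith
  · funext i
    exact congrFun (hE.2 outXbar (by decide)) i

end PrimalGradient

namespace PrimalGradient

variable {m n : ℕ} {inp : Input m n} {H : History m}

/-! ## Amortization -/

/-- The entry `i` has been extracted `a i` times: every extraction is paid for by the steps since
the last one, relative to the accuracy. -/
def Account (T : ℕ) (E : ℝ≥0∞) (ε : ℝ) (w X xb : Fin m → ℝ) (a : Fin m → ℕ) : Prop :=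
  ∃ L e : Fin m → ℝ, (∀ i, 0 ≤ e i) ∧ E = ENNReal.ofReal (∑ i, e i) ∧
    ∀ i, 0 ≤ L i ∧ L i ^ 2 ≤ T * e i ∧ ε * a i ≤ L i ∧ |X i - xb i| ≤ w i * (L i - ε * a i)

namespace Account

variable {T : ℕ} {E : ℝ≥0∞} {ε : ℝ} {w X xb : Fin m → ℝ} {a : Fin m → ℕ}

theorem start (w x : Fin m → ℝ) (ε : ℝ) : Account 0 0 ε w x x 0 :=
  ⟨0, 0, by simp, by simp, by simp⟩

theorem congr (h : Account T E ε w X xb a) {w' xb' : Fin m → ℝ}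
    (h' : ∀ i, (xb' i = X i ∧ 0 ≤ w' i) ∨ (xb' i = xb i ∧ w' i = w i)) :
    Account T E ε w' X xb' a := by
  obtain ⟨L, e, h₁, h₂, h₃⟩ := h
  refine ⟨L, e, h₁, h₂, fun i => ⟨(h₃ i).1, (h₃ i).2.1, (h₃ i).2.2.1, ?_⟩⟩
  rcases h' i with ⟨h₄, h₅⟩ | ⟨h₄, h₅⟩
  · rw [h₄, sub_self, abs_zero]
    exact mul_nonneg h₅ (sub_nonneg.2 (h₃ i).2.2.1)
  · rw [h₄, h₅]; exact (h₃ i).2.2.2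

theorem sq_ratio {x y : ℝ} (hy : 0 ≤ y)
    (h : (ENNReal.ofReal |x| / ENNReal.ofReal y) ^ 2 ≠ ⊤) :
    (y = 0 → x = 0) ∧
      (ENNReal.ofReal |x| / ENNReal.ofReal y) ^ 2 = ENNReal.ofReal ((|x| / y) ^ 2) := by
  have h₀ : y = 0 → x = 0 := by
    rintro rfl
    by_contra hx
    refine h ?_
    rw [ENNReal.ofReal_zero, ENNReal.div_zero, ENNReal.top_pow (by norm_num)]
    simpa using hx
  refine ⟨h₀, ?_⟩
  rcases hy.eq_or_lt with h₁ | h₁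
  · rw [← h₁, h₀ h₁.symm]; simp
  · rw [ENNReal.ofReal_pow (by positivity), ENNReal.ofReal_div_of_pos h₁]

open Classical in
theorem query (h : Account T E ε w X xb a) (hε : 0 < ε) (hw : ∀ i, 0 ≤ w i) {v X' xb' : Fin m → ℝ}
    (hE : E + ∑ i, (ENNReal.ofReal |v i| / ENNReal.ofReal (w i)) ^ 2 ≠ ⊤) {Ex : Finset (Fin m)}
    (hin : ∀ i ∈ Ex, xb' i = X' i ∧ X' i = X i + v i ∧ ε * w i < |X' i - xb i|)
    (hout : ∀ i ∉ Ex, xb' i = X' i ∨ (xb' i = xb i ∧ X' i = X i + v i)) :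
    Account (T + 1) (E + ∑ i, (ENNReal.ofReal |v i| / ENNReal.ofReal (w i)) ^ 2) ε w X' xb'
      (fun i => a i + if i ∈ Ex then 1 else 0) := by
  obtain ⟨L, e, h₁, h₂, h₃⟩ := h
  have hr := fun i => sq_ratio (hw i) ((ENNReal.sum_ne_top.1 (ENNReal.add_ne_top.1 hE).2) i
    (Finset.mem_univ i))
  refine ⟨fun i => L i + |v i| / w i, fun i => e i + (|v i| / w i) ^ 2,
    fun i => add_nonneg (h₁ i) (sq_nonneg _), ?_, fun i => ?_⟩
  · rw [h₂, Finset.sum_add_distrib, ENNReal.ofReal_add (Finset.sum_nonneg fun i _ => h₁ i)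
      (Finset.sum_nonneg fun i _ => sq_nonneg _), ENNReal.ofReal_sum_of_nonneg
      (fun i _ => sq_nonneg _)]
    congr 1
    exact Finset.sum_congr rfl fun i _ => (hr i).2
  · obtain ⟨hL, hLe, ha, hd⟩ := h₃ i
    set x := |v i| / w i with hx
    have hx0 : 0 ≤ x := div_nonneg (abs_nonneg _) (hw i)
    have hvx : |v i| = w i * x := by
      rcases (hw i).eq_or_lt with h0 | h0
      · rw [(hr i).1 h0.symm, ← h0]; simp
      · rw [hx]; field_simp
    have hdrift : X' i = X i + v i → |X' i - xb i| ≤ w i * (L i + x - ε * a i) := by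
      intro he
      calc |X' i - xb i| = |(X i - xb i) + v i| := by rw [he]; congr 1; ring
        _ ≤ |X i - xb i| + |v i| := abs_add_le _ _
        _ ≤ w i * (L i - ε * a i) + w i * x := add_le_add hd hvx.le
        _ = _ := by ring
    refine ⟨by positivity, ?_, ?_, ?_⟩
    · have h₄ : 2 * L i * x ≤ e i + T * x ^ 2 := by
        refine abs_le_of_sq_le_sq' ?_ (by have := h₁ i; positivity) |>.2
        have : L i ^ 2 * x ^ 2 ≤ T * e i * x ^ 2 := mul_le_mul_of_nonneg_right hLe (sq_nonneg _)
        nlinarith [sq_nonneg (e i - T * x ^ 2)]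
      push_cast
      nlinarith
    · by_cases hi : i ∈ Ex
      · simp only [hi, if_true]
        obtain ⟨-, h₅, h₆⟩ := hin i hi
        have h₇ := h₆.trans_le (hdrift h₅)
        rcases (hw i).eq_or_lt with h0 | h0
        · rw [← h0] at h₇; simp at h₇
        · rw [mul_comm, mul_lt_mul_iff_right₀ h0] at h₇
          push_cast
          linarith
      · simp only [hi, if_false, add_zero]
        linarith
    · by_cases hi : i ∈ Ex
      · simp only [hi, if_true]
        obtain ⟨h₄, h₅, h₆⟩ := hin i hi
        have h₇ := h₆.trans_le (hdrift h₅)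
        rw [h₄, sub_self, abs_zero]
        refine mul_nonneg (hw i) ?_
        rcases (hw i).eq_or_lt with h0 | h0
        · rw [← h0] at h₇; simp at h₇
        · rw [mul_comm, mul_lt_mul_iff_right₀ h0] at h₇
          push_cast
          linarith
      · simp only [hi, if_false, add_zero]
        rcases hout i hi with h₄ | ⟨h₄, h₅⟩
        · rw [h₄, sub_self, abs_zero]
          exact mul_nonneg (hw i) (by linarith)
        · rw [h₄]; exact hdrift h₅

theorem sum_le (h : Account T E ε w X xb a) (hε : 0 < ε) :
    ∃ e : ℝ, 0 ≤ e ∧ E = ENNReal.ofReal e ∧ ((∑ i, a i : ℕ) : ℝ) ≤ T * e * (1 / ε ^ 2) := by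
  obtain ⟨L, e, h₁, h₂, h₃⟩ := h
  refine ⟨∑ i, e i, Finset.sum_nonneg fun i _ => h₁ i, h₂, ?_⟩
  push_cast
  rw [mul_one_div, Finset.mul_sum, Finset.sum_div]
  refine Finset.sum_le_sum fun i _ => ?_
  obtain ⟨hL, hLe, ha, -⟩ := h₃ i
  rw [le_div_iff₀ (by positivity)]
  have h₄ : (ε * a i) ^ 2 ≤ L i ^ 2 := by gcongr
  have h₅ : (a i : ℝ) ≤ (a i : ℝ) ^ 2 := by
    exact_mod_cast Nat.le_self_pow (by norm_num) (a i)
  nlinarith [mul_le_mul_of_nonneg_right h₅ (sq_nonneg ε)]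

end Account

/-! ## The run of the data structure -/

instance : Nonempty (Res m) := ⟨⟨Mem.zero, 0, 0, 0⟩⟩

/-- The result of `Initialize` is as required. -/
def InitWorks (inp : Input m n) (R : Res m) : Prop :=
  Runs (wordBound 12 m n inp.ε) initProg inp.load R.mem R.work R.depth ∧
    (R.work : ℝ) ≤ polyFactor (10 ^ 9) 12 m inp.ε * inp.nnzA ∧
    (R.depth : ℝ) ≤ polyFactor (10 ^ 9) 12 m inp.ε ∧
    Good inp [] { R with X := inp.x, last := inp.x } ∧ R.mem.vec outXbar m = inp.x

/-- The stage after a history. -/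
noncomputable def stage (inp : Input m n) : History m → Stage m
  | [] => { Classical.epsilon (InitWorks inp) with X := inp.x, last := inp.x }
  | o :: H => (stage inp H).next o (Classical.epsilon (Works inp H (stage inp H) o))

theorem stage_init (h : inp.Valid) : InitWorks inp (stage inp []).toRes :=
  Classical.epsilon_spec (exists_init h)

theorem exists_works (h : inp.Valid) {s : Stage m} (hs : Good inp H s) {o : Op m}
    (hH : ValidHistory n (o :: H)) : ∃ R, Works inp H s o R := by
  obtain ⟨-, ho, hp⟩ := hH
  cases o with
  | update u => exact exists_update h hs (fun hp' => by obtain ⟨_, he⟩ := hp.1 hp'; cases he) ho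
  | setAccuracy u =>
    exact exists_setAccuracy h hs (fun hp' => by obtain ⟨_, he⟩ := hp.1 hp'; cases he) ho
  | queryProduct =>
    exact exists_queryProduct h hs fun hp' => by obtain ⟨_, he⟩ := hp.1 hp'; cases he
  | querySum u => exact exists_querySum h hs (hp.2 ⟨u, rfl⟩) ho
  | computeExactSum =>
    exact exists_computeExactSum h hs fun hp' => by obtain ⟨_, he⟩ := hp.1 hp'; cases he
  | potential =>
    exact exists_potential h hs fun hp' => by obtain ⟨_, he⟩ := hp.1 hp'; cases he

theorem stage_good (h : inp.Valid) : ∀ H, ValidHistory n H → Good inp H (stage inp H)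
  | [], _ => (stage_init h).2.2.2.1
  | o :: H, hH =>
    (Classical.epsilon_spec (exists_works h (stage_good h H hH.1) hH)).2.2

theorem stage_works (h : inp.Valid) {o : Op m} (hH : ValidHistory n (o :: H)) :
    Works inp H (stage inp H) o (stage inp (o :: H)).toRes :=
  Classical.epsilon_spec (exists_works h (stage_good h H hH.1) hH)

theorem stage_X (o : Op m) : (stage inp (o :: H)).X = nextX (stage inp H) o := rfl

theorem exactSum_stage : ∀ H, exactSum inp (fun H => (stage inp H).v) H = (stage inp H).X
  | [] => rfl
  | o :: H => by
    have ih := exactSum_stage H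
    rw [stage_X]
    cases o <;> simp only [exactSum, nextX, ih]

theorem lastXbar_stage : ∀ H, lastXbar inp (fun H => (stage inp H).mem) H = (stage inp H).last
  | [] => rfl
  | o :: H => by
    have ih := lastXbar_stage H
    cases o <;> first | exact ih | rfl

theorem current_w_nonneg (h : inp.Valid) (hH : ValidHistory n H) (i : Fin m) :
    0 ≤ (current inp H).w i := by
  have hs := stage_good h H hH
  have h₁ := hs.core.weight i i.2
  rw [hs.agrees.w] at h₁
  exact nonneg_of_mul_nonneg_right h₁ h.ε_pos

open Classical in
theorem amortized_work (h : inp.Valid) : ∀ H, ValidHistory n H → ∃ a : Fin m → ℕ,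
    queryCost (fun H => (stage inp H).work) H ≤ 200000 * inp.fac ^ 3 *
      ((2 * numQueries H + if Pending H then 1 else 0) * n + sumSupport H + ∑ i, a i) ∧
    (sumEnergy inp (fun H => (stage inp H).v) H ≠ ⊤ →
      Account (numQueries H) (sumEnergy inp (fun H => (stage inp H).v) H) inp.ε (current inp H).w
        (stage inp H).X ((stage inp H).mem.vec outXbar m) a)
  | [], _ => by
    refine ⟨0, by simp [queryCost], fun _ => ?_⟩
    rw [(stage_init h).2.2.2.2]
    exact Account.start _ _ _
  | o :: H, hH => by
    obtain ⟨a, ha, hacc⟩ := amortized_work h H hH.1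
    obtain ⟨-, hM, -⟩ := stage_works h hH
    have hw := fun i => current_w_nonneg h hH i
    have hp := hH.2.2
    have hidle : (∀ u, o ≠ Op.querySum u) → ¬ Pending H := fun ho hp' => by
      obtain ⟨u, he⟩ := hp.1 hp'; exact ho u he
    cases o with
    | update u =>
      obtain ⟨-, -, h₁, h₂⟩ := hM
      rw [if_neg (hidle (by simp))] at ha
      refine ⟨a, by simpa [queryCost, numQueries, sumSupport, Pending] using ha, fun hE =>
        (hacc hE).congr fun i => ?_⟩
      by_cases hi : ∀ p ∈ u, p.1 ≠ i
      · exact Or.inr ⟨h₂ i hi, rfl⟩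
      · push Not at hi
        obtain ⟨p, hp, rfl⟩ := hi
        exact Or.inl ⟨h₁ p hp, hw _⟩
    | setAccuracy u =>
      obtain ⟨-, -, h₁, h₂⟩ := hM
      rw [if_neg (hidle (by simp))] at ha
      refine ⟨a, by simpa [queryCost, numQueries, sumSupport, Pending] using ha, fun hE =>
        (hacc hE).congr fun i => ?_⟩
      by_cases hi : ∀ p ∈ u, p.1 ≠ i
      · exact Or.inr ⟨h₂ i hi, by simp [current, lookup_of_forall_ne hi]⟩
      · push Not at hi
        obtain ⟨p, hp, rfl⟩ := hi
        exact Or.inl ⟨h₁ p hp, hw _⟩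
    | queryProduct =>
      obtain ⟨h₁, -, -, -, h₂⟩ := hM
      rw [if_neg (hidle (by simp))] at ha
      refine ⟨a, ?_, fun hE => (hacc hE).congr fun i => Or.inr ⟨congrFun h₂ i, rfl⟩⟩
      rw [if_pos (show Pending (Op.queryProduct :: H) from trivial)]
      simp only [queryCost, numQueries, sumSupport]
      calc _ ≤ _ := Nat.add_le_add ha h₁
        _ = _ := by ring
    | querySum u =>
      obtain ⟨Ex, h₁, -, h₂, h₃, h₄, -, -⟩ := hM
      rw [if_pos (hp.2 ⟨u, rfl⟩)] at ha
      refine ⟨fun i => a i + if i ∈ Ex then 1 else 0, ?_, fun hE => ?_⟩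
      · rw [if_neg (show ¬ Pending (Op.querySum u :: H) from id)]
        simp only [queryCost, numQueries, sumSupport]
        rw [nnz_ofEntries hH.2.1, Finset.sum_add_distrib, Finset.sum_ite_mem, Finset.univ_inter,
          Finset.sum_const, smul_eq_mul, mul_one]
        calc _ ≤ _ := Nat.add_le_add ha h₁
          _ = _ := by ring
      · have hX : ∀ i, (∀ p ∈ u, p.1 ≠ i) → nextX (stage inp H) (Op.querySum u) i =
            (stage inp H).X i + (stage inp H).v i := fun i hi => by
          simp [nextX, ofEntries, lookup_of_forall_ne hi]
        refine (hacc fun h' => hE (by simp [sumEnergy, h'])).query h.ε_pos hw hE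
          (fun i hi => ⟨(h₂ i hi).1, hX i (h₂ i hi).2.1, (h₂ i hi).2.2⟩) fun i hi => ?_
        by_cases hi' : ∀ p ∈ u, p.1 ≠ i
        · exact Or.inr ⟨h₃ i hi hi', hX i hi'⟩
        · push Not at hi'
          obtain ⟨p, hp, rfl⟩ := hi'
          exact Or.inl (h₄ p hp)
    | computeExactSum =>
      rw [if_neg (hidle (by simp))] at ha
      exact ⟨a, by simpa [queryCost, numQueries, sumSupport, Pending] using ha, fun hE =>
        (hacc hE).congr fun i => Or.inr ⟨congrFun hM.2.2.2 i, rfl⟩⟩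
    | potential =>
      rw [if_neg (hidle (by simp))] at ha
      exact ⟨a, by simpa [queryCost, numQueries, sumSupport, Pending] using ha, fun hE =>
        (hacc hE).congr fun i => Or.inr ⟨congrFun hM.2.2.2 i, rfl⟩⟩

open Classical in
theorem total_depth (h : inp.Valid) : ∀ H, ValidHistory n H →
    queryCost (fun H => (stage inp H).depth) H ≤ 200000 * inp.fac ^ 3 *
      (2 * numQueries H + if Pending H then 1 else 0)
  | [], _ => by simp [queryCost]
  | o :: H, hH => by
    have ha := total_depth h H hH.1
    obtain ⟨-, hM, -⟩ := stage_works h hH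
    have hp := hH.2.2
    by_cases ho : ∃ u, o = Op.querySum u
    · obtain ⟨u, rfl⟩ := ho
      obtain ⟨Ex, -, h₁, -⟩ := hM
      rw [if_pos (hp.2 ⟨u, rfl⟩)] at ha
      rw [if_neg (show ¬ Pending (Op.querySum u :: H) from id)]
      simp only [queryCost, numQueries]
      calc _ ≤ _ := Nat.add_le_add ha h₁
        _ = _ := by ring
    · rw [if_neg fun hp' => ho (hp.1 hp')] at ha
      cases o with
      | queryProduct =>
        rw [if_pos (show Pending (Op.queryProduct :: H) from trivial)]
        simp only [queryCost, numQueries]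
        calc _ ≤ _ := Nat.add_le_add ha hM.2.1
          _ = _ := by ring
      | querySum u => exact absurd ⟨u, rfl⟩ ho
      | _ => simpa [queryCost, numQueries, Pending] using ha

theorem polyFactor_pos (h : inp.Valid) : 0 < polyFactor (10 ^ 9) 12 m inp.ε := by
  have h₁ := mul_fac_le' h
  have : (3 : ℝ) ≤ inp.fac := by exact_mod_cast three_le_fac
  linarith

theorem query_work_le (h : inp.Valid) {u : List (Fin m × ℝ)}
    (hH : ValidHistory n (Op.querySum u :: H)) :
    (queryCost (fun H => (stage inp H).work) (Op.querySum u :: H) : ℝ≥0∞) ≤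
      ENNReal.ofReal (polyFactor (10 ^ 9) 12 m inp.ε) *
        ((numQueries (Op.querySum u :: H) : ℝ≥0∞) * (n : ℝ≥0∞) +
          (sumSupport (Op.querySum u :: H) : ℝ≥0∞) +
          (numQueries (Op.querySum u :: H) : ℝ≥0∞) *
            sumEnergy inp (fun H => (stage inp H).v) (Op.querySum u :: H)) := by
  classical
  obtain ⟨a, ha, hacc⟩ := amortized_work h _ hH
  rw [if_neg (show ¬ Pending (Op.querySum u :: H) from id), add_zero] at ha
  have hT : numQueries (Op.querySum u :: H) ≠ 0 := Nat.succ_ne_zero _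
  generalize sumEnergy inp (fun H => (stage inp H).v) (Op.querySum u :: H) = E at *
  generalize numQueries (Op.querySum u :: H) = T at *
  generalize sumSupport (Op.querySum u :: H) = S at *
  generalize queryCost (fun H => (stage inp H).work) (Op.querySum u :: H) = W at *
  have hpos := polyFactor_pos h
  by_cases hE : E = ⊤
  · rw [hE, ENNReal.mul_top (by exact_mod_cast hT), add_top, ENNReal.mul_top]
    · exact le_top
    · simpa using hpos
  obtain ⟨e, he, rfl, hsum⟩ := (hacc hE).sum_le h.ε_pos
  have hbound := mul_fac_le h
  have hinv : 0 ≤ 1 / inp.ε ^ 2 := by have := h.ε_pos; positivity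
  have ha' : (W : ℝ) ≤ 200000 * (inp.fac : ℝ) ^ 3 *
      (2 * T * n + S + ((∑ i, a i : ℕ) : ℝ)) := by exact_mod_cast ha
  have key : (W : ℝ) ≤ polyFactor (10 ^ 9) 12 m inp.ε * (T * n + S + T * e) := by
    have h0 : (0 : ℝ) ≤ 200000 * (inp.fac : ℝ) ^ 3 := by positivity
    have hTn : (0 : ℝ) ≤ (T : ℝ) * n := by positivity
    have hTe : (0 : ℝ) ≤ (T : ℝ) * e := by positivity
    have hS : (0 : ℝ) ≤ S := Nat.cast_nonneg _
    calc (W : ℝ) ≤ 200000 * (inp.fac : ℝ) ^ 3 * (2 * T * n + S + ((∑ i, a i : ℕ) : ℝ)) := ha'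
      _ ≤ 200000 * (inp.fac : ℝ) ^ 3 * (2 * (1 + 1 / inp.ε ^ 2) * (T * n + S + T * e)) := by
          refine mul_le_mul_of_nonneg_left ?_ h0
          nlinarith [mul_nonneg hinv hTn, mul_nonneg hinv hS, mul_nonneg hinv hTe]
      _ = 400000 * (inp.fac : ℝ) ^ 3 * (1 + 1 / inp.ε ^ 2) * (T * n + S + T * e) := by ring
      _ ≤ _ := mul_le_mul_of_nonneg_right hbound (by positivity)
  calc (W : ℝ≥0∞) = ENNReal.ofReal W := (ENNReal.ofReal_natCast W).symm
    _ ≤ ENNReal.ofReal (polyFactor (10 ^ 9) 12 m inp.ε * (T * n + S + T * e)) :=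
        ENNReal.ofReal_le_ofReal key
    _ = _ := by
        rw [ENNReal.ofReal_mul hpos.le, ENNReal.ofReal_add (by positivity) (by positivity),
          ENNReal.ofReal_add (by positivity) (by positivity), ENNReal.ofReal_mul (by positivity),
          ENNReal.ofReal_mul (by positivity)]
        simp only [ENNReal.ofReal_natCast]

theorem query_depth_le (h : inp.Valid) {u : List (Fin m × ℝ)}
    (hH : ValidHistory n (Op.querySum u :: H)) :
    (queryCost (fun H => (stage inp H).depth) (Op.querySum u :: H) : ℝ) ≤
      polyFactor (10 ^ 9) 12 m inp.ε * numQueries (Op.querySum u :: H) := by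
  classical
  have ha := total_depth h _ hH
  rw [if_neg (show ¬ Pending (Op.querySum u :: H) from id), add_zero] at ha
  have hinv : 0 ≤ 1 / inp.ε ^ 2 := by have := h.ε_pos; positivity
  have h0 : (0 : ℝ) ≤ 400000 * (inp.fac : ℝ) ^ 3 := by positivity
  have hb : 400000 * (inp.fac : ℝ) ^ 3 ≤ polyFactor (10 ^ 9) 12 m inp.ε := by
    refine le_trans ?_ (mul_fac_le h)
    nlinarith [mul_nonneg h0 hinv]
  have ha' : (queryCost (fun H => (stage inp H).depth) (Op.querySum u :: H) : ℝ) ≤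
      200000 * (inp.fac : ℝ) ^ 3 * (2 * numQueries (Op.querySum u :: H)) := by exact_mod_cast ha
  refine ha'.trans ?_
  calc _ = 400000 * (inp.fac : ℝ) ^ 3 * numQueries (Op.querySum u :: H) := by ring
    _ ≤ _ := mul_le_mul_of_nonneg_right hb (Nat.cast_nonneg _)

end PrimalGradient

theorem mainTheorem11 :
    ∃ (ds : DataStructure) (c k : ℕ), ∀ (m n : ℕ) (inp : Input m n), inp.Valid →
      ∃ (mem : History m → Mem) (work depth : History m → ℕ) (v : History m → Fin m → ℝ),
        -- Initialize
        Runs (wordBound k m n inp.ε) ds.init inp.load (mem []) (work []) (depth []) ∧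
        (work [] : ℝ) ≤ polyFactor c k m inp.ε * inp.nnzA ∧
        (depth [] : ℝ) ≤ polyFactor c k m inp.ε ∧
        -- every further operation, after every sequence of operations
        ∀ (H : History m) (o : Op m), ValidHistory n (o :: H) →
          Runs (wordBound k m n inp.ε) (ds.prog o) (o.load (mem H)) (mem (o :: H))
            (work (o :: H)) (depth (o :: H)) ∧
          match o with
          | Op.update u =>
              (work (Op.update u :: H) : ℝ) ≤
                polyFactor c k m inp.ε * (1 + (u.map fun p => (nnz (inp.A p.1) : ℝ)).sum) ∧
              (depth (Op.update u :: H) : ℝ) ≤ polyFactor c k m inp.ε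
          | Op.setAccuracy u =>
              (work (Op.setAccuracy u :: H) : ℝ) ≤ polyFactor c k m inp.ε * (1 + u.length) ∧
              (depth (Op.setAccuracy u :: H) : ℝ) ≤ polyFactor c k m inp.ε
          | Op.queryProduct =>
              IsStep inp (current inp H) (v (Op.queryProduct :: H)) ∧
              (mem (Op.queryProduct :: H)).vec outV n =
                inp.A.transpose.mulVec (v (Op.queryProduct :: H))
          | Op.querySum h =>
              (∀ i, |(mem (Op.querySum h :: H)).vec outXbar m i -
                  exactSum inp v (Op.querySum h :: H) i| ≤ inp.ε * (current inp H).w i) ∧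
              (mem (Op.querySum h :: H)).ListsJ
                {i | (mem (Op.querySum h :: H)).vec outXbar m i ≠ lastXbar inp mem H i} ∧
              (queryCost work (Op.querySum h :: H) : ENNReal) ≤
                ENNReal.ofReal (polyFactor c k m inp.ε) *
                  ((numQueries (Op.querySum h :: H) : ENNReal) * (n : ENNReal) +
                    (sumSupport (Op.querySum h :: H) : ENNReal) +
                    (numQueries (Op.querySum h :: H) : ENNReal) *
                      sumEnergy inp v (Op.querySum h :: H)) ∧
              (queryCost depth (Op.querySum h :: H) : ℝ) ≤
                polyFactor c k m inp.ε * numQueries (Op.querySum h :: H)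
          | Op.computeExactSum =>
              (mem (Op.computeExactSum :: H)).vec outExact m = exactSum inp v H ∧
              (work (Op.computeExactSum :: H) : ℝ) ≤ polyFactor c k m inp.ε * m ∧
              (depth (Op.computeExactSum :: H) : ℝ) ≤ polyFactor c k m inp.ε
          | Op.potential =>
              (mem (Op.potential :: H)).real outPot 0 = Psi inp.lam (current inp H).z ∧
              (work (Op.potential :: H) : ℝ) ≤ polyFactor c k m inp.ε ∧
              (depth (Op.potential :: H) : ℝ) ≤ polyFactor c k m inp.ε := by
  refine ⟨structureProgs, 10 ^ 9, 12, fun m n inp h => ⟨fun H => (stage inp H).mem,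
    fun H => (stage inp H).work, fun H => (stage inp H).depth, fun H => (stage inp H).v,
    (stage_init h).1, (stage_init h).2.1, (stage_init h).2.2.1, fun H o hH => ?_⟩⟩
  obtain ⟨hR, hM, -⟩ := stage_works h hH
  refine ⟨hR, ?_⟩
  cases o with
  | update u => exact ⟨hM.1, hM.2.1⟩
  | setAccuracy u => exact ⟨hM.1, hM.2.1⟩
  | queryProduct => exact ⟨hM.2.2.1, hM.2.2.2.1⟩
  | querySum u =>
    obtain ⟨E, -, -, -, -, -, hx, hJ⟩ := hM
    refine ⟨?_, ?_, query_work_le h hH, query_depth_le h hH⟩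
    · rw [exactSum_stage]; exact hx
    · rw [lastXbar_stage]; exact hJ
  | computeExactSum =>
    rw [exactSum_stage]; exact ⟨hM.1, hM.2.1, hM.2.2.1⟩
  | potential => exact ⟨hM.1, hM.2.1, hM.2.2.1⟩
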